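/- **Setting.** Let $n\ge 3$ and $0<\theta_1<\theta_2<\pi$. *Data.* Let $\frac{n-2}{2}<\check p\le n-2$, and let $(\check g,\check k)$ be the end of an asymptotically flat initial data set in asymptotically flat coordinates $y$, $|y|>R$: $\check g$ is a Riemannian metric with $\check g_{ij}=\delta_{ij}+O^{2}(|y|^{-\check p})$ and $\check k$ a symmetric $(0,2)$-tensor with $\check k_{ij}=O^{1}(|y|^{-\check p-1})$. Here $f=O^{m}(|y|^{-q})$ means that $f$ is $C^m$ and $|\partial^\beta f|\le K|y|^{-q-|\beta|}$ for $|\beta|\le m$. (In particular this covers every vacuum initial data set $(M,\check g,\check k)$ with $\check g_{ij}=\delta_{ij}+O^{l,\alpha}(|y|^{-\check p})$, $\check k_{ij}=O^{l-1,\alpha}(|y|^{-\check p-1})$, $l\ge 2$.) *Region and weights.* Fix a unit vector $e$, let $\theta(x)$ be the angle between $x$ and $e$, and fix a regularized conical shell: pairwise disjoint open sets $\Omega_I,\Omega,\Omega_O\subset\mathbb R^n$ with $\Omega$ connected, $\partial\Omega=\partial\Omega_I\cup\partial\Omega_O$, $\partial\Omega_I\cap\partial\Omega_O=\emptyset$,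 $\Omega_I\cup\Omega\cup\Omega_O=\mathbb R^n\setminus\partial\Omega$, which on $\{|x|\ge1\}$ are given by $\theta<\theta_1$, $\theta_1<\theta<\theta_2$, $\theta>\theta_2$ respectively; and a function $\phi$, smooth in a neighbourhood of $\overline\Omega$, positive in $\Omega$, vanishing with non-zero gradient on $\partial\Omega$, and such that on $\overline\Omega\cap\{|x|\ge1\}$ it is constant along rays, equal to $\theta-\theta_1$ for $\theta$ near $\theta_1$ and to $\theta_2-\theta$ for $\theta$ near $\theta_2$. Let $\rho=\phi^{2N}$ with $N\in\mathbb N$, and let $r\in C^\infty(\mathbb R^n)$ be positive with $r(x)=|x|$ for $|x|\ge1$. Let $\chi\in C^2(\mathbb R^n,[0,1])$ be a cutoff function with $\chi=1$ in $\Omega_I$, $\chi=0$ in $\Omega_O$, depending only on $\theta$ for $|x|\ge1$. *Rough patch.* For a vertex $a\in\mathbb R^n\setminus\{0\}$ use the coordinates $x=y-a$ centred at $a$, and move $\Omega,\phi,\rho,\chi$ by a linear isometry of $\mathbb R^n$ that maps $e$ to $-a/|a|$ (the moved objects are denoted by the same letters). Put $$g_{ij}(x)=\chi(x)\check g_{ij}(x+a)+(1-\chi(x))\delta_{ij},\qquad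 k_{ij}(x)=\chi(x)\check k_{ij}(x+a),\qquad \pi^{ij}=k^{ij}-(\mathrm{Tr}_g k)g^{ij}.$$ These are defined in $\Omega$ for $|a|$ large. *Spaces.* $\mathcal H_{k,-q,\rho}(\Omega)$ is the completion of the smooth functions (or tensors) with bounded support, without any condition on $\partial\Omega$, for the norm $$\|f\|_{k,-q,\rho}^2=\sum_{i=0}^k\sum_{|\beta|=i}\int_\Omega|\partial^\beta f|^2\,r^{-n+2(i+q)}\rho\,d\mathscr L^n .$$ $\mathcal X$, $\mathcal M$, $\mathcal S$ denote the analogous spaces of vector fields, symmetric $(0,2)$-tensors and symmetric $(2,0)$-tensors, and a product of two spaces carries the sum of the norms. *Operator.* $d\Phi^*_{(g,\pi)}$ is the formal $L^2(d\upsilon_g)$-adjoint of the linearization at $(g,\pi)$ of $\Phi(g,\pi)=\big(R_g+\frac1{n-1}(\mathrm{Tr}_g\pi)^2-|\pi|_g^2,\ \mathrm{Div}_g\pi\big)$. Its components are $$\begin{aligned}d\Phi^{*(1)}[u,Z]_{ij}={}&-(\Delta_gu)g_{ij}+(\mathrm{Hess}_gu)_{ij}-uR_{ij}+u\big(\tfrac{2}{n-1}(\mathrm{Tr}_g\pi)\pi_{ij}-2\pi_i{}^k\pi_{kj}\big)\\&-\tfrac12\nabla_l(Z_i\pi^l{}_j+Z_j\pi^l{}_i)+\tfrac12\nabla_l(Z^l\pi_{ij})-\tfrac12g_{ij}\nabla_l(Z_m\pi^{lm}),\\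 d\Phi^{*(2)}[u,Z]^{ij}={}&-\tfrac12(\nabla^iZ^j+\nabla^jZ^i)+u\big(\tfrac2{n-1}(\mathrm{Tr}_g\pi)g^{ij}-2\pi^{ij}\big).\end{aligned}$$ **Proposition.** Let $\frac{n-2}{2}<p<\check p$, with $p\ne n/2$ if $n\ge5$, and let $N\ge N_0$, where $N_0$ depends only on $n$, $p$, $\theta_1$, $\theta_2$ and on the choice of the shell $(\Omega,\phi)$ and of $r$. Then there are constants $a_{\infty}$ and $C>0$, independent of $a$ (they depend on $\check g,\check k,\theta_1,\theta_2,p$ and on the fixed choices of the shell, $r$, $\chi$ and $N$), such that for all $a$ with $|a|>a_{\infty}$ $$\|(u,Z)\|_{\mathcal H_{2,-n+p+2,\rho}\times\mathcal X_{1,-n+p+2,\rho}}\le C\,\|d\Phi^*_{(g,\pi)}[u,Z]\|_{\mathcal M_{0,-n+p,\rho}\times\mathcal S_{0,-n+p+1,\rho}}$$ for all $u\in\mathcal H_{2,-n+p+2,\rho}(\Omega)$ and $Z\in\mathcal X_{1,-n+p+2,\rho}(\Omega)$. -/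

import Mathlib

open MeasureTheory Filter Topology
open scoped ContDiff ENNReal

noncomputable section

namespace ConeGluing

/-- Euclidean space `ℝⁿ`. -/
abbrev E (n : ℕ) : Type := EuclideanSpace ℝ (Fin n)

/-! ### Partial derivatives -/

/-- The partial derivative `∂ᵢ f`. -/
def pd {n : ℕ} {F : Type*} [NormedAddCommGroup F] [NormedSpace ℝ F] (i : Fin n) (f : E n → F) :
    E n → F :=
  fun x => fderiv ℝ f x (EuclideanSpace.single i 1)

/-- The derivative `∂^β f` for a multi-index `β`. -/
def mpd {n : ℕ} {F : Type*} [NormedAddCommGroup F] [NormedSpace ℝ F] (β : Fin n → ℕ)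
    (f : E n → F) : E n → F :=
  (List.finRange n).foldr (fun i h => (pd i)^[β i] h) f

/-! ### Doubly weighted Sobolev spaces

An element of a weighted Sobolev space of order `k` is given together with its derivatives, as a
family `J β`, `|β| ≤ k`, of functions on `Ω`: `J β` stands for `∂^β f`. Values of `J β` for
`|β| > k` are never used. -/

section Sobolev

variable {n : ℕ} {F : Type*} [NormedAddCommGroup F] [NormedSpace ℝ F]

/-- The square of the norm of `H_{k,-q,ρ}(Ω)`:
`∑_{i ≤ k} ∑_{|β| = i} ∫_Ω |J β|² r^{-n+2(i+q)} ρ`. -/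
def sobolevNormSq (k : ℕ) (q : ℝ) (r ρ : E n → ℝ) (Ω : Set (E n))
    (J : (Fin n → ℕ) → E n → F) : ℝ≥0∞ :=
  ∑ i ∈ Finset.range (k + 1), ∑ β ∈ Finset.piAntidiag (Finset.univ : Finset (Fin n)) i,
    ∫⁻ x in Ω, ‖J β x‖ₑ ^ 2 * ENNReal.ofReal (r x ^ (-(n : ℝ) + 2 * ((i : ℝ) + q)) * ρ x)

/-- The norm of `H_{k,-q,ρ}(Ω)`. -/
def sobolevNorm (k : ℕ) (q : ℝ) (r ρ : E n → ℝ) (Ω : Set (E n))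
    (J : (Fin n → ℕ) → E n → F) : ℝ≥0∞ :=
  sobolevNormSq k q r ρ Ω J ^ (1 / 2 : ℝ)

/-- Membership in `H_{k,-q,ρ}(Ω)`, the completion of the smooth functions with bounded support
(without any condition on `∂Ω`) for the above norm: the derivatives of some sequence of such
functions converge to the family `J` in this norm. -/
def MemSobolev (k : ℕ) (q : ℝ) (r ρ : E n → ℝ) (Ω : Set (E n))
    (J : (Fin n → ℕ) → E n → F) : Prop :=
  (∀ β : Fin n → ℕ, ∑ i, β i ≤ k → AEStronglyMeasurable (J β) (volume.restrict Ω)) ∧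
  ∃ f : ℕ → E n → F, (∀ m, ContDiff ℝ ∞ (f m) ∧ HasCompactSupport (f m)) ∧
    Tendsto (fun m => sobolevNormSq k q r ρ Ω (fun β x => mpd β (f m) x - J β x)) atTop (𝓝 0)

/-- The norm of `H_{0,-q,ρ}(Ω)` for tensors with two indices:
`(∫_Ω ∑_{ij} |T_{ij}|² r^{-n+2q} ρ)^{1/2}`. -/
def tensorNorm (q : ℝ) (r ρ : E n → ℝ) (Ω : Set (E n))
    (T : E n → Matrix (Fin n) (Fin n) ℝ) : ℝ≥0∞ :=
  (∫⁻ x in Ω, (∑ i, ∑ j, ‖T x i j‖ₑ ^ 2) *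
    ENNReal.ofReal (r x ^ (-(n : ℝ) + 2 * q) * ρ x)) ^ (1 / 2 : ℝ)

end Sobolev

/-! ### Riemannian geometry in coordinates -/

section Geometry

variable {n : ℕ}

/-- Christoffel symbols `Γᵏᵢⱼ = ½ gᵏˡ (∂ᵢ gⱼₗ + ∂ⱼ gᵢₗ - ∂ₗ gᵢⱼ)`. -/
def christoffel (g : E n → Matrix (Fin n) (Fin n) ℝ) (k i j : Fin n) (x : E n) : ℝ :=
  ∑ l, (1 / 2 : ℝ) * (g x)⁻¹ k l *
    (pd i (fun y => g y j l) x + pd j (fun y => g y i l) x - pd l (fun y => g y i j) x)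

/-- Ricci curvature
`Rᵢⱼ = ∂ₖ Γᵏᵢⱼ - ∂ⱼ Γᵏᵢₖ + Γᵏₖₗ Γˡᵢⱼ - Γᵏⱼₗ Γˡᵢₖ`. -/
def ricci (g : E n → Matrix (Fin n) (Fin n) ℝ) (x : E n) : Matrix (Fin n) (Fin n) ℝ :=
  fun i j =>
    ∑ k, (pd k (christoffel g k i j) x - pd j (christoffel g k i k) x) +
    ∑ k, ∑ l, (christoffel g k k l x * christoffel g l i j x -
      christoffel g k j l x * christoffel g l i k x)

/-- The momentum tensor `πⁱʲ = kⁱʲ - (Tr_g k) gⁱʲ`, where `k` has lower indices. -/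
def momentum (g k : E n → Matrix (Fin n) (Fin n) ℝ) (x : E n) : Matrix (Fin n) (Fin n) ℝ :=
  (g x)⁻¹ * k x * (g x)⁻¹ - (∑ i, ∑ j, (g x)⁻¹ i j * k x i j) • (g x)⁻¹

/-- `Hess_g u`, for a function `u` given with its derivatives by the family `J`. -/
def hessian (g : E n → Matrix (Fin n) (Fin n) ℝ) (J : (Fin n → ℕ) → E n → ℝ) (x : E n) :
    Matrix (Fin n) (Fin n) ℝ :=
  fun i j => J (Pi.single i 1 + Pi.single j 1) x -
    ∑ k, christoffel g k i j x * J (Pi.single k 1) x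

/-- `Δ_g u`. -/
def laplacian (g : E n → Matrix (Fin n) (Fin n) ℝ) (J : (Fin n → ℕ) → E n → ℝ) (x : E n) : ℝ :=
  ∑ i, ∑ j, (g x)⁻¹ i j * hessian g J x i j

/-- The covariant derivative `∇ₗ Zᵃ` of a vector field `Z`, given with its derivatives by the
family `W`. -/
def covVec (g : E n → Matrix (Fin n) (Fin n) ℝ) (W : (Fin n → ℕ) → E n → E n) (l a : Fin n)
    (x : E n) : ℝ :=
  W (Pi.single l 1) x a + ∑ m, christoffel g a l m x * W 0 x m

/-- The covariant derivative `∇ₗ πᵃᵇ` of a tensor with two upper indices. -/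
def covTensor (g π : E n → Matrix (Fin n) (Fin n) ℝ) (l a b : Fin n) (x : E n) : ℝ :=
  pd l (fun y => π y a b) x +
    ∑ m, (christoffel g a l m x * π x m b + christoffel g b l m x * π x a m)

/-- `∇ₗ (Zᵃ πᵇᶜ)`. -/
def covVecTensor (g π : E n → Matrix (Fin n) (Fin n) ℝ) (W : (Fin n → ℕ) → E n → E n)
    (l a b c : Fin n) (x : E n) : ℝ :=
  covVec g W l a x * π x b c + W 0 x a * covTensor g π l b c x

/-- The trace `Tr_g π = gᵢⱼ πⁱʲ`. -/
def trUp (g π : E n → Matrix (Fin n) (Fin n) ℝ) (x : E n) : ℝ :=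
  ∑ i, ∑ j, g x i j * π x i j

/-- First component of `dΦ*_{(g,π)}[u,Z]`, the formal `L²(dυ_g)`-adjoint of the linearization at
`(g,π)` of the constraint map
`Φ(g,π) = (R_g + (Tr_g π)²/(n-1) - |π|_g², Div_g π)`, where `π` has upper indices and `Div_g π`
is a vector field. It is the symmetric tensor with lower indices
`-(Δ_g u) gᵢⱼ + (Hess_g u)ᵢⱼ - u Rᵢⱼ + u (2/(n-1) (Tr_g π) πᵢⱼ - 2 πᵢᵏ πₖⱼ)`
`  - ½ ∇ₗ (Zᵢ πˡⱼ + Zⱼ πˡᵢ) + ½ ∇ₗ (Zˡ πᵢⱼ) - ½ gᵢⱼ ∇ₗ (Zₘ πˡᵐ)`. -/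
def adjoint₁ (g π : E n → Matrix (Fin n) (Fin n) ℝ) (J : (Fin n → ℕ) → E n → ℝ)
    (W : (Fin n → ℕ) → E n → E n) (x : E n) : Matrix (Fin n) (Fin n) ℝ :=
  fun i j =>
    -(laplacian g J x) * g x i j + hessian g J x i j - J 0 x * ricci g x i j +
    J 0 x * (2 / ((n : ℝ) - 1) * trUp g π x * (g x * π x * g x) i j -
      2 * (g x * π x * g x * π x * g x) i j) +
    ∑ a, ∑ b, g x i a * g x j b *
      (∑ l, (-(1 / 2 : ℝ) * (covVecTensor g π W l a l b x + covVecTensor g π W l b l a x) +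
        (1 / 2 : ℝ) * covVecTensor g π W l l a b x)) -
    (1 / 2 : ℝ) * g x i j * ∑ l, ∑ a, ∑ m, g x a m * covVecTensor g π W l a l m x

/-- Second component of `dΦ*_{(g,π)}[u,Z]`, the symmetric tensor with upper indices
`-½ (∇ⁱ Zʲ + ∇ʲ Zⁱ) + u (2/(n-1) (Tr_g π) gⁱʲ - 2 πⁱʲ)`, that is `-½ 𝓛_Z g` plus a term
`π ∗ u`. -/
def adjoint₂ (g π : E n → Matrix (Fin n) (Fin n) ℝ) (J : (Fin n → ℕ) → E n → ℝ)
    (W : (Fin n → ℕ) → E n → E n) (x : E n) : Matrix (Fin n) (Fin n) ℝ :=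
  fun i j =>
    -(1 / 2 : ℝ) * ∑ l, ((g x)⁻¹ i l * covVec g W l j x + (g x)⁻¹ j l * covVec g W l i x) +
    J 0 x * (2 / ((n : ℝ) - 1) * trUp g π x * (g x)⁻¹ i j - 2 * π x i j)

end Geometry

/-! ### Asymptotically flat data -/

/-- `f = O^m(|y|^{-q})` on the exterior region `|y| > R`. -/
def DecaysLike {n : ℕ} (m : ℕ) (q R : ℝ) (f : E n → ℝ) : Prop :=
  ContDiffOn ℝ m f {y | R < ‖y‖} ∧
  ∃ K : ℝ, ∀ β : Fin n → ℕ, ∑ i, β i ≤ m → ∀ y : E n, R < ‖y‖ →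
    |mpd β f y| ≤ K * ‖y‖ ^ (-(q + ((∑ i, β i : ℕ) : ℝ)))

/-- The end of an asymptotically flat data set with decay `s`, in asymptotically flat coordinates
on `|y| > R`: a Riemannian metric `g` with `gᵢⱼ = δᵢⱼ + O²(|y|^{-s})` and a symmetric tensor `k`
with `kᵢⱼ = O¹(|y|^{-s-1})`. -/
structure AFEnd (n : ℕ) (s : ℝ) where
  R : ℝ
  R_pos : 0 < R
  g : E n → Matrix (Fin n) (Fin n) ℝ
  k : E n → Matrix (Fin n) (Fin n) ℝ
  g_posDef : ∀ y, R < ‖y‖ → (g y).PosDef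
  k_symm : ∀ y, R < ‖y‖ → (k y).IsSymm
  g_decay : ∀ i j, DecaysLike 2 s R (fun y => g y i j - (1 : Matrix (Fin n) (Fin n) ℝ) i j)
  k_decay : ∀ i j, DecaysLike 1 (s + 1) R (fun y => k y i j)

/-! ### Regularized cones and weights -/

/-- A regularized conical shell with vertex at the origin, angles `θ₁ < θ₂` about the axis spanned
by the unit vector `axis`, together with its angular weight `φ`. The space is cut by `∂Ω` into the
inner region `ΩI`, the transition region `Ω` and the outer region `ΩO`, which outside the unit
ball are given by the conditions `θ < θ₁`, `θ₁ < θ < θ₂` and `θ₂ < θ` on the angle `θ` with the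
axis. The function `φ` is smooth up to `∂Ω`, positive in `Ω`, vanishes on `∂Ω` with non-zero
gradient (so that `∂Ω` is a smooth hypersurface with `Ω` on one side), is the angular distance to
`∂Ω` near `∂Ω` outside the unit ball, and is constant along rays there. -/
structure RegularizedCone (n : ℕ) (θ₁ θ₂ : ℝ) where
  axis : E n
  axis_norm : ‖axis‖ = 1
  Ω : Set (E n)
  ΩI : Set (E n)
  ΩO : Set (E n)
  isOpen : IsOpen Ω
  isOpen_inner : IsOpen ΩI
  isOpen_outer : IsOpen ΩO
  isConnected : IsConnected Ω
  disjoint_inner : Disjoint Ω ΩI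
  disjoint_outer : Disjoint Ω ΩO
  disjoint_inner_outer : Disjoint ΩI ΩO
  frontier_eq : frontier Ω = frontier ΩI ∪ frontier ΩO
  disjoint_frontier : Disjoint (frontier ΩI) (frontier ΩO)
  union_eq : ΩI ∪ Ω ∪ ΩO = (frontier Ω)ᶜ
  mem_iff : ∀ x, 1 ≤ ‖x‖ →
    (x ∈ Ω ↔ θ₁ < InnerProductGeometry.angle axis x ∧ InnerProductGeometry.angle axis x < θ₂)
  mem_inner_iff : ∀ x, 1 ≤ ‖x‖ → (x ∈ ΩI ↔ InnerProductGeometry.angle axis x < θ₁)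
  mem_outer_iff : ∀ x, 1 ≤ ‖x‖ → (x ∈ ΩO ↔ θ₂ < InnerProductGeometry.angle axis x)
  φ : E n → ℝ
  φ_smooth : ∃ U : Set (E n), IsOpen U ∧ closure Ω ⊆ U ∧ ContDiffOn ℝ ∞ φ U
  φ_pos : ∀ x ∈ Ω, 0 < φ x
  φ_zero : ∀ x ∈ frontier Ω, φ x = 0
  φ_grad : ∀ x ∈ frontier Ω, fderiv ℝ φ x ≠ 0
  φ_near_inner : ∃ ε : ℝ, 0 < ε ∧ ∀ x, 1 ≤ ‖x‖ → θ₁ ≤ InnerProductGeometry.angle axis x →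
    InnerProductGeometry.angle axis x < θ₁ + ε → φ x = InnerProductGeometry.angle axis x - θ₁
  φ_near_outer : ∃ ε : ℝ, 0 < ε ∧ ∀ x, 1 ≤ ‖x‖ → InnerProductGeometry.angle axis x ≤ θ₂ →
    θ₂ - ε < InnerProductGeometry.angle axis x → φ x = θ₂ - InnerProductGeometry.angle axis x
  φ_cone : ∀ x ∈ Ω, 1 ≤ ‖x‖ → ∀ t : ℝ, 1 ≤ t → φ (t • x) = φ x

/-- A radial weight: smooth, positive, equal to `|x|` outside the unit ball. -/
def IsRadialWeight {n : ℕ} (r : E n → ℝ) : Prop :=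
  ContDiff ℝ ∞ r ∧ (∀ x, 0 < r x) ∧ ∀ x, 1 ≤ ‖x‖ → r x = ‖x‖

/-- An angular cutoff function for a regularized cone: it is `1` in the inner region, `0` in the
outer region, and outside the unit ball it depends only on the angle with the axis. -/
structure IsAngularCutoff {n : ℕ} {θ₁ θ₂ : ℝ} (D : RegularizedCone n θ₁ θ₂) (χ : E n → ℝ) :
    Prop where
  contDiff : ContDiff ℝ 2 χ
  mem_Icc : ∀ x, χ x ∈ Set.Icc (0 : ℝ) 1
  inner : ∀ x ∈ D.ΩI, χ x = 1
  outer : ∀ x ∈ D.ΩO, χ x = 0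
  angular : ∃ f : ℝ → ℝ, ∀ x, 1 ≤ ‖x‖ → χ x = f (InnerProductGeometry.angle D.axis x)

/-! ### The rough patch

The coordinates `x = y - a` are centred at the vertex `a`. The regularized cone with vertex `a` is
the model cone moved by a linear isometry `A` which maps its axis to the direction of `-a`. -/

/-- The transition region `Ω(a)` in the coordinates centred at `a`. -/
def RegularizedCone.region {n : ℕ} {θ₁ θ₂ : ℝ} (D : RegularizedCone n θ₁ θ₂)
    (A : E n ≃ₗᵢ[ℝ] E n) : Set (E n) :=
  {x | A.symm x ∈ D.Ω}

/-- The angular weight `ρ = φ^{2N}` on `Ω(a)`. -/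
def RegularizedCone.weight {n : ℕ} {θ₁ θ₂ : ℝ} (D : RegularizedCone n θ₁ θ₂)
    (A : E n ≃ₗᵢ[ℝ] E n) (N : ℕ) (x : E n) : ℝ :=
  D.φ (A.symm x) ^ (2 * N)

/-- The patched metric `χ g + (1 - χ) δ` in the coordinates centred at `a`. -/
def AFEnd.patchMetric {n : ℕ} {s : ℝ} (M : AFEnd n s) (χ : E n → ℝ) (a : E n)
    (A : E n ≃ₗᵢ[ℝ] E n) (x : E n) : Matrix (Fin n) (Fin n) ℝ :=
  χ (A.symm x) • M.g (x + a) + (1 - χ (A.symm x)) • (1 : Matrix (Fin n) (Fin n) ℝ)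

/-- The patched tensor `χ k` in the coordinates centred at `a`. -/
def AFEnd.patchTensor {n : ℕ} {s : ℝ} (M : AFEnd n s) (χ : E n → ℝ) (a : E n)
    (A : E n ≃ₗᵢ[ℝ] E n) (x : E n) : Matrix (Fin n) (Fin n) ℝ :=
  χ (A.symm x) • M.k (x + a)

/-- The momentum tensor of the patched data. -/
def AFEnd.patchMomentum {n : ℕ} {s : ℝ} (M : AFEnd n s) (χ : E n → ℝ) (a : E n)
    (A : E n ≃ₗᵢ[ℝ] E n) : E n → Matrix (Fin n) (Fin n) ℝ :=
  momentum (M.patchMetric χ a A) (M.patchTensor χ a A)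

end ConeGluing

end

open MeasureTheory Filter Topology
open scoped ContDiff ENNReal

noncomputable section

namespace ConeGluing

open scoped InnerProductSpace

/-! ### Divergence theorem and the multiplier identity for the symmetric gradient -/

section Divergence

variable {n : ℕ}

/-! At flat data the adjoint operator splits into `u ↦ Hess u - (Δu) δ` and `Z ↦ -½ (DZ + DZᵀ)`. The
first determines `Hess u` as soon as `n ≥ 2`. The flat estimate therefore reduces to a weighted Korn
inequality on the shell, bounding `∫ (|Z|² r^(b-2) + |DZ|² r^b) ρ` by `∫ |DZ + DZᵀ|² r^b ρ`
(`weighted_korn`, `korn_region`), with `b = n - 2p - 2`. It is applied to `Z`, to `∇u` with `b + 2`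
in place of `b`, and to `u v` with `v` a fixed unit vector, where it becomes a Hardy inequality for
`u`. What is needed of `p` is `b ≤ 0` and `n + b - 2 > 0`.

The Korn inequality is proved directly, without compactness or contradiction. For any vector field
`X`, the divergence of `⟨Z,X⟩ Z + ½|Z|² X` is the quadratic form `⟨Z, DX Z⟩ + ½|Z|² div X` plus
terms that contain only the symmetric gradient of `Z`. So every `X` whose form is bounded below
yields an `L²` bound for `Z`. No boundary condition on `Z` is needed, because `X` carries a power of
`φ` and its extension by zero is `C¹` on the whole space. Three choices of `X` are used. (1) `X =
φ^(2k+1) H ∇φ` gains two powers of `φ` at `∂Ω`, modulo a term of lower order (`boundary_estimate`).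
(2) A truncated radial field controls `Z` on the exact cone. There `φ` has no radial derivative, and
the radial component of `Z` is estimated separately (`radial_component_estimate`,
`exterior_estimate`). (3) A radial bump field in a ball carries control from a small ball to a
larger one (`ball_propagation`). Since `Ω` is connected, control spreads from the exact cone to
every compact subset (`controlled_nhds`). Together they absorb the lower order term of (1) and give
`weighted_norm_le`. The gradient follows from the null Lagrangian `(div Z)² - ∂ᵢZⱼ ∂ⱼZᵢ`, which is
the divergence of `(div Z) Z - ∂_Z Z` (`sum_pd_sq_le`).

For the patched data, the axis of the cone with vertex `a` points to the origin of the data, and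
`Ω(a)` stays outside the angle `θ₁` about it. Hence `|x + a|` is bounded below by a multiple of `|a|
+ |x|` on `Ω(a)` (`exists_separation`), and in scale invariant norms the patched data differ from
flat data by `O(|a|^(-s))`. The adjoint then differs from its flat model by `O(|a|^(-s))` times the
jets of `(u, Z)` (`exists_adjoint_bounds`), and for large `|a|` this error is absorbed. Uniformity
in `a` comes from two facts: the Korn constant is invariant under isometries, and all decay bounds
are proved for whole families at once. -/

/-- The divergence of a vector field. -/
def dvg (F : E n → E n) (x : E n) : ℝ := ∑ i, pd i F x i

/-- The operator norm of twice the symmetric gradient of a vector field. -/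
def symGrad (Z : E n → E n) (x : E n) : ℝ :=
  ‖fderiv ℝ Z x + ContinuousLinearMap.adjoint (fderiv ℝ Z x)‖

lemma sum_coord_smul (v : E n) :
    ∑ i, v i • (EuclideanSpace.single i (1 : ℝ) : E n) = v := by
  ext j
  simp [Finset.sum_apply, Pi.single_apply]

lemma clm_sum_coord {F : Type*} [NormedAddCommGroup F] [NormedSpace ℝ F] (L : E n →L[ℝ] F)
    (v : E n) : ∑ i, v i • L (EuclideanSpace.single i (1 : ℝ)) = L v := by
  conv_rhs => rw [← sum_coord_smul v]
  simp

lemma fderiv_coord {F : E n → E n} {x : E n} (hF : DifferentiableAt ℝ F x) (i : Fin n) (v : E n) :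
    fderiv ℝ (fun y => F y i) x v = fderiv ℝ F x v i := by
  have h := ((EuclideanSpace.proj i : E n →L[ℝ] ℝ).hasFDerivAt.comp x hF.hasFDerivAt).fderiv
  have h2 : ((EuclideanSpace.proj i : E n →L[ℝ] ℝ) ∘ F) = fun y => F y i := by
    ext y; simp
  rw [h2] at h
  rw [h]; simp

lemma continuous_dvg {F : E n → E n} (hF : ContDiff ℝ 1 F) : Continuous (dvg F) := by
  have : Continuous (fderiv ℝ F) := hF.continuous_fderiv one_ne_zero
  unfold dvg pd
  fun_prop

lemma dvg_eq_zero_of_fderiv {F : E n → E n} {x : E n} (h : fderiv ℝ F x = 0) : dvg F x = 0 := by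
  simp [dvg, pd, h]

lemma integral_dvg_eq_zero {F : E n → E n} (hF : ContDiff ℝ 1 F) (hc : HasCompactSupport F) :
    ∫ x, dvg F x = 0 := by
  have hd : Differentiable ℝ F := hF.differentiable one_ne_zero
  have hcont : Continuous (fderiv ℝ F) := hF.continuous_fderiv one_ne_zero
  have hcs : HasCompactSupport (fderiv ℝ F) := hc.fderiv ℝ
  have hint : ∀ i : Fin n, Integrable (fun x => pd i F x i) := by
    intro i
    refine Continuous.integrable_of_hasCompactSupport (by unfold pd; fun_prop) ?_
    refine hcs.comp_left (g := fun L : E n →L[ℝ] E n => (L (EuclideanSpace.single i 1)) i) ?_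
    simp
  unfold dvg
  rw [integral_finsetSum _ (fun i _ => hint i)]
  refine Finset.sum_eq_zero fun i _ => ?_
  have key := integral_mul_fderiv_eq_neg_fderiv_mul_of_integrable (μ := (volume : Measure (E n)))
    (f := fun _ : E n => (1 : ℝ)) (g := fun x => F x i) (v := EuclideanSpace.single i 1)
    (by simp) (by
      simp only [one_mul]
      refine (hint i).congr (Eventually.of_forall fun x => ?_)
      simp only [pd]
      rw [fderiv_coord (hd x)]) (by
      simp only [one_mul]
      refine Continuous.integrable_of_hasCompactSupport (by fun_prop) ?_
      exact hc.comp_left (g := fun v : E n => v i) (by simp))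
    (by intro x _; fun_prop) (by
      intro x _
      have := hd x
      fun_prop)
  simp only [one_mul, fderiv_fun_const, Pi.zero_apply, zero_apply, zero_mul,
    integral_zero, neg_zero] at key
  rw [← key]
  refine integral_congr_ae (Eventually.of_forall fun x => ?_)
  simp only [pd]
  rw [fderiv_coord (hd x)]

lemma HasCompactSupport.dvg {F : E n → E n} (hc : HasCompactSupport F) :
    HasCompactSupport (dvg F) := by
  refine (hc.fderiv ℝ).comp_left
    (g := fun L : E n →L[ℝ] E n => ∑ i, (L (EuclideanSpace.single i 1)) i) ?_
  simp

/-- Integrating a pointwise inequality modulo a divergence. -/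
lemma integral_le_of_le_add_dvg {P Q : E n → ℝ} {F : E n → E n} (hP : Integrable P)
    (hQ : Integrable Q) (hF : ContDiff ℝ 1 F) (hc : HasCompactSupport F)
    (h : ∀ x, P x ≤ Q x + ConeGluing.dvg F x) : ∫ x, P x ≤ ∫ x, Q x := by
  have hi : Integrable (ConeGluing.dvg F) :=
    (continuous_dvg hF).integrable_of_hasCompactSupport (HasCompactSupport.dvg hc)
  calc ∫ x, P x ≤ ∫ x, (Q x + ConeGluing.dvg F x) := integral_mono hP (hQ.add hi) h
    _ = ∫ x, Q x := by rw [integral_add hQ hi, integral_dvg_eq_zero hF hc, add_zero]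

lemma dvg_add {F G : E n → E n} {x : E n} (hF : DifferentiableAt ℝ F x)
    (hG : DifferentiableAt ℝ G x) :
    dvg (fun y => F y + G y) x = dvg F x + dvg G x := by
  simp only [dvg, pd]
  rw [fderiv_fun_add hF hG]
  simp [Finset.sum_add_distrib]

lemma dvg_smul {g : E n → ℝ} {Y : E n → E n} {x : E n} (hg : DifferentiableAt ℝ g x)
    (hY : DifferentiableAt ℝ Y x) :
    dvg (fun y => g y • Y y) x = g x * dvg Y x + fderiv ℝ g x (Y x) := by
  simp only [dvg, pd]
  rw [fderiv_fun_smul hg hY]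
  simp only [add_apply, smul_apply, PiLp.add_apply,
    PiLp.smul_apply, smul_eq_mul, Finset.sum_add_distrib, ContinuousLinearMap.smulRight_apply,
    ← Finset.mul_sum]
  congr 1
  rw [← clm_sum_coord (fderiv ℝ g x) (Y x)]
  exact Finset.sum_congr rfl fun i _ => by simp [mul_comm]

lemma dvg_id (x : E n) : dvg (fun y => y) x = n := by
  simp [dvg, pd]

lemma symGrad_nonneg (Z : E n → E n) (x : E n) : 0 ≤ symGrad Z x := norm_nonneg _

lemma abs_inner_add_inner_le (Z : E n → E n) (x v w : E n) :
    |⟪fderiv ℝ Z x v, w⟫_ℝ + ⟪fderiv ℝ Z x w, v⟫_ℝ| ≤ symGrad Z x * ‖v‖ * ‖w‖ := by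
  have h : ⟪fderiv ℝ Z x v, w⟫_ℝ + ⟪fderiv ℝ Z x w, v⟫_ℝ =
      ⟪(fderiv ℝ Z x + ContinuousLinearMap.adjoint (fderiv ℝ Z x)) v, w⟫_ℝ := by
    rw [add_apply, inner_add_left, ContinuousLinearMap.adjoint_inner_left,
      real_inner_comm v]
  rw [h]
  refine (abs_real_inner_le_norm _ _).trans ?_
  gcongr
  exact ContinuousLinearMap.le_opNorm _ _

lemma pd_eq_inner (Z : E n → E n) (x : E n) (i j : Fin n) :
    pd i Z x j = ⟪fderiv ℝ Z x (EuclideanSpace.single i 1), EuclideanSpace.single j (1 : ℝ)⟫_ℝ := by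
  rw [real_inner_comm, EuclideanSpace.inner_single_left]
  simp [pd]

lemma abs_pd_add_pd_le (Z : E n → E n) (x : E n) (i j : Fin n) :
    |pd i Z x j + pd j Z x i| ≤ symGrad Z x := by
  rw [pd_eq_inner, pd_eq_inner]
  simpa using abs_inner_add_inner_le Z x (EuclideanSpace.single i 1) (EuclideanSpace.single j 1)

lemma abs_dvg_le (Z : E n → E n) (x : E n) : |dvg Z x| ≤ n * symGrad Z x := by
  unfold dvg
  refine (Finset.abs_sum_le_sum_abs _ _).trans ?_
  refine (Finset.sum_le_sum (g := fun _ => symGrad Z x) fun i _ => ?_).trans (by simp)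
  have h := abs_pd_add_pd_le Z x i i
  rw [← two_mul, abs_mul, abs_two] at h
  linarith [abs_nonneg (pd i Z x i)]

lemma continuous_symGrad {Z : E n → E n} (hZ : ContDiff ℝ 1 Z) : Continuous (symGrad Z) := by
  have : Continuous (fderiv ℝ Z) := hZ.continuous_fderiv one_ne_zero
  unfold symGrad
  fun_prop

/-- The field whose divergence gives the multiplier identity for the symmetric gradient. -/
def multiplierField (Z X : E n → E n) (y : E n) : E n :=
  ⟪Z y, X y⟫_ℝ • Z y + ((1 / 2 : ℝ) * ‖Z y‖ ^ 2) • X y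

/-- The two parts of the field are balanced so that first derivatives of `Z` occur only in the
symmetric combination `⟨D_Z Z, X⟩ + ⟨D_X Z, Z⟩` and in `div Z`. Both are bounded by the symmetric
gradient. -/
lemma dvg_multiplierField {Z X : E n → E n} {x : E n} (hZ : DifferentiableAt ℝ Z x)
    (hX : DifferentiableAt ℝ X x) :
    dvg (multiplierField Z X) x = ⟪Z x, fderiv ℝ X x (Z x)⟫_ℝ + 1 / 2 * ‖Z x‖ ^ 2 * dvg X x +
      (⟪fderiv ℝ Z x (Z x), X x⟫_ℝ + ⟪fderiv ℝ Z x (X x), Z x⟫_ℝ) +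
      ⟪Z x, X x⟫_ℝ * dvg Z x := by
  unfold multiplierField
  have hi : DifferentiableAt ℝ (fun y => ⟪Z y, X y⟫_ℝ) x := hZ.inner ℝ hX
  have hs : DifferentiableAt ℝ (fun y => ‖Z y‖ ^ 2) x := hZ.norm_sq ℝ
  have hs' := hs.const_mul (1 / 2 : ℝ)
  rw [dvg_add (hi.fun_smul hZ) (hs'.fun_smul hX), dvg_smul hi hZ, dvg_smul hs' hX,
    fderiv_inner_apply ℝ hZ hX, fderiv_const_mul hs]
  have h : fderiv ℝ (fun y => ‖Z y‖ ^ 2) x (X x) = 2 * ⟪fderiv ℝ Z x (X x), Z x⟫_ℝ := by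
    have h2 : (fun y => ‖Z y‖ ^ 2) = fun y => ⟪Z y, Z y⟫_ℝ := by
      ext y; rw [real_inner_self_eq_norm_sq]
    rw [h2, fderiv_inner_apply ℝ hZ hZ, real_inner_comm]
    ring
  simp only [smul_apply, smul_eq_mul, h]
  ring

/-- This reduces an integral estimate to a pointwise inequality for the form defined by `X`. In the
factor `n + 1`, the `1` pays for the symmetric cross terms and the `n` for `div Z`. -/
lemma multiplier_le {Z X : E n → E n} (hZ : ContDiff ℝ 1 Z) (hZc : HasCompactSupport Z)
    (hX : ContDiff ℝ 1 X) {P Q : E n → ℝ} (hP : Integrable P) (hQ : Integrable Q)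
    (h : ∀ x, P x + (n + 1) * symGrad Z x * ‖Z x‖ * ‖X x‖ ≤
      Q x + (⟪Z x, fderiv ℝ X x (Z x)⟫_ℝ + 1 / 2 * ‖Z x‖ ^ 2 * dvg X x)) :
    ∫ x, P x ≤ ∫ x, Q x := by
  refine integral_le_of_le_add_dvg (F := multiplierField Z X) hP hQ ?_ ?_ fun x => ?_
  · unfold multiplierField
    exact ((hZ.inner ℝ hX).smul hZ).add ((contDiff_const.mul (hZ.norm_sq ℝ)).smul hX)
  · refine hZc.mono' ?_
    intro x hx
    apply subset_tsupport
    intro h0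
    apply hx
    simp [multiplierField, h0]
  · rw [dvg_multiplierField (hZ.differentiable one_ne_zero x) (hX.differentiable one_ne_zero x)]
    have h1 := abs_inner_add_inner_le Z x (Z x) (X x)
    have h2 : |⟪Z x, X x⟫_ℝ * dvg Z x| ≤ n * symGrad Z x * ‖Z x‖ * ‖X x‖ := by
      rw [abs_mul]
      calc _ ≤ (‖Z x‖ * ‖X x‖) * (n * symGrad Z x) := by
            gcongr
            · exact abs_real_inner_le_norm _ _
            · exact abs_dvg_le Z x
        _ = _ := by ring
    have h3 := h x
    have h4 := neg_abs_le (⟪fderiv ℝ Z x (Z x), X x⟫_ℝ + ⟪fderiv ℝ Z x (X x), Z x⟫_ℝ)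
    have h5 := neg_abs_le (⟪Z x, X x⟫_ℝ * dvg Z x)
    linarith

end Divergence

/-! ### Extension by zero of fields weighted by a power of a defining function -/

section Extension

variable {G F : Type*} [NormedAddCommGroup G] [NormedSpace ℝ G] [NormedAddCommGroup F]
  [NormedSpace ℝ F]

lemma continuous_indicator_of_frontier {G F : Type*} [TopologicalSpace G] [TopologicalSpace F]
    [Zero F] {Ω U : Set G} (hU : closure Ω ⊆ U) {f : G → F}
    (hf : ContinuousOn f U) (h0 : ∀ x ∈ frontier Ω, f x = 0) : Continuous (Ω.indicator f) :=
  continuous_indicator (fun x hx => h0 x hx) (hf.mono hU)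

/-- At a frontier point `φ` is `O(|y - x|)` and `f` is bounded, so a power `k ≥ 2` of `φ` makes the
product `o(|y - x|)`, whatever the sign of `φ` outside `Ω`. -/
lemma hasFDerivAt_indicator_pow_smul {Ω U : Set G} (hΩ : IsOpen Ω) (hUo : IsOpen U)
    (hU : closure Ω ⊆ U) {φ : G → ℝ} (hφ : DifferentiableOn ℝ φ U)
    (h0 : ∀ x ∈ frontier Ω, φ x = 0) {f : G → F} (hf : ContinuousOn f U)
    {k : ℕ} (hk : 2 ≤ k) {x : G} (hx : x ∉ Ω) :
    HasFDerivAt (Ω.indicator (fun y => φ y ^ k • f y)) (0 : G →L[ℝ] F) x := by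
  by_cases hxc : x ∈ closure Ω
  · have hxf : x ∈ frontier Ω := by
      rw [frontier, hΩ.interior_eq]; exact ⟨hxc, hx⟩
    have hUx : U ∈ 𝓝 x := hUo.mem_nhds (hU hxc)
    have hφx := (hφ x (hU hxc)).differentiableAt hUx
    have hO : (fun y => φ y) =O[𝓝 x] fun y => y - x := by
      have := hφx.hasFDerivAt.isBigO_sub
      simpa [h0 x hxf] using this
    have hfO : f =O[𝓝 x] fun _ => (1 : ℝ) :=
      (hf.continuousAt hUx).isBigO_one ℝ
    have h2 : (fun y => φ y ^ k • f y) =o[𝓝 x] fun y => y - x := by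
      have h3 : (fun y => φ y ^ k • f y) =O[𝓝 x] fun y => ‖y - x‖ ^ k • (1 : ℝ) :=
        (hO.norm_right.pow k).smul hfO
      refine h3.trans_isLittleO ?_
      have h4 : (fun y : G => ‖y - x‖ ^ k) =o[𝓝 x] fun y => ‖y - x‖ ^ 1 := by
        have := Asymptotics.isLittleO_pow_pow (𝕜 := ℝ) (show 1 < k by omega)
        refine this.comp_tendsto ?_
        have : Tendsto (fun y : G => ‖y - x‖) (𝓝 x) (𝓝 ‖x - x‖) :=
          (continuous_id.sub continuous_const).norm.tendsto x
        simpa using this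
      simpa using h4
    refine HasFDerivAt.of_isLittleO ?_
    have hxz : Ω.indicator (fun y => φ y ^ k • f y) x = 0 := Set.indicator_of_notMem hx _
    simp only [hxz, sub_zero, zero_apply]
    refine Asymptotics.IsBigO.trans_isLittleO ?_ h2
    refine Asymptotics.IsBigO.of_bound 1 (Eventually.of_forall fun y => ?_)
    rw [one_mul]
    exact norm_indicator_le_norm_self _ _
  · have : Ω.indicator (fun y => φ y ^ k • f y) =ᶠ[𝓝 x] fun _ => (0 : F) := by
      filter_upwards [isClosed_closure.isOpen_compl.mem_nhds hxc] with y hy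
      exact Set.indicator_of_notMem (fun h => hy (subset_closure h)) _
    exact (hasFDerivAt_const (0 : F) x).congr_of_eventuallyEq this

/-- This replaces integration by parts on `Ω`: the weighted field becomes a `C¹` field on the whole
space, so no boundary terms appear even though the fields tested against are arbitrary on `∂Ω`. -/
lemma contDiff_indicator_pow_smul {Ω U : Set G} (hΩ : IsOpen Ω) (hUo : IsOpen U)
    (hU : closure Ω ⊆ U) {φ : G → ℝ} (hφ : ContDiffOn ℝ 1 φ U)
    (h0 : ∀ x ∈ frontier Ω, φ x = 0) {f : G → F} (hf : ContDiffOn ℝ 1 f U)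
    {k : ℕ} (hk : 2 ≤ k) :
    ContDiff ℝ 1 (Ω.indicator (fun y => φ y ^ k • f y)) := by
  have hg : ContDiffOn ℝ 1 (fun y => φ y ^ k • f y) U := (hφ.pow k).smul hf
  have hgd : DifferentiableOn ℝ (fun y => φ y ^ k • f y) U := hg.differentiableOn one_ne_zero
  have hφd : DifferentiableOn ℝ φ U := hφ.differentiableOn one_ne_zero
  have hfd : DifferentiableOn ℝ f U := hf.differentiableOn one_ne_zero
  rw [contDiff_one_iff_hasFDerivAt]
  refine ⟨Ω.indicator (fderiv ℝ (fun y => φ y ^ k • f y)), ?_, fun x => ?_⟩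
  · refine continuous_indicator_of_frontier hU (hg.continuousOn_fderiv_of_isOpen hUo le_rfl) ?_
    intro x hx
    have hxU : x ∈ U := hU (frontier_subset_closure hx)
    have h1 := (hφd x hxU).differentiableAt (hUo.mem_nhds hxU)
    have h2 := (hfd x hxU).differentiableAt (hUo.mem_nhds hxU)
    rw [fderiv_fun_smul (h1.fun_pow k) h2]
    have : fderiv ℝ (fun y => φ y ^ k) x = 0 := by
      have := (h1.hasFDerivAt.pow k).fderiv
      rw [this, h0 x hx]
      simp [show k - 1 ≠ 0 by omega]
    rw [this, h0 x hx]
    simp [show k ≠ 0 by omega]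
  · by_cases hx : x ∈ Ω
    · rw [Set.indicator_of_mem hx]
      have hxU : x ∈ U := hU (subset_closure hx)
      refine (((hgd x hxU).differentiableAt (hUo.mem_nhds hxU)).hasFDerivAt).congr_of_eventuallyEq ?_
      filter_upwards [hΩ.mem_nhds hx] with y hy
      exact Set.indicator_of_mem hy _
    · rw [Set.indicator_of_notMem hx]
      exact hasFDerivAt_indicator_pow_smul hΩ hUo hU hφd h0 hf.continuousOn hk hx

end Extension

/-! ### Homogeneity of the angular weight and scale invariant bounds -/

section ConeBounds

variable {n : ℕ} {θ₁ θ₂ : ℝ} (D : RegularizedCone n θ₁ θ₂)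

namespace RegularizedCone

lemma smul_mem_iff {x : E n} (hx : 1 ≤ ‖x‖) {c : ℝ} (hc : 0 < c) (hcx : 1 ≤ ‖c • x‖) :
    c • x ∈ D.Ω ↔ x ∈ D.Ω := by
  rw [D.mem_iff _ hcx, D.mem_iff _ hx, InnerProductGeometry.angle_smul_right_of_pos _ _ hc]

lemma φ_smul {x : E n} (hx : x ∈ D.Ω) (h1 : 1 ≤ ‖x‖) {c : ℝ} (hc : 0 < c)
    (hcx : 1 ≤ ‖c • x‖) : D.φ (c • x) = D.φ x := by
  rcases le_total 1 c with h | h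
  · exact D.φ_cone x hx h1 c h
  · have := D.φ_cone (c • x) ((D.smul_mem_iff h1 hc hcx).2 hx) hcx c⁻¹
      ((one_le_inv₀ hc).2 h)
    rw [smul_smul, inv_mul_cancel₀ hc.ne', one_smul] at this
    exact this.symm

lemma contDiffAt_φ {x : E n} (hx : x ∈ closure D.Ω) : ContDiffAt ℝ ∞ D.φ x := by
  obtain ⟨U, hU, hc, hs⟩ := D.φ_smooth
  exact hs.contDiffAt (hU.mem_nhds (hc hx))

lemma differentiableAt_φ {x : E n} (hx : x ∈ closure D.Ω) : DifferentiableAt ℝ D.φ x :=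
  (D.contDiffAt_φ hx).differentiableAt (by simp)

/-- The gradient of the angular weight. -/
def grad : E n → E n := gradient D.φ

lemma inner_grad (x v : E n) : ⟪D.grad x, v⟫_ℝ = fderiv ℝ D.φ x v := inner_gradient_left

lemma norm_grad (x : E n) : ‖D.grad x‖ = ‖fderiv ℝ D.φ x‖ := by
  rw [← toDual_gradient, LinearIsometryEquiv.norm_map]; rfl

lemma contDiffAt_grad {x : E n} (hx : x ∈ closure D.Ω) : ContDiffAt ℝ ∞ D.grad x := by
  have h : ContDiffAt ℝ ∞ (fderiv ℝ D.φ) x := (D.contDiffAt_φ hx).fderiv_right (by simp)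
  exact ((InnerProductSpace.toDual ℝ (E n)).symm.contDiff.contDiffAt).comp x h

lemma eventually_φ_smul {x : E n} (hx : x ∈ D.Ω) (h1 : 1 < ‖x‖) {c : ℝ}
    (hcx : 1 < ‖c • x‖) : ∀ᶠ y in 𝓝 x, y ∈ D.Ω ∧ 1 < ‖y‖ ∧ 1 < ‖c • y‖ := by
  refine (D.isOpen.eventually_mem hx).and (Filter.Eventually.and ?_ ?_)
  · exact (continuous_norm.continuousAt).eventually (lt_mem_nhds h1)
  · exact ((continuous_const_smul c).norm.continuousAt).eventually (lt_mem_nhds hcx)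

lemma grad_smul {x : E n} (hx : x ∈ D.Ω) (h1 : 1 < ‖x‖) {c : ℝ} (hc : 0 < c)
    (hcx : 1 < ‖c • x‖) : c • D.grad (c • x) = D.grad x := by
  have h : c • fderiv ℝ D.φ (c • x) = fderiv ℝ D.φ x := by
    rw [← fderiv_comp_smul]
    refine Filter.EventuallyEq.fderiv_eq ?_
    filter_upwards [D.eventually_φ_smul hx h1 hcx] with y hy
    exact D.φ_smul hy.1 hy.2.1.le hc hy.2.2.le
  refine ext_inner_right ℝ fun v => ?_
  rw [inner_smul_left, D.inner_grad, D.inner_grad, ← h]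
  simp

lemma fderiv_grad_smul {x : E n} (hx : x ∈ D.Ω) (h1 : 1 < ‖x‖) {c : ℝ} (hc : 0 < c)
    (hcx : 1 < ‖c • x‖) :
    (c ^ 2) • fderiv ℝ D.grad (c • x) = fderiv ℝ D.grad x := by
  have h : (fun y => D.grad (c • y)) =ᶠ[𝓝 x] fun y => c⁻¹ • D.grad y := by
    filter_upwards [D.eventually_φ_smul hx h1 hcx] with y hy
    rw [← D.grad_smul hy.1 hy.2.1 hc hy.2.2, smul_smul, inv_mul_cancel₀ hc.ne', one_smul]
  have h2 := h.fderiv_eq (𝕜 := ℝ)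
  rw [fderiv_comp_smul] at h2
  have h3 : fderiv ℝ (fun y => c⁻¹ • D.grad y) x = c⁻¹ • fderiv ℝ D.grad x :=
    fderiv_fun_const_smul ((D.contDiffAt_grad (subset_closure hx)).differentiableAt (by simp))
      (c⁻¹ : ℝ)
  rw [h3] at h2
  rw [pow_two, ← smul_smul, h2, smul_smul, mul_inv_cancel₀ hc.ne', one_smul]

/-- Euler's relation in degree zero. It is the reason why radial multipliers produce no term that is
singular at `∂Ω`. -/
lemma fderiv_φ_self {x : E n} (hx : x ∈ D.Ω) (h1 : 1 < ‖x‖) : fderiv ℝ D.φ x x = 0 := by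
  have hd : HasDerivAt (fun c : ℝ => D.φ (c • x)) (fderiv ℝ D.φ ((1 : ℝ) • x) ((1 : ℝ) • x)) 1 := by
    have h0 : HasDerivAt (fun c : ℝ => c • x) ((1 : ℝ) • x) 1 := (hasDerivAt_id (1 : ℝ)).smul_const x
    have h2 : HasFDerivAt D.φ (fderiv ℝ D.φ ((1 : ℝ) • x)) ((1 : ℝ) • x) := by
      rw [one_smul]; exact (D.differentiableAt_φ (subset_closure hx)).hasFDerivAt
    exact h2.comp_hasDerivAt (1 : ℝ) h0
  have he : (fun c : ℝ => D.φ (c • x)) =ᶠ[𝓝 1] fun _ => D.φ x := by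
    have hcont : ContinuousAt (fun c : ℝ => ‖c • x‖) 1 :=
      (continuous_id.smul continuous_const).norm.continuousAt
    filter_upwards [hcont.eventually (lt_mem_nhds (show 1 < ‖(1 : ℝ) • x‖ by rwa [one_smul])),
      lt_mem_nhds (show (0 : ℝ) < 1 by norm_num)] with c hc hc0
    exact D.φ_smul hx h1.le hc0 hc.le
  have h3 := (he.hasDerivAt_iff.1 hd).unique (hasDerivAt_const 1 (D.φ x))
  simpa using h3

/-- Scale invariant bounds for the angular weight. -/
lemma exists_bounds : ∃ K c : ℝ, 1 ≤ K ∧ 0 < c ∧ ∀ x ∈ D.Ω,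
    D.φ x ≤ K ∧ (1 + ‖x‖ ^ 2) * ‖D.grad x‖ ^ 2 ≤ K ^ 2 ∧
    (1 + ‖x‖ ^ 2) * ‖fderiv ℝ D.grad x‖ ≤ K ∧
    c ≤ D.φ x ^ 2 + (1 + ‖x‖ ^ 2) * ‖D.grad x‖ ^ 2 := by
  set S : Set (E n) := closure D.Ω ∩ Metric.closedBall 0 2 with hS
  have hSc : IsCompact S := (isCompact_closedBall _ _).inter_left isClosed_closure
  have c0 : ContinuousOn D.φ S := fun x hx => (D.contDiffAt_φ hx.1).continuousAt.continuousWithinAt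
  have c1 : ContinuousOn D.grad S :=
    fun x hx => (D.contDiffAt_grad hx.1).continuousAt.continuousWithinAt
  have c2 : ContinuousOn (fderiv ℝ D.grad) S := fun x hx =>
    (((D.contDiffAt_grad hx.1).fderiv_right (m := ∞) (by simp)).continuousAt).continuousWithinAt
  obtain ⟨K0, hK0⟩ := hSc.exists_bound_of_continuousOn c0
  obtain ⟨K1, hK1⟩ := hSc.exists_bound_of_continuousOn c1
  obtain ⟨K2, hK2⟩ := hSc.exists_bound_of_continuousOn c2
  obtain ⟨c, hc, hcS⟩ : ∃ c : ℝ, 0 < c ∧ ∀ x ∈ S, c ≤ D.φ x ^ 2 + ‖D.grad x‖ ^ 2 := by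
    -- In `Ω` the weight is positive, and on the frontier its gradient does not vanish. The sum
    -- therefore has a positive minimum on the compact set.
    refine hSc.exists_forall_le' (a := (0 : ℝ)) ((c0.pow 2).add (c1.norm.pow 2)) ?_
    intro x hx
    by_cases hxΩ : x ∈ D.Ω
    · have := D.φ_pos x hxΩ
      simp only [Pi.add_apply, Pi.pow_apply]
      positivity
    · have hf : x ∈ frontier D.Ω := by
        rw [frontier, D.isOpen.interior_eq]; exact ⟨hx.1, hxΩ⟩
      have := norm_pos_iff.2 (D.φ_grad x hf)
      rw [← D.norm_grad] at this
      simp only [Pi.add_apply, Pi.pow_apply]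
      positivity
  set K : ℝ := 1 + |K0| + 5 * |K1| + 5 * |K2| with hK
  have a0 := abs_nonneg K0
  have a1 := abs_nonneg K1
  have a2 := abs_nonneg K2
  have b0 := le_abs_self K0
  have b1 := le_abs_self K1
  have b2 := le_abs_self K2
  refine ⟨K, c, by linarith, hc, fun x hx => ?_⟩
  rcases le_or_gt ‖x‖ 2 with h2 | h2
  · have hxS : x ∈ S := ⟨subset_closure hx, by simpa using h2⟩
    have e0 := hK0 x hxS
    have e1 := hK1 x hxS
    have e2 := hK2 x hxS
    have ht : 1 + ‖x‖ ^ 2 ≤ 5 := by nlinarith [norm_nonneg x]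
    refine ⟨?_, ?_, ?_, ?_⟩
    · have := le_abs_self (D.φ x)
      rw [Real.norm_eq_abs] at e0
      linarith
    · calc (1 + ‖x‖ ^ 2) * ‖D.grad x‖ ^ 2 ≤ 5 * |K1| ^ 2 := by
            gcongr; linarith
        _ ≤ (5 * |K1|) ^ 2 := by nlinarith
        _ ≤ K ^ 2 := by gcongr; linarith
    · calc (1 + ‖x‖ ^ 2) * ‖fderiv ℝ D.grad x‖ ≤ 5 * |K2| := by
            gcongr; linarith
        _ ≤ K := by linarith
    · refine (hcS x hxS).trans ?_
      nlinarith [sq_nonneg ‖x‖, sq_nonneg ‖D.grad x‖,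
        mul_nonneg (sq_nonneg ‖x‖) (sq_nonneg ‖D.grad x‖)]
  · have hx0 : 0 < ‖x‖ := by linarith
    -- Points outside the ball of radius 2 are scaled back to its sphere, where compactness applies.
    -- The weight, its gradient and the derivative of the gradient are homogeneous of degrees 0, -1
    -- and -2. The radius 2 keeps the scaled point in the open set `|x| > 1` where homogeneity may
    -- be differentiated.
    set d : ℝ := 2 / ‖x‖ with hd
    have hd0 : 0 < d := by positivity
    have hdx : ‖d • x‖ = 2 := by
      rw [norm_smul, Real.norm_eq_abs, abs_of_pos hd0, hd, div_mul_cancel₀ _ hx0.ne']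
    have h1 : 1 < ‖x‖ := by linarith
    have h1' : 1 < ‖d • x‖ := by rw [hdx]; norm_num
    have hyΩ : d • x ∈ D.Ω := (D.smul_mem_iff h1.le hd0 h1'.le).2 hx
    have hyS : d • x ∈ S := ⟨subset_closure hyΩ, by simp [hdx]⟩
    have e0 := hK0 _ hyS
    have e1 := hK1 _ hyS
    have e2 := hK2 _ hyS
    have e3 := hcS _ hyS
    rw [D.φ_smul hx h1.le hd0 h1'.le] at e0 e3
    have f1 : ‖D.grad x‖ = d * ‖D.grad (d • x)‖ := by
      rw [← D.grad_smul hx h1 hd0 h1', norm_smul, Real.norm_eq_abs, abs_of_pos hd0]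
    have f2 : ‖fderiv ℝ D.grad x‖ = d ^ 2 * ‖fderiv ℝ D.grad (d • x)‖ := by
      rw [← D.fderiv_grad_smul hx h1 hd0 h1', norm_smul, Real.norm_eq_abs,
        abs_of_pos (by positivity)]
    have hdd : (1 + ‖x‖ ^ 2) * d ^ 2 ≤ 5 := by
      rw [hd, div_pow, ← mul_div_assoc, div_le_iff₀ (by positivity)]
      nlinarith
    have hdd' : 1 ≤ (1 + ‖x‖ ^ 2) * d ^ 2 := by
      rw [hd, div_pow, ← mul_div_assoc, le_div_iff₀ (by positivity)]
      nlinarith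
    refine ⟨?_, ?_, ?_, ?_⟩
    · have := le_abs_self (D.φ x)
      rw [Real.norm_eq_abs] at e0
      linarith
    · rw [f1]
      calc _ = ((1 + ‖x‖ ^ 2) * d ^ 2) * ‖D.grad (d • x)‖ ^ 2 := by ring
        _ ≤ 5 * |K1| ^ 2 := by gcongr; linarith
        _ ≤ (5 * |K1|) ^ 2 := by nlinarith
        _ ≤ K ^ 2 := by gcongr; linarith
    · rw [f2]
      calc _ = ((1 + ‖x‖ ^ 2) * d ^ 2) * ‖fderiv ℝ D.grad (d • x)‖ := by ring
        _ ≤ 5 * |K2| := by gcongr; linarith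
        _ ≤ K := by linarith
    · rw [f1]
      have : ‖D.grad (d • x)‖ ^ 2 ≤
          ((1 + ‖x‖ ^ 2) * d ^ 2) * ‖D.grad (d • x)‖ ^ 2 :=
        le_mul_of_one_le_left (by positivity) hdd'
      calc c ≤ _ := e3
        _ ≤ D.φ x ^ 2 + ((1 + ‖x‖ ^ 2) * d ^ 2) * ‖D.grad (d • x)‖ ^ 2 := by linarith
        _ = _ := by ring

/-- This point lies in the exact cone and is the seed for the spreading of control along `Ω`. It is
obtained by tilting the axis by the mean angle towards an orthogonal unit vector. -/
lemma exists_mem_norm_eq_two (hn : 2 ≤ n) (h1 : 0 < θ₁) (h12 : θ₁ < θ₂) (h2 : θ₂ < Real.pi) :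
    ∃ x ∈ D.Ω, ‖x‖ = 2 := by
  obtain ⟨f, hf, hf1⟩ : ∃ f : E n, ⟪D.axis, f⟫_ℝ = 0 ∧ ‖f‖ = 1 := by
    have hne : (ℝ ∙ D.axis)ᗮ ≠ ⊥ := by
      intro h
      have h3 := Submodule.finrank_add_finrank_orthogonal (ℝ ∙ D.axis)
      have h4 := finrank_span_singleton (K := ℝ) (v := D.axis) (by
        intro h0; have := D.axis_norm; rw [h0, norm_zero] at this; norm_num at this)
      rw [h, finrank_bot, h4, finrank_euclideanSpace, Fintype.card_fin] at h3
      omega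
    obtain ⟨f, hf, hf0⟩ := Submodule.exists_mem_ne_zero_of_ne_bot hne
    rw [Submodule.mem_orthogonal_singleton_iff_inner_right] at hf
    refine ⟨‖f‖⁻¹ • f, by rw [inner_smul_right, hf, mul_zero], ?_⟩
    rw [norm_smul, norm_inv, norm_norm, inv_mul_cancel₀ (norm_ne_zero_iff.2 hf0)]
  set t := (θ₁ + θ₂) / 2 with ht
  set y : E n := Real.cos t • D.axis + Real.sin t • f with hy
  have hy1 : ‖y‖ = 1 := by
    have h : ‖y‖ ^ 2 = 1 := by
      rw [hy, norm_add_sq_real, norm_smul, norm_smul, D.axis_norm, hf1, inner_smul_left,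
        inner_smul_right, hf]
      simp
    nlinarith [norm_nonneg y]
  have hang : InnerProductGeometry.angle D.axis y = t := by
    rw [InnerProductGeometry.angle, hy1, D.axis_norm, hy, inner_add_right, inner_smul_right,
      inner_smul_right, hf, real_inner_self_eq_norm_sq, D.axis_norm]
    simp only [one_pow, mul_one, mul_zero, add_zero, div_one]
    exact Real.arccos_cos (by linarith) (by linarith)
  refine ⟨(2 : ℝ) • y, ?_, by rw [norm_smul, hy1]; norm_num⟩
  rw [D.mem_iff _ (by rw [norm_smul, hy1]; norm_num),
    InnerProductGeometry.angle_smul_right_of_pos _ _ (by norm_num), hang]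
  constructor <;> linarith

/-- The angular weight extended by zero. -/
def ψ : E n → ℝ := D.Ω.indicator D.φ

lemma ψ_of_mem {x : E n} (hx : x ∈ D.Ω) : D.ψ x = D.φ x := Set.indicator_of_mem hx _

lemma ψ_of_notMem {x : E n} (hx : x ∉ D.Ω) : D.ψ x = 0 := Set.indicator_of_notMem hx _

lemma ψ_nonneg (x : E n) : 0 ≤ D.ψ x := Set.indicator_nonneg (fun y hy => (D.φ_pos y hy).le) x

lemma ψ_pos_iff {x : E n} : 0 < D.ψ x ↔ x ∈ D.Ω := by
  by_cases hx : x ∈ D.Ω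
  · simp [D.ψ_of_mem hx, D.φ_pos x hx, hx]
  · simp [D.ψ_of_notMem hx, hx]

lemma continuous_ψ : Continuous D.ψ := by
  obtain ⟨U, hU, hc, hs⟩ := D.φ_smooth
  exact continuous_indicator_of_frontier hc hs.continuousOn D.φ_zero

lemma exists_isOpen_contDiffOn {F : Type*} [NormedAddCommGroup F] [NormedSpace ℝ F] {f : E n → F}
    (hf : ∀ x ∈ closure D.Ω, ContDiffAt ℝ 1 f x) :
    ∃ U : Set (E n), IsOpen U ∧ closure D.Ω ⊆ U ∧ ContDiffOn ℝ 1 D.φ U ∧ ContDiffOn ℝ 1 f U := by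
  obtain ⟨U, hU, hc, hs⟩ := D.φ_smooth
  have h2 : ∀ x ∈ closure D.Ω, ∃ V : Set (E n), IsOpen V ∧ x ∈ V ∧ ContDiffOn ℝ 1 f V := by
    intro x hx
    obtain ⟨V, hV, hxV⟩ := (hf x hx).contDiffOn le_rfl (by simp)
    obtain ⟨V', hV', ho, hx'⟩ := mem_nhds_iff.1 (by simpa using hV)
    exact ⟨V', ho, hx', hxV.mono hV'⟩
  choose! V hVo hxV hV using h2
  refine ⟨U ∩ ⋃ x ∈ closure D.Ω, V x, hU.inter (isOpen_biUnion fun x hx => hVo x hx), ?_, ?_, ?_⟩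
  · exact fun x hx => ⟨hc hx, Set.mem_biUnion hx (hxV x hx)⟩
  · exact (hs.mono Set.inter_subset_left).of_le (by simp)
  · rintro x ⟨-, hx⟩
    obtain ⟨y, hy, hxy⟩ := Set.mem_iUnion₂.1 hx
    exact ((hV y hy).contDiffAt ((hVo y hy).mem_nhds hxy)).contDiffWithinAt

/-- Multiplication by a power of the extended weight of a field which is regular up to `∂Ω`. -/
lemma contDiff_indicator_pow {F : Type*} [NormedAddCommGroup F] [NormedSpace ℝ F] {f : E n → F}
    (hf : ∀ x ∈ closure D.Ω, ContDiffAt ℝ 1 f x) {k : ℕ} (hk : 2 ≤ k) :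
    ContDiff ℝ 1 (D.Ω.indicator fun y => D.φ y ^ k • f y) := by
  obtain ⟨U, hU, hc, hs, hfU⟩ := D.exists_isOpen_contDiffOn hf
  exact contDiff_indicator_pow_smul D.isOpen hU hc hs D.φ_zero hfU hk

lemma fderiv_indicator_pow_of_notMem {F : Type*} [NormedAddCommGroup F] [NormedSpace ℝ F]
    {f : E n → F} (hf : ∀ x ∈ closure D.Ω, ContDiffAt ℝ 1 f x) {k : ℕ} (hk : 2 ≤ k) {x : E n}
    (hx : x ∉ D.Ω) : fderiv ℝ (D.Ω.indicator fun y => D.φ y ^ k • f y) x = 0 := by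
  obtain ⟨U, hU, hc, hs, hfU⟩ := D.exists_isOpen_contDiffOn hf
  exact (hasFDerivAt_indicator_pow_smul D.isOpen hU hc (hs.differentiableOn one_ne_zero) D.φ_zero
    hfU.continuousOn hk hx).fderiv

lemma fderiv_indicator_of_mem {F : Type*} [NormedAddCommGroup F] [NormedSpace ℝ F]
    (f : E n → F) {x : E n} (hx : x ∈ D.Ω) :
    fderiv ℝ (D.Ω.indicator f) x = fderiv ℝ f x := by
  refine Filter.EventuallyEq.fderiv_eq ?_
  filter_upwards [D.isOpen.mem_nhds hx] with y hy
  exact Set.indicator_of_mem hy _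

end RegularizedCone

end ConeBounds

/-! ### Radial weights truncated to the exterior of the unit ball -/

section RadialWeights

variable {n : ℕ}

lemma hasDerivAt_max_zero_pow {j : ℕ} (hj : 2 ≤ j) (s : ℝ) :
    HasDerivAt (fun s : ℝ => max s 0 ^ j) (j * max s 0 ^ (j - 1)) s := by
  rcases lt_trichotomy s 0 with h | h | h
  · rw [max_eq_right h.le, zero_pow (by omega), mul_zero]
    refine (hasDerivAt_const s (0 : ℝ)).congr_of_eventuallyEq ?_
    filter_upwards [gt_mem_nhds h] with y hy
    rw [max_eq_right hy.le, zero_pow (by omega)]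
  · subst h
    rw [max_self, zero_pow (by omega), mul_zero, hasDerivAt_iff_isLittleO]
    simp only [max_self, sub_zero, smul_zero]
    rw [zero_pow (by omega)]
    simp only [sub_zero]
    have h1 : (fun y : ℝ => max y 0 ^ j) =O[𝓝 0] fun y => y ^ j := by
      refine Asymptotics.IsBigO.of_bound 1 (Eventually.of_forall fun y => ?_)
      rw [one_mul, norm_pow, norm_pow]
      gcongr
      rw [Real.norm_eq_abs, Real.norm_eq_abs, abs_of_nonneg (le_max_right _ _)]
      exact max_le (le_abs_self y) (abs_nonneg y)
    refine h1.trans_isLittleO ?_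
    simpa using Asymptotics.isLittleO_pow_pow (𝕜 := ℝ) (show 1 < j by omega)
  · rw [max_eq_left h.le]
    refine (hasDerivAt_pow j s).congr_of_eventuallyEq ?_
    filter_upwards [lt_mem_nhds h] with y hy
    rw [max_eq_left hy.le]

/-- The radial weights `(|x|² - 1)₊ʲ (1 + |x|²)ᶜ`. -/
def rad (j : ℕ) (c : ℝ) (x : E n) : ℝ := max (‖x‖ ^ 2 - 1) 0 ^ j * (1 + ‖x‖ ^ 2) ^ c

lemma one_add_norm_sq_pos (x : E n) : 0 < 1 + ‖x‖ ^ 2 := by positivity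

lemma rad_nonneg (j : ℕ) (c : ℝ) (x : E n) : 0 ≤ rad j c x := by
  have := le_max_right (‖x‖ ^ 2 - 1) 0
  unfold rad
  positivity

lemma continuous_rad (j : ℕ) (c : ℝ) : Continuous (rad j c : E n → ℝ) := by
  unfold rad
  refine Continuous.mul (by fun_prop) ?_
  exact Continuous.rpow_const (by fun_prop) fun x => Or.inl (one_add_norm_sq_pos x).ne'

/-- The case `j = 1` is excluded because the truncation then has a corner. For `j = 0` the truncated
exponent `j - 1` is harmless, since its coefficient vanishes. -/
lemma hasFDerivAt_rad {j : ℕ} (hj : j ≠ 1) (c : ℝ) (x : E n) :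
    HasFDerivAt (rad j c : E n → ℝ)
      ((2 * (j * rad (j - 1) c x + c * rad j (c - 1) x)) • innerSL ℝ x) x := by
  have h1 : HasFDerivAt (fun y : E n => ‖y‖ ^ 2) (2 • innerSL ℝ x) x :=
    (hasStrictFDerivAt_norm_sq x).hasFDerivAt
  have h2 : HasDerivAt (fun s : ℝ => max (s - 1) 0 ^ j)
      (j * max (‖x‖ ^ 2 - 1) 0 ^ (j - 1)) (‖x‖ ^ 2) := by
    rcases Nat.lt_or_ge j 2 with h | h
    · have : j = 0 := by omega
      subst this
      simpa using hasDerivAt_const (‖x‖ ^ 2) (1 : ℝ)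
    · have h3 := hasDerivAt_max_zero_pow h (‖x‖ ^ 2 - 1)
      have h4 := h3.comp (‖x‖ ^ 2) ((hasDerivAt_id (‖x‖ ^ 2)).sub_const 1)
      rw [mul_one] at h4
      exact h4
  have h3 : HasDerivAt (fun s : ℝ => (1 + s) ^ c) (c * (1 + ‖x‖ ^ 2) ^ (c - 1)) (‖x‖ ^ 2) := by
    have := ((hasDerivAt_id (‖x‖ ^ 2)).const_add 1).rpow_const (p := c)
      (Or.inl (one_add_norm_sq_pos x).ne')
    simpa using this
  have h4 := (h2.mul h3).comp_hasFDerivAt x h1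
  refine h4.congr_fderiv ?_
  ext v
  simp only [rad, smul_apply, smul_eq_mul, nsmul_eq_mul, Nat.cast_ofNat, innerSL_apply_apply]
  ring

lemma contDiff_rad {j : ℕ} (hj : j ≠ 1) (c : ℝ) : ContDiff ℝ 1 (rad j c : E n → ℝ) := by
  rw [contDiff_one_iff_hasFDerivAt]
  refine ⟨_, ?_, fun x => hasFDerivAt_rad hj c x⟩
  have h1 := continuous_rad (n := n) (j - 1) c
  have h2 := continuous_rad (n := n) j (c - 1)
  fun_prop

lemma norm_fderiv_rad_le {j : ℕ} (hj : j ≠ 1) (c : ℝ) (x : E n) :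
    ‖fderiv ℝ (rad j c) x‖ ≤ 2 * |j * rad (j - 1) c x + c * rad j (c - 1) x| * ‖x‖ := by
  rw [(hasFDerivAt_rad hj c x).fderiv, norm_smul, innerSL_apply_norm, Real.norm_eq_abs, abs_mul,
    abs_two]

end RadialWeights

/-! ### The estimate near the boundary: a gain of two powers of the weight -/

section Boundary

variable {n : ℕ}

lemma abs_dvg_le_norm (F : E n → E n) (x : E n) : |dvg F x| ≤ n * ‖fderiv ℝ F x‖ := by
  unfold dvg
  refine (Finset.abs_sum_le_sum_abs _ _).trans ?_
  refine (Finset.sum_le_sum (g := fun _ => ‖fderiv ℝ F x‖) fun i _ => ?_).trans (by simp)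
  refine (PiLp.norm_apply_le (pd i F x) i).trans ?_
  refine ((fderiv ℝ F x).le_opNorm _).trans ?_
  simp

lemma symGrad_eq_zero_of_notMem {Z : E n → E n} {x : E n} (hx : x ∉ tsupport Z) :
    symGrad Z x = 0 := by
  have : fderiv ℝ Z x = 0 := by
    by_contra h
    exact hx (tsupport_fderiv_subset ℝ (subset_tsupport _ h))
  simp [symGrad, this]

lemma integrable_of_tsupport {Z : E n → E n} (hZc : HasCompactSupport Z) {f : E n → ℝ}
    (hf : Continuous f) (h : ∀ x, x ∉ tsupport Z → f x = 0) : Integrable f := by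
  refine hf.integrable_of_hasCompactSupport (hZc.mono' ?_)
  intro x hx
  by_contra h2
  exact hx (h x h2)

/-- The share `c / 12` is chosen because three cross terms have to be absorbed at a total cost of `c
/ 4`. -/
lemma young_le {c A : ℝ} (hc : 0 < c) (x y : ℝ) :
    A * (x * y) ≤ c / 12 * x ^ 2 + 3 * A ^ 2 / c * y ^ 2 := by
  have h : 0 ≤ c / 12 * (x - 6 * A / c * y) ^ 2 := by positivity
  have h2 : c / 12 * (x - 6 * A / c * y) ^ 2 =
      c / 12 * x ^ 2 + 3 * A ^ 2 / c * y ^ 2 - A * (x * y) := by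
    field_simp
    ring
  linarith

/-- In terms of `α = z sh fᵏ / st`, the square that comes from differentiating the power of `φ`
gives `c/2 · α²` up to `δ²`, because `f² + st² g² ≥ c`. Each remaining term has one more factor `f`
and is a product of `α` with `β`, `γ` or `δ`. Young's inequality spends `c/4` on these three
products and leaves the `c/4` on the left. -/
lemma boundary_algebra {c K f z s sh sM st g dH dG ν : ℝ} (k : ℕ) (hc : 0 < c) (hK : 1 ≤ K)
    (hf : 0 < f) (hz : 0 ≤ z) (hs : 0 ≤ s) (hsh : 0 ≤ sh) (hsM : 0 ≤ sM) (hst : 0 < st)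
    (hg : 0 ≤ g) (hν : 0 ≤ ν) (hgK : st * g ≤ K) (hcf : c ≤ f ^ 2 + st ^ 2 * g ^ 2)
    (hdH : dH ≤ sh * sM) (hdG : st ^ 2 * dG ≤ K) :
    c / 4 * (z ^ 2 * sh ^ 2 * f ^ (2 * k) / st ^ 2) +
        (ν + 1) * s * z * (f ^ (2 * k + 1) * sh ^ 2 * g) ≤
      (1 + 3 * ((ν + 2) * K) ^ 2 / c) * (s ^ 2 * sh ^ 2 * f ^ (2 * k + 2) +
        z ^ 2 * (sM ^ 2 + sh ^ 2 / st ^ 2) * f ^ (2 * k + 2)) +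
      (((2 * k + 1) / 2) * (f ^ (2 * k) * sh ^ 2 * g ^ 2 * z ^ 2) -
        3 / 2 * (f ^ (2 * k + 1) * dH * g * z ^ 2) -
        (1 + ν / 2) * (f ^ (2 * k + 1) * sh ^ 2 * dG * z ^ 2)) := by
  obtain ⟨α, hα⟩ : ∃ α, α = z * sh * f ^ k / st := ⟨_, rfl⟩
  obtain ⟨β, hβ⟩ : ∃ β, β = s * sh * f ^ (k + 1) := ⟨_, rfl⟩
  obtain ⟨γ, hγ⟩ : ∃ γ, γ = sM * f ^ (k + 1) * z := ⟨_, rfl⟩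
  obtain ⟨δ, hδ⟩ : ∃ δ, δ = z * sh * f ^ (k + 1) / st := ⟨_, rfl⟩
  obtain ⟨A, hA⟩ : ∃ A, A = (ν + 2) * K := ⟨_, rfl⟩
  have hα0 : 0 ≤ α := by rw [hα]; positivity
  have hβ0 : 0 ≤ β := by rw [hβ]; positivity
  have hγ0 : 0 ≤ γ := by rw [hγ]; positivity
  have hδ0 : 0 ≤ δ := by rw [hδ]; positivity
  have e0 : z ^ 2 * sh ^ 2 * f ^ (2 * k) / st ^ 2 = α ^ 2 := by
    rw [hα]; field_simp; ring
  have e1 : s ^ 2 * sh ^ 2 * f ^ (2 * k + 2) = β ^ 2 := by rw [hβ]; ring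
  have e2 : z ^ 2 * (sM ^ 2 + sh ^ 2 / st ^ 2) * f ^ (2 * k + 2) = γ ^ 2 + δ ^ 2 := by
    rw [hγ, hδ]; field_simp; ring
  have e3 : f ^ (2 * k) * sh ^ 2 * g ^ 2 * z ^ 2 = α ^ 2 * (st ^ 2 * g ^ 2) := by
    rw [hα]; field_simp; ring
  have e4 : α ^ 2 * f ^ 2 = δ ^ 2 := by rw [hα, hδ]; field_simp; ring
  have t1 : f ^ (2 * k + 1) * dH * g * z ^ 2 ≤ K * (α * γ) := by
    calc f ^ (2 * k + 1) * dH * g * z ^ 2 ≤ f ^ (2 * k + 1) * (sh * sM) * g * z ^ 2 := by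
          gcongr
      _ = (st * g) * (α * γ) := by rw [hα, hγ]; field_simp; ring
      _ ≤ K * (α * γ) := by gcongr
  have t2 : f ^ (2 * k + 1) * sh ^ 2 * dG * z ^ 2 ≤ K * (α * δ) := by
    calc f ^ (2 * k + 1) * sh ^ 2 * dG * z ^ 2 = (st ^ 2 * dG) * (α * δ) := by
          rw [hα, hδ]; field_simp; ring
      _ ≤ K * (α * δ) := by gcongr
  have t3 : s * z * (f ^ (2 * k + 1) * sh ^ 2 * g) ≤ K * (α * β) := by
    calc s * z * (f ^ (2 * k + 1) * sh ^ 2 * g) = (st * g) * (α * β) := by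
          rw [hα, hβ]; field_simp; ring
      _ ≤ K * (α * β) := by gcongr
  have y1 := young_le (A := A) hc α γ
  have y2 := young_le (A := A) hc α δ
  have y3 := young_le (A := A) hc α β
  have k0 : (0 : ℝ) ≤ k := Nat.cast_nonneg k
  have m0 : α ^ 2 * c ≤ δ ^ 2 + α ^ 2 * (st ^ 2 * g ^ 2) := by
    rw [← e4, ← mul_add]; gcongr
  have m1 : α ^ 2 * (st ^ 2 * g ^ 2) / 2 ≤ (2 * k + 1) / 2 * (α ^ 2 * (st ^ 2 * g ^ 2)) := by
    have : 0 ≤ α ^ 2 * (st ^ 2 * g ^ 2) := by positivity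
    nlinarith
  have s1 : 3 / 2 * (f ^ (2 * k + 1) * dH * g * z ^ 2) ≤ A * (α * γ) := by
    calc _ ≤ 3 / 2 * (K * (α * γ)) := by gcongr
      _ ≤ (ν + 2) * (K * (α * γ)) := mul_le_mul_of_nonneg_right (by linarith) (by positivity)
      _ = _ := by rw [hA]; ring
  have s2 : (1 + ν / 2) * (f ^ (2 * k + 1) * sh ^ 2 * dG * z ^ 2) ≤ A * (α * δ) := by
    calc _ ≤ (1 + ν / 2) * (K * (α * δ)) := by gcongr
      _ ≤ (ν + 2) * (K * (α * δ)) := mul_le_mul_of_nonneg_right (by linarith) (by positivity)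
      _ = _ := by rw [hA]; ring
  have s3 : (ν + 1) * s * z * (f ^ (2 * k + 1) * sh ^ 2 * g) ≤ A * (α * β) := by
    calc _ = (ν + 1) * (s * z * (f ^ (2 * k + 1) * sh ^ 2 * g)) := by ring
      _ ≤ (ν + 1) * (K * (α * β)) := by gcongr
      _ ≤ (ν + 2) * (K * (α * β)) := mul_le_mul_of_nonneg_right (by linarith) (by positivity)
      _ = _ := by rw [hA]; ring
  rw [e0, e1, e2, e3, ← hA]
  have b2 := sq_nonneg β
  have g2 := sq_nonneg γ
  have d2 := sq_nonneg δ
  have r : (1 + 3 * A ^ 2 / c) * (β ^ 2 + (γ ^ 2 + δ ^ 2)) = β ^ 2 + γ ^ 2 + δ ^ 2 +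
    3 * A ^ 2 / c * β ^ 2 + 3 * A ^ 2 / c * γ ^ 2 + 3 * A ^ 2 / c * δ ^ 2 := by ring
  rw [r]
  linarith

variable {θ₁ θ₂ : ℝ} (D : RegularizedCone n θ₁ θ₂)

lemma inner_fderiv_smul_add {a : E n → ℝ} {Y : E n → E n} {x : E n} (ha : DifferentiableAt ℝ a x)
    (hY : DifferentiableAt ℝ Y x) (z : E n) :
    ⟪z, fderiv ℝ (fun y => a y • Y y) x z⟫_ℝ + 1 / 2 * ‖z‖ ^ 2 * dvg (fun y => a y • Y y) x =
      a x * (⟪z, fderiv ℝ Y x z⟫_ℝ + 1 / 2 * ‖z‖ ^ 2 * dvg Y x) +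
      fderiv ℝ a x z * ⟪z, Y x⟫_ℝ + 1 / 2 * ‖z‖ ^ 2 * fderiv ℝ a x (Y x) := by
  rw [dvg_smul ha hY, fderiv_fun_smul ha hY]
  simp only [add_apply, smul_apply, ContinuousLinearMap.smulRight_apply, inner_add_right,
    inner_smul_right]
  ring

lemma dvg_congr_of_fderiv {F G : E n → E n} {x : E n} (h : fderiv ℝ F x = fderiv ℝ G x) :
    dvg F x = dvg G x := by
  simp [dvg, pd, h]

/-- Lower bound for the form of `X = φ^(2k+1) H ∇φ`. The nonnegative square of `⟨∇φ, Z⟩` is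
discarded. The factor 3/2 adds the full contribution of `D_Z H` to half of that of `D_X H`, and `1 +
ν/2` does the same for the second derivatives of `φ`. -/
lemma boundary_lower {p q h κ ν g z2 dG dH i1 i2 i3 i4 i5 : ℝ} (l1 : -(dG * z2) ≤ i1)
    (l2 : -(ν * dG) ≤ i2) (l3 : -(dH * g * z2) ≤ i3 * i5) (l4 : -(dH * g) ≤ i4) (hp : 0 ≤ p)
    (hph : 0 ≤ p * h) (hq : 0 ≤ h * (κ * q) * i5 ^ 2) (hz : 0 ≤ z2) :
    κ / 2 * (q * h * g ^ 2 * z2) - 3 / 2 * (p * dH * g * z2) - (1 + ν / 2) * (p * h * dG * z2) ≤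
      p * h * (i1 + 1 / 2 * z2 * i2) + (p * i3 + h * (κ * q * i5)) * i5 +
        1 / 2 * z2 * (p * i4 + h * (κ * q * g ^ 2)) := by
  have q1 := mul_le_mul_of_nonneg_left l1 hph
  have q2 := mul_le_mul_of_nonneg_left l2 (mul_nonneg hph hz)
  have q3 := mul_le_mul_of_nonneg_left l3 hp
  have q4 := mul_le_mul_of_nonneg_left l4 (mul_nonneg hp hz)
  linarith

/-- A Hardy inequality transversal to `∂Ω`: the derivative of `φ^(2k+1)` along `∇φ` is positive and
has two powers of `φ` fewer than the last term on the right. The weight `H` is left free, with `M`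
measuring its variation. It is used with a truncated weight on the exact cone and with an
untruncated one on all of `Ω`. -/
lemma boundary_estimate (k : ℕ) (hk : 1 ≤ k) : ∃ C : ℝ, 0 < C ∧ ∀ H M : E n → ℝ,
    ContDiff ℝ 1 H → Continuous M → (∀ x, 0 ≤ H x) → (∀ x, 0 ≤ M x) →
    (∀ x, ‖fderiv ℝ H x‖ ^ 2 ≤ H x * M x) → ∀ Z : E n → E n, ContDiff ℝ 1 Z →
    HasCompactSupport Z →
    ∫ x, ‖Z x‖ ^ 2 * H x * D.ψ x ^ (2 * k) / (1 + ‖x‖ ^ 2) ≤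
      C * (∫ x, symGrad Z x ^ 2 * H x * D.ψ x ^ (2 * k + 2)) +
      C * (∫ x, ‖Z x‖ ^ 2 * (M x + H x / (1 + ‖x‖ ^ 2)) * D.ψ x ^ (2 * k + 2)) := by
  obtain ⟨K, c, hK, hc, hb⟩ := D.exists_bounds
  set C₁ : ℝ := 1 + 3 * (((n : ℝ) + 2) * K) ^ 2 / c with hC₁
  have hC₁0 : 0 < C₁ := by positivity
  refine ⟨4 / c * C₁, by positivity, fun H M hH hM hH0 hM0 hHM Z hZ hZc => ?_⟩
  set X : E n → E n := D.Ω.indicator fun y => D.φ y ^ (2 * k + 1) • (H y • D.grad y) with hX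
  have hreg : ∀ x ∈ closure D.Ω, ContDiffAt ℝ 1 (fun y => H y • D.grad y) x := fun x hx =>
    hH.contDiffAt.smul ((D.contDiffAt_grad hx).of_le (by simp))
  have hXc : ContDiff ℝ 1 X := D.contDiff_indicator_pow hreg (by omega)
  have hψ := D.continuous_ψ
  have hHc := hH.continuous
  have hsg := continuous_symGrad hZ
  have hZcont := hZ.continuous
  have ht0 : ∀ x : E n, 1 + ‖x‖ ^ 2 ≠ 0 := fun x => (one_add_norm_sq_pos x).ne'
  have hP : Integrable fun x => ‖Z x‖ ^ 2 * H x * D.ψ x ^ (2 * k) / (1 + ‖x‖ ^ 2) := by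
    refine integrable_of_tsupport hZc (by fun_prop (disch := exact ht0 _)) fun x hx => ?_
    simp [image_eq_zero_of_notMem_tsupport hx]
  have hQ1 : Integrable fun x => symGrad Z x ^ 2 * H x * D.ψ x ^ (2 * k + 2) := by
    refine integrable_of_tsupport hZc (by fun_prop) fun x hx => ?_
    simp [symGrad_eq_zero_of_notMem hx]
  have hQ2 : Integrable fun x => ‖Z x‖ ^ 2 * (M x + H x / (1 + ‖x‖ ^ 2)) *
      D.ψ x ^ (2 * k + 2) := by
    refine integrable_of_tsupport hZc (by fun_prop (disch := exact ht0 _)) fun x hx => ?_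
    simp [image_eq_zero_of_notMem_tsupport hx]
  have key := multiplier_le (Z := Z) (X := X) hZ hZc hXc (hP.const_mul (c / 4))
    ((hQ1.add hQ2).const_mul C₁) ?_
  · rw [integral_const_mul, integral_const_mul, integral_add' hQ1 hQ2] at key
    rw [← mul_add]
    have : 4 / c * (c / 4 * ∫ x, ‖Z x‖ ^ 2 * H x * D.ψ x ^ (2 * k) / (1 + ‖x‖ ^ 2)) ≤
      4 / c * _ := mul_le_mul_of_nonneg_left key (by positivity)
    rw [← mul_assoc, show 4 / c * (c / 4) = 1 by field_simp, one_mul, ← mul_assoc] at this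
    exact this
  · intro x
    by_cases hx : x ∈ D.Ω
    · obtain ⟨-, b1, b2, b3⟩ := hb x hx
      have hfx := D.φ_pos x hx
      have hcl := subset_closure hx
      have hdφ := D.differentiableAt_φ hcl
      have hdG : DifferentiableAt ℝ D.grad x := (D.contDiffAt_grad hcl).differentiableAt (by simp)
      have hdH : DifferentiableAt ℝ H x := hH.differentiable one_ne_zero x
      set a : E n → ℝ := fun y => D.φ y ^ (2 * k + 1) * H y with ha
      have had : HasFDerivAt a (D.φ x ^ (2 * k + 1) • fderiv ℝ H x +
          H x • ((2 * k + 1 : ℕ) * D.φ x ^ (2 * k)) • fderiv ℝ D.φ x) x := by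
        have := (hdφ.hasFDerivAt.pow (2 * k + 1)).mul hdH.hasFDerivAt
        refine this.congr_fderiv ?_
        simp
      have hXe : fderiv ℝ X x = fderiv ℝ (fun y => a y • D.grad y) x := by
        rw [hX, D.fderiv_indicator_of_mem _ hx]
        simp only [ha, smul_smul]
      rw [dvg_congr_of_fderiv hXe, hXe, inner_fderiv_smul_add had.differentiableAt hdG, had.fderiv]
      have hXn : ‖X x‖ = D.φ x ^ (2 * k + 1) * H x * ‖D.grad x‖ := by
        rw [hX, Set.indicator_of_mem hx, norm_smul, norm_smul, Real.norm_eq_abs, Real.norm_eq_abs,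
          abs_of_nonneg (hH0 x), abs_of_pos (by positivity)]
        ring
      set t := 1 + ‖x‖ ^ 2 with ht
      have htp : 0 < t := one_add_norm_sq_pos x
      have hst : Real.sqrt t ^ 2 = t := Real.sq_sqrt htp.le
      have hsh : Real.sqrt (H x) ^ 2 = H x := Real.sq_sqrt (hH0 x)
      have hsM : Real.sqrt (M x) ^ 2 = M x := Real.sq_sqrt (hM0 x)
      have alg := boundary_algebra (c := c) (K := K) (f := D.φ x) (z := ‖Z x‖) (s := symGrad Z x)
        (sh := Real.sqrt (H x)) (sM := Real.sqrt (M x)) (st := Real.sqrt t) (g := ‖D.grad x‖)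
        (dH := ‖fderiv ℝ H x‖) (dG := ‖fderiv ℝ D.grad x‖) (ν := n) k hc hK hfx (norm_nonneg _)
        (symGrad_nonneg _ _) (Real.sqrt_nonneg _) (Real.sqrt_nonneg _) (Real.sqrt_pos.2 htp)
        (norm_nonneg _) (Nat.cast_nonneg _) (by
          refine abs_le_of_sq_le_sq' ?_ (by linarith) |>.2
          rw [mul_pow, hst]; exact b1) (by rw [hst]; exact b3) (by
          refine abs_le_of_sq_le_sq' ?_ (by positivity) |>.2
          rw [mul_pow, hsh, hsM]; exact hHM x) (by rw [hst]; exact b2)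
      rw [hst, hsh, hsM] at alg
      simp only [Pi.add_apply]
      rw [hXn, D.ψ_of_mem hx]
      refine alg.trans ?_
      refine add_le_add (le_of_eq rfl) ?_
      simp only [add_apply, smul_apply, smul_eq_mul, ← D.inner_grad, ha]
      rw [real_inner_self_eq_norm_sq, real_inner_comm (D.grad x) (Z x)]
      have l1 : -(‖fderiv ℝ D.grad x‖ * ‖Z x‖ ^ 2) ≤ ⟪Z x, fderiv ℝ D.grad x (Z x)⟫_ℝ := by
        have h1 := abs_real_inner_le_norm (Z x) (fderiv ℝ D.grad x (Z x))
        have h2 := (fderiv ℝ D.grad x).le_opNorm (Z x)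
        have h3 := neg_abs_le ⟪Z x, fderiv ℝ D.grad x (Z x)⟫_ℝ
        nlinarith [norm_nonneg (Z x)]
      have l2 : -(n * ‖fderiv ℝ D.grad x‖) ≤ dvg D.grad x :=
        (neg_le_neg (abs_dvg_le_norm D.grad x)).trans (neg_abs_le _)
      have l3 : -(‖fderiv ℝ H x‖ * ‖D.grad x‖ * ‖Z x‖ ^ 2) ≤
          fderiv ℝ H x (Z x) * ⟪D.grad x, Z x⟫_ℝ := by
        have h1 : |fderiv ℝ H x (Z x) * ⟪D.grad x, Z x⟫_ℝ| ≤
            (‖fderiv ℝ H x‖ * ‖Z x‖) * (‖D.grad x‖ * ‖Z x‖) := by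
          rw [abs_mul]
          gcongr
          · exact (fderiv ℝ H x).le_opNorm _
          · exact abs_real_inner_le_norm _ _
        have h3 := neg_abs_le (fderiv ℝ H x (Z x) * ⟪D.grad x, Z x⟫_ℝ)
        nlinarith
      have l4 : -(‖fderiv ℝ H x‖ * ‖D.grad x‖) ≤ fderiv ℝ H x (D.grad x) :=
        (neg_le_neg ((fderiv ℝ H x).le_opNorm _)).trans (neg_abs_le _)
      have p1 : 0 ≤ D.φ x ^ (2 * k + 1) := by positivity
      have p2 : 0 ≤ D.φ x ^ (2 * k + 1) * H x := mul_nonneg p1 (hH0 x)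
      have p3 : 0 ≤ H x * ((2 * k + 1 : ℕ) * D.φ x ^ (2 * k)) * ⟪D.grad x, Z x⟫_ℝ ^ 2 := by
        have := hH0 x
        positivity
      push_cast at p3 ⊢
      exact boundary_lower l1 l2 l3 l4 p1 p2 p3 (sq_nonneg _)
    · have hX0 : fderiv ℝ X x = 0 := D.fderiv_indicator_pow_of_notMem hreg (by omega) hx
      have hXx : X x = 0 := Set.indicator_of_notMem hx _
      simp only [Pi.add_apply]
      rw [dvg_eq_zero_of_fderiv hX0, hX0, hXx, D.ψ_of_notMem hx]
      simp [show k ≠ 0 by omega]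

end Boundary

/-! ### The estimate on the exact cone -/

section Exterior

variable {n : ℕ}

/-- The radial weights in terms of `m = (|x|² - 1)₊`, `t = 1 + |x|²` and a power `τ` of `t`. -/
lemma rad_data (c : ℝ) (x : E n) : ∃ m t τ : ℝ, 0 ≤ m ∧ 0 < t ∧ 0 < τ ∧ m ≤ t ∧
    t = 1 + ‖x‖ ^ 2 ∧ (m = 0 ∨ (m = t - 2 ∧ 1 < ‖x‖)) ∧
    (∀ j, rad j (c - 5) x = m ^ j * τ) ∧ (∀ j, rad j (c - 4) x = m ^ j * (t * τ)) ∧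
    (∀ j, rad j (c - 3) x = m ^ j * (t ^ 2 * τ)) ∧ (∀ j, rad j c x = m ^ j * (t ^ 5 * τ)) := by
  have ht := one_add_norm_sq_pos x
  have hpow : ∀ i : ℕ, (1 + ‖x‖ ^ 2) ^ (c - 5 + i) = (1 + ‖x‖ ^ 2) ^ i * (1 + ‖x‖ ^ 2) ^ (c - 5) := by
    intro i
    rw [Real.rpow_add ht, Real.rpow_natCast, mul_comm]
  refine ⟨max (‖x‖ ^ 2 - 1) 0, 1 + ‖x‖ ^ 2, (1 + ‖x‖ ^ 2) ^ (c - 5), le_max_right _ _, ht,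
    by positivity, max_le (by linarith) ht.le, rfl, ?_, fun j => rfl, fun j => ?_, fun j => ?_,
    fun j => ?_⟩
  · rcases le_or_gt ‖x‖ 1 with h | h
    · left
      exact max_eq_right (by nlinarith [norm_nonneg x])
    · right
      exact ⟨by rw [max_eq_left (by nlinarith)]; ring, h⟩
  · have := hpow 1
    rw [pow_one] at this
    rw [rad, ← this]; congr 2; push_cast; ring
  · rw [rad, ← hpow 2]; congr 2; push_cast; ring
  · rw [rad, ← hpow 5]; congr 2; push_cast; ring

variable {θ₁ θ₂ : ℝ} (D : RegularizedCone n θ₁ θ₂)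

lemma rad_mul_fderiv_φ_self {j : ℕ} (hj : j ≠ 0) (c : ℝ) {x : E n} (hx : x ∈ D.Ω) :
    rad j c x * fderiv ℝ D.φ x x = 0 := by
  rcases le_or_gt ‖x‖ 1 with h | h
  · have : max (‖x‖ ^ 2 - 1) 0 = 0 := max_eq_right (by nlinarith [norm_nonneg x])
    simp [rad, this, hj]
  · rw [D.fderiv_φ_self hx h, mul_zero]

/-- The weight `(|x|² - 1)₊ʲ (1 + |x|²)ᶜ φᵏ`, extended by zero. -/
def RegularizedCone.extWeight (k j : ℕ) (c : ℝ) : E n → ℝ :=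
  D.Ω.indicator fun y => D.φ y ^ k • rad j c y

lemma extWeight_eq {k : ℕ} (hk : k ≠ 0) (j : ℕ) (c : ℝ) (x : E n) :
    D.extWeight k j c x = rad j c x * D.ψ x ^ k := by
  by_cases hx : x ∈ D.Ω
  · rw [RegularizedCone.extWeight, Set.indicator_of_mem hx, D.ψ_of_mem hx, smul_eq_mul, mul_comm]
  · rw [RegularizedCone.extWeight, Set.indicator_of_notMem hx, D.ψ_of_notMem hx, zero_pow hk,
      mul_zero]

lemma contDiff_extWeight {k j : ℕ} (hk : 2 ≤ k) (hj : j ≠ 1) (c : ℝ) :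
    ContDiff ℝ 1 (D.extWeight k j c) :=
  D.contDiff_indicator_pow (fun _ _ => (contDiff_rad hj c).contDiffAt) hk

lemma fderiv_extWeight_of_notMem {k j : ℕ} (hk : 2 ≤ k) (hj : j ≠ 1) (c : ℝ) {x : E n}
    (hx : x ∉ D.Ω) : fderiv ℝ (D.extWeight k j c) x = 0 :=
  D.fderiv_indicator_pow_of_notMem (fun _ _ => (contDiff_rad hj c).contDiffAt) hk hx

lemma fderiv_extWeight {k j : ℕ} (hj : j ≠ 1) (c : ℝ) {x : E n} (hx : x ∈ D.Ω) (v : E n) :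
    fderiv ℝ (D.extWeight (k + 1) j c) x v =
      D.φ x ^ (k + 1) * (2 * (j * rad (j - 1) c x + c * rad j (c - 1) x) * ⟪x, v⟫_ℝ) +
      rad j c x * ((k + 1 : ℕ) * D.φ x ^ k) * fderiv ℝ D.φ x v := by
  have h := ((D.differentiableAt_φ (subset_closure hx)).hasFDerivAt.pow (k + 1)).mul
    (hasFDerivAt_rad hj c x)
  rw [RegularizedCone.extWeight, D.fderiv_indicator_of_mem _ hx]
  simp only [smul_eq_mul]
  have h2 := h.fderiv
  rw [show (fun y => D.φ y ^ (k + 1) * rad j c y) = (fun x => D.φ x ^ (k + 1)) * rad j c from rfl,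
    h2]
  simp only [add_apply, smul_apply, smul_eq_mul, innerSL_apply_apply, nsmul_eq_mul,
    Nat.add_sub_cancel]
  ring

/-- Flux of `⟨Z,x⟩² W x` with `W` of degree `2c - 4` at infinity. The derivative of `⟨Z,x⟩` along
`x` is `⟨Z,x⟩` plus a component of the symmetric gradient, so the coefficient of `⟨Z,x⟩² W` is `n +
2 + (2c - 4) = n + 2c - 2 > 0`. The angular weight contributes nothing, being constant along rays.
-/
lemma radial_component_estimate {k : ℕ} (hk : 1 ≤ k) {c : ℝ} (hc : c ≤ 1)
    (hcn : 0 < n + 2 * c - 2) {Z : E n → E n} (hZ : ContDiff ℝ 1 Z) (hZc : HasCompactSupport Z) :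
    ∫ x, ⟪Z x, x⟫_ℝ ^ 2 * rad 2 (c - 4) x * D.ψ x ^ (2 * k + 2) ≤
      1 / (n + 2 * c - 2) ^ 2 * ∫ x, symGrad Z x ^ 2 * rad 0 c x * D.ψ x ^ (2 * k + 2) := by
  set κ : ℝ := n + 2 * c - 2 with hκ
  have hψ := D.continuous_ψ
  have hsg := continuous_symGrad hZ
  have hZcont := hZ.continuous
  have hr1 := continuous_rad (n := n) 2 (c - 4)
  have hr2 := continuous_rad (n := n) 0 c
  have hP : Integrable fun x => ⟪Z x, x⟫_ℝ ^ 2 * rad 2 (c - 4) x * D.ψ x ^ (2 * k + 2) := by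
    refine integrable_of_tsupport hZc (by fun_prop) fun x hx => ?_
    simp [image_eq_zero_of_notMem_tsupport hx]
  have hQ : Integrable fun x => symGrad Z x ^ 2 * rad 0 c x * D.ψ x ^ (2 * k + 2) := by
    refine integrable_of_tsupport hZc (by fun_prop) fun x hx => ?_
    simp [symGrad_eq_zero_of_notMem hx]
  have hW := contDiff_extWeight D (show 2 ≤ 2 * k + 2 by omega) (show 2 ≠ 1 by omega) (c - 4)
  have hV : ContDiff ℝ 1 fun x => ⟪Z x, x⟫_ℝ := hZ.inner ℝ contDiff_id
  set a : E n → ℝ := fun y => ⟪Z y, y⟫_ℝ ^ 2 * D.extWeight (2 * k + 2) 2 (c - 4) y with ha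
  have haC : ContDiff ℝ 1 a := (hV.pow 2).mul hW
  have key := integral_le_of_le_add_dvg (F := fun y => a y • y) (hP.const_mul (κ / 2))
    (hQ.const_mul (1 / (2 * κ))) (haC.smul contDiff_id) ?_ ?_
  · rw [integral_const_mul, integral_const_mul] at key
    have := mul_le_mul_of_nonneg_left key (show 0 ≤ 2 / κ by positivity)
    rw [← mul_assoc, ← mul_assoc, show 2 / κ * (κ / 2) = 1 by field_simp, one_mul,
      show 2 / κ * (1 / (2 * κ)) = 1 / κ ^ 2 by field_simp] at this
    exact this
  · refine hZc.mono' fun x hx => subset_tsupport _ fun h0 => hx ?_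
    simp [ha, h0]
  · intro x
    have had := haC.differentiable one_ne_zero x
    rw [dvg_smul had differentiableAt_fun_id, dvg_id]
    have hda : fderiv ℝ a x x = 2 * ⟪Z x, x⟫_ℝ * (⟪Z x, x⟫_ℝ + ⟪fderiv ℝ Z x x, x⟫_ℝ) *
        D.extWeight (2 * k + 2) 2 (c - 4) x +
        ⟪Z x, x⟫_ℝ ^ 2 * fderiv ℝ (D.extWeight (2 * k + 2) 2 (c - 4)) x x := by
      have h1 := ((hV.differentiable one_ne_zero x).hasFDerivAt.pow 2).mul
        (hW.differentiable one_ne_zero x).hasFDerivAt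
      have h2 := h1.fderiv
      rw [show a = (fun x => ⟪Z x, x⟫_ℝ ^ 2) * D.extWeight (2 * k + 2) 2 (c - 4) from rfl, h2]
      have h3 : fderiv ℝ (fun x => ⟪Z x, x⟫_ℝ) x x = ⟪Z x, x⟫_ℝ + ⟪fderiv ℝ Z x x, x⟫_ℝ := by
        rw [fderiv_inner_apply ℝ (hZ.differentiable one_ne_zero x) differentiableAt_fun_id]
        simp
      simp only [add_apply, smul_apply, smul_eq_mul, h3, nsmul_eq_mul]
      norm_num
      ring
    rw [hda]
    simp only [ha]
    by_cases hx : x ∈ D.Ω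
    · have hsym : |2 * ⟪fderiv ℝ Z x x, x⟫_ℝ| ≤ symGrad Z x * ‖x‖ ^ 2 := by
        have := abs_inner_add_inner_le Z x x x
        rw [← two_mul, mul_assoc] at this
        rw [pow_two]; exact this
      rw [fderiv_extWeight D (by omega) _ hx, extWeight_eq D (by omega), D.ψ_of_mem hx,
        mul_assoc, mul_comm (rad 2 (c - 4) x)]
      have h0 := rad_mul_fderiv_φ_self D (two_ne_zero) (c - 4) hx
      obtain ⟨m, t, τ, hm, ht, hτ, hmt, hte, hcase, r5, r4, r3, r0⟩ := rad_data c x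
      rw [show c - 4 - 1 = c - 5 by ring, real_inner_self_eq_norm_sq] 
      have h0' : rad 2 (c - 4) x * ((2 * k + 1 + 1 : ℕ) * D.φ x ^ (2 * k + 1)) *
          fderiv ℝ D.φ x x = 0 := by
        rw [mul_right_comm, h0, zero_mul]
      rw [h0', add_zero]
      simp only [r4, r5, r0]
      have hq : ‖x‖ ^ 2 = t - 1 := by rw [hte]; ring
      rw [hq] at hsym ⊢
      set V := ⟪Z x, x⟫_ℝ
      set f := D.φ x ^ (2 * k + 2) with hf
      have hf0 : 0 < f := pow_pos (D.φ_pos x hx) _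
      set s := symGrad Z x
      have hs : 0 ≤ s := symGrad_nonneg _ _
      set i := ⟪fderiv ℝ Z x x, x⟫_ℝ
      have hi := (abs_le.1 hsym).1
      have hi2 := (abs_le.1 hsym).2
      have ht1 : 0 ≤ t - 1 := by rw [← hq]; positivity
      -- The corrections to the leading coefficient come from the truncation and from the `1` in `1
      -- + |x|²`. They are nonnegative, so the estimate is not limited to large `|x|`.
      have bracket : κ * (m ^ 2 * (t * τ)) ≤ (n + 2) * (m ^ 2 * (t * τ)) +
          2 * (2 * (m * (t * τ)) + (c - 4) * (m ^ 2 * τ)) * (t - 1) := by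
        rcases hcase with h | ⟨h, -⟩
        · rw [h]; simp
        · have : (n + 2) * (m ^ 2 * (t * τ)) +
              2 * (2 * (m * (t * τ)) + (c - 4) * (m ^ 2 * τ)) * (t - 1) - κ * (m ^ 2 * (t * τ)) =
              m * τ * (4 * t + (8 - 2 * c) * m) := by
            rw [h, hκ]; ring
          have : 0 ≤ m * τ * (4 * t + (8 - 2 * c) * m) := by
            have : 0 ≤ 8 - 2 * c := by linarith
            positivity
          linarith
      have sterm : m ^ 2 * (t * τ) * (t - 1) ^ 2 ≤ t ^ 5 * τ := by
        have h1 : m ^ 2 ≤ t ^ 2 := by gcongr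
        have h2 : (t - 1) ^ 2 ≤ t ^ 2 := by gcongr; linarith
        calc m ^ 2 * (t * τ) * (t - 1) ^ 2 ≤ t ^ 2 * (t * τ) * t ^ 2 := by gcongr
          _ = _ := by ring
      have young : -(V * (2 * i)) ≤ κ / 2 * V ^ 2 + 1 / (2 * κ) * (s * (t - 1)) ^ 2 := by
        have h1 : -(V * (2 * i)) ≤ |V| * (s * (t - 1)) := by
          refine (neg_le_abs _).trans ?_
          rw [abs_mul]; gcongr
        have h2 : 0 ≤ κ / 2 * (|V| - 1 / κ * (s * (t - 1))) ^ 2 := by positivity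
        have h3 : κ / 2 * (|V| - 1 / κ * (s * (t - 1))) ^ 2 = κ / 2 * V ^ 2 +
            1 / (2 * κ) * (s * (t - 1)) ^ 2 - |V| * (s * (t - 1)) := by
          rw [← sq_abs V]; field_simp; ring
        linarith
      have p1 : 0 ≤ V ^ 2 * f := by positivity
      have p2 : 0 ≤ m ^ 2 * (t * τ) * f := by positivity
      have p3 : 0 ≤ 1 / (2 * κ) * s ^ 2 * f := by positivity
      have q1 := mul_le_mul_of_nonneg_left bracket p1
      have q2 := mul_le_mul_of_nonneg_left young p2
      have q3 := mul_le_mul_of_nonneg_left sterm p3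
      simp only [Nat.cast_ofNat, pow_zero, one_mul, Nat.reduceSub, pow_one]
      generalize 1 / (2 * κ) = e at q2 q3 ⊢
      clear_value V f s i κ
      linarith
    · rw [fderiv_extWeight_of_notMem D (by omega) (by omega) _ hx, extWeight_eq D (by omega),
        D.ψ_of_notMem hx]
      simp

/-- For `X = W x` the leading coefficient of `|Z|² W` is `1 + n/2 + (c - 1) = n/2 + c ≥ 1`. Half of
this pays for the symmetric gradient terms. The remaining term `⟨Z,x⟩ ∂_Z W` is indefinite: its
radial part is a multiple of `⟨Z,x⟩²`. Its angular part contains `φ^(2k+1)` and is split into `ε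
|Z|² φ^(2k)` and a large multiple of `⟨Z,x⟩² φ^(2k+2)`. -/
lemma exterior_algebra {m ρ σ z V s f ξ g dZ c K ν ε : ℝ} (k : ℕ) (hm : 0 ≤ m) (hρ : 0 < ρ)
    (hσ : 0 < σ) (hz : 0 ≤ z) (hs : 0 ≤ s) (hf : 0 < f) (hν : 0 ≤ ν) (hε : 0 < ε)
    (hmt : m ≤ ρ ^ 2) (hξρ : ξ ≤ ρ) (hg : ρ * g ≤ K) (hdZ : |dZ| ≤ g * z)
    (hc : c ≤ 1) (hcn : 1 ≤ ν / 2 + c) (hcase : m = 0 ∨ m = ρ ^ 2 - 2) :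
    1 / 2 * (z ^ 2 * (m ^ 2 * ((ρ ^ 2) ^ 2 * σ ^ 2)) * f ^ (2 * k + 2)) +
        (ν + 1) * s * z * (m ^ 3 * (ρ ^ 2 * σ ^ 2) * f ^ (2 * k + 2) * ξ) ≤
      ε * (z ^ 2 * (m ^ 4 * σ ^ 2) * f ^ (2 * k)) +
      (((2 * k + 2) * K) ^ 2 / (4 * ε) + 2 * |c - 4|) *
        (V ^ 2 * (m ^ 2 * (ρ ^ 2 * σ ^ 2)) * f ^ (2 * k + 2)) +
      (ν + 1) ^ 2 * (s ^ 2 * ((ρ ^ 2) ^ 5 * σ ^ 2) * f ^ (2 * k + 2)) +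
      (m ^ 3 * (ρ ^ 2 * σ ^ 2) * f ^ (2 * k + 2) * (z ^ 2 + 1 / 2 * z ^ 2 * ν) +
        (f ^ (2 * k + 2) *
          (2 * (3 * (m ^ 2 * (ρ ^ 2 * σ ^ 2)) + (c - 4) * (m ^ 3 * σ ^ 2)) * V) +
          m ^ 3 * (ρ ^ 2 * σ ^ 2) * ((2 * k + 2) * f ^ (2 * k + 1)) * dZ) * V +
        1 / 2 * z ^ 2 * (f ^ (2 * k + 2) *
          (2 * (3 * (m ^ 2 * (ρ ^ 2 * σ ^ 2)) + (c - 4) * (m ^ 3 * σ ^ 2)) * (ρ ^ 2 - 1)))) := by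
  have bracket : m ^ 2 * ((ρ ^ 2) ^ 2 * σ ^ 2) ≤ m ^ 3 * (ρ ^ 2 * σ ^ 2) * (1 + ν / 2) +
      (3 * (m ^ 2 * (ρ ^ 2 * σ ^ 2)) + (c - 4) * (m ^ 3 * σ ^ 2)) * (ρ ^ 2 - 1) := by
    rcases hcase with h | h
    · rw [h]; simp
    · have e : m ^ 3 * (ρ ^ 2 * σ ^ 2) * (1 + ν / 2) +
          (3 * (m ^ 2 * (ρ ^ 2 * σ ^ 2)) + (c - 4) * (m ^ 3 * σ ^ 2)) * (ρ ^ 2 - 1) -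
          m ^ 2 * ((ρ ^ 2) ^ 2 * σ ^ 2) =
          m ^ 2 * σ ^ 2 * ((ν / 2 + c - 1) * (m * ρ ^ 2) + ρ ^ 2 + (4 - c) * m) := by
        have hρ2 : ρ ^ 2 = m + 2 := by linarith
        rw [hρ2]; ring
      have h1 : 0 ≤ ν / 2 + c - 1 := by linarith
      have h2 : 0 ≤ 4 - c := by linarith
      have : 0 ≤ m ^ 2 * σ ^ 2 * ((ν / 2 + c - 1) * (m * ρ ^ 2) + ρ ^ 2 + (4 - c) * m) := by
        positivity
      linarith
  have hb : -(|c - 4| * (m ^ 2 * (ρ ^ 2 * σ ^ 2))) ≤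
      3 * (m ^ 2 * (ρ ^ 2 * σ ^ 2)) + (c - 4) * (m ^ 3 * σ ^ 2) := by
    have h1 : |c - 4| * (m ^ 3 * σ ^ 2) ≤ |c - 4| * (m ^ 2 * (ρ ^ 2 * σ ^ 2)) := by
      gcongr ?_ * ?_
      calc m ^ 3 * σ ^ 2 = m ^ 2 * (m * σ ^ 2) := by ring
        _ ≤ m ^ 2 * (ρ ^ 2 * σ ^ 2) := by gcongr
    have h2 : -(|c - 4| * (m ^ 3 * σ ^ 2)) ≤ (c - 4) * (m ^ 3 * σ ^ 2) := by
      rw [← neg_mul]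
      exact mul_le_mul_of_nonneg_right (neg_abs_le _) (by positivity)
    have h3 : 0 ≤ 3 * (m ^ 2 * (ρ ^ 2 * σ ^ 2)) := by positivity
    linarith
  have cross : -(ε * (z ^ 2 * (m ^ 4 * σ ^ 2) * f ^ (2 * k)) + ((2 * k + 2) * K) ^ 2 / (4 * ε) *
      (V ^ 2 * (m ^ 2 * (ρ ^ 2 * σ ^ 2)) * f ^ (2 * k + 2))) ≤
      m ^ 3 * (ρ ^ 2 * σ ^ 2) * ((2 * k + 2) * f ^ (2 * k + 1)) * dZ * V := by
    have h1 : |m ^ 3 * (ρ ^ 2 * σ ^ 2) * ((2 * k + 2) * f ^ (2 * k + 1)) * dZ * V| ≤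
        ((2 * k + 2) * K) * ((z * m ^ 2 * σ * f ^ k) * (|V| * m * ρ * σ * f ^ (k + 1))) := by
      rw [abs_mul, abs_mul, abs_of_nonneg (show 0 ≤ m ^ 3 * (ρ ^ 2 * σ ^ 2) *
        ((2 * k + 2) * f ^ (2 * k + 1)) by positivity)]
      calc m ^ 3 * (ρ ^ 2 * σ ^ 2) * ((2 * k + 2) * f ^ (2 * k + 1)) * |dZ| * |V| ≤
          m ^ 3 * (ρ ^ 2 * σ ^ 2) * ((2 * k + 2) * f ^ (2 * k + 1)) * (g * z) * |V| := by gcongr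
        _ = (ρ * g) * ((2 * k + 2) *
            ((z * m ^ 2 * σ * f ^ k) * (|V| * m * ρ * σ * f ^ (k + 1)))) := by ring
        _ ≤ K * ((2 * k + 2) *
            ((z * m ^ 2 * σ * f ^ k) * (|V| * m * ρ * σ * f ^ (k + 1)))) := by gcongr
        _ = _ := by ring
    have h2 : 0 ≤ ε * ((z * m ^ 2 * σ * f ^ k) -
        ((2 * k + 2) * K) / (2 * ε) * (|V| * m * ρ * σ * f ^ (k + 1))) ^ 2 := by positivity
    have h3 : ε * ((z * m ^ 2 * σ * f ^ k) -
        ((2 * k + 2) * K) / (2 * ε) * (|V| * m * ρ * σ * f ^ (k + 1))) ^ 2 =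
        ε * (z ^ 2 * (m ^ 4 * σ ^ 2) * f ^ (2 * k)) + ((2 * k + 2) * K) ^ 2 / (4 * ε) *
        (V ^ 2 * (m ^ 2 * (ρ ^ 2 * σ ^ 2)) * f ^ (2 * k + 2)) -
        ((2 * k + 2) * K) * ((z * m ^ 2 * σ * f ^ k) * (|V| * m * ρ * σ * f ^ (k + 1))) := by
      rw [← sq_abs V]; field_simp; ring
    have h4 := neg_abs_le (m ^ 3 * (ρ ^ 2 * σ ^ 2) * ((2 * k + 2) * f ^ (2 * k + 1)) * dZ * V)
    linarith
  have sterm : (ν + 1) * s * z * (m ^ 3 * (ρ ^ 2 * σ ^ 2) * f ^ (2 * k + 2) * ξ) ≤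
      1 / 2 * (z ^ 2 * (m ^ 2 * ((ρ ^ 2) ^ 2 * σ ^ 2)) * f ^ (2 * k + 2)) +
      (ν + 1) ^ 2 * (s ^ 2 * ((ρ ^ 2) ^ 5 * σ ^ 2) * f ^ (2 * k + 2)) := by
    have h1 : (ν + 1) * s * z * (m ^ 3 * (ρ ^ 2 * σ ^ 2) * f ^ (2 * k + 2) * ξ) ≤
        (z * m * ρ ^ 2 * σ * f ^ (k + 1)) * ((ν + 1) * (s * m ^ 2 * ρ * σ * f ^ (k + 1))) := by
      calc _ ≤ (ν + 1) * s * z * (m ^ 3 * (ρ ^ 2 * σ ^ 2) * f ^ (2 * k + 2) * ρ) := by gcongr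
        _ = _ := by ring
    have h2 := sq_nonneg ((z * m * ρ ^ 2 * σ * f ^ (k + 1)) -
      ((ν + 1) * (s * m ^ 2 * ρ * σ * f ^ (k + 1))))
    have h3 : (ν + 1) ^ 2 * (s ^ 2 * (m ^ 4 * ρ ^ 2 * σ ^ 2) * f ^ (2 * k + 2)) ≤
        (ν + 1) ^ 2 * (s ^ 2 * ((ρ ^ 2) ^ 5 * σ ^ 2) * f ^ (2 * k + 2)) := by
      gcongr ?_ * (?_ * ?_ * ?_)
      calc m ^ 4 * ρ ^ 2 * σ ^ 2 ≤ (ρ ^ 2) ^ 4 * ρ ^ 2 * σ ^ 2 := by gcongr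
        _ = _ := by ring
    have h4 : 0 ≤ (ν + 1) ^ 2 * (s ^ 2 * (m ^ 4 * ρ ^ 2 * σ ^ 2) * f ^ (2 * k + 2)) := by
      positivity
    have h5 : ((z * m * ρ ^ 2 * σ * f ^ (k + 1)) -
        ((ν + 1) * (s * m ^ 2 * ρ * σ * f ^ (k + 1)))) ^ 2 =
        z ^ 2 * (m ^ 2 * ((ρ ^ 2) ^ 2 * σ ^ 2)) * f ^ (2 * k + 2) +
        (ν + 1) ^ 2 * (s ^ 2 * (m ^ 4 * ρ ^ 2 * σ ^ 2) * f ^ (2 * k + 2)) -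
        2 * ((z * m * ρ ^ 2 * σ * f ^ (k + 1)) *
          ((ν + 1) * (s * m ^ 2 * ρ * σ * f ^ (k + 1)))) := by ring
    linarith
  have q1 := mul_le_mul_of_nonneg_left bracket (show 0 ≤ z ^ 2 * f ^ (2 * k + 2) by positivity)
  have q2 := mul_le_mul_of_nonneg_left hb (show 0 ≤ 2 * V ^ 2 * f ^ (2 * k + 2) by positivity)
  linarith

/-- Radial multiplier on the exact cone. The two error terms are of known kind: the one with small
factor `ε` is handled by the boundary estimate, the one with the radial component of `Z` by the flux
estimate. -/
lemma exterior_multiplier {k : ℕ} (hk : 1 ≤ k) {c : ℝ} (hc : c ≤ 1)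
    (hcn : 0 < n + 2 * c - 2) {ε : ℝ} (hε : 0 < ε) : ∃ C : ℝ, 0 < C ∧ ∀ Z : E n → E n,
    ContDiff ℝ 1 Z → HasCompactSupport Z →
    1 / 2 * (∫ x, ‖Z x‖ ^ 2 * rad 2 (c - 3) x * D.ψ x ^ (2 * k + 2)) ≤
      ε * (∫ x, ‖Z x‖ ^ 2 * rad 4 (c - 5) x * D.ψ x ^ (2 * k)) +
      C * (∫ x, ⟪Z x, x⟫_ℝ ^ 2 * rad 2 (c - 4) x * D.ψ x ^ (2 * k + 2)) +
      C * (∫ x, symGrad Z x ^ 2 * rad 0 c x * D.ψ x ^ (2 * k + 2)) := by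
  obtain ⟨K, c₀, hK, hc₀, hb⟩ := D.exists_bounds
  set A : ℝ := ((2 * k + 2) * K) ^ 2 / (4 * ε) + 2 * |c - 4| with hA
  have hA0 : 0 ≤ A := by positivity
  refine ⟨A + ((n : ℝ) + 1) ^ 2, by positivity, fun Z hZ hZc => ?_⟩
  have hψ := D.continuous_ψ
  have hsg := continuous_symGrad hZ
  have hZcont := hZ.continuous
  have hr1 := continuous_rad (n := n) 2 (c - 3)
  have hr2 := continuous_rad (n := n) 4 (c - 5)
  have hr3 := continuous_rad (n := n) 2 (c - 4)
  have hr4 := continuous_rad (n := n) 0 c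
  have hP : Integrable fun x => ‖Z x‖ ^ 2 * rad 2 (c - 3) x * D.ψ x ^ (2 * k + 2) := by
    refine integrable_of_tsupport hZc (by fun_prop) fun x hx => ?_
    simp [image_eq_zero_of_notMem_tsupport hx]
  have hQ1 : Integrable fun x => ‖Z x‖ ^ 2 * rad 4 (c - 5) x * D.ψ x ^ (2 * k) := by
    refine integrable_of_tsupport hZc (by fun_prop) fun x hx => ?_
    simp [image_eq_zero_of_notMem_tsupport hx]
  have hQ2 : Integrable fun x => ⟪Z x, x⟫_ℝ ^ 2 * rad 2 (c - 4) x * D.ψ x ^ (2 * k + 2) := by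
    refine integrable_of_tsupport hZc (by fun_prop) fun x hx => ?_
    simp [image_eq_zero_of_notMem_tsupport hx]
  have hQ3 : Integrable fun x => symGrad Z x ^ 2 * rad 0 c x * D.ψ x ^ (2 * k + 2) := by
    refine integrable_of_tsupport hZc (by fun_prop) fun x hx => ?_
    simp [symGrad_eq_zero_of_notMem hx]
  have hW := contDiff_extWeight D (show 2 ≤ 2 * k + 2 by omega) (show 3 ≠ 1 by omega) (c - 4)
  have key := multiplier_le (Z := Z) (X := fun y => D.extWeight (2 * k + 2) 3 (c - 4) y • y) hZ hZc
    (hW.smul contDiff_id) (hP.const_mul (1 / 2))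
    (((hQ1.const_mul ε).add (hQ2.const_mul A)).add (hQ3.const_mul (((n : ℝ) + 1) ^ 2))) ?_
  · rw [integral_add' ((hQ1.const_mul ε).add (hQ2.const_mul A))
      (hQ3.const_mul (((n : ℝ) + 1) ^ 2)), integral_add' (hQ1.const_mul ε) (hQ2.const_mul A)] at key
    simp only [integral_const_mul] at key
    have i2 : 0 ≤ ∫ x, ⟪Z x, x⟫_ℝ ^ 2 * rad 2 (c - 4) x * D.ψ x ^ (2 * k + 2) :=
      integral_nonneg fun x => by
        have := rad_nonneg 2 (c - 4) x
        have := D.ψ_nonneg x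
        positivity
    have i3 : 0 ≤ ∫ x, symGrad Z x ^ 2 * rad 0 c x * D.ψ x ^ (2 * k + 2) :=
      integral_nonneg fun x => by
        have := rad_nonneg 0 c x
        have := D.ψ_nonneg x
        positivity
    have j2 := mul_nonneg (sq_nonneg ((n : ℝ) + 1)) i2
    have j3 := mul_nonneg hA0 i3
    linarith
  · intro x
    rw [inner_fderiv_smul_add (hW.differentiable one_ne_zero x) differentiableAt_fun_id, dvg_id]
    simp only [Pi.add_apply]
    by_cases hx : x ∈ D.Ω
    · obtain ⟨-, b1, -, -⟩ := hb x hx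
      have hfx := D.φ_pos x hx
      rw [fderiv_extWeight D (by omega) _ hx, fderiv_extWeight D (by omega) _ hx, norm_smul,
        extWeight_eq D (by omega), D.ψ_of_mem hx]
      have h0 := rad_mul_fderiv_φ_self D (three_ne_zero) (c - 4) hx
      have h0' : rad 3 (c - 4) x * ((2 * k + 1 + 1 : ℕ) * D.φ x ^ (2 * k + 1)) *
          fderiv ℝ D.φ x x = 0 := by
        rw [mul_right_comm, h0, zero_mul]
      rw [h0', add_zero]
      obtain ⟨m, t, τ, hm, ht, hτ, hmt, hte, hcase, r5, r4, r3, r0⟩ := rad_data c x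
      rw [show c - 4 - 1 = c - 5 by ring, real_inner_self_eq_norm_sq x, real_inner_comm (Z x) x]
      simp only [r4, r5, r0, r3]
      have hq : ‖x‖ ^ 2 = t - 1 := by rw [hte]; ring
      have hst : Real.sqrt t ^ 2 = t := Real.sq_sqrt ht.le
      have hsτ : Real.sqrt τ ^ 2 = τ := Real.sq_sqrt hτ.le
      have alg := exterior_algebra (m := m) (ρ := Real.sqrt t) (σ := Real.sqrt τ) (z := ‖Z x‖)
        (V := ⟪Z x, x⟫_ℝ) (s := symGrad Z x) (f := D.φ x) (ξ := ‖x‖) (g := ‖D.grad x‖)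
        (dZ := fderiv ℝ D.φ x (Z x)) (c := c) (K := K) (ν := n) (ε := ε) k hm (Real.sqrt_pos.2 ht)
        (Real.sqrt_pos.2 hτ) (norm_nonneg _) (symGrad_nonneg _ _) hfx
        (Nat.cast_nonneg _) hε (by rw [hst]; exact hmt)
        (Real.le_sqrt_of_sq_le (by linarith)) (by
          refine abs_le_of_sq_le_sq' ?_ (by linarith) |>.2
          rw [mul_pow, hst, hte]; exact b1) (by
          rw [D.norm_grad]; exact (fderiv ℝ D.φ x).le_opNorm _) hc (by linarith) (by
          rw [hst]; exact hcase.imp id (fun h => h.1))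
      rw [hst, hsτ] at alg
      have hW0 : 0 ≤ m ^ 3 * (t * τ) * D.φ x ^ (2 * k + 2) := by positivity
      rw [Real.norm_eq_abs, abs_of_nonneg hW0, hq]
      push_cast at alg ⊢
      simp only [fderiv_fun_id, ContinuousLinearMap.id_apply, real_inner_self_eq_norm_sq,
        pow_zero, one_mul, show (2 * (k : ℝ) + 1 + 1) = 2 * k + 2 by ring]
      exact alg
    · rw [fderiv_extWeight_of_notMem D (by omega) (by omega) _ hx, extWeight_eq D (by omega),
        D.ψ_of_notMem hx]
      simp [show k ≠ 0 by omega]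

/-- Estimate of a vector field by its symmetric gradient on the exact cone. -/
lemma exterior_estimate {k : ℕ} (hk : 1 ≤ k) {c : ℝ} (hc : c ≤ 1)
    (hcn : 0 < n + 2 * c - 2) : ∃ C : ℝ, 0 < C ∧ ∀ Z : E n → E n,
    ContDiff ℝ 1 Z → HasCompactSupport Z →
    ∫ x, ‖Z x‖ ^ 2 * rad 2 (c - 3) x * D.ψ x ^ (2 * k + 2) ≤
      C * ∫ x, symGrad Z x ^ 2 * rad 0 c x * D.ψ x ^ (2 * k + 2) := by
  obtain ⟨CA, hCA, hA⟩ := boundary_estimate D k hk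
  set L : ℝ := 4 * (4 + |c - 4|) ^ 2 with hL
  have hL0 : 0 ≤ L := by positivity
  -- This `ε` turns the loss in the boundary estimate, of size `CA (L + 1)`, into a quarter of the
  -- integral on the left, while half of it is available.
  obtain ⟨CC, hCC, hC⟩ := exterior_multiplier D hk hc hcn
    (ε := 1 / (4 * (CA * (L + 1)))) (by positivity)
  refine ⟨4 * (1 / (4 * (CA * (L + 1))) * CA + CC * (1 / (n + 2 * c - 2) ^ 2) + CC), by positivity,
    fun Z hZ hZc => ?_⟩
  have hψ := D.continuous_ψ
  have hsg := continuous_symGrad hZ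
  have hZcont := hZ.continuous
  have hr1 := continuous_rad (n := n) 2 (c - 3)
  have hr2 := continuous_rad (n := n) 4 (c - 4)
  have hr4 := continuous_rad (n := n) 0 c
  have ht0 : ∀ x : E n, 1 + ‖x‖ ^ 2 ≠ 0 := fun x => (one_add_norm_sq_pos x).ne'
  have hB := radial_component_estimate D hk hc hcn hZ hZc
  have hCZ := hC Z hZ hZc
  -- The truncation power 4 is chosen so that `|∇H|² ≤ H M` holds with `M` a multiple of `rad 2 (c -
  -- 3)`, the weight of the quantity to be estimated.
  have hAZ := hA (rad 4 (c - 4)) (fun x => L * rad 2 (c - 3) x) (contDiff_rad (by omega) _)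
    (by fun_prop) (rad_nonneg _ _) (fun x => mul_nonneg hL0 (rad_nonneg _ _ _)) (by
      intro x
      have h1 := norm_fderiv_rad_le (n := n) (show 4 ≠ 1 by omega) (c - 4) x
      obtain ⟨m, t, τ, hm, ht, hτ, hmt, hte, -, r5, r4, r3, r0⟩ := rad_data c x
      rw [show c - 4 - 1 = c - 5 by ring] at h1
      simp only [r4, r5, r3] at h1 ⊢
      have h2 : |((4 : ℕ) : ℝ) * (m ^ (4 - 1) * (t * τ)) + (c - 4) * (m ^ 4 * τ)| ≤
          (4 + |c - 4|) * (m ^ 3 * (t * τ)) := by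
        refine (abs_add_le _ _).trans ?_
        rw [abs_mul, abs_mul (c - 4), abs_of_nonneg (show 0 ≤ m ^ (4 - 1) * (t * τ) by positivity),
          abs_of_nonneg (show 0 ≤ m ^ 4 * τ by positivity)]
        have : m ^ 4 * τ ≤ m ^ 3 * (t * τ) := by
          calc m ^ 4 * τ = m ^ 3 * (m * τ) := by ring
            _ ≤ m ^ 3 * (t * τ) := by gcongr
        have := mul_le_mul_of_nonneg_left this (abs_nonneg (c - 4))
        norm_num
        linarith
      calc ‖fderiv ℝ (rad 4 (c - 4)) x‖ ^ 2 ≤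
          (2 * ((4 + |c - 4|) * (m ^ 3 * (t * τ))) * ‖x‖) ^ 2 := by
            gcongr
            exact h1.trans (by gcongr)
        _ = L * ((m ^ 3 * (t * τ)) ^ 2 * ‖x‖ ^ 2) := by rw [hL]; ring
        _ ≤ L * ((m ^ 3 * (t * τ)) ^ 2 * t) := by gcongr; linarith
        _ = _ := by ring) Z hZ hZc
  have e1 : ∫ x, ‖Z x‖ ^ 2 * rad 4 (c - 4) x * D.ψ x ^ (2 * k) / (1 + ‖x‖ ^ 2) =
      ∫ x, ‖Z x‖ ^ 2 * rad 4 (c - 5) x * D.ψ x ^ (2 * k) := by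
    congr 1
    ext x
    obtain ⟨m, t, τ, hm, ht, hτ, hmt, hte, -, r5, r4, r3, r0⟩ := rad_data c x
    rw [r4, r5, ← hte]
    field_simp
  have e2 : ∫ x, symGrad Z x ^ 2 * rad 4 (c - 4) x * D.ψ x ^ (2 * k + 2) ≤
      ∫ x, symGrad Z x ^ 2 * rad 0 c x * D.ψ x ^ (2 * k + 2) := by
    refine integral_mono ?_ ?_ fun x => ?_
    · refine integrable_of_tsupport hZc (by fun_prop) fun x hx => ?_
      simp [symGrad_eq_zero_of_notMem hx]
    · refine integrable_of_tsupport hZc (by fun_prop) fun x hx => ?_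
      simp [symGrad_eq_zero_of_notMem hx]
    · have := D.ψ_nonneg x
      beta_reduce
      gcongr ?_ * ?_ * ?_
      obtain ⟨m, t, τ, hm, ht, hτ, hmt, hte, -, r5, r4, r3, r0⟩ := rad_data c x
      rw [r4, r0, pow_zero, one_mul]
      calc m ^ 4 * (t * τ) ≤ t ^ 4 * (t * τ) := by gcongr
        _ = _ := by ring
  have e3 : ∫ x, ‖Z x‖ ^ 2 * (L * rad 2 (c - 3) x + rad 4 (c - 4) x / (1 + ‖x‖ ^ 2)) *
      D.ψ x ^ (2 * k + 2) ≤ (L + 1) * ∫ x, ‖Z x‖ ^ 2 * rad 2 (c - 3) x * D.ψ x ^ (2 * k + 2) := by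
    rw [← integral_const_mul]
    refine integral_mono ?_ ?_ fun x => ?_
    · refine integrable_of_tsupport hZc (by fun_prop (disch := exact ht0 _)) fun x hx => ?_
      simp [image_eq_zero_of_notMem_tsupport hx]
    · refine integrable_of_tsupport hZc (by fun_prop) fun x hx => ?_
      simp [image_eq_zero_of_notMem_tsupport hx]
    · have := D.ψ_nonneg x
      beta_reduce
      have h : L * rad 2 (c - 3) x + rad 4 (c - 4) x / (1 + ‖x‖ ^ 2) ≤
          (L + 1) * rad 2 (c - 3) x := by
        obtain ⟨m, t, τ, hm, ht, hτ, hmt, hte, -, r5, r4, r3, r0⟩ := rad_data c x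
        rw [r4, r3, ← hte]
        have : m ^ 4 * (t * τ) / t ≤ m ^ 2 * (t ^ 2 * τ) := by
          rw [div_le_iff₀ ht]
          calc m ^ 4 * (t * τ) = m ^ 2 * m ^ 2 * (t * τ) := by ring
            _ ≤ m ^ 2 * t ^ 2 * (t * τ) := by gcongr
            _ = _ := by ring
        linarith
      calc _ ≤ ‖Z x‖ ^ 2 * ((L + 1) * rad 2 (c - 3) x) * D.ψ x ^ (2 * k + 2) := by gcongr
        _ = _ := by ring
  rw [e1] at hAZ
  set IA := ∫ x, ‖Z x‖ ^ 2 * rad 4 (c - 5) x * D.ψ x ^ (2 * k)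
  set IS := ∫ x, symGrad Z x ^ 2 * rad 0 c x * D.ψ x ^ (2 * k + 2)
  set Im := ∫ x, ‖Z x‖ ^ 2 * rad 2 (c - 3) x * D.ψ x ^ (2 * k + 2)
  set IV := ∫ x, ⟪Z x, x⟫_ℝ ^ 2 * rad 2 (c - 4) x * D.ψ x ^ (2 * k + 2)
  have h1 : IA ≤ CA * IS + CA * ((L + 1) * Im) :=
    hAZ.trans (add_le_add (mul_le_mul_of_nonneg_left e2 hCA.le)
      (mul_le_mul_of_nonneg_left e3 hCA.le))
  have h2 := mul_le_mul_of_nonneg_left h1 (show 0 ≤ 1 / (4 * (CA * (L + 1))) by positivity)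
  have h3 : 1 / (4 * (CA * (L + 1))) * (CA * IS + CA * ((L + 1) * Im)) =
      1 / (4 * (CA * (L + 1))) * CA * IS + 1 / 4 * Im := by
    field_simp
  have h4 := mul_le_mul_of_nonneg_left hB hCC.le
  linarith

end Exterior

/-! ### Propagation of control from ball to ball and along the connected region -/

section Propagation

variable {n : ℕ}

lemma hasFDerivAt_bump {m : ℕ} (hm : 2 ≤ m) (R : ℝ) (y x : E n) :
    HasFDerivAt (fun x => -(max (R ^ 2 - ‖x - y‖ ^ 2) 0) ^ m)
      ((2 * m * max (R ^ 2 - ‖x - y‖ ^ 2) 0 ^ (m - 1)) • innerSL ℝ (x - y)) x := by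
  have h1 : HasFDerivAt (fun x => ‖x - y‖ ^ 2) (2 • innerSL ℝ (x - y)) x := by
    have h := HasFDerivAt.comp (g := fun v : E n => ‖v‖ ^ 2) x
      (hasStrictFDerivAt_norm_sq (x - y)).hasFDerivAt ((hasFDerivAt_id x).sub_const y)
    rw [ContinuousLinearMap.comp_id] at h
    exact h
  have h2 := ((hasDerivAt_max_zero_pow hm (R ^ 2 - ‖x - y‖ ^ 2)).comp_hasFDerivAt x
    (h1.const_sub (R ^ 2))).neg
  refine h2.congr_fderiv ?_
  ext v
  simp only [neg_apply, smul_apply, smul_eq_mul, nsmul_eq_mul, Nat.cast_ofNat, innerSL_apply_apply]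
  ring

/-- For `X = -tᵐ (x - y)`, with `t` the truncation of `R² - |x - y|²`, differentiating the power
yields the positive term `m t^(m-1) |x - y|² |Z|²`. Away from the small ball it beats the negative
term of size `tᵐ |Z|²` once `m` is large. Inside the small ball the deficit is charged to the `L²`
norm there. -/
lemma ball_algebra {m₁ : ℕ} (hm₁ : 1 ≤ m₁) {ν R ε t d z s i m : ℝ} (ht : 0 ≤ t)
    (hR : 0 < R) (htR : t = max (R ^ 2 - d ^ 2) 0) (hε : 0 < ε)
    (hm : ((1 + ν / 2) * R ^ 2 + 1) / ε ^ 2 ≤ m) (hν : 0 ≤ ν) :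
    1 / 2 * (t ^ m₁ * z ^ 2) + (ν + 1) * s * z * (t ^ (m₁ + 1) * d) ≤
      ((1 + ν / 2) * R ^ 2 + 1) * (if d < ε then t ^ m₁ * z ^ 2 else 0) +
        1 / 2 * (ν + 1) ^ 2 * R ^ 6 * (t ^ m₁ * s ^ 2) +
      (-t ^ (m₁ + 1) * (z ^ 2 + 1 / 2 * z ^ 2 * ν) + 2 * m * t ^ m₁ * i * i +
        1 / 2 * z ^ 2 * (2 * m * t ^ m₁ * d ^ 2)) := by
  have hm0 : 0 < m := lt_of_lt_of_le (by positivity) hm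
  rcases eq_or_lt_of_le ht with h0 | h0
  · rw [← h0, zero_pow (by omega), zero_pow (by omega)]
    simp
  · have hdt : t = R ^ 2 - d ^ 2 := by
      rw [htR]
      refine max_eq_left ?_
      by_contra hcon
      rw [max_eq_right (by linarith)] at htR
      linarith
    have hT : 0 < t ^ m₁ := by positivity
    have htR2 : t ≤ R ^ 2 := by nlinarith
    have hdR2 : d ^ 2 ≤ R ^ 2 := by linarith
    have h1 : (1 + ν / 2) * R ^ 2 + 1 ≤ m * ε ^ 2 := by
      rwa [div_le_iff₀ (by positivity)] at hm
    have hs : (ν + 1) * s * z * (t * d) ≤ 1 / 2 * z ^ 2 + 1 / 2 * (ν + 1) ^ 2 * R ^ 6 * s ^ 2 := by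
      have h2 := sq_nonneg (z - (ν + 1) * s * (t * d))
      have h3 : (t * d) ^ 2 ≤ R ^ 6 := by
        calc (t * d) ^ 2 = t ^ 2 * d ^ 2 := by ring
          _ ≤ (R ^ 2) ^ 2 * R ^ 2 := by gcongr
          _ = R ^ 6 := by ring
      have h4 : ((ν + 1) * s) ^ 2 * (t * d) ^ 2 ≤ ((ν + 1) * s) ^ 2 * R ^ 6 := by gcongr
      nlinarith
    have hmain : z ^ 2 ≤ ((1 + ν / 2) * R ^ 2 + 1) * (if d < ε then z ^ 2 else 0) +
        (-t * (z ^ 2 + 1 / 2 * z ^ 2 * ν) + z ^ 2 * (m * d ^ 2)) := by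
      have h5 : t * (z ^ 2 + 1 / 2 * z ^ 2 * ν) ≤ R ^ 2 * (z ^ 2 + 1 / 2 * z ^ 2 * ν) := by gcongr
      split_ifs with hif
      · have : 0 ≤ z ^ 2 * (m * d ^ 2) := by positivity
        linarith
      · have hdε : ε ^ 2 ≤ d ^ 2 := by gcongr; linarith
        have h6 : z ^ 2 * ((1 + ν / 2) * R ^ 2 + 1) ≤ z ^ 2 * (m * d ^ 2) := by
          gcongr
          exact h1.trans (by gcongr)
        linarith
    have hi : 0 ≤ 2 * m * (i * i) := mul_nonneg (by positivity) (mul_self_nonneg i)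
    have q1 := mul_le_mul_of_nonneg_left hs hT.le
    have q2 := mul_le_mul_of_nonneg_left hmain hT.le
    have q3 := mul_nonneg hT.le hi
    rw [pow_succ t]
    split_ifs at q2 ⊢ <;> linarith

/-- Propagation of the estimate of a vector field by its symmetric gradient from a small ball to
a larger one. -/
lemma ball_propagation (y : E n) {R ε : ℝ} (hR : 0 < R) (hε : 0 < ε) : ∃ C : ℝ, 0 ≤ C ∧
    ∀ Z : E n → E n, ContDiff ℝ 1 Z → HasCompactSupport Z →
    ∫ x in Metric.ball y (R / 2), ‖Z x‖ ^ 2 ≤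
      C * (∫ x in Metric.ball y ε, ‖Z x‖ ^ 2) + C * ∫ x in Metric.ball y R, symGrad Z x ^ 2 := by
  obtain ⟨m₀, hm₀⟩ := exists_nat_ge (((1 + (n : ℝ) / 2) * R ^ 2 + 1) / ε ^ 2)
  set m₁ := m₀ + 1 with hm₁
  -- The exponent of the bump is `m₁ + 1`, large enough to dominate outside the ball of radius `ε`.
  -- The extra unit in `m₁` makes `m₁ ≥ 1`, so that the bump is `C¹`.
  have hm : ((1 + (n : ℝ) / 2) * R ^ 2 + 1) / ε ^ 2 ≤ ((m₁ + 1 : ℕ) : ℝ) := by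
    push_cast [hm₁]; linarith
  set A : ℝ := (1 + (n : ℝ) / 2) * R ^ 2 + 1 with hA
  set B : ℝ := 1 / 2 * ((n : ℝ) + 1) ^ 2 * R ^ 6 with hB
  have hA0 : 0 < A := by positivity
  have hB0 : 0 < B := by positivity
  set T : E n → ℝ := fun x => max (R ^ 2 - ‖x - y‖ ^ 2) 0 with hT
  have hTc : Continuous T := by fun_prop
  have hT0 : ∀ x, 0 ≤ T x := fun x => le_max_right _ _
  have hTR : ∀ x, T x ≤ R ^ 2 := fun x => max_le (by nlinarith [sq_nonneg ‖x - y‖]) (by positivity)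
  -- A lower bound of the bump weight on the half ball, where `R² - |x - y|² ≥ 3R²/4`.
  set δ : ℝ := (R ^ 2 * 3 / 4) ^ m₁ with hδ
  have hδ0 : 0 < δ := by positivity
  set S : ℝ := (R ^ 2) ^ m₁ with hS
  have hS0 : 0 < S := by positivity
  refine ⟨2 / δ * (A * S + B * S), by positivity, fun Z hZ hZc => ?_⟩
  have hsg := continuous_symGrad hZ
  have hZcont := hZ.continuous
  have hz2 : Integrable fun x => ‖Z x‖ ^ 2 := by
    refine integrable_of_tsupport hZc (by fun_prop) fun x hx => ?_
    simp [image_eq_zero_of_notMem_tsupport hx]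
  have hs2 : Integrable fun x => symGrad Z x ^ 2 := by
    refine integrable_of_tsupport hZc (by fun_prop) fun x hx => ?_
    simp [symGrad_eq_zero_of_notMem hx]
  have hP : Integrable fun x => T x ^ m₁ * ‖Z x‖ ^ 2 := by
    refine integrable_of_tsupport hZc (by fun_prop) fun x hx => ?_
    simp [image_eq_zero_of_notMem_tsupport hx]
  have hQ2 : Integrable fun x => T x ^ m₁ * symGrad Z x ^ 2 := by
    refine integrable_of_tsupport hZc (by fun_prop) fun x hx => ?_
    simp [symGrad_eq_zero_of_notMem hx]
  have hQ1 : Integrable ((Metric.ball y ε).indicator fun x => T x ^ m₁ * ‖Z x‖ ^ 2) :=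
    hP.indicator Metric.isOpen_ball.measurableSet
  have hbump : ContDiff ℝ 1 (fun x => -(max (R ^ 2 - ‖x - y‖ ^ 2) 0) ^ (m₁ + 1)) := by
    rw [contDiff_one_iff_hasFDerivAt]
    refine ⟨_, ?_, fun x => hasFDerivAt_bump (by omega) R y x⟩
    fun_prop
  have key := multiplier_le (Z := Z)
    (X := fun x => (-(max (R ^ 2 - ‖x - y‖ ^ 2) 0) ^ (m₁ + 1)) • (x - y)) hZ hZc
    (hbump.smul (contDiff_id.sub contDiff_const)) (hP.const_mul (1 / 2))
    ((hQ1.const_mul A).add (hQ2.const_mul B)) ?_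
  · rw [integral_add' (hQ1.const_mul A) (hQ2.const_mul B)] at key
    simp only [integral_const_mul] at key
    rw [integral_indicator Metric.isOpen_ball.measurableSet] at key
    have l1 : δ * ∫ x in Metric.ball y (R / 2), ‖Z x‖ ^ 2 ≤ ∫ x, T x ^ m₁ * ‖Z x‖ ^ 2 := by
      rw [← integral_const_mul]
      calc _ ≤ ∫ x in Metric.ball y (R / 2), T x ^ m₁ * ‖Z x‖ ^ 2 := by
            refine setIntegral_mono_on (hz2.integrableOn.const_mul δ) hP.integrableOn
              Metric.isOpen_ball.measurableSet fun x hx => ?_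
            gcongr
            rw [hδ]
            gcongr
            rw [Metric.mem_ball, dist_eq_norm] at hx
            refine le_max_of_le_left ?_
            nlinarith [norm_nonneg (x - y)]
        _ ≤ _ := setIntegral_le_integral hP (Eventually.of_forall fun x => by
            have := hT0 x
            simp only [Pi.zero_apply]
            positivity)
    have l2 : ∫ x in Metric.ball y ε, T x ^ m₁ * ‖Z x‖ ^ 2 ≤
        S * ∫ x in Metric.ball y ε, ‖Z x‖ ^ 2 := by
      rw [← integral_const_mul]
      refine setIntegral_mono_on hP.integrableOn (hz2.integrableOn.const_mul S)
        Metric.isOpen_ball.measurableSet fun x _ => ?_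
      have := hT0 x
      gcongr
      rw [hS]
      gcongr
      exact hTR x
    have l3 : ∫ x, T x ^ m₁ * symGrad Z x ^ 2 ≤ S * ∫ x in Metric.ball y R, symGrad Z x ^ 2 := by
      rw [← integral_const_mul, ← integral_indicator Metric.isOpen_ball.measurableSet]
      refine integral_mono hQ2
        ((hs2.const_mul S).indicator Metric.isOpen_ball.measurableSet) fun x => ?_
      beta_reduce
      by_cases hx : x ∈ Metric.ball y R
      · rw [Set.indicator_of_mem hx]
        have := hT0 x
        gcongr
        rw [hS]
        gcongr
        exact hTR x
      · rw [Set.indicator_of_notMem hx]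
        rw [Metric.mem_ball, dist_eq_norm, not_lt] at hx
        have : T x = 0 := max_eq_right (by nlinarith)
        rw [this, zero_pow (by omega), zero_mul]
    have n2 : 0 ≤ ∫ x in Metric.ball y ε, ‖Z x‖ ^ 2 := integral_nonneg fun x => by positivity
    have n3 : 0 ≤ ∫ x in Metric.ball y R, symGrad Z x ^ 2 := integral_nonneg fun x => by positivity
    set I0 := ∫ x in Metric.ball y (R / 2), ‖Z x‖ ^ 2
    set I1 := ∫ x in Metric.ball y ε, ‖Z x‖ ^ 2
    set I2 := ∫ x in Metric.ball y R, symGrad Z x ^ 2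
    have h1 : δ * I0 ≤ 2 * (A * (S * I1) + B * (S * I2)) := by
      have := mul_le_mul_of_nonneg_left l2 hA0.le
      have := mul_le_mul_of_nonneg_left l3 hB0.le
      linarith
    have h2 : 2 * (A * (S * I1) + B * (S * I2)) ≤ 2 * ((A * S + B * S) * I1 +
        (A * S + B * S) * I2) := by
      have : 0 ≤ B * S * I1 := by positivity
      have : 0 ≤ A * S * I2 := by positivity
      nlinarith
    have h3 : 2 / δ * (A * S + B * S) * I1 + 2 / δ * (A * S + B * S) * I2 =
        2 * ((A * S + B * S) * I1 + (A * S + B * S) * I2) / δ := by ring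
    rw [h3, le_div_iff₀ hδ0]
    linarith
  · intro x
    rw [inner_fderiv_smul_add (hbump.differentiable one_ne_zero x) (by fun_prop),
      (hasFDerivAt_bump (by omega) R y x).fderiv]
    have hdv : dvg (fun x => x - y) x = n := by
      rw [← dvg_id x]
      refine dvg_congr_of_fderiv ?_
      rw [fderiv_sub_const]
    rw [hdv, fderiv_sub_const]
    have alg := ball_algebra (m₁ := m₁) (by omega) (ν := n) (R := R) (ε := ε) (t := T x) (d := ‖x - y‖)
      (z := ‖Z x‖) (s := symGrad Z x) (i := ⟪x - y, Z x⟫_ℝ) (m := ((m₁ + 1 : ℕ) : ℝ)) (hT0 x)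
      hR rfl hε hm (Nat.cast_nonneg _)
    simp only [Pi.add_apply, norm_smul, norm_neg, norm_pow, smul_apply, smul_eq_mul,
      innerSL_apply_apply, Nat.add_sub_cancel, fderiv_fun_id, ContinuousLinearMap.id_apply,
      real_inner_self_eq_norm_sq, real_inner_comm (x - y) (Z x)]
    rw [Real.norm_eq_abs, abs_of_nonneg (hT0 x)]
    have hind : (Metric.ball y ε).indicator (fun x => T x ^ m₁ * ‖Z x‖ ^ 2) x =
        if ‖x - y‖ < ε then T x ^ m₁ * ‖Z x‖ ^ 2 else 0 := by
      simp only [Set.indicator, Metric.mem_ball, dist_eq_norm]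
    rw [hind]
    exact alg

lemma setIntegral_le_const_mul_integral {w : E n → ℝ} (hw : Continuous w) (hw0 : ∀ x, 0 ≤ w x)
    {K : Set (E n)} (hK : IsCompact K) (hpos : ∀ x ∈ K, 0 < w x) : ∃ C : ℝ, 0 ≤ C ∧
    ∀ f : E n → ℝ, Continuous f → HasCompactSupport f → (∀ x, 0 ≤ f x) →
    ∫ x in K, f x ≤ C * ∫ x, f x * w x := by
  obtain ⟨δ, hδ, hδK⟩ : ∃ δ : ℝ, 0 < δ ∧ ∀ x ∈ K, δ ≤ w x :=
    hK.exists_forall_le' hw.continuousOn hpos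
  refine ⟨1 / δ, by positivity, fun f hf hfc hf0 => ?_⟩
  have hi : Integrable f := hf.integrable_of_hasCompactSupport hfc
  have hiw : Integrable fun x => f x * w x :=
    (hf.mul hw).integrable_of_hasCompactSupport hfc.mul_right
  have h : δ * ∫ x in K, f x ≤ ∫ x, f x * w x := by
    rw [← integral_const_mul]
    calc _ ≤ ∫ x in K, f x * w x := by
          refine setIntegral_mono_on (hi.integrableOn.const_mul δ) hiw.integrableOn
            hK.measurableSet fun x hx => ?_
          rw [mul_comm]
          exact mul_le_mul_of_nonneg_left (hδK x hx) (hf0 x)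
      _ ≤ _ := setIntegral_le_integral hiw
        (Eventually.of_forall fun x => mul_nonneg (hf0 x) (hw0 x))
  rw [one_div, inv_mul_eq_div, le_div_iff₀ hδ, mul_comm]
  exact h

lemma setIntegral_union_le {f : E n → ℝ} (hf : Integrable f) (hf0 : ∀ x, 0 ≤ f x)
    (s t : Set (E n)) : ∫ x in s ∪ t, f x ≤ (∫ x in s, f x) + ∫ x in t, f x := by
  rw [← integral_add_measure hf.integrableOn hf.integrableOn]
  refine integral_mono_measure (Measure.restrict_union_le s t) (Eventually.of_forall hf0) ?_
  exact Integrable.add_measure hf.integrableOn hf.integrableOn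

variable {θ₁ θ₂ : ℝ} (D : RegularizedCone n θ₁ θ₂)

/-- The `L²` norm on `s` is controlled by the weighted norm of the symmetric gradient. -/
def RegularizedCone.Controlled (k : ℕ) (c : ℝ) (s : Set (E n)) : Prop :=
  ∃ C : ℝ, 0 ≤ C ∧ ∀ Z : E n → E n, ContDiff ℝ 1 Z → HasCompactSupport Z →
    ∫ x in s, ‖Z x‖ ^ 2 ≤ C * ∫ x, symGrad Z x ^ 2 * (rad 0 c x * D.ψ x ^ (2 * k + 2))

lemma integrable_norm_sq {Z : E n → E n} (hZ : ContDiff ℝ 1 Z) (hZc : HasCompactSupport Z) :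
    Integrable fun x => ‖Z x‖ ^ 2 := by
  have hZcont := hZ.continuous
  refine integrable_of_tsupport hZc (by fun_prop) fun x hx => ?_
  simp [image_eq_zero_of_notMem_tsupport hx]

lemma Controlled.mono {k : ℕ} {c : ℝ} {s t : Set (E n)} (hst : s ⊆ t)
    (h : D.Controlled k c t) : D.Controlled k c s := by
  obtain ⟨C, hC, h⟩ := h
  refine ⟨C, hC, fun Z hZ hZc => le_trans ?_ (h Z hZ hZc)⟩
  exact setIntegral_mono_set (integrable_norm_sq hZ hZc).integrableOn
    (Eventually.of_forall fun x => by simp only [Pi.zero_apply]; positivity)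
    (Eventually.of_forall hst)

lemma weight_nonneg (k : ℕ) (c : ℝ) (x : E n) : 0 ≤ rad 0 c x * D.ψ x ^ (2 * k + 2) :=
  mul_nonneg (rad_nonneg _ _ _) (pow_nonneg (D.ψ_nonneg x) _)

lemma Controlled.union {k : ℕ} {c : ℝ} {s t : Set (E n)} (hs : D.Controlled k c s)
    (ht : D.Controlled k c t) : D.Controlled k c (s ∪ t) := by
  obtain ⟨C, hC, hs⟩ := hs
  obtain ⟨C', hC', ht⟩ := ht
  refine ⟨C + C', by positivity, fun Z hZ hZc => ?_⟩
  rw [add_mul]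
  exact (setIntegral_union_le (integrable_norm_sq hZ hZc) (fun x => by positivity) s t).trans
    (add_le_add (hs Z hZ hZc) (ht Z hZ hZc))

/-- Connectedness argument: the points with a controlled ball form an open set, which meets `Ω` in
the exact cone and is relatively closed in `Ω` by propagation. Control in the exact cone excludes
Killing fields, so no normalisation of `Z` is needed. -/
lemma controlled_nhds (hn : 2 ≤ n) (h1 : 0 < θ₁) (h12 : θ₁ < θ₂) (h2 : θ₂ < Real.pi) {k : ℕ}
    (hk : 1 ≤ k) {c : ℝ} (hc : c ≤ 1) (hcn : 0 < n + 2 * c - 2) :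
    D.Ω ⊆ {x | ∃ ε : ℝ, 0 < ε ∧ D.Controlled k c (Metric.ball x ε)} := by
  have hψ := D.continuous_ψ
  refine D.isConnected.isPreconnected.subset_of_closure_inter_subset ?_ ?_ ?_
  · rw [Metric.isOpen_iff]
    rintro x ⟨ε, hε, h⟩
    refine ⟨ε / 2, by positivity, fun y hy => ⟨ε / 2, by positivity, Controlled.mono D ?_ h⟩⟩
    refine Metric.ball_subset_ball' ?_
    rw [Metric.mem_ball] at hy
    linarith
  · obtain ⟨x₀, hx₀, hx2⟩ := D.exists_mem_norm_eq_two hn h1 h12 h2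
    refine ⟨x₀, hx₀, ?_⟩
    have hr := continuous_rad (n := n) 2 (c - 3)
    set w : E n → ℝ := fun x => rad 2 (c - 3) x * D.ψ x ^ (2 * k + 2) with hw
    have hwc : Continuous w := by fun_prop
    have hw0 : 0 < w x₀ := by
      have a1 := D.ψ_pos_iff.2 hx₀
      have a2 : 0 < rad 2 (c - 3) x₀ := by
        rw [rad, hx2, max_eq_left (by norm_num)]; positivity
      positivity
    obtain ⟨ε, hε, hball⟩ := Metric.mem_nhds_iff.1 (hwc.continuousAt.eventually (lt_mem_nhds hw0))
    obtain ⟨C, hC, hset⟩ := setIntegral_le_const_mul_integral hwc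
      (fun x => mul_nonneg (rad_nonneg _ _ _) (pow_nonneg (D.ψ_nonneg x) _))
      (isCompact_closedBall x₀ (ε / 2)) (fun x hx => hball
        (Metric.closedBall_subset_ball (by linarith) hx))
    obtain ⟨C', hC', hext⟩ := exterior_estimate D hk hc hcn
    refine ⟨ε / 2, by positivity, Controlled.mono D Metric.ball_subset_closedBall
      ⟨C * C', by positivity, fun Z hZ hZc => ?_⟩⟩
    have hZcont := hZ.continuous
    have e1 := hset (fun x => ‖Z x‖ ^ 2) (by fun_prop)
      (hZc.comp_left (g := fun v : E n => ‖v‖ ^ 2) (by simp)) (fun x => by positivity)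
    have e2 := hext Z hZ hZc
    simp only [hw, ← mul_assoc] at e1 ⊢
    rw [mul_assoc C]
    exact e1.trans (mul_le_mul_of_nonneg_left e2 hC)
  -- Relative closedness: a controlled point `y` lies within `R/8` of `x`. Propagation in the ball
  -- of radius `R/2` about `y`, which stays in `Ω`, controls the ball of radius `R/4`, and this
  -- contains the ball of radius `R/8` about `x`.
  · rintro x ⟨hx, hxΩ⟩
    obtain ⟨R, hR, hRball⟩ := Metric.isOpen_iff.1 D.isOpen x hxΩ
    obtain ⟨y, ⟨ε, hε, hy⟩, hxy⟩ := Metric.mem_closure_iff.1 hx (R / 8) (by positivity)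
    have hcb : Metric.closedBall y (R / 2) ⊆ D.Ω :=
      (Metric.closedBall_subset_ball' (by rw [dist_comm]; linarith)).trans hRball
    obtain ⟨C, hC, hprop⟩ := ball_propagation y (R := R / 2) (by positivity) hε
    have hr := continuous_rad (n := n) 0 c
    obtain ⟨C', hC', hset⟩ := setIntegral_le_const_mul_integral
      (w := fun x => rad 0 c x * D.ψ x ^ (2 * k + 2)) (by fun_prop) (weight_nonneg D k c)
      (isCompact_closedBall y (R / 2)) (fun x hx => by
        have a1 := D.ψ_pos_iff.2 (hcb hx)
        have a2 : 0 < rad 0 c x := by rw [rad]; positivity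
        positivity)
    obtain ⟨C'', hC'', hy⟩ := hy
    refine ⟨R / 8, by positivity, Controlled.mono D (t := Metric.ball y (R / 2 / 2)) ?_
      ⟨C * C'' + C * C', by positivity, fun Z hZ hZc => ?_⟩⟩
    · exact Metric.ball_subset_ball' (by linarith)
    · have hsg := continuous_symGrad hZ
      have hsgc : HasCompactSupport (fun x => symGrad Z x ^ 2) := by
        refine hZc.mono' fun x hx => ?_
        by_contra h
        exact hx (by simp [symGrad_eq_zero_of_notMem h])
      have hsgi : Integrable (fun x => symGrad Z x ^ 2) :=
        (hsg.pow 2).integrable_of_hasCompactSupport hsgc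
      have e1 := hset (fun x => symGrad Z x ^ 2) (by fun_prop) hsgc (fun x => by positivity)
      have e2 := hy Z hZ hZc
      have e3 := hprop Z hZ hZc
      have e4 : ∫ x in Metric.ball y (R / 2), symGrad Z x ^ 2 ≤
          ∫ x in Metric.closedBall y (R / 2), symGrad Z x ^ 2 :=
        setIntegral_mono_set hsgi.integrableOn
          (Eventually.of_forall fun x => by simp only [Pi.zero_apply]; positivity)
          (Eventually.of_forall Metric.ball_subset_closedBall)
      have e5 := mul_le_mul_of_nonneg_left e2 hC
      have e6 := mul_le_mul_of_nonneg_left (e4.trans e1) hC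
      rw [add_mul, mul_assoc, mul_assoc]
      exact e3.trans (add_le_add e5 e6)

lemma controlled_of_isCompact (hn : 2 ≤ n) (h1 : 0 < θ₁) (h12 : θ₁ < θ₂) (h2 : θ₂ < Real.pi) {k : ℕ}
    (hk : 1 ≤ k) {c : ℝ} (hc : c ≤ 1) (hcn : 0 < n + 2 * c - 2) {K : Set (E n)}
    (hK : IsCompact K) (hKΩ : K ⊆ D.Ω) : D.Controlled k c K := by
  refine hK.induction_on (p := D.Controlled k c) ?_ (fun s t hst h => Controlled.mono D hst h)
    (fun s t hs ht => Controlled.union D hs ht) fun x hx => ?_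
  · exact ⟨0, le_rfl, fun Z _ _ => by simp⟩
  · obtain ⟨ε, hε, h⟩ := controlled_nhds D hn h1 h12 h2 hk hc hcn (hKΩ hx)
    exact ⟨Metric.ball x ε, mem_nhdsWithin_of_mem_nhds (Metric.ball_mem_nhds x hε), h⟩

end Propagation

/-! ### Absorption of the lower order term and the null Lagrangian -/

section Korn

variable {n : ℕ}

lemma rad_zero_data (c : ℝ) (x : E n) : ∃ t τ : ℝ, 1 ≤ t ∧ 0 < τ ∧ t = 1 + ‖x‖ ^ 2 ∧
    rad 0 (c - 1) x = τ ∧ rad 0 c x = t * τ := by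
  have ht := one_add_norm_sq_pos x
  refine ⟨1 + ‖x‖ ^ 2, (1 + ‖x‖ ^ 2) ^ (c - 1), by nlinarith [sq_nonneg ‖x‖], by positivity, rfl,
    by simp [rad], ?_⟩
  rw [rad, pow_zero, one_mul]
  nth_rewrite 2 [← Real.rpow_one (1 + ‖x‖ ^ 2)]
  rw [← Real.rpow_add ht]
  congr 1
  ring

variable {θ₁ θ₂ : ℝ} (D : RegularizedCone n θ₁ θ₂)

lemma integrable_weighted_norm {Z : E n → E n} (hZ : ContDiff ℝ 1 Z) (hZc : HasCompactSupport Z)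
    (j : ℕ) (c : ℝ) (k : ℕ) : Integrable fun x => ‖Z x‖ ^ 2 * rad j c x * D.ψ x ^ k := by
  have hψ := D.continuous_ψ
  have hZcont := hZ.continuous
  have hr := continuous_rad (n := n) j c
  refine integrable_of_tsupport hZc (by fun_prop) fun x hx => ?_
  simp [image_eq_zero_of_notMem_tsupport hx]

lemma integrable_weighted_symGrad {Z : E n → E n} (hZ : ContDiff ℝ 1 Z) (hZc : HasCompactSupport Z)
    (j : ℕ) (c : ℝ) (k : ℕ) : Integrable fun x => symGrad Z x ^ 2 * rad j c x * D.ψ x ^ k := by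
  have hψ := D.continuous_ψ
  have hsg := continuous_symGrad hZ
  have hr := continuous_rad (n := n) j c
  refine integrable_of_tsupport hZc (by fun_prop) fun x hx => ?_
  simp [symGrad_eq_zero_of_notMem hx]

/-- Three regions. Where `ψ² < η` the extra two powers of `ψ` give the small factor. For `|x| > 2`
the truncated and untruncated weights are comparable and the exterior estimate applies. What remains
is compact in `Ω`, where control has been propagated. -/
lemma lower_order_le (hn : 2 ≤ n) (h1 : 0 < θ₁) (h12 : θ₁ < θ₂) (h2 : θ₂ < Real.pi) {k : ℕ}
    (hk : 1 ≤ k) {c : ℝ} (hc : c ≤ 1) (hcn : 0 < n + 2 * c - 2) {η : ℝ} (hη : 0 < η) :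
    ∃ C : ℝ, 0 ≤ C ∧ ∀ Z : E n → E n, ContDiff ℝ 1 Z → HasCompactSupport Z →
    ∫ x, ‖Z x‖ ^ 2 * rad 0 (c - 1) x * D.ψ x ^ (2 * k + 2) ≤
      η * (∫ x, ‖Z x‖ ^ 2 * rad 0 (c - 1) x * D.ψ x ^ (2 * k)) +
      C * ∫ x, symGrad Z x ^ 2 * rad 0 c x * D.ψ x ^ (2 * k + 2) := by
  have hψ := D.continuous_ψ
  set K : Set (E n) := {x | η ≤ D.ψ x ^ 2} ∩ Metric.closedBall 0 2 with hK
  have hKc : IsCompact K :=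
    (isCompact_closedBall _ _).inter_left (isClosed_le continuous_const (by fun_prop))
  have hKΩ : K ⊆ D.Ω := by
    intro x hx
    rw [← D.ψ_pos_iff]
    have : η ≤ D.ψ x ^ 2 := hx.1
    have h0 := D.ψ_nonneg x
    by_contra hcon
    have h3 : D.ψ x = 0 := le_antisymm (not_lt.1 hcon) h0
    rw [h3] at this
    norm_num at this
    linarith
  obtain ⟨C₁, hC₁, hext⟩ := exterior_estimate D hk hc hcn
  obtain ⟨C₂, hC₂, hcomp⟩ := controlled_of_isCompact D hn h1 h12 h2 hk hc hcn hKc hKΩ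
  have hr := continuous_rad (n := n) 0 (c - 1)
  obtain ⟨B, hB⟩ := hKc.exists_bound_of_continuousOn
    (f := fun x => rad 0 (c - 1) x * D.ψ x ^ (2 * k + 2)) (by fun_prop)
  refine ⟨4 * C₁ + |B| * C₂, by positivity, fun Z hZ hZc => ?_⟩
  have hind : Integrable (K.indicator fun x => ‖Z x‖ ^ 2) :=
    (integrable_norm_sq hZ hZc).indicator hKc.measurableSet
  have i1 := (integrable_weighted_norm D hZ hZc 0 (c - 1) (2 * k)).const_mul η
  have i2 := (integrable_weighted_norm D hZ hZc 2 (c - 3) (2 * k + 2)).const_mul 4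
  have i3 := hind.const_mul |B|
  have key : ∫ x, ‖Z x‖ ^ 2 * rad 0 (c - 1) x * D.ψ x ^ (2 * k + 2) ≤
      η * (∫ x, ‖Z x‖ ^ 2 * rad 0 (c - 1) x * D.ψ x ^ (2 * k)) +
      4 * (∫ x, ‖Z x‖ ^ 2 * rad 2 (c - 3) x * D.ψ x ^ (2 * k + 2)) +
      |B| * ∫ x in K, ‖Z x‖ ^ 2 := by
    rw [← integral_indicator hKc.measurableSet, ← integral_const_mul, ← integral_const_mul,
      ← integral_const_mul, ← integral_add i1 i2,
      ← integral_add (f := fun x => η * _ + 4 * _) (i1.add i2) i3]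
    refine integral_mono (integrable_weighted_norm D hZ hZc 0 (c - 1) (2 * k + 2))
      ((i1.add i2).add i3) fun x => ?_
    beta_reduce
    have hp := D.ψ_nonneg x
    have r1 := rad_nonneg 0 (c - 1) x
    have r2 := rad_nonneg 2 (c - 3) x
    have p1 : 0 ≤ η * (‖Z x‖ ^ 2 * rad 0 (c - 1) x * D.ψ x ^ (2 * k)) := by positivity
    have p2 : 0 ≤ 4 * (‖Z x‖ ^ 2 * rad 2 (c - 3) x * D.ψ x ^ (2 * k + 2)) := by positivity
    have p3 : 0 ≤ |B| * K.indicator (fun x => ‖Z x‖ ^ 2) x :=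
      mul_nonneg (abs_nonneg _) (Set.indicator_nonneg (fun _ _ => by positivity) _)
    rcases le_or_gt η (D.ψ x ^ 2) with hη' | hη'
    · rcases le_or_gt ‖x‖ 2 with hx | hx
      · have hxK : x ∈ K := ⟨hη', by simpa using hx⟩
        have hb := hB x hxK
        rw [Real.norm_eq_abs] at hb
        have hb' := (le_abs_self _).trans (hb.trans (le_abs_self B))
        rw [Set.indicator_of_mem hxK] at p3 ⊢
        have : ‖Z x‖ ^ 2 * rad 0 (c - 1) x * D.ψ x ^ (2 * k + 2) ≤ |B| * ‖Z x‖ ^ 2 := by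
          rw [mul_assoc, mul_comm]
          gcongr
        linarith
      · have hr : rad 0 (c - 1) x ≤ 4 * rad 2 (c - 3) x := by
          have ht := one_add_norm_sq_pos x
          rw [rad, rad, pow_zero, one_mul, max_eq_left (by nlinarith)]
          have e : (1 + ‖x‖ ^ 2) ^ (c - 1) = (1 + ‖x‖ ^ 2) ^ 2 * (1 + ‖x‖ ^ 2) ^ (c - 3) := by
            rw [← Real.rpow_natCast (1 + ‖x‖ ^ 2) 2, ← Real.rpow_add ht]
            congr 1; push_cast; ring
          rw [e, ← mul_assoc]
          gcongr
          have h4 : 4 < ‖x‖ ^ 2 := by nlinarith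
          nlinarith
        have : ‖Z x‖ ^ 2 * rad 0 (c - 1) x * D.ψ x ^ (2 * k + 2) ≤
            ‖Z x‖ ^ 2 * (4 * rad 2 (c - 3) x) * D.ψ x ^ (2 * k + 2) := by gcongr
        linarith
    · have : ‖Z x‖ ^ 2 * rad 0 (c - 1) x * D.ψ x ^ (2 * k + 2) ≤
          η * (‖Z x‖ ^ 2 * rad 0 (c - 1) x * D.ψ x ^ (2 * k)) := by
        calc _ = D.ψ x ^ 2 * (‖Z x‖ ^ 2 * rad 0 (c - 1) x * D.ψ x ^ (2 * k)) := by ring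
          _ ≤ _ := by gcongr
      linarith
  have e1 := mul_le_mul_of_nonneg_left (hext Z hZ hZc) (show (0 : ℝ) ≤ 4 by norm_num)
  have e2 := mul_le_mul_of_nonneg_left (hcomp Z hZ hZc) (abs_nonneg B)
  simp only [← mul_assoc] at e1 e2
  rw [add_mul]
  linarith

/-- Weighted `L²` estimate of a vector field by its symmetric gradient. -/
lemma weighted_norm_le (hn : 2 ≤ n) (h1 : 0 < θ₁) (h12 : θ₁ < θ₂) (h2 : θ₂ < Real.pi) {k : ℕ}
    (hk : 1 ≤ k) {c : ℝ} (hc : c ≤ 1) (hcn : 0 < n + 2 * c - 2) :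
    ∃ C : ℝ, 0 ≤ C ∧ ∀ Z : E n → E n, ContDiff ℝ 1 Z → HasCompactSupport Z →
    ∫ x, ‖Z x‖ ^ 2 * rad 0 (c - 1) x * D.ψ x ^ (2 * k) ≤
      C * ∫ x, symGrad Z x ^ 2 * rad 0 c x * D.ψ x ^ (2 * k + 2) := by
  obtain ⟨CA, hCA, hA⟩ := boundary_estimate D k hk
  -- With this `η` the lower order term of the boundary estimate, which has the factor `CA (4c² +
  -- 1)`, costs half of the left side.
  obtain ⟨C₁, hC₁, hlow⟩ := lower_order_le D hn h1 h12 h2 hk hc hcn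
    (η := 1 / (2 * (CA * (4 * c ^ 2 + 1)))) (by positivity)
  refine ⟨2 * (CA + CA * (4 * c ^ 2 + 1) * C₁), by positivity, fun Z hZ hZc => ?_⟩
  have hr := continuous_rad (n := n) 0 (c - 1)
  have hAZ := hA (rad 0 c) (fun x => 4 * c ^ 2 * rad 0 (c - 1) x) (contDiff_rad (by omega) _)
    (by fun_prop) (rad_nonneg _ _) (fun x => mul_nonneg (by positivity) (rad_nonneg _ _ _)) (by
      intro x
      have h1 := norm_fderiv_rad_le (n := n) (show 0 ≠ 1 by omega) c x
      obtain ⟨t, τ, ht, hτ, hte, r1, r0⟩ := rad_zero_data c x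
      rw [r1, r0]
      rw [r1] at h1
      simp only [Nat.cast_zero, zero_mul, zero_add, abs_mul, abs_of_pos hτ] at h1
      calc ‖fderiv ℝ (rad 0 c) x‖ ^ 2 ≤ (2 * (|c| * τ) * ‖x‖) ^ 2 := by gcongr
        _ = 4 * c ^ 2 * τ ^ 2 * ‖x‖ ^ 2 := by rw [← sq_abs c]; ring
        _ ≤ 4 * c ^ 2 * τ ^ 2 * t := by gcongr; linarith
        _ = _ := by ring) Z hZ hZc
  have hlowZ := hlow Z hZ hZc
  have e1 : ∫ x, ‖Z x‖ ^ 2 * rad 0 c x * D.ψ x ^ (2 * k) / (1 + ‖x‖ ^ 2) =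
      ∫ x, ‖Z x‖ ^ 2 * rad 0 (c - 1) x * D.ψ x ^ (2 * k) := by
    congr 1
    ext x
    obtain ⟨t, τ, ht, hτ, hte, r1, r0⟩ := rad_zero_data c x
    rw [r1, r0, ← hte]
    field_simp
  have e2 : ∫ x, ‖Z x‖ ^ 2 * (4 * c ^ 2 * rad 0 (c - 1) x + rad 0 c x / (1 + ‖x‖ ^ 2)) *
      D.ψ x ^ (2 * k + 2) =
      (4 * c ^ 2 + 1) * ∫ x, ‖Z x‖ ^ 2 * rad 0 (c - 1) x * D.ψ x ^ (2 * k + 2) := by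
    rw [← integral_const_mul]
    congr 1
    ext x
    obtain ⟨t, τ, ht, hτ, hte, r1, r0⟩ := rad_zero_data c x
    rw [r1, r0, ← hte]
    field_simp
  rw [e1, e2] at hAZ
  set IA := ∫ x, ‖Z x‖ ^ 2 * rad 0 (c - 1) x * D.ψ x ^ (2 * k)
  set IS := ∫ x, symGrad Z x ^ 2 * rad 0 c x * D.ψ x ^ (2 * k + 2)
  set IE := ∫ x, ‖Z x‖ ^ 2 * rad 0 (c - 1) x * D.ψ x ^ (2 * k + 2)
  have h3 := mul_le_mul_of_nonneg_left hlowZ (show 0 ≤ CA * (4 * c ^ 2 + 1) by positivity)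
  have h4 : CA * (4 * c ^ 2 + 1) * (1 / (2 * (CA * (4 * c ^ 2 + 1))) * IA + C₁ * IS) =
      IA / 2 + CA * (4 * c ^ 2 + 1) * C₁ * IS := by field_simp
  linarith

lemma clm_norm_sq_le (L : E n →L[ℝ] E n) :
    ‖L‖ ^ 2 ≤ ∑ i, ∑ j, L (EuclideanSpace.single i 1) j ^ 2 := by
  have h : ‖L‖ ≤ Real.sqrt (∑ i, ‖L (EuclideanSpace.single i 1)‖ ^ 2) := by
    refine ContinuousLinearMap.opNorm_le_bound _ (Real.sqrt_nonneg _) fun v => ?_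
    rw [← clm_sum_coord L v]
    calc ‖∑ i, v i • L (EuclideanSpace.single i 1)‖ ≤
        ∑ i, |v i| * ‖L (EuclideanSpace.single i 1)‖ := by
          refine (norm_sum_le _ _).trans (Finset.sum_le_sum fun i _ => ?_)
          rw [norm_smul, Real.norm_eq_abs]
      _ ≤ Real.sqrt (∑ i, |v i| ^ 2) * Real.sqrt (∑ i, ‖L (EuclideanSpace.single i 1)‖ ^ 2) :=
          Real.sum_mul_le_sqrt_mul_sqrt _ _ _
      _ = _ := by
          rw [EuclideanSpace.norm_eq v, mul_comm]
          simp
  calc ‖L‖ ^ 2 ≤ Real.sqrt (∑ i, ‖L (EuclideanSpace.single i 1)‖ ^ 2) ^ 2 := by gcongr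
    _ = ∑ i, ‖L (EuclideanSpace.single i 1)‖ ^ 2 := Real.sq_sqrt (by positivity)
    _ = _ := by
        refine Finset.sum_congr rfl fun i _ => ?_
        rw [EuclideanSpace.norm_sq_eq]
        simp

lemma norm_fderiv_sq_le (Z : E n → E n) (x : E n) :
    ‖fderiv ℝ Z x‖ ^ 2 ≤ ∑ i, ∑ j, pd i Z x j ^ 2 := clm_norm_sq_le _

lemma symGrad_sq_le (Z : E n → E n) (x : E n) :
    symGrad Z x ^ 2 ≤ ∑ i, ∑ j, (pd i Z x j + pd j Z x i) ^ 2 := by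
  refine (clm_norm_sq_le _).trans (le_of_eq ?_)
  refine Finset.sum_congr rfl fun i _ => Finset.sum_congr rfl fun j _ => ?_
  rw [pd_eq_inner, pd_eq_inner]
  have h : (ContinuousLinearMap.adjoint (fderiv ℝ Z x) (EuclideanSpace.single i 1)) j =
      ⟪fderiv ℝ Z x (EuclideanSpace.single j 1), EuclideanSpace.single i 1⟫_ℝ := by
    rw [← ContinuousLinearMap.adjoint_inner_right, EuclideanSpace.inner_single_left]
    simp
  rw [add_apply, PiLp.add_apply, h]
  simp [EuclideanSpace.inner_single_right]

/-- The vector field `(div Z) Z - ∂_Z Z`, whose divergence is of first order. -/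
def nullField (Z : E n → E n) (x : E n) : E n := dvg Z x • Z x - fderiv ℝ Z x (Z x)

lemma contDiff_dvg {Z : E n → E n} (hZ : ContDiff ℝ 2 Z) : ContDiff ℝ 1 (dvg Z) := by
  have h : ContDiff ℝ 1 (fderiv ℝ Z) := hZ.fderiv_right (by norm_num)
  unfold dvg pd
  refine ContDiff.sum fun i _ => ?_
  exact (EuclideanSpace.proj i : E n →L[ℝ] ℝ).contDiff.comp (h.clm_apply contDiff_const)

lemma contDiff_nullField {Z : E n → E n} (hZ : ContDiff ℝ 2 Z) : ContDiff ℝ 1 (nullField Z) := by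
  have h : ContDiff ℝ 1 (fderiv ℝ Z) := hZ.fderiv_right (by norm_num)
  have hZ1 : ContDiff ℝ 1 Z := hZ.of_le (by norm_num)
  exact ((contDiff_dvg hZ).smul hZ1).sub (h.clm_apply hZ1)

/-- The second derivatives of `Z` cancel: `∂_Z (div Z)` appears in the divergence of both parts, by
the symmetry of second derivatives. -/
lemma dvg_nullField {Z : E n → E n} (hZ : ContDiff ℝ 2 Z) (x : E n) :
    dvg (nullField Z) x = dvg Z x ^ 2 - ∑ i, ∑ j, pd i Z x j * pd j Z x i := by
  have h : ContDiff ℝ 1 (fderiv ℝ Z) := hZ.fderiv_right (by norm_num)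
  have hd : DifferentiableAt ℝ (fderiv ℝ Z) x := h.differentiable one_ne_zero x
  have hZd : DifferentiableAt ℝ Z x := hZ.differentiable (by norm_num) x
  have hdd : DifferentiableAt ℝ (dvg Z) x := (contDiff_dvg hZ).differentiable one_ne_zero x
  have hDZ : DifferentiableAt ℝ (fun y => fderiv ℝ Z y (Z y)) x := hd.clm_apply hZd
  have hsymm : IsSymmSndFDerivAt ℝ Z x := hZ.contDiffAt.isSymmSndFDerivAt (by simp)
  have e1 : nullField Z = fun y => dvg Z y • Z y + (-1 : ℝ) • fderiv ℝ Z y (Z y) := by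
    ext y; simp [nullField, sub_eq_add_neg]
  have e2 : dvg (fun y => (-1 : ℝ) • fderiv ℝ Z y (Z y)) x =
      -dvg (fun y => fderiv ℝ Z y (Z y)) x := by
    rw [dvg_smul (g := fun _ => (-1 : ℝ)) (by fun_prop) hDZ]
    simp
  have e3 : fderiv ℝ (dvg Z) x (Z x) = ∑ i, (fderiv ℝ (fderiv ℝ Z) x (Z x)
      (EuclideanSpace.single i 1)) i := by
    have hcomp : ∀ i : Fin n, HasFDerivAt (fun y => pd i Z y i)
        ((EuclideanSpace.proj i : E n →L[ℝ] ℝ).comp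
          ((fderiv ℝ (fderiv ℝ Z) x).flip (EuclideanSpace.single i 1))) x := by
      intro i
      have h4 := hd.hasFDerivAt.clm_apply (hasFDerivAt_const (EuclideanSpace.single i (1 : ℝ)) x)
      have h5 := (EuclideanSpace.proj i : E n →L[ℝ] ℝ).hasFDerivAt.comp x h4
      refine h5.congr_fderiv ?_
      ext v
      simp
    have hs : HasFDerivAt (dvg Z) _ x := HasFDerivAt.fun_sum fun i (_ : i ∈ Finset.univ) => hcomp i
    rw [hs.fderiv]
    simp
  have e4 : dvg (fun y => fderiv ℝ Z y (Z y)) x = ∑ i, (fderiv ℝ (fderiv ℝ Z) x (Z x)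
      (EuclideanSpace.single i 1)) i + ∑ i, ∑ j, pd i Z x j * pd j Z x i := by
    have h4 := hd.hasFDerivAt.clm_apply hZd.hasFDerivAt
    unfold dvg pd
    rw [h4.fderiv, ← Finset.sum_add_distrib]
    refine Finset.sum_congr rfl fun i _ => ?_
    have h5 := hsymm (EuclideanSpace.single i 1) (Z x)
    have h6 := clm_sum_coord (fderiv ℝ Z x) (fderiv ℝ Z x (EuclideanSpace.single i 1))
    simp only [add_apply, ContinuousLinearMap.coe_comp, Function.comp_apply,
      ContinuousLinearMap.flip_apply, PiLp.add_apply]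
    rw [h5, ← h6]
    simp [add_comm]
  rw [e1, dvg_add (hdd.fun_smul hZd) (hDZ.fun_const_smul _), dvg_smul hdd hZd, e2, e3, e4]
  ring

/-- Half of `∑ (∂ᵢZⱼ + ∂ⱼZᵢ)²` equals `∑ (∂ᵢZⱼ)² + ∑ ∂ᵢZⱼ ∂ⱼZᵢ`, and the last sum is `(div Z)²`
minus the divergence of the null field. The term `(div Z)²` has a favourable sign. -/
lemma sum_pd_sq_le {Z : E n → E n} (hZ : ContDiff ℝ 2 Z) (x : E n) :
    ∑ i, ∑ j, pd i Z x j ^ 2 ≤ n ^ 2 * symGrad Z x ^ 2 + dvg (nullField Z) x := by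
  rw [dvg_nullField hZ]
  have h1 : ∑ i, ∑ j, (pd i Z x j + pd j Z x i) ^ 2 ≤ (n : ℝ) ^ 2 * symGrad Z x ^ 2 := by
    calc ∑ i, ∑ j, (pd i Z x j + pd j Z x i) ^ 2 ≤ ∑ i : Fin n, ∑ j : Fin n, symGrad Z x ^ 2 := by
          refine Finset.sum_le_sum fun i _ => Finset.sum_le_sum fun j _ => ?_
          exact sq_le_sq' (by linarith [(abs_le.1 (abs_pd_add_pd_le Z x i j)).1])
            (abs_le.1 (abs_pd_add_pd_le Z x i j)).2
      _ = _ := by simp; ring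
  have h2 : ∑ i, ∑ j, (pd i Z x j + pd j Z x i) ^ 2 = 2 * (∑ i, ∑ j, pd i Z x j ^ 2) +
      2 * ∑ i, ∑ j, pd i Z x j * pd j Z x i := by
    have h3 : ∑ i, ∑ j, pd j Z x i ^ 2 = ∑ i, ∑ j, pd i Z x j ^ 2 := Finset.sum_comm
    have h4 : ∑ i, ∑ j, (pd i Z x j + pd j Z x i) ^ 2 = (∑ i, ∑ j, pd i Z x j ^ 2) +
        (∑ i, ∑ j, pd j Z x i ^ 2) + 2 * ∑ i, ∑ j, pd i Z x j * pd j Z x i := by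
      simp only [Finset.mul_sum, ← Finset.sum_add_distrib]
      exact Finset.sum_congr rfl fun i _ => Finset.sum_congr rfl fun j _ => by ring
    rw [h4, h3]; ring
  have h5 := sq_nonneg (dvg Z x)
  nlinarith [sq_nonneg (symGrad Z x), sq_nonneg (n : ℝ), mul_nonneg (sq_nonneg (n : ℝ)) (sq_nonneg (symGrad Z x))]

end Korn

/-! ### The weighted Korn inequality -/

section KornInequality

variable {n : ℕ}

lemma norm_nullField_le (Z : E n → E n) (x : E n) :
    ‖nullField Z x‖ ≤ (n + 1) * ‖fderiv ℝ Z x‖ * ‖Z x‖ := by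
  calc ‖nullField Z x‖ ≤ ‖dvg Z x • Z x‖ + ‖fderiv ℝ Z x (Z x)‖ := norm_sub_le _ _
    _ ≤ n * ‖fderiv ℝ Z x‖ * ‖Z x‖ + ‖fderiv ℝ Z x‖ * ‖Z x‖ := by
        rw [norm_smul, Real.norm_eq_abs]
        gcongr
        · exact abs_dvg_le_norm Z x
        · exact (fderiv ℝ Z x).le_opNorm _
    _ = _ := by ring

lemma HasCompactSupport.nullField {Z : E n → E n} (hZ : HasCompactSupport Z) :
    HasCompactSupport (nullField Z) := by
  refine hZ.mono fun x hx => ?_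
  by_contra h
  exact hx (by simp [ConeGluing.nullField, Function.notMem_support.1 h])

lemma gradient_algebra (k : ℕ) {t τ ψ B m d z Fr ν w : ℝ} (ht : 0 ≤ t) (hτ : 0 ≤ τ) (hp : 0 ≤ ψ)
    (hB : 0 ≤ B) (hfr : d ^ 2 ≤ Fr) (hν : ν ≤ m * d * z)
    (hw : w ≤ B * (ψ ^ (2 * k + 1) * τ * Real.sqrt t) * ν) :
    w ≤ 1 / 2 * (Fr * (t * τ) * ψ ^ (2 * k + 2)) +
      1 / 2 * (B * m) ^ 2 * (z ^ 2 * τ * ψ ^ (2 * k)) := by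
  have hs0 : 0 ≤ Real.sqrt t := Real.sqrt_nonneg t
  have hss : Real.sqrt t * Real.sqrt t = t := Real.mul_self_sqrt ht
  obtain ⟨s, hs'⟩ : ∃ s, s = Real.sqrt t := ⟨_, rfl⟩
  rw [← hs'] at hs0 hss hw
  have hP0 : 0 ≤ ψ ^ k := pow_nonneg hp k
  have p1 : ψ ^ (2 * k + 1) = (ψ ^ k) ^ 2 * ψ := by ring
  have p2 : ψ ^ (2 * k + 2) = (ψ ^ k) ^ 2 * ψ ^ 2 := by ring
  have p0 : ψ ^ (2 * k) = (ψ ^ k) ^ 2 := by ring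
  rw [p1] at hw
  rw [p2, p0]
  obtain ⟨P, hP⟩ : ∃ P, P = ψ ^ k := ⟨_, rfl⟩
  rw [← hP] at hP0 hw ⊢
  have e1 : w ≤ τ * (1 / 2 * (P * ψ * s * d) ^ 2 + 1 / 2 * (B * m * P * z) ^ 2) := by
    calc _ ≤ _ := hw
      _ ≤ B * (P ^ 2 * ψ * τ * s) * (m * d * z) := by gcongr
      _ = τ * ((P * ψ * s * d) * (B * m * P * z)) := by ring
      _ ≤ _ := by
        gcongr
        linarith [sq_nonneg (P * ψ * s * d - B * m * P * z), sub_sq (P * ψ * s * d) (B * m * P * z)]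
  have e2 : τ * (1 / 2 * (P * ψ * s * d) ^ 2) ≤ 1 / 2 * (Fr * (t * τ) * (P ^ 2 * ψ ^ 2)) := by
    calc τ * (1 / 2 * (P * ψ * s * d) ^ 2) =
        1 / 2 * (d ^ 2 * (t * τ) * (P ^ 2 * ψ ^ 2)) := by rw [← hss]; ring
      _ ≤ _ := by gcongr
  linarith

variable {θ₁ θ₂ : ℝ} (D : RegularizedCone n θ₁ θ₂)

/-- Differentiating the weight `r^(2c) ψ^(2k+2)` costs one power of `ψ` or one power of `r`. As `ψ`
is bounded, both losses fit under the same bound. -/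
lemma exists_norm_fderiv_extWeight_le (k : ℕ) (c : ℝ) : ∃ B : ℝ, 0 ≤ B ∧ ∀ x v : E n,
    |fderiv ℝ (D.extWeight (2 * k + 2) 0 c) x v| ≤
      B * (D.ψ x ^ (2 * k + 1) * rad 0 (c - 1) x * Real.sqrt (1 + ‖x‖ ^ 2)) * ‖v‖ := by
  obtain ⟨K, c', hK1, -, hK⟩ := D.exists_bounds
  refine ⟨2 * |c| * K + (2 * k + 2) * K, by positivity, fun x v => ?_⟩
  by_cases hx : x ∈ D.Ω
  · obtain ⟨hφK, hgK, -, -⟩ := hK x hx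
    have hφ := D.φ_pos x hx
    obtain ⟨t, τ, ht, hτ, hte, r1, r0⟩ := rad_zero_data c x
    have hfd := fderiv_extWeight D (k := 2 * k + 1) (show 0 ≠ 1 by omega) c hx v
    rw [show 2 * k + 1 + 1 = 2 * k + 2 by ring] at hfd
    rw [hfd, r1, r0, D.ψ_of_mem hx, ← hte]
    rw [← hte] at hgK
    have hs0 : 0 ≤ Real.sqrt t := Real.sqrt_nonneg t
    have hss : Real.sqrt t * Real.sqrt t = t := Real.mul_self_sqrt (by linarith)
    obtain ⟨s, hs⟩ : ∃ s, s = Real.sqrt t := ⟨_, rfl⟩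
    rw [← hs] at hs0 hss ⊢
    have hxs : ‖x‖ ≤ s := abs_le_of_sq_le_sq' (by nlinarith) hs0 |>.2
    have hgs : s * ‖D.grad x‖ ≤ K :=
      abs_le_of_sq_le_sq' (by rw [mul_pow, sq s, hss]; exact hgK) (by linarith) |>.2
    have h1 : |⟪x, v⟫_ℝ| ≤ s * ‖v‖ := (abs_real_inner_le_norm x v).trans (by gcongr)
    have h2 : |fderiv ℝ D.φ x v| ≤ ‖D.grad x‖ * ‖v‖ := by
      rw [← D.inner_grad]; exact abs_real_inner_le_norm _ _
    simp only [Nat.cast_zero, zero_mul, zero_add]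
    refine (abs_add_le _ _).trans ?_
    have e1 : |D.φ x ^ (2 * k + 2) * (2 * (c * τ) * ⟪x, v⟫_ℝ)| ≤
        K * D.φ x ^ (2 * k + 1) * (2 * (|c| * τ) * (s * ‖v‖)) := by
      rw [abs_mul, abs_mul, abs_mul, abs_mul, abs_two, abs_of_pos hτ, abs_of_pos (by positivity),
        pow_succ' (D.φ x) (2 * k + 1)]
      gcongr
    have e2 : |t * τ * (((2 * k + 1 + 1 : ℕ) : ℝ) * D.φ x ^ (2 * k + 1)) * fderiv ℝ D.φ x v| ≤
        s * τ * ((2 * k + 2) * D.φ x ^ (2 * k + 1)) * (K * ‖v‖) := by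
      rw [abs_mul, abs_of_nonneg (by positivity)]
      calc t * τ * (((2 * k + 1 + 1 : ℕ) : ℝ) * D.φ x ^ (2 * k + 1)) * |fderiv ℝ D.φ x v| ≤
          t * τ * (((2 * k + 1 + 1 : ℕ) : ℝ) * D.φ x ^ (2 * k + 1)) * (‖D.grad x‖ * ‖v‖) := by
            gcongr
        _ = s * τ * ((2 * k + 2) * D.φ x ^ (2 * k + 1)) * ((s * ‖D.grad x‖) * ‖v‖) := by
            rw [← hss]; push_cast; ring
        _ ≤ _ := by gcongr
    refine (add_le_add e1 e2).trans (le_of_eq ?_)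
    ring
  · rw [fderiv_extWeight_of_notMem D (by omega) (by omega) c hx, D.ψ_of_notMem hx]
    simp

/-- When the null Lagrangian is integrated against the weight, the derivative of the weight pairs
`|DZ|` with `|Z|`. Half of the gradient absorbs this at the price of `|Z|² ψ^(2k)`, two powers of
`ψ` below the gradient term. This is exactly what the weighted `L²` estimate controls. -/
lemma gradient_pointwise {k : ℕ} {c B : ℝ} (hB0 : 0 ≤ B) (hB : ∀ x v : E n,
    |fderiv ℝ (D.extWeight (2 * k + 2) 0 c) x v| ≤
      B * (D.ψ x ^ (2 * k + 1) * rad 0 (c - 1) x * Real.sqrt (1 + ‖x‖ ^ 2)) * ‖v‖)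
    {Z : E n → E n} (hZ : ContDiff ℝ 2 Z) (x : E n) :
    1 / 2 * ((∑ i, ∑ j, pd i Z x j ^ 2) * rad 0 c x * D.ψ x ^ (2 * k + 2)) ≤
      (n ^ 2 * (symGrad Z x ^ 2 * rad 0 c x * D.ψ x ^ (2 * k + 2)) +
      1 / 2 * (B * (n + 1)) ^ 2 * (‖Z x‖ ^ 2 * rad 0 (c - 1) x * D.ψ x ^ (2 * k))) +
      dvg (fun x => D.extWeight (2 * k + 2) 0 c x • nullField Z x) x := by
  have hw := contDiff_extWeight D (k := 2 * k + 2) (by omega) (show 0 ≠ 1 by omega) c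
  rw [dvg_smul (hw.differentiable one_ne_zero x)
    ((contDiff_nullField hZ).differentiable one_ne_zero x), extWeight_eq D (by omega)]
  have hp := D.ψ_nonneg x
  obtain ⟨t, τ, ht, hτ, hte, r1, r0⟩ := rad_zero_data c x
  have hDw := hB x (nullField Z x)
  rw [r1, ← hte] at hDw
  rw [r0, r1]
  have hlow := neg_abs_le (fderiv ℝ (D.extWeight (2 * k + 2) 0 c) x (nullField Z x))
  have hal := gradient_algebra k (by linarith) hτ.le hp hB0 (norm_fderiv_sq_le Z x)
    (norm_nullField_le Z x) hDw
  have e4 := mul_le_mul_of_nonneg_left (sum_pd_sq_le hZ x)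
    (show 0 ≤ t * τ * D.ψ x ^ (2 * k + 2) by positivity)
  linarith

lemma weighted_gradient_le (hn : 2 ≤ n) (h1 : 0 < θ₁) (h12 : θ₁ < θ₂) (h2 : θ₂ < Real.pi) {k : ℕ}
    (hk : 1 ≤ k) {c : ℝ} (hc : c ≤ 1) (hcn : 0 < n + 2 * c - 2) :
    ∃ C : ℝ, 0 ≤ C ∧ ∀ Z : E n → E n, ContDiff ℝ 2 Z → HasCompactSupport Z →
    ∫ x, (∑ i, ∑ j, pd i Z x j ^ 2) * rad 0 c x * D.ψ x ^ (2 * k + 2) ≤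
      C * ∫ x, symGrad Z x ^ 2 * rad 0 c x * D.ψ x ^ (2 * k + 2) := by
  obtain ⟨C₁, hC₁, hA⟩ := weighted_norm_le D hn h1 h12 h2 hk hc hcn
  obtain ⟨B, hB0, hB⟩ := exists_norm_fderiv_extWeight_le D k c
  obtain ⟨B', hB'⟩ : ∃ B', B' = B * (n + 1) := ⟨_, rfl⟩
  refine ⟨2 * (n ^ 2 + 1 / 2 * B' ^ 2 * C₁), by positivity, fun Z hZ hZc => ?_⟩
  have hZ1 : ContDiff ℝ 1 Z := hZ.of_le (by norm_num)
  have hZd : Continuous (fderiv ℝ Z) := hZ1.continuous_fderiv one_ne_zero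
  have hψ := D.continuous_ψ
  have hr := continuous_rad (n := n) 0 c
  have iP : Integrable fun x => (∑ i, ∑ j, pd i Z x j ^ 2) * rad 0 c x * D.ψ x ^ (2 * k + 2) := by
    refine integrable_of_tsupport hZc (by unfold pd; fun_prop) fun x hx => ?_
    have : fderiv ℝ Z x = 0 := fderiv_of_notMem_tsupport ℝ hx
    simp [pd, this]
  have iS := integrable_weighted_symGrad D hZ1 hZc 0 c (2 * k + 2)
  have iN := integrable_weighted_norm D hZ1 hZc 0 (c - 1) (2 * k)
  have hw := contDiff_extWeight D (k := 2 * k + 2) (by omega) (show 0 ≠ 1 by omega) c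
  have iQ : Integrable (fun x => n ^ 2 * (symGrad Z x ^ 2 * rad 0 c x * D.ψ x ^ (2 * k + 2)) +
      1 / 2 * B' ^ 2 * (‖Z x‖ ^ 2 * rad 0 (c - 1) x * D.ψ x ^ (2 * k))) :=
    (iS.const_mul ((n : ℝ) ^ 2)).add (iN.const_mul (1 / 2 * B' ^ 2))
  have hF : ContDiff ℝ 1 (fun x => D.extWeight (2 * k + 2) 0 c x • nullField Z x) :=
    hw.smul (contDiff_nullField hZ)
  have hFc : HasCompactSupport (fun x => D.extWeight (2 * k + 2) 0 c x • nullField Z x) :=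
    (HasCompactSupport.nullField hZc).mono fun x hx h => hx (by simp only [h, smul_zero])
  have key := integral_le_of_le_add_dvg (iP.const_mul (1 / 2)) iQ hF hFc 
    (by rw [hB']; exact gradient_pointwise D hB0 hB hZ)
  rw [integral_const_mul, integral_add (iS.const_mul _) (iN.const_mul _), integral_const_mul,
    integral_const_mul] at key
  have h3 := mul_le_mul_of_nonneg_left (hA Z hZ1 hZc) (show 0 ≤ 1 / 2 * B' ^ 2 by positivity)
  linarith

/-- Weighted Korn inequality on the conical shell. -/
theorem weighted_korn (hn : 2 ≤ n) (h1 : 0 < θ₁) (h12 : θ₁ < θ₂) (h2 : θ₂ < Real.pi) {N : ℕ}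
    (hN : 2 ≤ N) {c : ℝ} (hc : c ≤ 1) (hcn : 0 < n + 2 * c - 2) :
    ∃ C : ℝ, 0 ≤ C ∧ ∀ Z : E n → E n, ContDiff ℝ 2 Z → HasCompactSupport Z →
    ∫ x, (‖Z x‖ ^ 2 * rad 0 (c - 1) x + ‖fderiv ℝ Z x‖ ^ 2 * rad 0 c x) * D.ψ x ^ (2 * N) ≤
      C * ∫ x, symGrad Z x ^ 2 * rad 0 c x * D.ψ x ^ (2 * N) := by
  -- The boundary estimate requires `k ≥ 1`, and the symmetric gradient carries the power `2k + 2`.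
  -- This is the origin of the condition `N ≥ 2`.
  obtain ⟨k, rfl⟩ : ∃ k, N = k + 1 := ⟨N - 1, by omega⟩
  have hk : 1 ≤ k := by omega
  obtain ⟨C₁, hC₁, hA⟩ := weighted_norm_le D hn h1 h12 h2 hk hc hcn
  obtain ⟨C₂, hC₂, hB⟩ := weighted_gradient_le D hn h1 h12 h2 hk hc hcn
  obtain ⟨K, _, hK1, -, hK⟩ := D.exists_bounds
  refine ⟨K ^ 2 * C₁ + C₂, by positivity, fun Z hZ hZc => ?_⟩
  rw [show 2 * (k + 1) = 2 * k + 2 by ring]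
  have hZ1 : ContDiff ℝ 1 Z := hZ.of_le (by norm_num)
  have hZ0 : Continuous Z := hZ.continuous
  have hZd : Continuous (fderiv ℝ Z) := hZ1.continuous_fderiv one_ne_zero
  have hψ := D.continuous_ψ
  have hr := continuous_rad (n := n) 0 c
  have hr' := continuous_rad (n := n) 0 (c - 1)
  have iP : Integrable fun x => (∑ i, ∑ j, pd i Z x j ^ 2) * rad 0 c x * D.ψ x ^ (2 * k + 2) := by
    refine integrable_of_tsupport hZc (by unfold pd; fun_prop) fun x hx => ?_
    have : fderiv ℝ Z x = 0 := fderiv_of_notMem_tsupport ℝ hx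
    simp [pd, this]
  have iL : Integrable fun x =>
      (‖Z x‖ ^ 2 * rad 0 (c - 1) x + ‖fderiv ℝ Z x‖ ^ 2 * rad 0 c x) * D.ψ x ^ (2 * k + 2) := by
    refine integrable_of_tsupport hZc (by fun_prop) fun x hx => ?_
    have : fderiv ℝ Z x = 0 := fderiv_of_notMem_tsupport ℝ hx
    simp [this, image_eq_zero_of_notMem_tsupport hx]
  have iN := (integrable_weighted_norm D hZ1 hZc 0 (c - 1) (2 * k)).const_mul (K ^ 2)
  have e1 : ∫ x, (‖Z x‖ ^ 2 * rad 0 (c - 1) x + ‖fderiv ℝ Z x‖ ^ 2 * rad 0 c x) *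
        D.ψ x ^ (2 * k + 2) ≤ (K ^ 2 * ∫ x, ‖Z x‖ ^ 2 * rad 0 (c - 1) x * D.ψ x ^ (2 * k)) +
        ∫ x, (∑ i, ∑ j, pd i Z x j ^ 2) * rad 0 c x * D.ψ x ^ (2 * k + 2) := by
    rw [← integral_const_mul, ← integral_add iN iP]
    refine integral_mono iL (iN.add iP) fun x => ?_
    beta_reduce
    have hr1 := rad_nonneg 0 (c - 1) x
    have hr0 := rad_nonneg 0 c x
    have hp := D.ψ_nonneg x
    have hpK : D.ψ x ≤ K := by
      by_cases hx : x ∈ D.Ω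
      · rw [D.ψ_of_mem hx]; exact (hK x hx).1
      · rw [D.ψ_of_notMem hx]; linarith
    have hfr := norm_fderiv_sq_le Z x
    calc _ = D.ψ x ^ 2 * (‖Z x‖ ^ 2 * rad 0 (c - 1) x * D.ψ x ^ (2 * k)) +
          ‖fderiv ℝ Z x‖ ^ 2 * rad 0 c x * D.ψ x ^ (2 * k + 2) := by ring
      _ ≤ _ := by gcongr
  have e4 := mul_le_mul_of_nonneg_left (hA Z hZ1 hZc) (sq_nonneg K)
  have e5 := hB Z hZ hZc
  linarith

end KornInequality

/-! ### Transfer to the given radial weight and to rotated shells -/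

section Rotation

variable {n : ℕ}

lemma exists_radialWeight_bounds {r : E n → ℝ} (hr : IsRadialWeight r) :
    ∃ m M : ℝ, 0 < m ∧ ∀ x, m * Real.sqrt (1 + ‖x‖ ^ 2) ≤ r x ∧
      r x ≤ M * Real.sqrt (1 + ‖x‖ ^ 2) := by
  obtain ⟨hc, hpos, hout⟩ := hr
  have hcont := hc.continuous
  obtain ⟨m, hm, hm'⟩ := (isCompact_closedBall (0 : E n) 1).exists_forall_le' (f := r) (a := 0)
    hcont.continuousOn (fun x _ => hpos x)
  obtain ⟨M, hM⟩ := (isCompact_closedBall (0 : E n) 1).exists_bound_of_continuousOn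
    hcont.continuousOn
  have h1 : ∀ x : E n, 1 ≤ Real.sqrt (1 + ‖x‖ ^ 2) := fun x =>
    Real.one_le_sqrt.2 (by nlinarith [sq_nonneg ‖x‖])
  refine ⟨min (m / 2) (1 / 2), max M 1, by positivity, fun x => ?_⟩
  rcases le_or_gt ‖x‖ 1 with hx | hx
  · have hxb : x ∈ Metric.closedBall (0 : E n) 1 := by simpa using hx
    have h2 : Real.sqrt (1 + ‖x‖ ^ 2) ≤ 2 :=
      Real.sqrt_le_iff.2 ⟨by norm_num, by nlinarith [norm_nonneg x]⟩
    constructor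
    · calc min (m / 2) (1 / 2) * Real.sqrt (1 + ‖x‖ ^ 2) ≤ m / 2 * 2 := by
            gcongr; exact min_le_left _ _
        _ = m := by ring
        _ ≤ r x := hm' x hxb
    · calc r x ≤ M := (le_abs_self _).trans (hM x hxb)
        _ ≤ max M 1 * 1 := by rw [mul_one]; exact le_max_left _ _
        _ ≤ _ := by gcongr; exact h1 x
  · rw [hout x hx.le]
    constructor
    · calc min (m / 2) (1 / 2) * Real.sqrt (1 + ‖x‖ ^ 2) ≤ 1 / 2 * (2 * ‖x‖) := by
            gcongr
            · exact min_le_right _ _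
            · exact Real.sqrt_le_iff.2 ⟨by positivity, by nlinarith⟩
        _ = ‖x‖ := by ring
    · calc ‖x‖ ≤ Real.sqrt (1 + ‖x‖ ^ 2) := Real.le_sqrt_of_sq_le (by linarith)
        _ ≤ max M 1 * Real.sqrt (1 + ‖x‖ ^ 2) :=
          le_mul_of_one_le_left (Real.sqrt_nonneg _) (le_max_right _ _)

/-- The function `r` need not be rotation invariant in the unit ball, whereas `1 + |x|²` is.
Comparing the two makes the constants independent of the isometry. Compactness of the range of the
quotient covers exponents of both signs. -/
lemma exists_rpow_bounds {r : E n → ℝ} (hr : IsRadialWeight r) (e : ℝ) :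
    ∃ M : ℝ, 0 < M ∧ ∀ x, r x ^ e ≤ M * rad 0 (e / 2) x ∧ rad 0 (e / 2) x ≤ M * r x ^ e := by
  obtain ⟨m, M, hm, h⟩ := exists_radialWeight_bounds hr
  obtain ⟨M₁, hM₁⟩ := (isCompact_Icc (a := m) (b := M)).exists_bound_of_continuousOn
    (f := fun q : ℝ => q ^ e) (fun q hq => (Real.continuousAt_rpow_const q e
      (Or.inl (hm.trans_le hq.1).ne')).continuousWithinAt)
  obtain ⟨M₂, hM₂⟩ := (isCompact_Icc (a := m) (b := M)).exists_bound_of_continuousOn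
    (f := fun q : ℝ => (q ^ e)⁻¹) (fun q hq => ((Real.continuousAt_rpow_const q e
      (Or.inl (hm.trans_le hq.1).ne')).inv₀
        (Real.rpow_pos_of_pos (hm.trans_le hq.1) e).ne').continuousWithinAt)
  refine ⟨max (max M₁ M₂) 1, by positivity, fun x => ?_⟩
  have ht := one_add_norm_sq_pos x
  have hs : 0 < Real.sqrt (1 + ‖x‖ ^ 2) := Real.sqrt_pos.2 ht
  have hrad : rad 0 (e / 2) x = Real.sqrt (1 + ‖x‖ ^ 2) ^ e := by
    rw [rad, pow_zero, one_mul, Real.sqrt_eq_rpow, ← Real.rpow_mul ht.le]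
    congr 1; ring
  obtain ⟨q, hq⟩ : ∃ q, q = r x / Real.sqrt (1 + ‖x‖ ^ 2) := ⟨_, rfl⟩
  have hrq : r x = q * Real.sqrt (1 + ‖x‖ ^ 2) := by rw [hq]; field_simp
  have hqI : q ∈ Set.Icc m M := by
    rw [hq]
    exact ⟨(le_div_iff₀ hs).2 (h x).1, (div_le_iff₀ hs).2 (h x).2⟩
  have hq0 : 0 < q := hm.trans_le hqI.1
  have hqe : 0 < q ^ e := Real.rpow_pos_of_pos hq0 e
  rw [hrad, hrq, Real.mul_rpow hq0.le hs.le]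
  have hse : 0 < Real.sqrt (1 + ‖x‖ ^ 2) ^ e := Real.rpow_pos_of_pos hs e
  have b1 := (le_abs_self _).trans (hM₁ q hqI)
  have b2 := (le_abs_self _).trans (hM₂ q hqI)
  have c1 : M₁ ≤ max (max M₁ M₂) 1 := (le_max_left _ _).trans (le_max_left _ _)
  have c2 : M₂ ≤ max (max M₁ M₂) 1 := (le_max_right _ _).trans (le_max_left _ _)
  constructor
  · gcongr
    exact b1.trans c1
  · calc Real.sqrt (1 + ‖x‖ ^ 2) ^ e = (q ^ e)⁻¹ * (q ^ e * Real.sqrt (1 + ‖x‖ ^ 2) ^ e) := by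
          field_simp
      _ ≤ _ := by
          gcongr
          exact b2.trans c2

/-- The vector field `Z` rotated back by the isometry `A`. -/
def rotate (A : E n ≃ₗᵢ[ℝ] E n) (Z : E n → E n) (y : E n) : E n := A.symm (Z (A y))

variable (A : E n ≃ₗᵢ[ℝ] E n) {Z : E n → E n}

lemma contDiff_rotate (hZ : ContDiff ℝ 2 Z) : ContDiff ℝ 2 (rotate A Z) :=
  A.symm.contDiff.comp (hZ.comp A.contDiff)

lemma hasCompactSupport_rotate (hZ : HasCompactSupport Z) : HasCompactSupport (rotate A Z) :=
  (hZ.comp_homeomorph A.toHomeomorph).comp_left (g := A.symm) (map_zero _)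

lemma norm_rotate (Z : E n → E n) (y : E n) : ‖rotate A Z y‖ = ‖Z (A y)‖ := by
  rw [rotate, LinearIsometryEquiv.norm_map]

lemma fderiv_rotate (hZ : Differentiable ℝ Z) (y : E n) : fderiv ℝ (rotate A Z) y =
    (A.symm : E n →L[ℝ] E n) ∘L fderiv ℝ Z (A y) ∘L (A : E n →L[ℝ] E n) := by
  have h1 : HasFDerivAt (fun y => Z (A y)) (fderiv ℝ Z (A y) ∘L (A : E n →L[ℝ] E n)) y :=
    (hZ (A y)).hasFDerivAt.comp y A.hasFDerivAt
  exact (A.symm.hasFDerivAt.comp y h1).fderiv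

/-- One inequality suffices: the other is the same inequality for the inverse isometry applied to
the conjugated map. -/
lemma norm_conj (L : E n →L[ℝ] E n) :
    ‖(A.symm : E n →L[ℝ] E n) ∘L L ∘L (A : E n →L[ℝ] E n)‖ = ‖L‖ := by
  have h : ∀ (B : E n ≃ₗᵢ[ℝ] E n) (L : E n →L[ℝ] E n),
      ‖(B.symm : E n →L[ℝ] E n) ∘L L ∘L (B : E n →L[ℝ] E n)‖ ≤ ‖L‖ := by
    intro B L
    refine ContinuousLinearMap.opNorm_le_bound _ (norm_nonneg _) fun v => ?_
    calc _ = ‖L (B v)‖ := by simp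
      _ ≤ ‖L‖ * ‖B v‖ := L.le_opNorm _
      _ = _ := by rw [LinearIsometryEquiv.norm_map]
  refine le_antisymm (h A L) ?_
  have h2 := h A.symm ((A.symm : E n →L[ℝ] E n) ∘L L ∘L (A : E n →L[ℝ] E n))
  calc ‖L‖ = _ := by
        congr 1
        ext1 v
        simp
    _ ≤ _ := h2

lemma norm_fderiv_rotate (hZ : Differentiable ℝ Z) (y : E n) :
    ‖fderiv ℝ (rotate A Z) y‖ = ‖fderiv ℝ Z (A y)‖ := by
  rw [fderiv_rotate A hZ, norm_conj]

lemma symGrad_rotate (hZ : Differentiable ℝ Z) (y : E n) :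
    symGrad (rotate A Z) y = symGrad Z (A y) := by
  have h : ContinuousLinearMap.adjoint
      ((A.symm : E n →L[ℝ] E n) ∘L fderiv ℝ Z (A y) ∘L (A : E n →L[ℝ] E n)) =
      (A.symm : E n →L[ℝ] E n) ∘L ContinuousLinearMap.adjoint (fderiv ℝ Z (A y)) ∘L
        (A : E n →L[ℝ] E n) := by
    symm
    rw [ContinuousLinearMap.eq_adjoint_iff]
    intro v w
    have e1 : ∀ u w : E n, ⟪A.symm u, w⟫_ℝ = ⟪u, A w⟫_ℝ := fun u w => by
      rw [← A.inner_map_map (A.symm u) w, A.apply_symm_apply]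
    have e2 : ∀ u w : E n, ⟪u, A.symm w⟫_ℝ = ⟪A u, w⟫_ℝ := fun u w => by
      rw [← A.inner_map_map u (A.symm w), A.apply_symm_apply]
    change ⟪A.symm (ContinuousLinearMap.adjoint (fderiv ℝ Z (A y)) (A v)), w⟫_ℝ =
      ⟪v, A.symm (fderiv ℝ Z (A y) (A w))⟫_ℝ
    rw [e1, e2, ContinuousLinearMap.adjoint_inner_left]
  rw [symGrad, symGrad, fderiv_rotate A hZ, h,
    ← norm_conj A (fderiv ℝ Z (A y) + ContinuousLinearMap.adjoint (fderiv ℝ Z (A y)))]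
  congr 1
  ext1 v
  simp

variable {θ₁ θ₂ : ℝ} (D : RegularizedCone n θ₁ θ₂)

lemma isOpen_region : IsOpen (D.region A) := D.isOpen.preimage A.symm.continuous

lemma lintegral_region (f : E n → ℝ≥0∞) :
    ∫⁻ x in D.region A, f x = ∫⁻ y in D.Ω, f (A y) := by
  have h := A.symm.measurePreserving.setLIntegral_comp_preimage_emb
    A.symm.toHomeomorph.measurableEmbedding (fun y => f (A y)) D.Ω
  simp only [A.apply_symm_apply] at h
  exact h

/-- The weighted Korn inequality on the rotated shells, with constants independent of the
rotation. -/
theorem korn_region (hn : 2 ≤ n) (h1 : 0 < θ₁) (h12 : θ₁ < θ₂) (h2 : θ₂ < Real.pi) {N : ℕ}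
    (hN : 2 ≤ N) {r : E n → ℝ} (hr : IsRadialWeight r) {b : ℝ} (hb : b ≤ 2)
    (hbn : 0 < n + b - 2) :
    ∃ C : ℝ, 0 ≤ C ∧ ∀ (A : E n ≃ₗᵢ[ℝ] E n) (Z : E n → E n), ContDiff ℝ 2 Z →
      HasCompactSupport Z →
    ∫⁻ x in D.region A, ENNReal.ofReal
        ((‖Z x‖ ^ 2 * r x ^ (b - 2) + ‖fderiv ℝ Z x‖ ^ 2 * r x ^ b) * D.weight A N x) ≤
      ENNReal.ofReal C * ∫⁻ x in D.region A, ENNReal.ofReal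
        (symGrad Z x ^ 2 * (r x ^ b * D.weight A N x)) := by
  -- The exponent is halved because the radial weights are powers of `1 + |x|²`, not of its square
  -- root.
  obtain ⟨C, hC, hK⟩ := weighted_korn D hn h1 h12 h2 hN (c := b / 2) (by linarith) (by linarith)
  obtain ⟨M₀, hM₀, hr₀⟩ := exists_rpow_bounds hr b
  obtain ⟨M₁, hM₁, hr₁⟩ := exists_rpow_bounds hr (b - 2)
  rw [show (b - 2) / 2 = b / 2 - 1 by ring] at hr₁
  refine ⟨max M₀ M₁ * (C * M₀), by positivity, fun A Z hZ hZc => ?_⟩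
  have hZ' := contDiff_rotate A hZ
  have hZ1 : ContDiff ℝ 1 (rotate A Z) := hZ'.of_le (by norm_num)
  have hZc' := hasCompactSupport_rotate A hZc
  have hZdiff : Differentiable ℝ Z := hZ.differentiable (by norm_num)
  have hψ := D.continuous_ψ
  have hc0 := continuous_rad (n := n) 0 (b / 2)
  have hc1 := continuous_rad (n := n) 0 (b / 2 - 1)
  have hZd : Continuous (fderiv ℝ (rotate A Z)) := hZ1.continuous_fderiv one_ne_zero
  have hZcont : Continuous (rotate A Z) := hZ1.continuous
  have iL : Integrable fun x => (‖rotate A Z x‖ ^ 2 * rad 0 (b / 2 - 1) x +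
      ‖fderiv ℝ (rotate A Z) x‖ ^ 2 * rad 0 (b / 2) x) * D.ψ x ^ (2 * N) := by
    refine integrable_of_tsupport hZc' (by fun_prop) fun x hx => ?_
    have : fderiv ℝ (rotate A Z) x = 0 := fderiv_of_notMem_tsupport ℝ hx
    simp [this, image_eq_zero_of_notMem_tsupport hx]
  have iS := integrable_weighted_symGrad D hZ1 hZc' 0 (b / 2) (2 * N)
  have key := hK (rotate A Z) hZ' hZc'
  rw [lintegral_region, lintegral_region]
  have e1 : ∫⁻ y in D.Ω, ENNReal.ofReal ((‖Z (A y)‖ ^ 2 * r (A y) ^ (b - 2) +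
      ‖fderiv ℝ Z (A y)‖ ^ 2 * r (A y) ^ b) * D.weight A N (A y)) ≤
      ENNReal.ofReal (max M₀ M₁) * ∫⁻ y, ENNReal.ofReal ((‖rotate A Z y‖ ^ 2 * rad 0 (b / 2 - 1) y +
      ‖fderiv ℝ (rotate A Z) y‖ ^ 2 * rad 0 (b / 2) y) * D.ψ y ^ (2 * N)) := by
    rw [← lintegral_const_mul' _ _ ENNReal.ofReal_ne_top]
    refine le_trans ?_ (setLIntegral_le_lintegral D.Ω _)
    refine setLIntegral_mono' D.isOpen.measurableSet fun y hy => ?_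
    rw [← ENNReal.ofReal_mul (by positivity)]
    refine ENNReal.ofReal_le_ofReal ?_
    have n0 := rad_nonneg 0 (b / 2) y
    have n1 := rad_nonneg 0 (b / 2 - 1) y
    have hφ := D.φ_pos y hy
    have hra : ∀ e, rad 0 e (A y) = rad 0 e y := fun e => by simp [rad]
    have b0 := (hr₀ (A y)).1
    have b1 := (hr₁ (A y)).1
    rw [hra] at b0 b1
    rw [norm_rotate, norm_fderiv_rotate A hZdiff, D.ψ_of_mem hy, RegularizedCone.weight,
      A.symm_apply_apply, ← mul_assoc]
    gcongr
    calc ‖Z (A y)‖ ^ 2 * r (A y) ^ (b - 2) + ‖fderiv ℝ Z (A y)‖ ^ 2 * r (A y) ^ b ≤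
        ‖Z (A y)‖ ^ 2 * (max M₀ M₁ * rad 0 (b / 2 - 1) y) +
          ‖fderiv ℝ Z (A y)‖ ^ 2 * (max M₀ M₁ * rad 0 (b / 2) y) := by
          gcongr
          · exact b1.trans (by gcongr; exact le_max_right _ _)
          · exact b0.trans (by gcongr; exact le_max_left _ _)
      _ = _ := by ring
  have e2 : ∫⁻ y, ENNReal.ofReal (symGrad (rotate A Z) y ^ 2 * rad 0 (b / 2) y *
      D.ψ y ^ (2 * N)) ≤ ENNReal.ofReal M₀ * ∫⁻ y in D.Ω, ENNReal.ofReal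
        (symGrad Z (A y) ^ 2 * (r (A y) ^ b * D.weight A N (A y))) := by
    rw [← lintegral_const_mul' _ _ ENNReal.ofReal_ne_top,
      ← lintegral_indicator D.isOpen.measurableSet]
    refine lintegral_mono fun y => ?_
    by_cases hy : y ∈ D.Ω
    · rw [Set.indicator_of_mem hy, ← ENNReal.ofReal_mul hM₀.le]
      refine ENNReal.ofReal_le_ofReal ?_
      have hφ := D.φ_pos y hy
      have hra : rad 0 (b / 2) (A y) = rad 0 (b / 2) y := by simp [rad]
      have b0 := (hr₀ (A y)).2
      rw [hra] at b0
      rw [symGrad_rotate A hZdiff, D.ψ_of_mem hy, RegularizedCone.weight, A.symm_apply_apply]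
      calc _ ≤ symGrad Z (A y) ^ 2 * (M₀ * r (A y) ^ b) * D.φ y ^ (2 * N) := by gcongr
        _ = _ := by ring
    · rw [Set.indicator_of_notMem hy, D.ψ_of_notMem hy, zero_pow (by omega), mul_zero,
        ENNReal.ofReal_zero]
  have e3 : ∫⁻ y, ENNReal.ofReal ((‖rotate A Z y‖ ^ 2 * rad 0 (b / 2 - 1) y +
      ‖fderiv ℝ (rotate A Z) y‖ ^ 2 * rad 0 (b / 2) y) * D.ψ y ^ (2 * N)) ≤
      ENNReal.ofReal C * ∫⁻ y, ENNReal.ofReal (symGrad (rotate A Z) y ^ 2 * rad 0 (b / 2) y *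
      D.ψ y ^ (2 * N)) := by
    have hψ0 := D.ψ_nonneg
    have n0 := rad_nonneg (n := n) 0 (b / 2)
    have n1 := rad_nonneg (n := n) 0 (b / 2 - 1)
    rw [← ofReal_integral_eq_lintegral_ofReal iL (Eventually.of_forall fun x => by
        have := n0 x; have := n1 x; have := hψ0 x; simp only [Pi.zero_apply]; positivity),
      ← ofReal_integral_eq_lintegral_ofReal iS (Eventually.of_forall fun x => by
        have := n0 x; have := hψ0 x; simp only [Pi.zero_apply]; positivity),
      ← ENNReal.ofReal_mul hC]
    exact ENNReal.ofReal_le_ofReal key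
  rw [ENNReal.ofReal_mul (by positivity), ENNReal.ofReal_mul hC, mul_assoc, mul_assoc]
  calc _ ≤ _ := e1
    _ ≤ _ := mul_le_mul_right (e3.trans (mul_le_mul_right e2 _)) _

end Rotation

/-! ### Multi-indices of order at most two -/

section MultiIndex

variable {n : ℕ} {F : Type*} [NormedAddCommGroup F] [NormedSpace ℝ F]

lemma foldr_pd_of_eq_zero {β : Fin n → ℕ} (f : E n → F) {l : List (Fin n)}
    (h : ∀ k ∈ l, β k = 0) : l.foldr (fun i h => (pd i)^[β i] h) f = f := by
  induction l with
  | nil => rfl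
  | cons a l ih =>
    rw [List.foldr_cons, h a (by simp), ih fun k hk => h k (by simp [hk])]
    rfl

lemma foldr_pd_of_mem {β : Fin n → ℕ} (f : E n → F) {i : Fin n} {l : List (Fin n)} (hl : l.Nodup)
    (hi : i ∈ l) (h : ∀ k ∈ l, k ≠ i → β k = 0) :
    l.foldr (fun i h => (pd i)^[β i] h) f = (pd i)^[β i] f := by
  induction l with
  | nil => simp at hi
  | cons a l ih =>
    rw [List.nodup_cons] at hl
    rw [List.foldr_cons]
    by_cases ha : a = i
    · subst ha
      rw [foldr_pd_of_eq_zero f fun k hk => h k (by simp [hk]) (by rintro rfl; exact hl.1 hk)]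
    · rw [h a (by simp) ha, ih hl.2 (by simpa [Ne.symm ha] using hi)
        fun k hk hne => h k (by simp [hk]) hne]
      rfl

lemma foldr_pd_of_mem_of_lt {β : Fin n → ℕ} (f : E n → F) {i j : Fin n} (hij : i < j)
    {l : List (Fin n)} (hl : l.Pairwise (· < ·)) (hi : i ∈ l) (hj : j ∈ l)
    (h : ∀ k ∈ l, k ≠ i → k ≠ j → β k = 0) :
    l.foldr (fun i h => (pd i)^[β i] h) f = (pd i)^[β i] ((pd j)^[β j] f) := by
  induction l with
  | nil => simp at hi
  | cons a l ih =>
    rw [List.pairwise_cons] at hl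
    rw [List.foldr_cons]
    by_cases ha : a = i
    · subst ha
      rw [foldr_pd_of_mem f (hl.2.imp fun h => h.ne) (by simpa [hij.ne'] using hj)
        fun k hk hne => h k (by simp [hk]) (hl.1 k hk).ne' hne]
    · have hi' : i ∈ l := by simpa [Ne.symm ha] using hi
      have haj : a ≠ j := by
        rintro rfl
        exact lt_asymm hij (hl.1 i hi')
      rw [h a (by simp) ha haj, ih hl.2 hi' (by simpa [Ne.symm haj] using hj)
        fun k hk hne => h k (by simp [hk]) hne]
      rfl

lemma mpd_zero (f : E n → F) : mpd 0 f = f := foldr_pd_of_eq_zero f fun _ _ => rfl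

lemma mpd_single (i : Fin n) (f : E n → F) : mpd (Pi.single i 1) f = pd i f := by
  rw [mpd, foldr_pd_of_mem f (List.nodup_finRange n) (List.mem_finRange i)
    fun k _ hk => Pi.single_eq_of_ne hk 1]
  simp

/-- The multi-index derivative composes partial derivatives in a fixed order, so for `i ≤ j` no
regularity is needed. The other order requires the symmetry of second derivatives. -/
lemma mpd_single_add_single {i j : Fin n} (hij : i ≤ j) (f : E n → F) :
    mpd (Pi.single i 1 + Pi.single j 1) f = pd i (pd j f) := by
  rcases hij.eq_or_lt with rfl | hlt
  · rw [mpd, foldr_pd_of_mem f (List.nodup_finRange n) (List.mem_finRange i)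
      fun k _ hk => by simp [hk]]
    simp
  · rw [mpd, foldr_pd_of_mem_of_lt f hlt (List.pairwise_lt_finRange n) (List.mem_finRange i)
      (List.mem_finRange j) fun k _ hk hk' => by simp [hk, hk']]
    simp [hlt.ne, hlt.ne']

lemma pd_pd_comm {f : E n → F} {x : E n} (hf : ContDiffAt ℝ 2 f x) (i j : Fin n) :
    pd i (pd j f) x = pd j (pd i f) x := by
  have hd : DifferentiableAt ℝ (fderiv ℝ f) x :=
    (hf.fderiv_right (m := 1) (by norm_num)).differentiableAt one_ne_zero
  have hs : IsSymmSndFDerivAt ℝ f x := hf.isSymmSndFDerivAt (by simp)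
  have h : ∀ i j : Fin n, pd i (pd j f) x =
      fderiv ℝ (fderiv ℝ f) x (EuclideanSpace.single i 1) (EuclideanSpace.single j 1) := by
    intro i j
    unfold pd
    rw [fderiv_clm_apply hd (by fun_prop)]
    simp
  rw [h, h, hs]

lemma mpd_single_add_single_of_contDiffAt {f : E n → F} {x : E n} (hf : ContDiffAt ℝ 2 f x)
    (i j : Fin n) : mpd (Pi.single i 1 + Pi.single j 1) f x = pd i (pd j f) x := by
  rcases le_total i j with h | h
  · rw [mpd_single_add_single h]
  · rw [add_comm, mpd_single_add_single h, pd_pd_comm hf]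

lemma contDiff_pd {f : E n → F} (hf : ContDiff ℝ ∞ f) (i : Fin n) : ContDiff ℝ ∞ (pd i f) := by
  have h : ContDiff ℝ ∞ (fderiv ℝ f) := hf.fderiv_right (by simp)
  exact h.clm_apply contDiff_const

lemma hasCompactSupport_pd {f : E n → F} (hf : HasCompactSupport f) (i : Fin n) :
    HasCompactSupport (pd i f) := hf.fderiv_apply ℝ _

lemma contDiff_mpd {f : E n → F} (hf : ContDiff ℝ ∞ f ∧ HasCompactSupport f) (β : Fin n → ℕ) :
    ContDiff ℝ ∞ (mpd β f) ∧ HasCompactSupport (mpd β f) := by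
  unfold mpd
  induction List.finRange n with
  | nil => exact hf
  | cons a l ih =>
    rw [List.foldr_cons]
    generalize β a = k
    induction k with
    | zero => exact ih
    | succ k ihk =>
      rw [Function.iterate_succ_apply']
      exact ⟨contDiff_pd ihk.1 a, hasCompactSupport_pd ihk.2 a⟩

lemma exists_eq_single {β : Fin n → ℕ} (h : ∑ i, β i = 1) : ∃ i, β = Pi.single i 1 := by
  obtain ⟨i, hi⟩ : ∃ i, β i ≠ 0 := by
    by_contra! hc
    simp [hc] at h
  refine ⟨i, ?_⟩
  rw [← Finset.add_sum_erase _ _ (Finset.mem_univ i)] at h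
  have h1 : β i = 1 := by omega
  have h2 : ∑ j ∈ Finset.univ.erase i, β j = 0 := by omega
  rw [Finset.sum_eq_zero_iff] at h2
  ext j
  by_cases hj : j = i
  · subst hj; simp [h1]
  · rw [Pi.single_eq_of_ne hj]
    exact h2 j (by simp [hj])

lemma exists_eq_single_add_single {β : Fin n → ℕ} (h : ∑ i, β i = 2) :
    ∃ i j, β = Pi.single i 1 + Pi.single j 1 := by
  obtain ⟨i, hi⟩ : ∃ i, β i ≠ 0 := by
    by_contra! hc
    simp [hc] at h
  have hle : Pi.single i 1 ≤ β := by
    intro j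
    by_cases hj : j = i
    · subst hj; simp; omega
    · simp [hj]
  obtain ⟨γ, rfl⟩ := exists_add_of_le hle
  have hγ : ∑ j, γ j = 1 := by
    simp only [Pi.add_apply, Finset.sum_add_distrib, Finset.sum_pi_single', Finset.mem_univ,
      if_true] at h
    have : ∑ x, (Pi.single i 1 : Fin n → ℕ) x = 1 := by simp
    omega
  obtain ⟨j, rfl⟩ := exists_eq_single hγ
  exact ⟨i, j, rfl⟩

lemma sum_piAntidiag_one_le (G : (Fin n → ℕ) → ℝ≥0∞) :
    ∑ β ∈ Finset.piAntidiag (Finset.univ : Finset (Fin n)) 1, G β ≤ ∑ i, G (Pi.single i 1) := by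
  have hsub : Finset.piAntidiag (Finset.univ : Finset (Fin n)) 1 ⊆
      Finset.univ.image fun i : Fin n => (Pi.single i 1 : Fin n → ℕ) := by
    intro β hβ
    rw [Finset.mem_piAntidiag] at hβ
    obtain ⟨i, rfl⟩ := exists_eq_single hβ.1
    exact Finset.mem_image_of_mem _ (Finset.mem_univ i)
  refine (Finset.sum_le_sum_of_subset hsub).trans ?_
  exact Finset.sum_image_le_of_nonneg (fun _ _ => zero_le)

/-- Only an inequality, since a mixed multi-index arises from two ordered pairs. -/
lemma sum_piAntidiag_two_le (G : (Fin n → ℕ) → ℝ≥0∞) :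
    ∑ β ∈ Finset.piAntidiag (Finset.univ : Finset (Fin n)) 2, G β ≤
      ∑ i, ∑ j, G (Pi.single i 1 + Pi.single j 1) := by
  have hsub : Finset.piAntidiag (Finset.univ : Finset (Fin n)) 2 ⊆
      Finset.univ.image fun q : Fin n × Fin n =>
        (Pi.single q.1 1 + Pi.single q.2 1 : Fin n → ℕ) := by
    intro β hβ
    rw [Finset.mem_piAntidiag] at hβ
    obtain ⟨i, j, rfl⟩ := exists_eq_single_add_single hβ.1
    exact Finset.mem_image_of_mem (fun q : Fin n × Fin n =>
        (Pi.single q.1 1 + Pi.single q.2 1 : Fin n → ℕ)) (Finset.mem_univ (i, j))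
  refine (Finset.sum_le_sum_of_subset hsub).trans ?_
  rw [← Fintype.sum_prod_type']
  exact Finset.sum_image_le_of_nonneg (fun _ _ => zero_le)

lemma le_sum_piAntidiag_one (G : (Fin n → ℕ) → ℝ≥0∞) (i : Fin n) :
    G (Pi.single i 1) ≤ ∑ β ∈ Finset.piAntidiag (Finset.univ : Finset (Fin n)) 1, G β :=
  Finset.single_le_sum (f := G) (fun _ _ => zero_le) (by simp [Finset.mem_piAntidiag])

lemma le_sum_piAntidiag_two (G : (Fin n → ℕ) → ℝ≥0∞) (i j : Fin n) :
    G (Pi.single i 1 + Pi.single j 1) ≤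
      ∑ β ∈ Finset.piAntidiag (Finset.univ : Finset (Fin n)) 2, G β :=
  Finset.single_le_sum (f := G) (fun _ _ => zero_le)
    (by simp [Finset.mem_piAntidiag, Finset.sum_add_distrib])

end MultiIndex

/-! ### Weighted square integrals and the density argument -/

section WeightedIntegrals

variable {n : ℕ} {F : Type*} [NormedAddCommGroup F]

/-- The square of the weighted `L²` norm with weight `r ^ e ρ`. -/
def normInt (r ρ : E n → ℝ) (Ω : Set (E n)) (e : ℝ) (f : E n → F) : ℝ≥0∞ :=
  ∫⁻ x in Ω, ‖f x‖ₑ ^ 2 * ENNReal.ofReal (r x ^ e * ρ x)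

/-- The square of the weighted `L²` norm of a two-tensor with weight `r ^ e ρ`. -/
def tensorInt (r ρ : E n → ℝ) (Ω : Set (E n)) (e : ℝ) (T : E n → Matrix (Fin n) (Fin n) ℝ) :
    ℝ≥0∞ :=
  ∫⁻ x in Ω, (∑ i, ∑ j, ‖T x i j‖ₑ ^ 2) * ENNReal.ofReal (r x ^ e * ρ x)

lemma enorm_add_sq_le {G : Type*} [SeminormedAddCommGroup G] (a b : G) :
    ‖a + b‖ₑ ^ 2 ≤ 2 * ‖a‖ₑ ^ 2 + 2 * ‖b‖ₑ ^ 2 := by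
  simp only [← ofReal_norm]
  rw [← ENNReal.ofReal_pow (norm_nonneg _), ← ENNReal.ofReal_pow (norm_nonneg _),
    ← ENNReal.ofReal_pow (norm_nonneg _), show (2 : ℝ≥0∞) = ENNReal.ofReal 2 by simp,
    ← ENNReal.ofReal_mul zero_le_two, ← ENNReal.ofReal_mul zero_le_two,
    ← ENNReal.ofReal_add (by positivity) (by positivity)]
  refine ENNReal.ofReal_le_ofReal ?_
  have h := norm_add_le a b
  calc ‖a + b‖ ^ 2 ≤ (‖a‖ + ‖b‖) ^ 2 := by gcongr
    _ ≤ _ := by linarith [sq_nonneg (‖a‖ - ‖b‖), sub_sq ‖a‖ ‖b‖, add_sq ‖a‖ ‖b‖]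

variable {r ρ : E n → ℝ} {Ω : Set (E n)}

lemma normInt_add_le {e : ℝ}
    (hw : AEMeasurable (fun x => ENNReal.ofReal (r x ^ e * ρ x)) (volume.restrict Ω))
    {f g : E n → F} (hf : AEStronglyMeasurable f (volume.restrict Ω)) :
    normInt r ρ Ω e (fun x => f x + g x) ≤ 2 * normInt r ρ Ω e f + 2 * normInt r ρ Ω e g := by
  unfold normInt
  have hm : AEMeasurable (fun x => 2 * (‖f x‖ₑ ^ 2 * ENNReal.ofReal (r x ^ e * ρ x)))
      (volume.restrict Ω) := ((hf.enorm.pow_const 2).mul hw).const_mul 2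
  rw [← lintegral_const_mul' _ _ (by simp), ← lintegral_const_mul' _ _ (by simp),
    ← lintegral_add_left' hm]
  refine lintegral_mono fun x => ?_
  calc _ ≤ (2 * ‖f x‖ₑ ^ 2 + 2 * ‖g x‖ₑ ^ 2) * ENNReal.ofReal (r x ^ e * ρ x) := by
        gcongr; exact enorm_add_sq_le _ _
    _ = _ := by ring

lemma tensorInt_add_le {e : ℝ}
    (hw : AEMeasurable (fun x => ENNReal.ofReal (r x ^ e * ρ x)) (volume.restrict Ω))
    {S T : E n → Matrix (Fin n) (Fin n) ℝ}
    (hS : ∀ i j, AEStronglyMeasurable (fun x => S x i j) (volume.restrict Ω)) :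
    tensorInt r ρ Ω e (fun x => S x + T x) ≤
      2 * tensorInt r ρ Ω e S + 2 * tensorInt r ρ Ω e T := by
  unfold tensorInt
  have hm : AEMeasurable (fun x => 2 * ((∑ i, ∑ j, ‖S x i j‖ₑ ^ 2) *
      ENNReal.ofReal (r x ^ e * ρ x))) (volume.restrict Ω) := by
    refine AEMeasurable.const_mul (AEMeasurable.mul ?_ hw) 2
    exact Finset.aemeasurable_fun_sum _ fun i _ => Finset.aemeasurable_fun_sum _ fun j _ =>
      (hS i j).enorm.pow_const 2
  rw [← lintegral_const_mul' _ _ (by simp), ← lintegral_const_mul' _ _ (by simp),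
    ← lintegral_add_left' hm]
  refine lintegral_mono fun x => ?_
  calc _ ≤ (∑ i, ∑ j, (2 * ‖S x i j‖ₑ ^ 2 + 2 * ‖T x i j‖ₑ ^ 2)) *
        ENNReal.ofReal (r x ^ e * ρ x) := by
        gcongr; exact enorm_add_sq_le _ _
    _ = _ := by simp only [Finset.sum_add_distrib, ← Finset.mul_sum]; ring

lemma sobolevNormSq_eq (k : ℕ) (q : ℝ) (J : (Fin n → ℕ) → E n → F) :
    sobolevNormSq k q r ρ Ω J = ∑ i ∈ Finset.range (k + 1),
      ∑ β ∈ Finset.piAntidiag (Finset.univ : Finset (Fin n)) i,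
        normInt r ρ Ω (-(n : ℝ) + 2 * ((i : ℝ) + q)) (J β) := rfl

lemma sobolevNormSq_add_le {k : ℕ} {q : ℝ}
    (hw : ∀ e : ℝ, AEMeasurable (fun x => ENNReal.ofReal (r x ^ e * ρ x)) (volume.restrict Ω))
    {J K : (Fin n → ℕ) → E n → F}
    (hJ : ∀ β : Fin n → ℕ, ∑ i, β i ≤ k → AEStronglyMeasurable (J β) (volume.restrict Ω)) :
    sobolevNormSq k q r ρ Ω (fun β x => J β x + K β x) ≤
      2 * sobolevNormSq k q r ρ Ω J + 2 * sobolevNormSq k q r ρ Ω K := by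
  simp only [sobolevNormSq_eq, Finset.mul_sum, ← Finset.sum_add_distrib]
  refine Finset.sum_le_sum fun i hi => Finset.sum_le_sum fun β hβ => ?_
  rw [Finset.mem_piAntidiag] at hβ
  rw [Finset.mem_range] at hi
  exact normInt_add_le (hw _) (hJ β (hβ.1.trans_le (by omega)))

lemma sobolevNormSq_neg (k : ℕ) (q : ℝ) (J : (Fin n → ℕ) → E n → F) :
    sobolevNormSq k q r ρ Ω (fun β x => -J β x) = sobolevNormSq k q r ρ Ω J := by
  simp [sobolevNormSq]

variable [NormedSpace ℝ F]

lemma aestronglyMeasurable_mpd {f : E n → F} (hf : ContDiff ℝ ∞ f ∧ HasCompactSupport f)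
    (β : Fin n → ℕ) : AEStronglyMeasurable (mpd β f) (volume.restrict Ω) :=
  (contDiff_mpd hf β).1.continuous.aestronglyMeasurable

/-- A coercivity estimate for smooth functions with bounded support extends to the weighted
Sobolev space. -/
lemma sobolevNormSq_le_of_smooth {k : ℕ} {q : ℝ}
    (hw : ∀ e : ℝ, AEMeasurable (fun x => ENNReal.ofReal (r x ^ e * ρ x)) (volume.restrict Ω))
    {T : ((Fin n → ℕ) → E n → F) → ℝ≥0∞} {C C' : ℝ≥0∞} (hC : C ≠ ⊤) (hC' : C' ≠ ⊤)
    (h1 : ∀ f : E n → F, ContDiff ℝ ∞ f ∧ HasCompactSupport f →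
      sobolevNormSq k q r ρ Ω (fun β => mpd β f) ≤ C * T (fun β => mpd β f))
    (h2 : ∀ J K : (Fin n → ℕ) → E n → F,
      (∀ β : Fin n → ℕ, ∑ i, β i ≤ k → AEStronglyMeasurable (J β) (volume.restrict Ω)) →
      T (fun β x => J β x + K β x) ≤ 2 * T J + 2 * T K)
    (h3 : ∀ J : (Fin n → ℕ) → E n → F,
      (∀ β : Fin n → ℕ, ∑ i, β i ≤ k → AEStronglyMeasurable (J β) (volume.restrict Ω)) →
      T J ≤ C' * sobolevNormSq k q r ρ Ω J)
    {J : (Fin n → ℕ) → E n → F} (hJ : MemSobolev k q r ρ Ω J) :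
    sobolevNormSq k q r ρ Ω J ≤ 4 * C * T J := by
  obtain ⟨hm, f, hf, hlim⟩ := hJ
  set δ : ℕ → ℝ≥0∞ := fun m => sobolevNormSq k q r ρ Ω (fun β x => mpd β (f m) x - J β x)
  -- The factor 4 comes from two uses of the square inequality `|a + b|² ≤ 2|a|² + 2|b|²`: from the
  -- smooth approximation to `J` in the norm, and back in the functional `T`. The approximation
  -- error disappears in the limit.
  have hbd : ∀ m, sobolevNormSq k q r ρ Ω J ≤ 4 * C * T J + (4 * C * C' + 2) * δ m := by
    intro m
    have a1 : sobolevNormSq k q r ρ Ω J ≤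
        2 * sobolevNormSq k q r ρ Ω (fun β => mpd β (f m)) + 2 * δ m := by
      have h := sobolevNormSq_add_le (q := q) (K := fun β x => -(mpd β (f m) x - J β x)) hw
        (fun β (_ : ∑ i, β i ≤ k) => aestronglyMeasurable_mpd (hf m) β)
      rw [sobolevNormSq_neg] at h
      simpa using h
    have a2 : T (fun β => mpd β (f m)) ≤ 2 * T J + 2 * (C' * δ m) := by
      have h := h2 J (fun β x => mpd β (f m) x - J β x) hm
      have h' := h3 (fun β x => mpd β (f m) x - J β x) fun β hβ =>
        (aestronglyMeasurable_mpd (hf m) β).sub (hm β hβ)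
      calc _ = T (fun β x => J β x + (mpd β (f m) x - J β x)) := by simp
        _ ≤ _ := h
        _ ≤ _ := by gcongr
    calc _ ≤ _ := a1
      _ ≤ 2 * (C * (2 * T J + 2 * (C' * δ m))) + 2 * δ m := by
          gcongr
          exact (h1 (f m) (hf m)).trans (by gcongr)
      _ = _ := by ring
  have hl : Tendsto (fun m => 4 * C * T J + (4 * C * C' + 2) * δ m) atTop
      (𝓝 (4 * C * T J + (4 * C * C' + 2) * 0)) := by
    refine tendsto_const_nhds.add (ENNReal.Tendsto.const_mul hlim (Or.inr ?_))
    finiteness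
  rw [mul_zero, add_zero] at hl
  exact ge_of_tendsto' hl hbd

end WeightedIntegrals

/-! ### Coercivity of the symmetrized gradient and of the Hessian -/

section Coercivity

variable {n : ℕ} {θ₁ θ₂ : ℝ} (D : RegularizedCone n θ₁ θ₂) {r : E n → ℝ}

lemma weight_pos {A : E n ≃ₗᵢ[ℝ] E n} {N : ℕ} {x : E n} (hx : x ∈ D.region A) :
    0 < D.weight A N x := pow_pos (D.φ_pos _ hx) _

lemma aemeasurable_weight (hr : IsRadialWeight r) (A : E n ≃ₗᵢ[ℝ] E n) (N : ℕ) (e : ℝ) :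
    AEMeasurable (fun x => ENNReal.ofReal (r x ^ e * D.weight A N x))
      (volume.restrict (D.region A)) := by
  refine AEMeasurable.ennreal_ofReal (ContinuousOn.aemeasurable ?_ (isOpen_region A D).measurableSet)
  have h1 : Continuous fun x => r x ^ e :=
    hr.1.continuous.rpow_const fun x => Or.inl (hr.2.1 x).ne'
  refine h1.continuousOn.mul (ContinuousOn.pow ?_ _)
  intro x hx
  exact (((D.contDiffAt_φ (subset_closure hx)).continuousAt).comp
    A.symm.continuous.continuousAt).continuousWithinAt

lemma enorm_sq_mul_ofReal {F : Type*} [NormedAddCommGroup F] (v : F) {w : ℝ} :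
    ‖v‖ₑ ^ 2 * ENNReal.ofReal w = ENNReal.ofReal (‖v‖ ^ 2 * w) := by
  rw [ENNReal.ofReal_mul (by positivity), ← ofReal_norm, ENNReal.ofReal_pow (norm_nonneg _)]

lemma sum_enorm_sq_mul_ofReal (T : Matrix (Fin n) (Fin n) ℝ) {w : ℝ} :
    (∑ i, ∑ j, ‖T i j‖ₑ ^ 2) * ENNReal.ofReal w =
      ENNReal.ofReal ((∑ i, ∑ j, T i j ^ 2) * w) := by
  rw [ENNReal.ofReal_mul (by positivity), ENNReal.ofReal_sum_of_nonneg fun _ _ => by positivity]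
  congr 1
  refine Finset.sum_congr rfl fun i _ => ?_
  rw [ENNReal.ofReal_sum_of_nonneg fun _ _ => by positivity]
  refine Finset.sum_congr rfl fun j _ => ?_
  rw [← ofReal_norm, ← ENNReal.ofReal_pow (norm_nonneg _), Real.norm_eq_abs, sq_abs]

lemma normInt_lt_top (hr : IsRadialWeight r) (A : E n ≃ₗᵢ[ℝ] E n) (N : ℕ) (e : ℝ)
    {F : Type*} [NormedAddCommGroup F] {f : E n → F} (hf : Continuous f)
    (hfc : HasCompactSupport f) : normInt r (D.weight A N) (D.region A) e f < ⊤ := by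
  obtain ⟨K, _, hK1, -, hK⟩ := D.exists_bounds
  have h1 : Continuous fun x => r x ^ e :=
    hr.1.continuous.rpow_const fun x => Or.inl (hr.2.1 x).ne'
  have hi : Integrable fun x => ‖f x‖ ^ 2 * (r x ^ e * K ^ (2 * N)) := by
    refine Continuous.integrable_of_hasCompactSupport (by fun_prop) (hfc.mono fun x hx h => hx ?_)
    simp [h]
  refine lt_of_le_of_lt ?_ hi.lintegral_lt_top
  refine le_trans ?_ (setLIntegral_le_lintegral (D.region A) _)
  refine setLIntegral_mono' (isOpen_region A D).measurableSet fun x hx => ?_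
  rw [enorm_sq_mul_ofReal]
  refine ENNReal.ofReal_le_ofReal ?_
  have h2 : 0 ≤ r x ^ e := Real.rpow_nonneg (hr.2.1 x).le _
  have h3 : D.weight A N x ≤ K ^ (2 * N) :=
    pow_le_pow_left₀ (D.φ_pos _ hx).le (hK _ hx).1 _
  gcongr

/-- Finiteness is needed to subtract the perturbation term at the end. The angular weight is bounded
on the shell, so smooth functions of bounded support have finite norm. -/
lemma sobolevNormSq_lt_top (hr : IsRadialWeight r) (A : E n ≃ₗᵢ[ℝ] E n) {N k : ℕ} {q : ℝ}
    {F : Type*} [NormedAddCommGroup F] [NormedSpace ℝ F] {J : (Fin n → ℕ) → E n → F}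
    (hJ : MemSobolev k q r (D.weight A N) (D.region A) J) :
    sobolevNormSq k q r (D.weight A N) (D.region A) J < ⊤ := by
  obtain ⟨hm, f, hf, hlim⟩ := hJ
  obtain ⟨m, hm'⟩ := (hlim.eventually_lt_const ENNReal.zero_lt_top).exists
  have a1 := sobolevNormSq_add_le (r := r) (ρ := D.weight A N) (q := q)
    (K := fun β x => -(mpd β (f m) x - J β x)) (aemeasurable_weight D hr A N)
    (fun β (_ : ∑ i, β i ≤ k) => aestronglyMeasurable_mpd (Ω := D.region A) (hf m) β)
  rw [sobolevNormSq_neg] at a1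
  simp only [neg_sub, add_sub_cancel] at a1
  refine a1.trans_lt ?_
  have h2 : sobolevNormSq k q r (D.weight A N) (D.region A) (fun β => mpd β (f m)) < ⊤ := by
    rw [sobolevNormSq_eq]
    exact ENNReal.sum_lt_top.2 fun i _ => ENNReal.sum_lt_top.2 fun β _ =>
      normInt_lt_top D hr A N _ (contDiff_mpd (hf m) β).1.continuous (contDiff_mpd (hf m) β).2
  exact ENNReal.add_lt_top.2 ⟨ENNReal.mul_lt_top (by simp) h2, ENNReal.mul_lt_top (by simp) hm'⟩

/-- The symmetrized gradient of a vector field given with its derivatives. -/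
def symDeriv (W : (Fin n → ℕ) → E n → E n) (x : E n) : Matrix (Fin n) (Fin n) ℝ :=
  fun i j => W (Pi.single i 1) x j + W (Pi.single j 1) x i

/-- The matrix of second derivatives of a function given with its derivatives. -/
def flatHessian (J : (Fin n → ℕ) → E n → ℝ) (x : E n) : Matrix (Fin n) (Fin n) ℝ :=
  fun i j => J (Pi.single i 1 + Pi.single j 1) x

lemma norm_pd_le {F : Type*} [NormedAddCommGroup F] [NormedSpace ℝ F] (i : Fin n) (f : E n → F)
    (x : E n) : ‖pd i f x‖ ≤ ‖fderiv ℝ f x‖ := by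
  refine ((fderiv ℝ f x).le_opNorm _).trans ?_
  simp

variable {N : ℕ} {b q : ℝ}

lemma sobolevNormSq_one_le {F : Type*} [NormedAddCommGroup F] [NormedSpace ℝ F] {ρ : E n → ℝ}
    {Ω : Set (E n)} (hq : -(n : ℝ) + 2 * q = b - 2) (J : (Fin n → ℕ) → E n → F) :
    sobolevNormSq 1 q r ρ Ω J ≤
      normInt r ρ Ω (b - 2) (J 0) + ∑ i, normInt r ρ Ω b (J (Pi.single i 1)) := by
  rw [sobolevNormSq_eq, Finset.sum_range_succ, Finset.sum_range_one, Finset.piAntidiag_zero,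
    Finset.sum_singleton]
  gcongr
  · refine le_of_eq ?_
    congr 1
    push_cast; linarith
  · refine (sum_piAntidiag_one_le _).trans (le_of_eq ?_)
    refine Finset.sum_congr rfl fun i _ => ?_
    congr 1
    push_cast; linarith

lemma sobolevNormSq_two_le {F : Type*} [NormedAddCommGroup F] [NormedSpace ℝ F] {ρ : E n → ℝ}
    {Ω : Set (E n)} (hq : -(n : ℝ) + 2 * q = b - 2) (J : (Fin n → ℕ) → E n → F) :
    sobolevNormSq 2 q r ρ Ω J ≤
      normInt r ρ Ω (b - 2) (J 0) + (∑ i, normInt r ρ Ω b (J (Pi.single i 1))) +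
        ∑ i, ∑ j, normInt r ρ Ω (b + 2) (J (Pi.single i 1 + Pi.single j 1)) := by
  rw [sobolevNormSq_eq, Finset.sum_range_succ, ← sobolevNormSq_eq]
  gcongr
  · exact sobolevNormSq_one_le hq J
  · refine (sum_piAntidiag_two_le _).trans (le_of_eq ?_)
    refine Finset.sum_congr rfl fun i _ => Finset.sum_congr rfl fun j _ => ?_
    congr 1
    push_cast; linarith

lemma le_sobolevNormSq_zero {F : Type*} [NormedAddCommGroup F] [NormedSpace ℝ F] {ρ : E n → ℝ}
    {Ω : Set (E n)} (hq : -(n : ℝ) + 2 * q = b - 2) (k : ℕ) (J : (Fin n → ℕ) → E n → F) :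
    normInt r ρ Ω (b - 2) (J 0) ≤ sobolevNormSq k q r ρ Ω J := by
  rw [sobolevNormSq_eq]
  refine le_trans (le_of_eq ?_) (Finset.single_le_sum (f := fun i : ℕ =>
    ∑ β ∈ Finset.piAntidiag (Finset.univ : Finset (Fin n)) i,
        normInt r ρ Ω (-(n : ℝ) + 2 * ((i : ℝ) + q)) (J β)) (fun _ _ => zero_le)
          (Finset.mem_range.2 (Nat.succ_pos k)))
  rw [Finset.piAntidiag_zero, Finset.sum_singleton]
  congr 1
  push_cast; linarith

lemma le_sobolevNormSq_single {F : Type*} [NormedAddCommGroup F] [NormedSpace ℝ F] {ρ : E n → ℝ}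
    {Ω : Set (E n)} (hq : -(n : ℝ) + 2 * q = b - 2) {k : ℕ} (hk : 1 ≤ k)
    (J : (Fin n → ℕ) → E n → F) (i : Fin n) :
    normInt r ρ Ω b (J (Pi.single i 1)) ≤ sobolevNormSq k q r ρ Ω J := by
  rw [sobolevNormSq_eq]
  refine le_trans (le_trans (le_of_eq ?_) (le_sum_piAntidiag_one (fun β => normInt r ρ Ω
    (-(n : ℝ) + 2 * (((1 : ℕ) : ℝ) + q)) (J β)) i)) (Finset.single_le_sum (f := fun i : ℕ =>
    ∑ β ∈ Finset.piAntidiag (Finset.univ : Finset (Fin n)) i,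
        normInt r ρ Ω (-(n : ℝ) + 2 * ((i : ℝ) + q)) (J β)) (fun _ _ => zero_le)
          (Finset.mem_range.2 (show 1 < k + 1 by omega)))
  congr 1
  push_cast; linarith

lemma le_sobolevNormSq_single_add {F : Type*} [NormedAddCommGroup F] [NormedSpace ℝ F]
    {ρ : E n → ℝ} {Ω : Set (E n)} (hq : -(n : ℝ) + 2 * q = b - 2) (J : (Fin n → ℕ) → E n → F)
    (i j : Fin n) :
    normInt r ρ Ω (b + 2) (J (Pi.single i 1 + Pi.single j 1)) ≤ sobolevNormSq 2 q r ρ Ω J := by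
  rw [sobolevNormSq_eq]
  refine le_trans (le_trans (le_of_eq ?_) (le_sum_piAntidiag_two (fun β => normInt r ρ Ω
    (-(n : ℝ) + 2 * (((2 : ℕ) : ℝ) + q)) (J β)) i j)) (Finset.single_le_sum (f := fun i : ℕ =>
    ∑ β ∈ Finset.piAntidiag (Finset.univ : Finset (Fin n)) i,
        normInt r ρ Ω (-(n : ℝ) + 2 * ((i : ℝ) + q)) (J β)) (fun _ _ => zero_le)
          (Finset.mem_range.2 (show 2 < 2 + 1 by omega)))
  congr 1
  push_cast; linarith

lemma tensorInt_eq_sum {ρ : E n → ℝ} {Ω : Set (E n)} {e : ℝ}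
    (hw : AEMeasurable (fun x => ENNReal.ofReal (r x ^ e * ρ x)) (volume.restrict Ω))
    {T : E n → Matrix (Fin n) (Fin n) ℝ}
    (hT : ∀ i j, AEStronglyMeasurable (fun x => T x i j) (volume.restrict Ω)) :
    tensorInt r ρ Ω e T = ∑ i, ∑ j, normInt r ρ Ω e (fun x => T x i j) := by
  unfold tensorInt normInt
  simp only [Finset.sum_mul]
  have hm : ∀ i j, AEMeasurable (fun x => ‖T x i j‖ₑ ^ 2 * ENNReal.ofReal (r x ^ e * ρ x))
      (volume.restrict Ω) := fun i j => ((hT i j).enorm.pow_const 2).mul hw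
  rw [lintegral_finsetSum' _ fun i _ => Finset.aemeasurable_fun_sum _ fun j _ => hm i j]
  exact Finset.sum_congr rfl fun i _ => lintegral_finsetSum' _ fun j _ => hm i j

lemma vector_estimate_of_korn (hr : IsRadialWeight r) (hq : -(n : ℝ) + 2 * q = b - 2)
    (A : E n ≃ₗᵢ[ℝ] E n) {C : ℝ} {f : E n → E n}
    (hK : ∫⁻ x in D.region A, ENNReal.ofReal
        ((‖f x‖ ^ 2 * r x ^ (b - 2) + ‖fderiv ℝ f x‖ ^ 2 * r x ^ b) * D.weight A N x) ≤
      ENNReal.ofReal C * ∫⁻ x in D.region A, ENNReal.ofReal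
        (symGrad f x ^ 2 * (r x ^ b * D.weight A N x))) :
    sobolevNormSq 1 q r (D.weight A N) (D.region A) (fun β => mpd β f) ≤
      (n + 1) * ENNReal.ofReal C *
        tensorInt r (D.weight A N) (D.region A) b (symDeriv fun β => mpd β f) := by
  obtain ⟨I, hI⟩ : ∃ I, I = ∫⁻ x in D.region A, ENNReal.ofReal
      ((‖f x‖ ^ 2 * r x ^ (b - 2) + ‖fderiv ℝ f x‖ ^ 2 * r x ^ b) * D.weight A N x) := ⟨_, rfl⟩
  have e0 : normInt r (D.weight A N) (D.region A) (b - 2) (mpd 0 f) ≤ I := by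
    rw [hI, mpd_zero]
    refine setLIntegral_mono' (isOpen_region A D).measurableSet fun x hx => ?_
    rw [enorm_sq_mul_ofReal, ← mul_assoc]
    refine ENNReal.ofReal_le_ofReal (mul_le_mul_of_nonneg_right ?_ (weight_pos D hx).le)
    have := Real.rpow_nonneg (hr.2.1 x).le b
    exact le_add_of_nonneg_right (by positivity)
  have ei : ∀ i : Fin n,
      normInt r (D.weight A N) (D.region A) b (mpd (Pi.single i 1) f) ≤ I := by
    intro i
    rw [hI, mpd_single]
    refine setLIntegral_mono' (isOpen_region A D).measurableSet fun x hx => ?_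
    rw [enorm_sq_mul_ofReal, ← mul_assoc]
    refine ENNReal.ofReal_le_ofReal (mul_le_mul_of_nonneg_right ?_ (weight_pos D hx).le)
    have h3 := Real.rpow_nonneg (hr.2.1 x).le b
    have h4 := Real.rpow_nonneg (hr.2.1 x).le (b - 2)
    have h5 := norm_pd_le i f x
    calc ‖pd i f x‖ ^ 2 * r x ^ b ≤ ‖fderiv ℝ f x‖ ^ 2 * r x ^ b := by gcongr
      _ ≤ _ := le_add_of_nonneg_left (by positivity)
  have eS : ∫⁻ x in D.region A, ENNReal.ofReal
      (symGrad f x ^ 2 * (r x ^ b * D.weight A N x)) ≤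
      tensorInt r (D.weight A N) (D.region A) b (symDeriv fun β => mpd β f) := by
    refine setLIntegral_mono' (isOpen_region A D).measurableSet fun x hx => ?_
    rw [sum_enorm_sq_mul_ofReal]
    refine ENNReal.ofReal_le_ofReal ?_
    have h3 := Real.rpow_nonneg (hr.2.1 x).le b
    have h4 := (weight_pos D (N := N) hx).le
    have h5 := symGrad_sq_le f x
    simp only [symDeriv, mpd_single]
    gcongr
  calc sobolevNormSq 1 q r (D.weight A N) (D.region A) (fun β => mpd β f) ≤ _ :=
        sobolevNormSq_one_le hq _
    _ ≤ I + ∑ i : Fin n, I := add_le_add e0 (Finset.sum_le_sum fun i _ => ei i)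
    _ = (n + 1) * I := by simp; ring
    _ ≤ (n + 1) * (ENNReal.ofReal C *
        tensorInt r (D.weight A N) (D.region A) b (symDeriv fun β => mpd β f)) := by
      gcongr
      rw [hI]
      exact hK.trans (mul_le_mul_right eS _)
    _ = _ := by ring

/-- Coercivity of the symmetrized gradient on the weighted Sobolev space of vector fields. -/
theorem exists_vector_estimate (hn : 2 ≤ n) (h1 : 0 < θ₁) (h12 : θ₁ < θ₂) (h2 : θ₂ < Real.pi)
    (hN : 2 ≤ N) (hr : IsRadialWeight r) (hb : b ≤ 2) (hbn : 0 < n + b - 2)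
    (hq : -(n : ℝ) + 2 * q = b - 2) :
    ∃ C : ℝ≥0∞, C ≠ ⊤ ∧ ∀ (A : E n ≃ₗᵢ[ℝ] E n) (W : (Fin n → ℕ) → E n → E n),
      MemSobolev 1 q r (D.weight A N) (D.region A) W →
      sobolevNormSq 1 q r (D.weight A N) (D.region A) W ≤
        C * tensorInt r (D.weight A N) (D.region A) b (symDeriv W) := by
  obtain ⟨C, hC, hK⟩ := korn_region D hn h1 h12 h2 hN hr hb hbn
  refine ⟨4 * ((n + 1) * ENNReal.ofReal C), by finiteness, fun A W hW => ?_⟩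
  have hw := aemeasurable_weight D hr A N
  have hmeas : ∀ J : (Fin n → ℕ) → E n → E n, (∀ β : Fin n → ℕ, ∑ i, β i ≤ 1 →
      AEStronglyMeasurable (J β) (volume.restrict (D.region A))) → ∀ i j : Fin n,
      AEStronglyMeasurable (fun x => J (Pi.single i 1) x j) (volume.restrict (D.region A)) :=
    fun J hJ i j => (EuclideanSpace.proj j : E n →L[ℝ] ℝ).continuous.comp_aestronglyMeasurable
      (hJ _ (by simp))
  refine sobolevNormSq_le_of_smooth (T := fun J => tensorInt r (D.weight A N) (D.region A) b
    (symDeriv J)) hw (C' := ∑ i : Fin n, ∑ j : Fin n, 4) (by finiteness) (by simp; finiteness)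
    ?_ ?_ ?_ hW
  · intro f hf
    have hf2 : ContDiff ℝ 2 f := contDiff_infty.1 hf.1 2
    exact vector_estimate_of_korn D hr hq A (hK A f hf2 hf.2)
  · intro J K hJ
    have h := tensorInt_add_le (S := symDeriv J) (T := symDeriv K) (hw b)
      fun i j => (hmeas J hJ i j).add (hmeas J hJ j i)
    refine le_trans (le_of_eq ?_) h
    congr 1
    ext x i j
    simp only [symDeriv, PiLp.add_apply, Matrix.add_apply]
    ring
  · intro J hJ
    rw [tensorInt_eq_sum (T := symDeriv J) (hw b) fun i j => (hmeas J hJ i j).add (hmeas J hJ j i)]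
    simp only [Finset.sum_mul]
    refine Finset.sum_le_sum fun i _ => Finset.sum_le_sum fun j _ => ?_
    have hcomp : ∀ i j : Fin n, normInt r (D.weight A N) (D.region A) b
        (fun x => J (Pi.single i 1) x j) ≤ sobolevNormSq 1 q r (D.weight A N) (D.region A) J := by
      intro i j
      refine le_trans (lintegral_mono fun x => ?_) (le_sobolevNormSq_single hq le_rfl J i)
      gcongr
      exact enorm_le_iff_norm_le.2 (PiLp.norm_apply_le _ _)
    calc _ ≤ _ := normInt_add_le (hw b) (hmeas J hJ i j)
      _ ≤ 2 * _ + 2 * _ := add_le_add (mul_le_mul_right (hcomp i j) 2)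
        (mul_le_mul_right (hcomp j i) 2)
      _ = _ := by ring

/-- The gradient of a function as a vector field. -/
def gradField (f : E n → ℝ) (x : E n) : E n := WithLp.toLp 2 fun i => pd i f x

lemma contDiff_gradField {f : E n → ℝ} (hf : ContDiff ℝ ∞ f) : ContDiff ℝ ∞ (gradField f) :=
  (contDiff_euclidean (n := ∞) (f := gradField f)).2 fun i => contDiff_pd hf i

lemma hasCompactSupport_gradField {f : E n → ℝ} (hf : HasCompactSupport f) :
    HasCompactSupport (gradField f) := by
  refine (hf.fderiv ℝ).mono fun x hx h => hx ?_
  ext i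
  simp [gradField, pd, h]

lemma pd_gradField {f : E n → ℝ} (hf : ContDiff ℝ ∞ f) (i j : Fin n) (x : E n) :
    pd i (gradField f) x j = pd i (pd j f) x := by
  have h := ((EuclideanSpace.proj j : E n →L[ℝ] ℝ).hasFDerivAt.comp x
    (((contDiff_gradField hf).differentiable (by simp)) x).hasFDerivAt).fderiv
  have h' : (⇑(EuclideanSpace.proj j : E n →L[ℝ] ℝ) ∘ gradField f) = pd j f := rfl
  rw [h'] at h
  rw [pd, pd, h]
  rfl

lemma norm_gradField_sq (f : E n → ℝ) (x : E n) : ‖gradField f x‖ ^ 2 = ∑ i, pd i f x ^ 2 := by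
  rw [EuclideanSpace.norm_sq_eq]
  simp [gradField]

/-- This turns the Korn inequality for fields of fixed direction into a weighted Hardy inequality
for functions. -/
lemma symGrad_smul_const_le {f : E n → ℝ} (hf : Differentiable ℝ f) {v : E n} (hv : ‖v‖ = 1)
    (x : E n) : symGrad (fun y => f y • v) x ^ 2 ≤ 4 * ∑ i, pd i f x ^ 2 := by
  have h1 : fderiv ℝ (fun y => f y • v) x = (fderiv ℝ f x).smulRight v :=
    (fderiv_smul_const (hf x) v)
  have h2 : ‖fderiv ℝ f x‖ ^ 2 ≤ ∑ i, pd i f x ^ 2 := by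
    have h3 : ‖fderiv ℝ f x‖ ≤ ‖gradField f x‖ := by
      refine ContinuousLinearMap.opNorm_le_bound _ (norm_nonneg _) fun w => ?_
      have h4 : fderiv ℝ f x w = ⟪gradField f x, w⟫_ℝ := by
        rw [← clm_sum_coord (fderiv ℝ f x) w, PiLp.inner_apply]
        simp [gradField, pd]
      rw [h4]
      exact norm_inner_le_norm _ _
    rw [← norm_gradField_sq]
    gcongr
  have h5 : symGrad (fun y => f y • v) x ≤ 2 * ‖fderiv ℝ f x‖ := by
    rw [symGrad, h1]
    refine (norm_add_le _ _).trans ?_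
    rw [LinearIsometryEquiv.norm_map, ContinuousLinearMap.norm_smulRight_apply, hv]
    linarith
  calc symGrad (fun y => f y • v) x ^ 2 ≤ (2 * ‖fderiv ℝ f x‖) ^ 2 := by
        gcongr; exact symGrad_nonneg _ _
    _ = 4 * ‖fderiv ℝ f x‖ ^ 2 := by ring
    _ ≤ _ := by gcongr

lemma symGrad_gradField_le {f : E n → ℝ} (hf : ContDiff ℝ ∞ f) (x : E n) :
    symGrad (gradField f) x ^ 2 ≤ 4 * ∑ i, ∑ j, pd i (pd j f) x ^ 2 := by
  refine (symGrad_sq_le _ _).trans ?_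
  have hc : ContDiffAt ℝ 2 f x := (contDiff_infty.1 hf 2).contDiffAt
  rw [Finset.mul_sum]
  refine Finset.sum_le_sum fun i _ => ?_
  rw [Finset.mul_sum]
  refine Finset.sum_le_sum fun j _ => ?_
  rw [pd_gradField hf, pd_gradField hf, pd_pd_comm hc j i]
  linarith [sq_nonneg (pd i (pd j f) x)]

/-- The estimate climbs in two steps: Korn for `f v` bounds `f` by `∇f`, and Korn for `∇f`, whose
symmetric gradient is twice the Hessian, bounds `∇f` and its derivatives by `Hess f`. -/
lemma scalar_estimate_of_korn (hr : IsRadialWeight r) (hq : -(n : ℝ) + 2 * q = b - 2)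
    (A : E n ≃ₗᵢ[ℝ] E n) {C C' : ℝ} {f : E n → ℝ} (hf : ContDiff ℝ ∞ f) {v : E n} (hv : ‖v‖ = 1)
    (hK : ∫⁻ x in D.region A, ENNReal.ofReal
        ((‖f x • v‖ ^ 2 * r x ^ (b - 2) + ‖fderiv ℝ (fun y => f y • v) x‖ ^ 2 * r x ^ b) *
          D.weight A N x) ≤
      ENNReal.ofReal C * ∫⁻ x in D.region A, ENNReal.ofReal
        (symGrad (fun y => f y • v) x ^ 2 * (r x ^ b * D.weight A N x)))
    (hK' : ∫⁻ x in D.region A, ENNReal.ofReal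
        ((‖gradField f x‖ ^ 2 * r x ^ (b + 2 - 2) + ‖fderiv ℝ (gradField f) x‖ ^ 2 * r x ^ (b + 2)) *
          D.weight A N x) ≤
      ENNReal.ofReal C' * ∫⁻ x in D.region A, ENNReal.ofReal
        (symGrad (gradField f) x ^ 2 * (r x ^ (b + 2) * D.weight A N x))) :
    sobolevNormSq 2 q r (D.weight A N) (D.region A) (fun β => mpd β f) ≤
      (ENNReal.ofReal C * 4 + n + n ^ 2) * (ENNReal.ofReal C' * 4) *
        tensorInt r (D.weight A N) (D.region A) (b + 2) (flatHessian fun β => mpd β f) := by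
  rw [show b + 2 - 2 = b by ring] at hK'
  obtain ⟨I, hI⟩ : ∃ I, I = ∫⁻ x in D.region A, ENNReal.ofReal
      ((‖gradField f x‖ ^ 2 * r x ^ b + ‖fderiv ℝ (gradField f) x‖ ^ 2 * r x ^ (b + 2)) *
        D.weight A N x) := ⟨_, rfl⟩
  rw [← hI] at hK'
  have hp := fun e x => Real.rpow_nonneg (hr.2.1 x).le e
  have hΩ := (isOpen_region A D).measurableSet
  have e0 : normInt r (D.weight A N) (D.region A) (b - 2) (mpd 0 f) ≤
      ENNReal.ofReal C * (4 * I) := by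
    refine le_trans ?_ (hK.trans (mul_le_mul_right ?_ _))
    · rw [mpd_zero]
      refine setLIntegral_mono' hΩ fun x hx => ?_
      rw [enorm_sq_mul_ofReal, ← mul_assoc]
      refine ENNReal.ofReal_le_ofReal (mul_le_mul_of_nonneg_right ?_ (weight_pos D hx).le)
      have := hp b x
      rw [norm_smul, hv, mul_one]
      exact le_add_of_nonneg_right (by positivity)
    · rw [hI, ← lintegral_const_mul' _ _ (by simp)]
      refine setLIntegral_mono' hΩ fun x hx => ?_
      have h4 : (4 : ℝ≥0∞) = ENNReal.ofReal 4 := by simp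
      rw [h4, ← ENNReal.ofReal_mul (by norm_num)]
      refine ENNReal.ofReal_le_ofReal ?_
      have h3 := symGrad_smul_const_le (hf.differentiable (by simp)) hv x
      rw [← norm_gradField_sq] at h3
      have h5 := (weight_pos D (N := N) hx).le
      have h6 := hp b x
      have h7 := hp (b + 2) x
      calc _ ≤ 4 * ‖gradField f x‖ ^ 2 * (r x ^ b * D.weight A N x) := by gcongr
        _ = 4 * (‖gradField f x‖ ^ 2 * r x ^ b * D.weight A N x) := by ring
        _ ≤ _ := by
          gcongr
          exact le_add_of_nonneg_right (by positivity)
  have ei : ∀ i : Fin n, normInt r (D.weight A N) (D.region A) b (mpd (Pi.single i 1) f) ≤ I := by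
    intro i
    rw [hI, mpd_single]
    refine setLIntegral_mono' hΩ fun x hx => ?_
    rw [enorm_sq_mul_ofReal, ← mul_assoc]
    refine ENNReal.ofReal_le_ofReal (mul_le_mul_of_nonneg_right ?_ (weight_pos D hx).le)
    have h3 := hp b x
    have h4 := hp (b + 2) x
    have h5 : ‖pd i f x‖ ≤ ‖gradField f x‖ := PiLp.norm_apply_le (gradField f x) i
    calc ‖pd i f x‖ ^ 2 * r x ^ b ≤ ‖gradField f x‖ ^ 2 * r x ^ b := by gcongr
      _ ≤ _ := le_add_of_nonneg_right (by positivity)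
  have eij : ∀ i j : Fin n, normInt r (D.weight A N) (D.region A) (b + 2)
      (mpd (Pi.single i 1 + Pi.single j 1) f) ≤ I := by
    intro i j
    rw [hI]
    refine setLIntegral_mono' hΩ fun x hx => ?_
    rw [enorm_sq_mul_ofReal, ← mul_assoc]
    refine ENNReal.ofReal_le_ofReal (mul_le_mul_of_nonneg_right ?_ (weight_pos D hx).le)
    have h3 := hp b x
    have h4 := hp (b + 2) x
    have h5 : ‖mpd (Pi.single i 1 + Pi.single j 1) f x‖ ≤ ‖fderiv ℝ (gradField f) x‖ := by
      rw [mpd_single_add_single_of_contDiffAt (contDiff_infty.1 hf 2).contDiffAt,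
        ← pd_gradField hf]
      exact (PiLp.norm_apply_le _ j).trans (norm_pd_le i _ x)
    calc _ ≤ ‖fderiv ℝ (gradField f) x‖ ^ 2 * r x ^ (b + 2) := by gcongr
      _ ≤ _ := le_add_of_nonneg_left (by positivity)
  have eS : ∫⁻ x in D.region A, ENNReal.ofReal
      (symGrad (gradField f) x ^ 2 * (r x ^ (b + 2) * D.weight A N x)) ≤
      4 * tensorInt r (D.weight A N) (D.region A) (b + 2) (flatHessian fun β => mpd β f) := by
    rw [tensorInt, ← lintegral_const_mul' _ _ (by simp)]
    refine setLIntegral_mono' hΩ fun x hx => ?_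
    have h4 : (4 : ℝ≥0∞) = ENNReal.ofReal 4 := by simp
    rw [sum_enorm_sq_mul_ofReal, h4, ← ENNReal.ofReal_mul (by norm_num)]
    refine ENNReal.ofReal_le_ofReal ?_
    have h5 := symGrad_gradField_le hf x
    have h6 := (weight_pos D (N := N) hx).le
    have h7 := hp (b + 2) x
    simp only [flatHessian, mpd_single_add_single_of_contDiffAt (contDiff_infty.1 hf 2).contDiffAt]
    rw [← mul_assoc 4]
    gcongr
  calc sobolevNormSq 2 q r (D.weight A N) (D.region A) (fun β => mpd β f) ≤ _ :=
        sobolevNormSq_two_le hq _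
    _ ≤ ENNReal.ofReal C * (4 * I) + (∑ i : Fin n, I) + ∑ i : Fin n, ∑ j : Fin n, I :=
        add_le_add (add_le_add e0 (Finset.sum_le_sum fun i _ => ei i))
          (Finset.sum_le_sum fun i _ => Finset.sum_le_sum fun j _ => eij i j)
    _ = (ENNReal.ofReal C * 4 + n + n ^ 2) * I := by simp; ring
    _ ≤ (ENNReal.ofReal C * 4 + n + n ^ 2) * (ENNReal.ofReal C' * (4 *
        tensorInt r (D.weight A N) (D.region A) (b + 2) (flatHessian fun β => mpd β f))) :=
      mul_le_mul_right (hK'.trans (mul_le_mul_right eS _)) _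
    _ = _ := by ring

/-- Coercivity of the Hessian on the weighted Sobolev space of functions. -/
theorem exists_scalar_estimate (hn : 2 ≤ n) (h1 : 0 < θ₁) (h12 : θ₁ < θ₂) (h2 : θ₂ < Real.pi)
    (hN : 2 ≤ N) (hr : IsRadialWeight r) (hb : b ≤ 0) (hbn : 0 < n + b - 2)
    (hq : -(n : ℝ) + 2 * q = b - 2) :
    ∃ C : ℝ≥0∞, C ≠ ⊤ ∧ ∀ (A : E n ≃ₗᵢ[ℝ] E n) (J : (Fin n → ℕ) → E n → ℝ),
      MemSobolev 2 q r (D.weight A N) (D.region A) J →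
      sobolevNormSq 2 q r (D.weight A N) (D.region A) J ≤
        C * tensorInt r (D.weight A N) (D.region A) (b + 2) (flatHessian J) := by
  obtain ⟨C, hC, hK⟩ := korn_region D hn h1 h12 h2 hN hr (b := b) (by linarith) hbn
  -- The field `∇u` decays one order faster, so it takes the exponent `b + 2`. The bound `b + 2 ≤ 2`
  -- required for Korn is the condition `b ≤ 0`.
  obtain ⟨C', hC', hK'⟩ := korn_region D hn h1 h12 h2 hN hr (b := b + 2) (by linarith) (by linarith)
  refine ⟨4 * ((ENNReal.ofReal C * 4 + n + n ^ 2) * (ENNReal.ofReal C' * 4)), by finiteness,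
    fun A J hJ => ?_⟩
  have hw := aemeasurable_weight D hr A N
  have hmeas : ∀ J : (Fin n → ℕ) → E n → ℝ, (∀ β : Fin n → ℕ, ∑ i, β i ≤ 2 →
      AEStronglyMeasurable (J β) (volume.restrict (D.region A))) → ∀ i j : Fin n,
      AEStronglyMeasurable (fun x => flatHessian J x i j) (volume.restrict (D.region A)) :=
    fun J hJ i j => hJ _ (by simp [Finset.sum_add_distrib])
  refine sobolevNormSq_le_of_smooth (T := fun J => tensorInt r (D.weight A N) (D.region A) (b + 2)
    (flatHessian J)) hw (C' := ∑ i : Fin n, ∑ j : Fin n, 1) (by finiteness) (by simp; finiteness)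
    ?_ ?_ ?_ hJ
  · intro f hf
    have hf2 : ContDiff ℝ 2 f := contDiff_infty.1 hf.1 2
    have hv : ‖(EuclideanSpace.single (⟨0, by omega⟩ : Fin n) (1 : ℝ) : E n)‖ = 1 := by simp
    refine scalar_estimate_of_korn D hr hq A hf.1 hv
      (hK A _ (hf2.smul contDiff_const) hf.2.smul_right)
      (hK' A _ (contDiff_infty.1 (contDiff_gradField hf.1) 2) (hasCompactSupport_gradField hf.2))
  · intro J K hJ
    exact tensorInt_add_le (S := flatHessian J) (T := flatHessian K) (hw _) (hmeas J hJ)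
  · intro J hJ
    rw [tensorInt_eq_sum (hw _) (hmeas J hJ), Finset.sum_mul]
    refine Finset.sum_le_sum fun i _ => ?_
    rw [Finset.sum_mul]
    refine Finset.sum_le_sum fun j _ => ?_
    rw [one_mul]
    exact le_sobolevNormSq_single_add hq J i j

end Coercivity

/-! ### A calculus of uniformly decaying families -/

section Decay

variable {n : ℕ} {ι : Type*}

/-- The function `(1 + |x|²)^{1/2}`. -/
def jb (x : E n) : ℝ := Real.sqrt (1 + ‖x‖ ^ 2)

lemma one_le_jb (x : E n) : 1 ≤ jb x := Real.one_le_sqrt.2 (by nlinarith [sq_nonneg ‖x‖])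

lemma jb_pos (x : E n) : 0 < jb x := zero_lt_one.trans_le (one_le_jb x)

/-- A family of functions on sets `S i` is bounded by a constant times `e (1 + |x|²)^{-k/2}`. -/
def BoundedBy (S : ι → Set (E n)) (e : ι → E n → ℝ) (k : ℤ) (f : ι → E n → ℝ) : Prop :=
  ∃ C : ℝ, 0 ≤ C ∧ ∀ i, ∀ x ∈ S i, |f i x| ≤ C * (e i x * jb x ^ (-k))

/-- A family of functions on open sets `S i` is bounded, with its derivatives up to the order `m`,
by constants times `e (1 + |x|²)^{-(k + l)/2}`, where `l` is the order of the derivative. -/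
def Decay (S : ι → Set (E n)) : ℕ → (ι → E n → ℝ) → ℤ → (ι → E n → ℝ) → Prop
  | 0, e, k, f => BoundedBy S e k f
  | m + 1, e, k, f => BoundedBy S e k f ∧ (∀ i, ∀ x ∈ S i, DifferentiableAt ℝ (f i) x) ∧
      ∀ j : Fin n, Decay S m e (k + 1) fun i => pd j (f i)

variable {S : ι → Set (E n)} {e e' e'' : ι → E n → ℝ} {f g : ι → E n → ℝ} {m : ℕ}
  {k k' k'' : ℤ}

lemma BoundedBy.mono (h : BoundedBy S e k f) (he : ∀ i, ∀ x ∈ S i, e i x ≤ e' i x) :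
    BoundedBy S e' k f := by
  obtain ⟨C, hC, h⟩ := h
  refine ⟨C, hC, fun i x hx => (h i x hx).trans ?_⟩
  have hj : 0 < jb x ^ (-k) := zpow_pos (jb_pos x) _
  have := he i x hx
  gcongr

lemma BoundedBy.congr (h : BoundedBy S e k f) (hfg : ∀ i, ∀ x ∈ S i, f i x = g i x) :
    BoundedBy S e k g := by
  obtain ⟨C, hC, h⟩ := h
  exact ⟨C, hC, fun i x hx => by rw [← hfg i x hx]; exact h i x hx⟩

lemma BoundedBy.add (hf : BoundedBy S e k f) (hg : BoundedBy S e k g) :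
    BoundedBy S e k fun i x => f i x + g i x := by
  obtain ⟨C, hC, hf⟩ := hf
  obtain ⟨C', hC', hg⟩ := hg
  refine ⟨C + C', by positivity, fun i x hx => (abs_add_le _ _).trans ?_⟩
  linarith [hf i x hx, hg i x hx]

lemma BoundedBy.mul (hf : BoundedBy S e k f) (hg : BoundedBy S e' k' g)
    (he : ∀ i, ∀ x ∈ S i, e i x * e' i x ≤ e'' i x) (hk : k + k' = k'') :
    BoundedBy S e'' k'' fun i x => f i x * g i x := by
  obtain ⟨C, hC, hf⟩ := hf
  obtain ⟨C', hC', hg⟩ := hg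
  refine ⟨C * C', by positivity, fun i x hx => ?_⟩
  have hj : 0 < jb x ^ (-k) := zpow_pos (jb_pos x) _
  have hj' : 0 < jb x ^ (-k') := zpow_pos (jb_pos x) _
  have h1 := he i x hx
  rw [abs_mul, ← hk, neg_add, zpow_add₀ (jb_pos x).ne']
  calc |f i x| * |g i x| ≤ (C * (e i x * jb x ^ (-k))) * (C' * (e' i x * jb x ^ (-k'))) :=
        mul_le_mul (hf i x hx) (hg i x hx) (abs_nonneg _) ((abs_nonneg _).trans (hf i x hx))
    _ = C * C' * (e i x * e' i x * (jb x ^ (-k) * jb x ^ (-k'))) := by ring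
    _ ≤ _ := by gcongr

lemma Decay.bound (h : Decay S m e k f) : BoundedBy S e k f := by
  cases m with
  | zero => exact h
  | succ m => exact h.1

lemma Decay.pd (h : Decay S (m + 1) e k f) (j : Fin n) :
    Decay S m e (k + 1) fun i => ConeGluing.pd j (f i) := h.2.2 j

lemma Decay.of_succ (h : Decay S (m + 1) e k f) : Decay S m e k f := by
  induction m generalizing k f with
  | zero => exact h.1
  | succ m ih => exact ⟨h.1, h.2.1, fun j => ih (h.2.2 j)⟩

lemma Decay.mono (h : Decay S m e k f) (he : ∀ i, ∀ x ∈ S i, e i x ≤ e' i x) :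
    Decay S m e' k f := by
  induction m generalizing k f with
  | zero => exact BoundedBy.mono h he
  | succ m ih => exact ⟨h.1.mono he, h.2.1, fun j => ih (h.2.2 j)⟩

lemma pd_congr {f g : E n → ℝ} {s : Set (E n)} (hs : IsOpen s) (hfg : ∀ x ∈ s, f x = g x)
    (j : Fin n) {x : E n} (hx : x ∈ s) : pd j f x = pd j g x := by
  rw [pd, pd, (Filter.eventuallyEq_of_mem (hs.mem_nhds hx) hfg).fderiv_eq]

lemma Decay.congr (hS : ∀ i, IsOpen (S i)) (h : Decay S m e k f)
    (hfg : ∀ i, ∀ x ∈ S i, f i x = g i x) : Decay S m e k g := by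
  induction m generalizing k f g with
  | zero => exact BoundedBy.congr h hfg
  | succ m ih =>
    refine ⟨h.1.congr hfg, fun i x hx => ?_, fun j => ih (h.2.2 j) fun i x hx =>
      pd_congr (hS i) (hfg i) j hx⟩
    exact (h.2.1 i x hx).congr_of_eventuallyEq
      (Filter.eventuallyEq_of_mem ((hS i).mem_nhds hx) fun y hy => (hfg i y hy).symm)

lemma Decay.add (hS : ∀ i, IsOpen (S i)) (hf : Decay S m e k f) (hg : Decay S m e k g) :
    Decay S m e k fun i x => f i x + g i x := by
  induction m generalizing k f g with
  | zero => exact BoundedBy.add hf hg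
  | succ m ih =>
    refine ⟨hf.1.add hg.1, fun i x hx => (hf.2.1 i x hx).fun_add (hg.2.1 i x hx), fun j =>
      (ih (hf.2.2 j) (hg.2.2 j)).congr hS fun i x hx => ?_⟩
    simp only [ConeGluing.pd]
    rw [fderiv_fun_add (hf.2.1 i x hx) (hg.2.1 i x hx), add_apply]

lemma Decay.mul (hS : ∀ i, IsOpen (S i)) (hf : Decay S m e k f) (hg : Decay S m e' k' g)
    (he : ∀ i, ∀ x ∈ S i, e i x * e' i x ≤ e'' i x) (hk : k + k' = k'') :
    Decay S m e'' k'' fun i x => f i x * g i x := by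
  induction m generalizing k k' k'' f g with
  | zero => exact BoundedBy.mul hf hg he hk
  | succ m ih =>
    refine ⟨hf.1.mul hg.1 he hk, fun i x hx => (hf.2.1 i x hx).fun_mul (hg.2.1 i x hx), fun j =>
      ((ih hf.of_succ (hg.2.2 j) (k'' := k'' + 1) (by omega)).add hS
        (ih (hf.2.2 j) hg.of_succ (by omega))).congr hS fun i x hx => ?_⟩
    simp only [ConeGluing.pd]
    rw [fderiv_fun_mul (hf.2.1 i x hx) (hg.2.1 i x hx), add_apply, smul_apply, smul_apply,
      smul_eq_mul, smul_eq_mul]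
    ring

lemma Decay.zero (e : ι → E n → ℝ) (k : ℤ) : Decay S m e k fun _ _ => 0 := by
  have h0 : ∀ k, BoundedBy S e k fun _ _ => 0 := fun k => ⟨0, le_rfl, fun i x _ => by simp⟩
  induction m generalizing k with
  | zero => exact h0 k
  | succ m ih =>
    refine ⟨h0 k, fun i x _ => by fun_prop, fun j => ?_⟩
    convert ih (k + 1) using 3
    simp [ConeGluing.pd]

lemma Decay.const {c : ι → ℝ} {C : ℝ} (hc : ∀ i, |c i| ≤ C) :
    Decay S m (fun _ _ => 1) 0 fun i _ => c i := by
  have h0 : BoundedBy S (fun _ _ => 1) 0 fun i _ => c i :=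
    ⟨|C|, abs_nonneg C, fun i x _ => by simpa using (hc i).trans (le_abs_self C)⟩
  cases m with
  | zero => exact h0
  | succ m =>
    refine ⟨h0, fun i x _ => by fun_prop, fun j => ?_⟩
    convert Decay.zero (S := S) (m := m) (fun _ _ => 1) (0 + 1) using 3
    simp [ConeGluing.pd]

lemma Decay.const_mul (hS : ∀ i, IsOpen (S i)) (c : ℝ) (hf : Decay S m e k f) :
    Decay S m e k fun i x => c * f i x :=
  (Decay.const (c := fun _ => c) (C := |c|) fun _ => le_rfl).mul hS hf (fun i x _ => by simp)
    (by omega)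

lemma Decay.sub (hS : ∀ i, IsOpen (S i)) (hf : Decay S m e k f) (hg : Decay S m e k g) :
    Decay S m e k fun i x => f i x - g i x :=
  (hf.add hS (hg.const_mul hS (-1))).congr hS fun i x _ => by ring

lemma Decay.sum (hS : ∀ i, IsOpen (S i)) {α : Type*} (s : Finset α) {f : α → ι → E n → ℝ}
    (hf : ∀ a ∈ s, Decay S m e k (f a)) : Decay S m e k fun i x => ∑ a ∈ s, f a i x := by
  classical
  induction s using Finset.induction_on with
  | empty => simpa using Decay.zero e k
  | insert a s ha ih =>
    simp only [Finset.sum_insert ha]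
    exact (hf a (by simp)).add hS (ih fun b hb => hf b (by simp [hb]))

lemma Decay.prod (hS : ∀ i, IsOpen (S i)) {α : Type*} (s : Finset α) {f : α → ι → E n → ℝ}
    (hf : ∀ a ∈ s, Decay S m (fun _ _ => 1) 0 (f a)) :
    Decay S m (fun _ _ => 1) 0 fun i x => ∏ a ∈ s, f a i x := by
  classical
  induction s using Finset.induction_on with
  | empty => simpa using Decay.const (S := S) (m := m) (c := fun _ => 1) (C := 1) (by simp)
  | insert a s ha ih =>
    simp only [Finset.prod_insert ha]
    exact (hf a (by simp)).mul hS (ih fun b hb => hf b (by simp [hb])) (fun i x _ => by simp)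
      (by omega)

/-- Induction on the order through `∂(1/f) = -f⁻² ∂f`, with the inductive hypothesis used twice for
`f⁻²`. -/
lemma Decay.inv (hS : ∀ i, IsOpen (S i)) (hf : Decay S m (fun _ _ => 1) 0 f) {c : ℝ} (hc : 0 < c)
    (hfc : ∀ i, ∀ x ∈ S i, c ≤ f i x) : Decay S m (fun _ _ => 1) 0 fun i x => (f i x)⁻¹ := by
  have h0 : BoundedBy S (fun _ _ => 1) 0 fun i x => (f i x)⁻¹ := by
    refine ⟨c⁻¹, by positivity, fun i x hx => ?_⟩
    have h1 := hfc i x hx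
    have h2 : 0 < f i x := hc.trans_le h1
    rw [abs_of_pos (inv_pos.2 h2)]
    simpa using inv_anti₀ hc h1
  induction m with
  | zero => exact h0
  | succ m ih =>
    have hd := fun i x (hx : x ∈ S i) => hf.2.1 i x hx
    have hne := fun i x (hx : x ∈ S i) => (hc.trans_le (hfc i x hx)).ne'
    refine ⟨h0, fun i x hx => (hd i x hx).fun_inv (hne i x hx), fun j => ?_⟩
    have h1 := (((ih hf.of_succ).mul hS (ih hf.of_succ) (e'' := fun _ _ => 1) (by simp)
      (add_zero 0)).mul hS (hf.2.2 j) (e'' := fun _ _ => 1) (by simp) (k'' := 0 + 1)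
        (by omega)).const_mul hS (-1)
    refine h1.congr hS fun i x hx => ?_
    have h2 := ((hasDerivAt_inv (hne i x hx)).comp_hasFDerivAt x (hd i x hx).hasFDerivAt).fderiv
    simp only [ConeGluing.pd]
    rw [show (fun x => (f i x)⁻¹) = (fun y => y⁻¹) ∘ f i from rfl, h2]
    simp [pow_two]

/-- By the chain rule the derivatives are combinations of the rotated derivatives whose
coefficients, the entries of an isometry, are at most 1. This makes the constants uniform over all
isometries. -/
lemma Decay.comp_isometry {f : E n → ℝ} (hf : Decay (fun _ : Unit => Set.univ) m (fun _ _ => 1) k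
    fun _ => f) (hS : ∀ i, IsOpen (S i)) (A : ι → E n ≃ₗᵢ[ℝ] E n) :
    Decay S m (fun _ _ => 1) k fun i x => f ((A i).symm x) := by
  have hj : ∀ i x, jb ((A i).symm x) = jb x := fun i x => by simp [jb]
  have h0 : ∀ {k : ℤ} {f : E n → ℝ}, (BoundedBy (fun _ : Unit => Set.univ) (fun _ _ => 1) k
      fun _ => f) → BoundedBy S (fun _ _ => 1) k fun i x => f ((A i).symm x) := by
    rintro k f ⟨C, hC, h⟩
    refine ⟨C, hC, fun i x _ => ?_⟩
    have := h () ((A i).symm x) trivial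
    rwa [hj] at this
  induction m generalizing k f with
  | zero => exact h0 hf
  | succ m ih =>
    have hd : ∀ x, DifferentiableAt ℝ f x := fun x => hf.2.1 () x trivial
    refine ⟨h0 hf.1, fun i x _ => (hd _).comp x (A i).symm.differentiableAt, fun j => ?_⟩
    have h1 : Decay S m (fun _ _ => 1) (k + 1) fun i x => ∑ l,
        ((A i).symm (EuclideanSpace.single j 1)) l * ConeGluing.pd l f ((A i).symm x) := by
      refine Decay.sum hS _ fun l _ => ?_
      refine (Decay.const (C := 1) fun i => ?_).mul hS (ih (hf.2.2 l)) (by simp)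
        (zero_add (k + 1))
      have h2 := PiLp.norm_apply_le ((A i).symm (EuclideanSpace.single j 1)) l
      rw [LinearIsometryEquiv.norm_map] at h2
      simpa using h2
    refine h1.congr hS fun i x _ => ?_
    have h3 := ((hd ((A i).symm x)).hasFDerivAt.comp x (A i).symm.hasFDerivAt).fderiv
    have h4 : ConeGluing.pd j (fun x => f ((A i).symm x)) x =
        fderiv ℝ f ((A i).symm x) ((A i).symm (EuclideanSpace.single j 1)) := by
      rw [ConeGluing.pd]
      exact congrArg (fun L : E n →L[ℝ] ℝ => L (EuclideanSpace.single j 1)) h3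
    rw [h4]
    conv_rhs => rw [← sum_coord_smul ((A i).symm (EuclideanSpace.single j 1))]
    simp [ConeGluing.pd]

/-- Derivatives of a function homogeneous of degree `-k` outside the unit ball are homogeneous of
degree `-k - 1`, and each is bounded by scaling to a compact set. The angular cutoff is the case `k
= 0`. -/
lemma decay_of_homogeneous {f : E n → ℝ} (hf : ContDiff ℝ m f)
    (hk : ∀ x, 1 < ‖x‖ → ∀ t : ℝ, 1 ≤ t → f (t • x) = t ^ (-k) * f x) :
    Decay (fun _ : Unit => Set.univ) m (fun _ _ => 1) k fun _ => f := by
  have h0 : ∀ {k : ℤ} {f : E n → ℝ}, Continuous f →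
      (∀ x, 1 < ‖x‖ → ∀ t : ℝ, 1 ≤ t → f (t • x) = t ^ (-k) * f x) →
      BoundedBy (fun _ : Unit => Set.univ) (fun _ _ => 1) k fun _ => f := by
    intro k f hf hk
    have hjc : Continuous fun x : E n => jb x ^ k :=
      (by unfold jb; fun_prop : Continuous (jb : E n → ℝ)).zpow₀ k fun x => Or.inl (jb_pos x).ne'
    obtain ⟨C, hC⟩ := (isCompact_closedBall (0 : E n) 2).exists_bound_of_continuousOn
      (f := fun x => f x * jb x ^ k) (by fun_prop)
    obtain ⟨C', hC'⟩ := (isCompact_Icc (a := (1 / 4 : ℝ)) (b := 4)).exists_bound_of_continuousOn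
      (f := fun q : ℝ => q ^ k) (fun q hq => (continuousAt_zpow₀ q k
        (Or.inl (by linarith [hq.1]))).continuousWithinAt)
    refine ⟨|C| * (1 + |C'|), by positivity, fun _ x _ => ?_⟩
    have hjx : 0 < jb x ^ (-k) := zpow_pos (jb_pos x) _
    have hC0 : ∀ y : E n, ‖y‖ ≤ 2 → |f y| ≤ |C| * jb y ^ (-k) := by
      intro y hy
      have h1 := (hC y (by simpa using hy)).trans (le_abs_self C)
      have h2 : 0 < jb y ^ k := zpow_pos (jb_pos y) _
      rw [norm_mul, Real.norm_eq_abs, Real.norm_of_nonneg h2.le] at h1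
      rw [zpow_neg, ← div_eq_mul_inv, le_div_iff₀ h2]
      exact h1
    rw [one_mul]
    rcases le_or_gt ‖x‖ 2 with hx | hx
    · refine (hC0 x hx).trans ?_
      have : |C| ≤ |C| * (1 + |C'|) :=
        le_mul_of_one_le_right (abs_nonneg _) (by linarith [abs_nonneg C'])
      gcongr
    -- Scaling to the sphere of radius 2. The ratio of `jb x` to `t` times `jb y` stays in a fixed
    -- compact interval, so it may be raised to a power of either sign.
    · obtain ⟨t, ht⟩ : ∃ t, t = ‖x‖ / 2 := ⟨_, rfl⟩
      have ht1 : 1 < t := by rw [ht]; linarith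
      have ht0 : 0 < t := by linarith
      obtain ⟨y, hy⟩ : ∃ y, y = t⁻¹ • x := ⟨_, rfl⟩
      have hxy : x = t • y := by rw [hy, smul_inv_smul₀ ht0.ne']
      have hyn : ‖y‖ = 2 := by
        rw [hy, norm_smul, norm_inv, Real.norm_of_nonneg ht0.le, ht]
        field_simp
      have hfx : |f x| ≤ t ^ (-k) * (|C| * jb y ^ (-k)) := by
        rw [hxy, hk y (by rw [hyn]; norm_num) t ht1.le, abs_mul,
          abs_of_pos (zpow_pos ht0 _)]
        have := hC0 y hyn.le
        have := zpow_pos ht0 (-k)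
        gcongr
      have hjy : jb y = Real.sqrt 5 := by rw [jb, hyn]; norm_num
      obtain ⟨q, hq⟩ : ∃ q, q = jb x / (t * jb y) := ⟨_, rfl⟩
      have h5 : 0 < Real.sqrt 5 := by positivity
      have h5' : Real.sqrt 5 * Real.sqrt 5 = 5 := Real.mul_self_sqrt (by norm_num)
      have hxn : ‖x‖ = 2 * t := by rw [ht]; ring
      have hjx2 : jb x * jb x = 1 + 4 * t ^ 2 := by
        rw [jb, Real.mul_self_sqrt (by positivity), hxn]; ring
      have hjp := jb_pos x
      have hqI : q ∈ Set.Icc (1 / 4 : ℝ) 4 := by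
        rw [hq, hjy]
        constructor
        · rw [le_div_iff₀ (by positivity)]
          refine abs_le_of_sq_le_sq' ?_ hjp.le |>.2
          nlinarith
        · rw [div_le_iff₀ (by positivity)]
          refine abs_le_of_sq_le_sq' ?_ (by positivity) |>.2
          nlinarith
      have hq0 : 0 < q := by linarith [hqI.1]
      have hqk := (le_abs_self _).trans ((hC' q hqI).trans (le_abs_self C'))
      have hjy0 := jb_pos y
      have e1 : t ^ (-k) * jb y ^ (-k) = q ^ k * jb x ^ (-k) := by
        have h6 : t * jb y = q⁻¹ * jb x := by rw [hq]; field_simp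
        rw [← mul_zpow, h6, mul_zpow, inv_zpow, ← zpow_neg, neg_neg]
      calc |f x| ≤ t ^ (-k) * (|C| * jb y ^ (-k)) := hfx
        _ = |C| * (q ^ k) * jb x ^ (-k) := by
            rw [mul_assoc |C|, ← e1]; ring
        _ ≤ |C| * (1 + |C'|) * jb x ^ (-k) := by
            gcongr
            linarith
  induction m generalizing k f with
  | zero => exact h0 hf.continuous hk
  | succ m ih =>
    have hd : Differentiable ℝ f := hf.differentiable (by simp)
    refine ⟨h0 hf.continuous hk, fun _ x _ => hd x, fun j => ih ?_ ?_⟩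
    · exact (hf.fderiv_right (m := m) (by simp)).clm_apply contDiff_const
    · intro x hx t ht
      have ht0 : 0 < t := by linarith
      have h1 : HasFDerivAt (fun y => f (t • y)) (t • fderiv ℝ f (t • x)) x := by
        have h := (hd (t • x)).hasFDerivAt.comp x ((hasFDerivAt_id x).const_smul t)
        refine h.congr_fderiv ?_
        ext v
        simp
      have h2 : HasFDerivAt (fun y => t ^ (-k) * f y) (t ^ (-k) • fderiv ℝ f x) x :=
        (hd x).hasFDerivAt.const_mul _
      have h3 : (fun y => f (t • y)) =ᶠ[𝓝 x] fun y => t ^ (-k) * f y := by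
        filter_upwards [(isOpen_lt continuous_const continuous_norm).mem_nhds hx] with y hy
        exact hk y hy t ht
      have h4 := (h2.congr_of_eventuallyEq h3).unique h1
      have h5 := congrArg (fun L : E n →L[ℝ] ℝ => L (EuclideanSpace.single j 1)) h4
      simp only [smul_apply, smul_eq_mul] at h5
      simp only [pd]
      rw [neg_add, zpow_add₀ ht0.ne', zpow_neg_one]
      field_simp
      linarith

end Decay

/-! ### Separation of the shell from the origin of the data -/

section Separation

variable {n : ℕ} {θ₁ θ₂ : ℝ} (D : RegularizedCone n θ₁ θ₂)

/-- In the shell, `x` makes an angle larger than `θ₁` with `-a`, hence `⟨x, a⟩ ≥ -|cos θ₁| |x| |a|`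
and `|x + a|² ≥ (1 - |cos θ₁|)(|x|² + |a|²)`. For `|x| < 1`, where the shell is arbitrary, `|a| ≥ 2`
suffices. -/
lemma exists_separation (h1 : 0 < θ₁) (h2 : θ₁ < Real.pi) : ∃ κ : ℝ, 0 < κ ∧
    ∀ (a : E n) (A : E n ≃ₗᵢ[ℝ] E n), 2 ≤ ‖a‖ → ‖a‖ • A D.axis = -a → ∀ x ∈ D.region A,
      κ * ‖a‖ ≤ ‖x + a‖ ∧ κ * jb x ≤ ‖x + a‖ := by
  have hcos : |Real.cos θ₁| < 1 := by
    rw [abs_lt]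
    constructor
    · rw [← Real.cos_pi]
      exact Real.cos_lt_cos_of_nonneg_of_le_pi h1.le le_rfl h2
    · rw [← Real.cos_zero]
      exact Real.cos_lt_cos_of_nonneg_of_le_pi le_rfl h2.le h1
  obtain ⟨d, hd⟩ : ∃ d, d = 1 - |Real.cos θ₁| := ⟨_, rfl⟩
  have hd0 : 0 < d := by rw [hd]; linarith
  have hd1 : d ≤ 1 := by rw [hd]; linarith [abs_nonneg (Real.cos θ₁)]
  obtain ⟨κ, hκ⟩ : ∃ κ, κ = Real.sqrt (d / 4) := ⟨_, rfl⟩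
  have hκ0 : 0 < κ := by rw [hκ]; positivity
  have hκ2 : κ * κ = d / 4 := by rw [hκ]; exact Real.mul_self_sqrt (by positivity)
  refine ⟨κ, hκ0, fun a A ha hA x hx => ?_⟩
  have hjp := jb_pos x
  have hj2 : jb x * jb x = 1 + ‖x‖ ^ 2 := Real.mul_self_sqrt (by positivity)
  rcases le_or_gt 1 ‖x‖ with hx1 | hx1
  · have hy := ((D.mem_iff (A.symm x) (by simpa using hx1)).1 hx).1
    have hin : ⟪D.axis, A.symm x⟫_ℝ = ⟪A D.axis, x⟫_ℝ := by
      rw [← A.inner_map_map, A.apply_symm_apply]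
    have hc := InnerProductGeometry.cos_angle_mul_norm_mul_norm D.axis (A.symm x)
    rw [hin, D.axis_norm, one_mul, LinearIsometryEquiv.norm_map] at hc
    have hc2 : Real.cos (InnerProductGeometry.angle D.axis (A.symm x)) ≤ |Real.cos θ₁| :=
      (Real.cos_le_cos_of_nonneg_of_le_pi h1.le (InnerProductGeometry.angle_le_pi _ _) hy.le).trans
        (le_abs_self _)
    have hax : ⟪x, a⟫_ℝ = -(‖a‖ * ⟪A D.axis, x⟫_ℝ) := by
      rw [← real_inner_smul_left, hA, inner_neg_left, neg_neg, real_inner_comm]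
    have hlow : -(‖a‖ * (|Real.cos θ₁| * ‖x‖)) ≤ ⟪x, a⟫_ℝ := by
      rw [hax, ← hc]
      gcongr
    have hsq : d * (‖x‖ ^ 2 + ‖a‖ ^ 2) ≤ ‖x + a‖ ^ 2 := by
      rw [norm_add_sq_real, hd]
      nlinarith [mul_nonneg (abs_nonneg (Real.cos θ₁)) (sq_nonneg (‖x‖ - ‖a‖))]
    have h5 := mul_nonneg hd0.le (sq_nonneg ‖x‖)
    have h6 := mul_nonneg hd0.le (sq_nonneg ‖a‖)
    constructor
    · refine abs_le_of_sq_le_sq' ?_ (norm_nonneg _) |>.2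
      nlinarith
    · refine abs_le_of_sq_le_sq' ?_ (norm_nonneg _) |>.2
      have : (κ * jb x) ^ 2 = d / 4 * (1 + ‖x‖ ^ 2) := by
        rw [← hj2, ← hκ2]; ring
      have h7 : d * 1 ≤ d * ‖x‖ ^ 2 := by gcongr; nlinarith
      nlinarith
  · have hκh : κ ≤ 1 / 2 := abs_le_of_sq_le_sq' (by nlinarith) (by norm_num) |>.2
    have h3 : ‖a‖ - ‖x‖ ≤ ‖x + a‖ := by
      have := norm_sub_norm_le a (-x)
      rwa [norm_neg, sub_neg_eq_add, add_comm a x] at this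
    have hj : jb x ≤ 2 := abs_le_of_sq_le_sq' (by nlinarith [norm_nonneg x]) (by norm_num) |>.2
    constructor <;> nlinarith [norm_nonneg x]

end Separation

/-! ### Decay of the cutoff and of the translated data -/

section PatchDecay

variable {n : ℕ} {ι : Type*} {S : ι → Set (E n)}

lemma Decay.of_angularCutoff {θ₁ θ₂ : ℝ} {D : RegularizedCone n θ₁ θ₂} {χ : E n → ℝ}
    (hχ : IsAngularCutoff D χ) (hS : ∀ i, IsOpen (S i)) (A : ι → E n ≃ₗᵢ[ℝ] E n) :
    Decay S 2 (fun _ _ => 1) 0 fun i x => χ ((A i).symm x) := by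
  refine Decay.comp_isometry (decay_of_homogeneous hχ.contDiff fun x hx t ht => ?_) hS A
  obtain ⟨f, hf⟩ := hχ.angular
  have ht0 : 0 < t := by linarith
  rw [neg_zero, zpow_zero, one_mul, hf x hx.le, hf (t • x) (by
    rw [norm_smul, Real.norm_of_nonneg ht0.le]; nlinarith),
    InnerProductGeometry.angle_smul_right_of_pos _ _ ht0]

variable {a : ι → E n} {s κ R : ℝ}

/-- The decay in `|x + a|` is divided in two: the power `s` is spent on `|a|` and gives smallness,
and the integer part, which counts derivatives, is spent on `1 + |x|` and gives scale invariance. -/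
lemma boundedBy_of_decaysLike (hs : 0 ≤ s) (hκ : 0 < κ) (ha : ∀ i, 0 < ‖a i‖)
    (hS1 : ∀ i, ∀ x ∈ S i, κ * ‖a i‖ ≤ ‖x + a i‖) (hS2 : ∀ i, ∀ x ∈ S i, κ * jb x ≤ ‖x + a i‖)
    (hSR : ∀ i, ∀ x ∈ S i, R < ‖x + a i‖) {m l : ℕ} {q : ℝ} (hq : q = s + l) {f : E n → ℝ}
    (hf : DecaysLike m q R f) {β : Fin n → ℕ} {j : ℕ} (hβ : ∑ i, β i = j) (hj : j ≤ m) {k : ℤ}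
    (hk : k = l + j) :
    BoundedBy S (fun i _ => ‖a i‖ ^ (-s)) k fun i x => mpd β f (x + a i) := by
  obtain ⟨-, K, hK⟩ := hf
  refine ⟨|K| * (κ ^ (-s) * κ ^ (-k)), by positivity, fun i x hx => ?_⟩
  have hy := hK β (by omega) (x + a i) (hSR i x hx)
  have h1 := hS1 i x hx
  have h2 := hS2 i x hx
  have hj0 := jb_pos x
  have hy0 : 0 < ‖x + a i‖ := lt_of_lt_of_le (by positivity) h2
  have e1 : ‖x + a i‖ ^ (-s) ≤ κ ^ (-s) * ‖a i‖ ^ (-s) := by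
    rw [← Real.mul_rpow hκ.le (norm_nonneg _)]
    exact Real.rpow_le_rpow_of_nonpos (mul_pos hκ (ha i)) h1 (by linarith)
  have e2 : ‖x + a i‖ ^ (-k) ≤ κ ^ (-k) * jb x ^ (-k) := by
    rw [← mul_zpow, zpow_neg, zpow_neg, hk]
    have : (κ * jb x) ^ ((l : ℤ) + j) ≤ ‖x + a i‖ ^ ((l : ℤ) + j) :=
      zpow_le_zpow_left₀ (by omega) (by positivity) h2
    exact inv_anti₀ (by positivity) this
  have e3 : ‖x + a i‖ ^ (-(q + ((∑ i, β i : ℕ) : ℝ))) = ‖x + a i‖ ^ (-s) * ‖x + a i‖ ^ (-k) := by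
    rw [← Real.rpow_intCast, ← Real.rpow_add hy0, hβ, hq, hk]
    congr 1
    push_cast
    ring
  rw [e3] at hy
  have p1 : 0 ≤ ‖a i‖ ^ (-s) := by positivity
  calc _ ≤ K * (‖x + a i‖ ^ (-s) * ‖x + a i‖ ^ (-k)) := hy
    _ ≤ |K| * ((κ ^ (-s) * ‖a i‖ ^ (-s)) * (κ ^ (-k) * jb x ^ (-k))) := by
        gcongr
        exact le_abs_self K
    _ = _ := by ring

lemma pd_comp_add (f : E n → ℝ) (v : E n) (j : Fin n) :
    pd j (fun x => f (x + v)) = fun x => pd j f (x + v) := by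
  ext x
  rw [pd, fderiv_comp_add_right, pd]

lemma decay_one_comp_add {e : ι → E n → ℝ} {k : ℤ} {f : E n → ℝ}
    (h0 : BoundedBy S e k fun i x => f (x + a i))
    (hd : ∀ i, ∀ x ∈ S i, DifferentiableAt ℝ f (x + a i))
    (h1 : ∀ j, BoundedBy S e (k + 1) fun i x => pd j f (x + a i)) :
    Decay S 1 e k fun i x => f (x + a i) := by
  refine ⟨h0, fun i x hx => (hd i x hx).comp x (by fun_prop), fun j => ?_⟩
  simp only [pd_comp_add]
  exact h1 j

lemma decay_of_decaysLike_one (hs : 0 ≤ s) (hκ : 0 < κ) (ha : ∀ i, 0 < ‖a i‖)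
    (hS1 : ∀ i, ∀ x ∈ S i, κ * ‖a i‖ ≤ ‖x + a i‖) (hS2 : ∀ i, ∀ x ∈ S i, κ * jb x ≤ ‖x + a i‖)
    (hSR : ∀ i, ∀ x ∈ S i, R < ‖x + a i‖) {f : E n → ℝ} (hf : DecaysLike 1 (s + 1) R f) :
    Decay S 1 (fun i _ => ‖a i‖ ^ (-s)) 1 fun i x => f (x + a i) := by
  have hopen : IsOpen {y : E n | R < ‖y‖} := isOpen_lt continuous_const continuous_norm
  have hB := fun β j hβ hj k hk => boundedBy_of_decaysLike (β := β) (j := j) (k := k) hs hκ ha hS1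
    hS2 hSR (l := 1) (by simp) hf hβ hj hk
  refine decay_one_comp_add ?_ (fun i x hx => ?_) fun j => ?_
  · have := hB 0 0 (by simp) (by norm_num) 1 (by norm_num)
    rwa [mpd_zero] at this
  · exact (hf.1.contDiffAt (hopen.mem_nhds (hSR i x hx))).differentiableAt (by norm_num)
  · have := hB (Pi.single j 1) 1 (by simp) le_rfl (1 + 1) (by norm_num)
    rwa [mpd_single] at this

lemma decay_of_decaysLike_two (hs : 0 ≤ s) (hκ : 0 < κ) (ha : ∀ i, 0 < ‖a i‖)
    (hS1 : ∀ i, ∀ x ∈ S i, κ * ‖a i‖ ≤ ‖x + a i‖) (hS2 : ∀ i, ∀ x ∈ S i, κ * jb x ≤ ‖x + a i‖)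
    (hSR : ∀ i, ∀ x ∈ S i, R < ‖x + a i‖) {f : E n → ℝ} (hf : DecaysLike 2 s R f) :
    Decay S 2 (fun i _ => ‖a i‖ ^ (-s)) 0 fun i x => f (x + a i) := by
  have hopen : IsOpen {y : E n | R < ‖y‖} := isOpen_lt continuous_const continuous_norm
  have hB := fun β j hβ hj k hk => boundedBy_of_decaysLike (β := β) (j := j) (k := k) hs hκ ha hS1
    hS2 hSR (l := 0) (by simp) hf hβ hj hk
  have hC : ∀ i, ∀ x ∈ S i, ContDiffAt ℝ 2 f (x + a i) := fun i x hx =>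
    hf.1.contDiffAt (hopen.mem_nhds (hSR i x hx))
  refine ⟨?_, fun i x hx => ?_, fun j => ?_⟩
  · have := hB 0 0 (by simp) (by norm_num) 0 (by norm_num)
    rwa [mpd_zero] at this
  · exact ((hC i x hx).differentiableAt (by norm_num)).comp x (by fun_prop)
  · simp only [pd_comp_add]
    refine decay_one_comp_add ?_ (fun i x hx => ?_) fun l => ?_
    · have := hB (Pi.single j 1) 1 (by simp) (by norm_num) (0 + 1) (by norm_num)
      rwa [mpd_single] at this
    · have h : ContDiffAt ℝ 1 (fderiv ℝ f) (x + a i) := (hC i x hx).fderiv_right (by norm_num)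
      exact (h.differentiableAt one_ne_zero).clm_apply (by fun_prop)
    · refine (hB (Pi.single l 1 + Pi.single j 1) 2 (by simp [Finset.sum_add_distrib]) le_rfl
        (0 + 1 + 1) (by norm_num)).congr fun i x hx => ?_
      exact mpd_single_add_single_of_contDiffAt (hC i x hx) l j

end PatchDecay

/-! ### Geometric quantities of nearly flat metrics -/

section GeometryDecay

variable {n : ℕ} {ι : Type*} {S : ι → Set (E n)} {m : ℕ}

lemma Decay.matrix_mul (hS : ∀ i, IsOpen (S i)) {e e' e'' : ι → E n → ℝ} {k k' k'' : ℤ}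
    {P T : ι → E n → Matrix (Fin n) (Fin n) ℝ}
    (hP : ∀ a b, Decay S m e k fun i x => P i x a b)
    (hT : ∀ a b, Decay S m e' k' fun i x => T i x a b)
    (he : ∀ i, ∀ x ∈ S i, e i x * e' i x ≤ e'' i x) (hk : k + k' = k'') (a b : Fin n) :
    Decay S m e'' k'' fun i x => (P i x * T i x) a b := by
  simp only [Matrix.mul_apply]
  exact Decay.sum hS _ fun c _ => (hP a c).mul hS (hT c b) he hk

lemma Decay.det (hS : ∀ i, IsOpen (S i)) {P : ι → E n → Matrix (Fin n) (Fin n) ℝ}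
    (hP : ∀ a b, Decay S m (fun _ _ => 1) 0 fun i x => P i x a b) :
    Decay S m (fun _ _ => 1) 0 fun i x => (P i x).det := by
  simp only [Matrix.det_apply']
  exact Decay.sum hS _ fun σ _ => (Decay.prod hS _ fun j _ => hP (σ j) j).const_mul hS _

/-- Cramer's rule: an entry of the inverse is the determinant of a matrix with one constant row,
divided by a determinant bounded below. -/
lemma Decay.matrix_inv (hS : ∀ i, IsOpen (S i)) {P : ι → E n → Matrix (Fin n) (Fin n) ℝ}
    (hP : ∀ a b, Decay S m (fun _ _ => 1) 0 fun i x => P i x a b) {c : ℝ} (hc : 0 < c)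
    (hdet : ∀ i, ∀ x ∈ S i, c ≤ (P i x).det) (a b : Fin n) :
    Decay S m (fun _ _ => 1) 0 fun i x => (P i x)⁻¹ a b := by
  have h1 : Decay S m (fun _ _ => 1) 0 fun i x => ((P i x).updateRow b (Pi.single a 1)).det := by
    refine Decay.det hS fun a' b' => ?_
    by_cases h : a' = b
    · subst h
      simp only [Matrix.updateRow_self]
      exact Decay.const (C := |(Pi.single a 1 : Fin n → ℝ) b'|) fun _ => le_rfl
    · simp only [Matrix.updateRow_ne h]
      exact hP a' b'
  refine (((Decay.det hS hP).inv hS hc hdet).mul hS h1 (e'' := fun _ _ => 1) (by simp)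
    (add_zero 0)).congr hS fun i x hx => ?_
  rw [Matrix.inv_def, Matrix.smul_apply, Matrix.adjugate_apply, Ring.inverse_eq_inv', smul_eq_mul]

variable {ε : ι → E n → ℝ} {g k : ι → E n → Matrix (Fin n) (Fin n) ℝ}

/-- A family of metrics which is close to the Euclidean one, with its first two derivatives. -/
structure NearlyFlat (S : ι → Set (E n)) (ε : ι → E n → ℝ)
    (g : ι → E n → Matrix (Fin n) (Fin n) ℝ) : Prop where
  isOpen : ∀ i, IsOpen (S i)
  nonneg : ∀ i, ∀ x ∈ S i, 0 ≤ ε i x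
  le_one : ∀ i, ∀ x ∈ S i, ε i x ≤ 1
  decay : ∀ a b, Decay S 2 ε 0 fun i x => g i x a b - (1 : Matrix (Fin n) (Fin n) ℝ) a b
  det_ge : ∃ c : ℝ, 0 < c ∧ ∀ i, ∀ x ∈ S i, c ≤ (g i x).det

namespace NearlyFlat

variable (hg : NearlyFlat S ε g)
include hg

lemma metric (a b : Fin n) : Decay S 2 (fun _ _ => 1) 0 fun i x => g i x a b :=
  (((hg.decay a b).mono hg.le_one).add hg.isOpen (Decay.const
    (C := |(1 : Matrix (Fin n) (Fin n) ℝ) a b|) fun _ => le_rfl)).congr hg.isOpen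
      fun _ _ _ => sub_add_cancel _ _

lemma inv (a b : Fin n) : Decay S 2 (fun _ _ => 1) 0 fun i x => (g i x)⁻¹ a b := by
  obtain ⟨c, hc, hdet⟩ := hg.det_ge
  exact Decay.matrix_inv hg.isOpen hg.metric hc hdet a b

/-- Follows from `g⁻¹ - 1 = -g⁻¹ (g - 1)`. -/
lemma inv_sub_one (a b : Fin n) :
    Decay S 2 ε 0 fun i x => (g i x)⁻¹ a b - (1 : Matrix (Fin n) (Fin n) ℝ) a b := by
  obtain ⟨c, hc, hdet⟩ := hg.det_ge
  refine ((Decay.matrix_mul hg.isOpen (P := fun i x => (g i x)⁻¹) (T := fun i x => g i x - 1)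
    hg.inv hg.decay (e'' := ε) (by simp) (add_zero 0) a b).const_mul hg.isOpen (-1)).congr
      hg.isOpen fun i x hx => ?_
  have hu : IsUnit (g i x).det := (hc.trans_le (hdet i x hx)).ne'.isUnit
  rw [Matrix.mul_sub, Matrix.nonsing_inv_mul _ hu, Matrix.mul_one, Matrix.sub_apply]
  ring

lemma pd_metric (l a b : Fin n) : Decay S 1 ε 1 fun i x => pd l (fun y => g i y a b) x := by
  have h := (hg.decay a b).pd l
  rw [zero_add] at h
  refine h.congr hg.isOpen fun i x _ => ?_
  rw [pd, fderiv_sub_const, pd]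

lemma christoffel (l a b : Fin n) :
    Decay S 1 ε 1 fun i x => ConeGluing.christoffel (g i) l a b x := by
  unfold ConeGluing.christoffel
  refine Decay.sum hg.isOpen _ fun j _ => ?_
  refine (((hg.inv l j).of_succ).const_mul hg.isOpen (1 / 2)).mul hg.isOpen
    (((hg.pd_metric a b j).add hg.isOpen (hg.pd_metric b a j)).sub hg.isOpen
      (hg.pd_metric j a b)) (by simp) (zero_add 1)

/-- The part linear in the second derivatives of the metric is small of first order. The quadratic
terms in the Christoffel symbols have the factor `ε²`, which is at most `ε`. -/
lemma ricci (a b : Fin n) : Decay S 0 ε 2 fun i x => ConeGluing.ricci (g i) x a b := by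
  have hεε : ∀ i, ∀ x ∈ S i, ε i x * ε i x ≤ ε i x := fun i x hx =>
    mul_le_of_le_one_left (hg.nonneg i x hx) (hg.le_one i x hx)
  have hΓ := fun l a b => (hg.christoffel l a b).of_succ
  unfold ConeGluing.ricci
  refine (Decay.sum hg.isOpen _ fun l _ => ?_).add hg.isOpen
    (Decay.sum hg.isOpen _ fun l _ => Decay.sum hg.isOpen _ fun j _ => ?_)
  · exact ((hg.christoffel l a b).pd l).sub hg.isOpen ((hg.christoffel l a l).pd b)
  · exact ((hΓ l l j).mul hg.isOpen (hΓ j a b) hεε (by norm_num)).sub hg.isOpen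
      ((hΓ l b j).mul hg.isOpen (hΓ j a l) hεε (by norm_num))

lemma momentum (hk : ∀ a b, Decay S 1 ε 1 fun i x => k i x a b) (a b : Fin n) :
    Decay S 1 ε 1 fun i x => ConeGluing.momentum (g i) (k i) x a b := by
  have hG := fun a b => (hg.inv a b).of_succ
  unfold ConeGluing.momentum
  simp only [Matrix.sub_apply, Matrix.smul_apply, smul_eq_mul]
  refine Decay.sub hg.isOpen ?_ ?_
  · exact Decay.matrix_mul hg.isOpen (Decay.matrix_mul hg.isOpen hG hk (e'' := ε) (by simp)
      (zero_add 1)) hG (by simp) (add_zero 1) a b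
  · refine Decay.mul hg.isOpen (e := ε) (k := 1) (Decay.sum hg.isOpen _ fun c _ =>
      Decay.sum hg.isOpen _ fun d _ => (hG c d).mul hg.isOpen (hk c d) (by simp) (zero_add 1))
      (hG a b) (by simp) (add_zero 1)

variable {π : ι → E n → Matrix (Fin n) (Fin n) ℝ}
  (hπ : ∀ a b, Decay S 1 ε 1 fun i x => π i x a b)
include hπ

lemma trUp : Decay S 0 ε 1 fun i x => ConeGluing.trUp (g i) (π i) x := by
  unfold ConeGluing.trUp
  exact Decay.sum hg.isOpen _ fun a _ => Decay.sum hg.isOpen _ fun b _ =>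
    (hg.metric a b).of_succ.of_succ.mul hg.isOpen (hπ a b).of_succ (by simp) (zero_add 1)

lemma lower (a b : Fin n) : Decay S 0 ε 1 fun i x => (g i x * π i x * g i x) a b := by
  have hG := fun a b => (hg.metric a b).of_succ.of_succ
  exact Decay.matrix_mul hg.isOpen (Decay.matrix_mul hg.isOpen hG (fun a b => (hπ a b).of_succ)
    (e'' := ε) (by simp) (zero_add 1)) hG (by simp) (add_zero 1) a b

lemma lower_sq (a b : Fin n) :
    Decay S 0 ε 2 fun i x => (g i x * π i x * g i x * π i x * g i x) a b := by
  have hG := fun a b => (hg.metric a b).of_succ.of_succ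
  have hεε : ∀ i, ∀ x ∈ S i, ε i x * ε i x ≤ ε i x := fun i x hx =>
    mul_le_of_le_one_left (hg.nonneg i x hx) (hg.le_one i x hx)
  exact Decay.matrix_mul hg.isOpen (Decay.matrix_mul hg.isOpen (hg.lower hπ)
    (fun a b => (hπ a b).of_succ) hεε (k'' := 2) (by norm_num)) hG (by simp) (add_zero 2) a b

lemma covTensor (l a b : Fin n) :
    Decay S 0 ε 2 fun i x => ConeGluing.covTensor (g i) (π i) l a b x := by
  have hεε : ∀ i, ∀ x ∈ S i, ε i x * ε i x ≤ ε i x := fun i x hx =>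
    mul_le_of_le_one_left (hg.nonneg i x hx) (hg.le_one i x hx)
  have hΓ := fun l a b => (hg.christoffel l a b).of_succ
  have hπ0 := fun a b => (hπ a b).of_succ
  unfold ConeGluing.covTensor
  refine ((hπ a b).pd l).add hg.isOpen (Decay.sum hg.isOpen _ fun j _ => ?_)
  exact ((hΓ a l j).mul hg.isOpen (hπ0 j b) hεε (by norm_num)).add hg.isOpen
    ((hΓ b l j).mul hg.isOpen (hπ0 a j) hεε (by norm_num))

end NearlyFlat

end GeometryDecay

/-! ### Comparison of the adjoint operator with its flat model -/

section AdjointDecay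

variable {n : ℕ}

/-- The size of the scaling invariant jets of a function and of a vector field. -/
def jetSize (J : (Fin n → ℕ) → E n → ℝ) (W : (Fin n → ℕ) → E n → E n) (x : E n) : ℝ :=
  (∑ a, ∑ b, |J (Pi.single a 1 + Pi.single b 1) x|) + (∑ a, |J (Pi.single a 1) x|) * jb x ^ (-1 : ℤ)
    + |J 0 x| * jb x ^ (-2 : ℤ) + (∑ l, ∑ a, |W (Pi.single l 1) x a|) * jb x ^ (-1 : ℤ) +
    (∑ a, |W 0 x a|) * jb x ^ (-2 : ℤ)

lemma jetSize_parts_nonneg (J : (Fin n → ℕ) → E n → ℝ) (W : (Fin n → ℕ) → E n → E n) (x : E n) :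
    0 ≤ (∑ a, ∑ b, |J (Pi.single a 1 + Pi.single b 1) x|) ∧
    0 ≤ (∑ a, |J (Pi.single a 1) x|) * jb x ^ (-1 : ℤ) ∧ 0 ≤ |J 0 x| * jb x ^ (-2 : ℤ) ∧
    0 ≤ (∑ l, ∑ a, |W (Pi.single l 1) x a|) * jb x ^ (-1 : ℤ) ∧
    0 ≤ (∑ a, |W 0 x a|) * jb x ^ (-2 : ℤ) := by
  have := (jb_pos x).le
  refine ⟨?_, ?_, ?_, ?_, ?_⟩ <;> positivity

lemma jetSize_nonneg (J : (Fin n → ℕ) → E n → ℝ) (W : (Fin n → ℕ) → E n → E n) (x : E n) :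
    0 ≤ jetSize J W x := by
  obtain ⟨h1, h2, h3, h4, h5⟩ := jetSize_parts_nonneg J W x
  unfold jetSize
  linarith

variable {ι : Type*} {S : ι → Set (E n)} {ε : ι → E n → ℝ}
  {g π : ι → E n → Matrix (Fin n) (Fin n) ℝ}

lemma decay_of_le {Q : ι → E n → ℝ} {k : ℤ} {f : ι → E n → ℝ}
    (h : ∀ i, ∀ x ∈ S i, |f i x| * jb x ^ k ≤ Q i x) : Decay S 0 Q k f := by
  refine ⟨1, zero_le_one, fun i x hx => ?_⟩
  have h1 := zpow_pos (jb_pos x) k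
  rw [one_mul, zpow_neg, ← div_eq_mul_inv, le_div_iff₀ h1]
  exact h i x hx

variable (J : ι → (Fin n → ℕ) → E n → ℝ) (W : ι → (Fin n → ℕ) → E n → E n)

/-- Together with the next four lemmas this puts the jets of `u` and `Z` into the decay calculus,
with their common size as the envelope. Every term of the adjoint is then a product estimate in
which powers of `1 + |x|` are counted. -/
lemma decay_second (a b : Fin n) :
    Decay S 0 (fun i => jetSize (J i) (W i)) 0 fun i => J i (Pi.single a 1 + Pi.single b 1) := by
  refine decay_of_le fun i x _ => ?_
  obtain ⟨h1, h2, h3, h4, h5⟩ := jetSize_parts_nonneg (J i) (W i) x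
  have h6 : |J i (Pi.single a 1 + Pi.single b 1) x| ≤
      ∑ a, ∑ b, |J i (Pi.single a 1 + Pi.single b 1) x| :=
    (Finset.single_le_sum (f := fun b => |J i (Pi.single a 1 + Pi.single b 1) x|)
      (fun _ _ => abs_nonneg _) (Finset.mem_univ b)).trans
    (Finset.single_le_sum (f := fun a => ∑ b, |J i (Pi.single a 1 + Pi.single b 1) x|)
      (fun _ _ => by positivity) (Finset.mem_univ a))
  rw [zpow_zero, mul_one]
  unfold jetSize
  linarith

lemma decay_first (a : Fin n) :
    Decay S 0 (fun i => jetSize (J i) (W i)) (-1) fun i => J i (Pi.single a 1) := by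
  refine decay_of_le fun i x _ => ?_
  obtain ⟨h1, h2, h3, h4, h5⟩ := jetSize_parts_nonneg (J i) (W i) x
  have h6 : |J i (Pi.single a 1) x| * jb x ^ (-1 : ℤ) ≤
      (∑ a, |J i (Pi.single a 1) x|) * jb x ^ (-1 : ℤ) := by
    have := (jb_pos x).le
    gcongr
    exact Finset.single_le_sum (f := fun a => |J i (Pi.single a 1) x|)
      (fun _ _ => abs_nonneg _) (Finset.mem_univ a)
  unfold jetSize
  linarith

lemma decay_value : Decay S 0 (fun i => jetSize (J i) (W i)) (-2) fun i => J i 0 := by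
  refine decay_of_le fun i x _ => ?_
  obtain ⟨h1, h2, h3, h4, h5⟩ := jetSize_parts_nonneg (J i) (W i) x
  unfold jetSize
  linarith

lemma decay_vector_first (l a : Fin n) :
    Decay S 0 (fun i => jetSize (J i) (W i)) (-1) fun i x => W i (Pi.single l 1) x a := by
  refine decay_of_le fun i x _ => ?_
  obtain ⟨h1, h2, h3, h4, h5⟩ := jetSize_parts_nonneg (J i) (W i) x
  have h6 : |W i (Pi.single l 1) x a| * jb x ^ (-1 : ℤ) ≤
      (∑ l, ∑ a, |W i (Pi.single l 1) x a|) * jb x ^ (-1 : ℤ) := by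
    have := (jb_pos x).le
    gcongr
    exact (Finset.single_le_sum (f := fun a => |W i (Pi.single l 1) x a|)
      (fun _ _ => abs_nonneg _) (Finset.mem_univ a)).trans
      (Finset.single_le_sum (f := fun l => ∑ a, |W i (Pi.single l 1) x a|)
      (fun _ _ => by positivity) (Finset.mem_univ l))
  unfold jetSize
  linarith

lemma decay_vector_value (a : Fin n) :
    Decay S 0 (fun i => jetSize (J i) (W i)) (-2) fun i x => W i 0 x a := by
  refine decay_of_le fun i x _ => ?_
  obtain ⟨h1, h2, h3, h4, h5⟩ := jetSize_parts_nonneg (J i) (W i) x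
  have h6 : |W i 0 x a| * jb x ^ (-2 : ℤ) ≤ (∑ a, |W i 0 x a|) * jb x ^ (-2 : ℤ) := by
    have := (jb_pos x).le
    gcongr
    exact Finset.single_le_sum (f := fun a => |W i 0 x a|)
      (fun _ _ => abs_nonneg _) (Finset.mem_univ a)
  unfold jetSize
  linarith

namespace NearlyFlat

variable (hg : NearlyFlat S ε g)
include hg

lemma mul_jetSize_le (i : ι) (x : E n) (hx : x ∈ S i) :
    ε i x * jetSize (J i) (W i) x ≤ jetSize (J i) (W i) x :=
  mul_le_of_le_one_left (jetSize_nonneg _ _ _) (hg.le_one i x hx)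

lemma hessian_sub (a b : Fin n) : Decay S 0 (fun i x => ε i x * jetSize (J i) (W i) x) 0
    fun i x => hessian (g i) (J i) x a b - J i (Pi.single a 1 + Pi.single b 1) x := by
  refine ((Decay.sum hg.isOpen Finset.univ fun l _ => (hg.christoffel l a b).of_succ.mul hg.isOpen
    (decay_first J W l) (fun _ _ _ => le_rfl) (k'' := 0) (by norm_num)).const_mul hg.isOpen
      (-1)).congr hg.isOpen fun i x _ => ?_
  simp only [hessian]
  ring

lemma hessian (a b : Fin n) : Decay S 0 (fun i => jetSize (J i) (W i)) 0
    fun i x => ConeGluing.hessian (g i) (J i) x a b :=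
  (((hg.hessian_sub J W a b).mono (hg.mul_jetSize_le J W)).add hg.isOpen
    (decay_second J W a b)).congr hg.isOpen fun _ _ _ => sub_add_cancel _ _

lemma laplacian_sub : Decay S 0 (fun i x => ε i x * jetSize (J i) (W i) x) 0
    fun i x => laplacian (g i) (J i) x - ∑ a, J i (Pi.single a 1 + Pi.single a 1) x := by
  have hG := fun a b => (hg.inv_sub_one a b).of_succ.of_succ
  refine ((Decay.sum hg.isOpen Finset.univ fun a _ => Decay.sum hg.isOpen Finset.univ fun b _ =>
    (hG a b).mul hg.isOpen (hg.hessian J W a b) (fun _ _ _ => le_rfl) (add_zero 0)).add hg.isOpen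
      (Decay.sum hg.isOpen Finset.univ fun a _ => hg.hessian_sub J W a a)).congr hg.isOpen
        fun i x _ => ?_
  simp only [ConeGluing.laplacian, sub_mul, Finset.sum_sub_distrib, Matrix.one_apply, ite_mul,
    one_mul, zero_mul, Finset.sum_ite_eq, Finset.mem_univ, if_true]
  ring

lemma laplacian : Decay S 0 (fun i => jetSize (J i) (W i)) 0
    fun i x => ConeGluing.laplacian (g i) (J i) x :=
  (((hg.laplacian_sub J W).mono (hg.mul_jetSize_le J W)).add hg.isOpen
    (Decay.sum hg.isOpen Finset.univ fun a _ => decay_second J W a a)).congr hg.isOpen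
      fun _ _ _ => sub_add_cancel _ _

lemma covVec_sub (l a : Fin n) : Decay S 0 (fun i x => ε i x * jetSize (J i) (W i) x) (-1)
    fun i x => covVec (g i) (W i) l a x - W i (Pi.single l 1) x a := by
  refine (Decay.sum hg.isOpen Finset.univ fun b _ => (hg.christoffel a l b).of_succ.mul hg.isOpen
    (decay_vector_value J W b) (fun _ _ _ => le_rfl) (k'' := -1) (by norm_num)).congr hg.isOpen
      fun i x _ => ?_
  simp only [covVec]
  ring

lemma covVec (l a : Fin n) : Decay S 0 (fun i => jetSize (J i) (W i)) (-1)
    fun i x => ConeGluing.covVec (g i) (W i) l a x :=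
  (((hg.covVec_sub J W l a).mono (hg.mul_jetSize_le J W)).add hg.isOpen
    (decay_vector_first J W l a)).congr hg.isOpen fun _ _ _ => sub_add_cancel _ _

variable (hπ : ∀ a b, Decay S 1 ε 1 fun i x => π i x a b)
include hπ

lemma covVecTensor (l a b c : Fin n) : Decay S 0 (fun i x => ε i x * jetSize (J i) (W i) x) 0
    fun i x => ConeGluing.covVecTensor (g i) (π i) (W i) l a b c x :=
  ((hg.covVec J W l a).mul hg.isOpen (hπ b c).of_succ
    (fun _ _ _ => (mul_comm _ _).le) (by norm_num)).add hg.isOpen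
  ((decay_vector_value J W a).mul hg.isOpen (hg.covTensor hπ l b c)
    (fun _ _ _ => (mul_comm _ _).le) (by norm_num))

/-- The flat model is `Hess u - (Δu) δ`. All other terms contain a Christoffel symbol, curvature,
`π` or `g - δ`, hence a factor `ε`, and their weights add up to the scaling of second derivatives of
`u`. -/
lemma adjoint₁_sub (a b : Fin n) : Decay S 0 (fun i x => ε i x * jetSize (J i) (W i) x) 0
    fun i x => adjoint₁ (g i) (π i) (J i) (W i) x a b -
      (flatHessian (J i) x a b - (∑ c, flatHessian (J i) x c c) *
        (1 : Matrix (Fin n) (Fin n) ℝ) a b) := by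
  have hS := hg.isOpen
  have hG := fun a b => (hg.metric a b).of_succ.of_succ
  have hεε : ∀ i, ∀ x ∈ S i, ε i x * ε i x ≤ ε i x := fun i x hx =>
    mul_le_of_le_one_left (hg.nonneg i x hx) (hg.le_one i x hx)
  have hT := fun l a b c => hg.covVecTensor J W hπ l a b c
  have hone := fun a b : Fin n => Decay.const (S := S) (m := 0)
    (c := fun _ => (1 : Matrix (Fin n) (Fin n) ℝ) a b)
    (C := |(1 : Matrix (Fin n) (Fin n) ℝ) a b|) fun _ => le_rfl
  -- The term `(Δ_g u) g` is compared with its flat model in two steps, first the metric factor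
  -- (`t1`) and then the Laplacian (`t2`).
  have t1 := (hg.laplacian J W).mul hS (hg.decay a b).of_succ.of_succ
    (e'' := fun i x => ε i x * jetSize (J i) (W i) x)
    (fun _ _ _ => (mul_comm _ _).le) (add_zero 0)
  have t2 := (hg.laplacian_sub J W).mul hS (hone a b)
    (e'' := fun i x => ε i x * jetSize (J i) (W i) x) (fun _ _ _ => (mul_one _).le) (add_zero 0)
  have t3 := hg.hessian_sub J W a b
  have t4 := (decay_value J W).mul hS (hg.ricci a b)
    (e'' := fun i x => ε i x * jetSize (J i) (W i) x)
    (fun _ _ _ => (mul_comm _ _).le) (k'' := 0) (by norm_num)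
  have t5 := (decay_value J W).mul hS ((((hg.trUp hπ).const_mul hS (2 / ((n : ℝ) - 1))).mul hS
    (hg.lower hπ a b) hεε (k'' := 2) (by norm_num)).sub hS
      ((hg.lower_sq hπ a b).const_mul hS 2))
    (e'' := fun i x => ε i x * jetSize (J i) (W i) x)
    (fun _ _ _ => (mul_comm _ _).le) (k'' := 0) (by norm_num)
  have t6 : Decay S 0 (fun i x => ε i x * jetSize (J i) (W i) x) 0 fun i x =>
      ∑ c, ∑ d, g i x a c * g i x b d *
      (∑ l, (-(1 / 2 : ℝ) * (ConeGluing.covVecTensor (g i) (π i) (W i) l c l d x +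
        ConeGluing.covVecTensor (g i) (π i) (W i) l d l c x) +
        (1 / 2 : ℝ) * ConeGluing.covVecTensor (g i) (π i) (W i) l l c d x)) := by
    refine Decay.sum hS _ fun c _ => Decay.sum hS _ fun d _ => ?_
    refine ((hG a c).mul hS (hG b d) (e'' := fun _ _ => 1) (by simp) (add_zero 0)).mul hS
      (Decay.sum hS _ fun l _ => ?_) (fun _ _ _ => (one_mul _).le) (add_zero 0)
    exact (((hT l c l d).add hS (hT l d l c)).const_mul hS _).add hS ((hT l l c d).const_mul hS _)
  have t7 : Decay S 0 (fun i x => ε i x * jetSize (J i) (W i) x) 0 fun i x =>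
      (1 / 2 : ℝ) * g i x a b * ∑ l, ∑ c, ∑ d, g i x c d *
        ConeGluing.covVecTensor (g i) (π i) (W i) l c l d x := by
    refine ((hG a b).const_mul hS _).mul hS (Decay.sum hS _ fun l _ => Decay.sum hS _ fun c _ =>
      Decay.sum hS _ fun d _ => (hG c d).mul hS (hT l c l d) (fun _ _ _ => (one_mul _).le)
        (add_zero 0)) (fun _ _ _ => (one_mul _).le) (add_zero 0)
  refine (((((((t3.sub hS t1).sub hS t2).sub hS t4).add hS t5).add hS t6).sub hS t7)).congr hS
    fun i x _ => ?_
  simp only [adjoint₁, flatHessian]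
  ring

/-- The flat model is minus half of the symmetrized gradient. The errors scale like first
derivatives of `Z`, one power of `1 + |x|` above the first component. -/
lemma adjoint₂_sub (a b : Fin n) : Decay S 0 (fun i x => ε i x * jetSize (J i) (W i) x) (-1)
    fun i x => adjoint₂ (g i) (π i) (J i) (W i) x a b -
      (-(1 / 2 : ℝ)) * symDeriv (W i) x a b := by
  have hS := hg.isOpen
  have hG := fun a b => (hg.inv a b).of_succ.of_succ
  have hG1 := fun a b => (hg.inv_sub_one a b).of_succ.of_succ
  have h1 : ∀ a b, Decay S 0 (fun i x => ε i x * jetSize (J i) (W i) x) (-1) fun i x =>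
      (∑ l, ((g i x)⁻¹ a l * ConeGluing.covVec (g i) (W i) l b x)) - W i (Pi.single a 1) x b := by
    intro a b
    refine ((Decay.sum hS Finset.univ fun l _ => (hG1 a l).mul hS (hg.covVec J W l b)
      (fun _ _ _ => le_rfl) (zero_add (-1))).add hS (hg.covVec_sub J W a b)).congr hS
        fun i x _ => ?_
    simp only [sub_mul, Finset.sum_sub_distrib, Matrix.one_apply, ite_mul,
      one_mul, zero_mul, Finset.sum_ite_eq, Finset.mem_univ, if_true]
    ring
  have t2 := (decay_value J W).mul hS ((((hg.trUp hπ).const_mul hS (2 / ((n : ℝ) - 1))).mul hS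
    (hG a b) (e'' := ε) (fun _ _ _ => (mul_one _).le) (k'' := 1) (by norm_num)).sub hS
      (((hπ a b).of_succ).const_mul hS 2))
    (e'' := fun i x => ε i x * jetSize (J i) (W i) x)
    (fun _ _ _ => (mul_comm _ _).le) (k'' := -1) (by norm_num)
  refine ((((h1 a b).add hS (h1 b a)).const_mul hS (-(1 / 2))).add hS t2).congr hS fun i x _ => ?_
  simp only [adjoint₂, symDeriv, Finset.sum_add_distrib]
  ring

end NearlyFlat

end AdjointDecay

/-! ### Uniform estimates for the patched data -/

section PatchEstimates

variable {n : ℕ}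

/-- Continuity of the determinant at the identity. It yields a uniform bound of the inverse metric
for large `|a|`. -/
lemma exists_det_ge (n : ℕ) : ∃ η : ℝ, 0 < η ∧ ∀ P : Matrix (Fin n) (Fin n) ℝ,
    (∀ a b, |P a b - (1 : Matrix (Fin n) (Fin n) ℝ) a b| ≤ η) → 1 / 2 ≤ P.det := by
  have hc : Continuous fun P : Fin n → Fin n → ℝ => (Matrix.of P).det :=
    Continuous.matrix_det continuous_id
  obtain ⟨I, hI⟩ : ∃ I : Fin n → Fin n → ℝ, I = fun a b => (1 : Matrix (Fin n) (Fin n) ℝ) a b :=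
    ⟨_, rfl⟩
  obtain ⟨δ, hδ, h⟩ := Metric.continuousAt_iff.1 (hc.continuousAt (x := I)) (1 / 2) (by norm_num)
  refine ⟨δ / 2, by positivity, fun P hP => ?_⟩
  obtain ⟨T, hT⟩ : ∃ T : Fin n → Fin n → ℝ, T = fun a b => P a b := ⟨_, rfl⟩
  have h1 : dist T I < δ := by
    refine lt_of_le_of_lt ?_ (half_lt_self hδ)
    rw [dist_pi_le_iff (by positivity)]
    intro a
    rw [dist_pi_le_iff (by positivity)]
    intro b
    rw [Real.dist_eq, hT, hI]
    exact hP a b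
  have h2 := h h1
  have h3 : (Matrix.of I).det = 1 := by
    rw [hI]; exact Matrix.det_one
  have h4 : (Matrix.of T).det = P.det := by
    rw [hT]; rfl
  rw [Real.dist_eq, h3, h4] at h2
  linarith [(abs_lt.1 h2).1]

variable {θ₁ θ₂ : ℝ} (D : RegularizedCone n θ₁ θ₂) {s : ℝ}

/-- The vertices of size larger than `a₀` with the isometries moving the axis towards the origin of
the data. -/
def Placement (a₀ : ℝ) : Type :=
  {q : E n × (E n ≃ₗᵢ[ℝ] E n) // a₀ < ‖q.1‖ ∧ ‖q.1‖ • q.2 D.axis = -q.1}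

lemma exists_decay_patch (h1 : 0 < θ₁) (h2 : θ₁ < Real.pi) (hs : 0 < s) (M : AFEnd n s)
    {χ : E n → ℝ} (hχ : IsAngularCutoff D χ) : ∃ a₀ : ℝ, 2 ≤ a₀ ∧
    ∀ {ι : Type} (q : ι → Placement D a₀),
      (∀ a b, Decay (fun i => D.region (q i).1.2) 2 (fun i _ => ‖(q i).1.1‖ ^ (-s)) 0 fun i x =>
        M.patchMetric χ (q i).1.1 (q i).1.2 x a b - (1 : Matrix (Fin n) (Fin n) ℝ) a b) ∧
      ∀ a b, Decay (fun i => D.region (q i).1.2) 1 (fun i _ => ‖(q i).1.1‖ ^ (-s)) 1 fun i x =>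
        M.patchTensor χ (q i).1.1 (q i).1.2 x a b := by
  obtain ⟨κ, hκ, hsep⟩ := exists_separation D h1 h2
  refine ⟨max 2 (M.R / κ), le_max_left _ _, fun {ι} q => ?_⟩
  have ha2 : ∀ i, 2 < ‖(q i).1.1‖ := fun i => (le_max_left _ _).trans_lt (q i).2.1
  have ha : ∀ i, 0 < ‖(q i).1.1‖ := fun i => by linarith [ha2 i]
  have hS : ∀ i, IsOpen (D.region (q i).1.2) := fun i => isOpen_region _ D
  have hS1 : ∀ i, ∀ x ∈ D.region (q i).1.2, κ * ‖(q i).1.1‖ ≤ ‖x + (q i).1.1‖ := fun i x hx =>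
    (hsep _ _ (ha2 i).le (q i).2.2 x hx).1
  have hS2 : ∀ i, ∀ x ∈ D.region (q i).1.2, κ * jb x ≤ ‖x + (q i).1.1‖ := fun i x hx =>
    (hsep _ _ (ha2 i).le (q i).2.2 x hx).2
  have hSR : ∀ i, ∀ x ∈ D.region (q i).1.2, M.R < ‖x + (q i).1.1‖ := fun i x hx => by
    refine lt_of_lt_of_le ?_ (hS1 i x hx)
    have h3 : M.R / κ < ‖(q i).1.1‖ := (le_max_right _ _).trans_lt (q i).2.1
    rwa [div_lt_iff₀' hκ] at h3
  have hχd := Decay.of_angularCutoff hχ hS fun i => (q i).1.2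
  constructor
  · intro a b
    refine (hχd.mul hS (decay_of_decaysLike_two hs.le hκ ha hS1 hS2 hSR (M.g_decay a b))
      (fun _ _ _ => (one_mul _).le) (zero_add 0)).congr hS fun i x _ => ?_
    simp only [AFEnd.patchMetric, Matrix.add_apply, Matrix.smul_apply, smul_eq_mul]
    ring
  · intro a b
    exact hχd.of_succ.mul hS (decay_of_decaysLike_one hs.le hκ ha hS1 hS2 hSR (M.k_decay a b))
      (fun _ _ _ => (one_mul _).le) (zero_add 1)

lemma exists_nearlyFlat (h1 : 0 < θ₁) (h2 : θ₁ < Real.pi) (hs : 0 < s) (M : AFEnd n s)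
    {χ : E n → ℝ} (hχ : IsAngularCutoff D χ) : ∃ a₀ : ℝ, 2 ≤ a₀ ∧
    ∀ {ι : Type} (q : ι → Placement D a₀),
      NearlyFlat (fun i => D.region (q i).1.2) (fun i _ => ‖(q i).1.1‖ ^ (-s))
        (fun i => M.patchMetric χ (q i).1.1 (q i).1.2) ∧
      ∀ a b, Decay (fun i => D.region (q i).1.2) 1 (fun i _ => ‖(q i).1.1‖ ^ (-s)) 1 fun i x =>
        M.patchMomentum χ (q i).1.1 (q i).1.2 x a b := by
  obtain ⟨a₁, ha₁, hdec⟩ := exists_decay_patch D h1 h2 hs M hχ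
  obtain ⟨η, hη, hdet⟩ := exists_det_ge n
  -- The constants are fixed for the family of all placements beyond `a₁` before the threshold is
  -- raised to `a₂`, so that they do not depend on `a₂`.
  have hC : ∀ a b : Fin n, ∃ C : ℝ, 0 ≤ C ∧ ∀ q : Placement D a₁, ∀ x ∈ D.region q.1.2,
      |M.patchMetric χ q.1.1 q.1.2 x a b - (1 : Matrix (Fin n) (Fin n) ℝ) a b| ≤
        C * ‖q.1.1‖ ^ (-s) := by
    intro a b
    obtain ⟨C, hC, h⟩ := ((hdec (ι := Placement D a₁) id).1 a b).bound
    refine ⟨C, hC, fun q x hx => ?_⟩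
    have := h q x hx
    rwa [neg_zero, zpow_zero, mul_one] at this
  choose C hC0 hC using hC
  obtain ⟨B, hB⟩ : ∃ B, B = ∑ a, ∑ b, C a b := ⟨_, rfl⟩
  have hlim : Tendsto (fun y : ℝ => B * y ^ (-s)) atTop (𝓝 0) := by
    simpa using (tendsto_rpow_neg_atTop hs).const_mul B
  obtain ⟨a₂, ha₂⟩ := (hlim.eventually (gt_mem_nhds hη)).exists_forall_of_atTop
  refine ⟨max a₁ a₂, ha₁.trans (le_max_left _ _), fun {ι} q => ?_⟩
  obtain ⟨q', hq'⟩ : ∃ q' : ι → Placement D a₁, ∀ i, (q' i).1 = (q i).1 :=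
    ⟨fun i => ⟨(q i).1, (le_max_left _ _).trans_lt (q i).2.1, (q i).2.2⟩, fun i => rfl⟩
  have hd := hdec q'
  simp only [hq'] at hd
  have hflat : NearlyFlat (fun i => D.region (q i).1.2) (fun i _ => ‖(q i).1.1‖ ^ (-s))
      (fun i => M.patchMetric χ (q i).1.1 (q i).1.2) := by
    refine ⟨fun i => isOpen_region _ D, fun i x _ => by positivity, fun i x _ => ?_, hd.1,
      1 / 2, by norm_num, fun i x hx => hdet _ fun a b => ?_⟩
    · have h3 : 1 ≤ ‖(q i).1.1‖ := by
        have := (le_max_left a₁ a₂).trans_lt (q i).2.1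
        linarith
      exact Real.rpow_le_one_of_one_le_of_nonpos h3 (by linarith)
    · have h3 := hC a b (q' i) x (by rw [hq']; exact hx)
      rw [hq'] at h3
      refine h3.trans (le_trans ?_ (ha₂ ‖(q i).1.1‖
        ((le_max_right a₁ a₂).trans (q i).2.1.le)).le)
      have h4 : C a b ≤ B := by
        rw [hB]
        exact (Finset.single_le_sum (f := fun b => C a b) (fun _ _ => hC0 _ _)
          (Finset.mem_univ b)).trans (Finset.single_le_sum (f := fun a => ∑ b, C a b)
          (fun _ _ => Finset.sum_nonneg fun _ _ => hC0 _ _) (Finset.mem_univ a))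
      gcongr
  exact ⟨hflat, hflat.momentum hd.2⟩

/-- The adjoint operator of the patched data is close to the adjoint operator of the flat data. -/
theorem exists_adjoint_bounds (h1 : 0 < θ₁) (h2 : θ₁ < Real.pi) (hs : 0 < s) (M : AFEnd n s)
    {χ : E n → ℝ} (hχ : IsAngularCutoff D χ) : ∃ a₀ C : ℝ, 2 ≤ a₀ ∧ 0 ≤ C ∧
    ∀ (a : E n) (A : E n ≃ₗᵢ[ℝ] E n), a₀ < ‖a‖ → ‖a‖ • A D.axis = -a →
    ∀ (J : (Fin n → ℕ) → E n → ℝ) (W : (Fin n → ℕ) → E n → E n), ∀ x ∈ D.region A, ∀ i j,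
      |adjoint₁ (M.patchMetric χ a A) (M.patchMomentum χ a A) J W x i j -
        (flatHessian J x i j - (∑ c, flatHessian J x c c) *
          (1 : Matrix (Fin n) (Fin n) ℝ) i j)| ≤ C * (‖a‖ ^ (-s) * jetSize J W x) ∧
      |adjoint₂ (M.patchMetric χ a A) (M.patchMomentum χ a A) J W x i j -
        (-(1 / 2 : ℝ)) * symDeriv W x i j| ≤ C * (‖a‖ ^ (-s) * jetSize J W x * jb x) := by
  obtain ⟨a₀, ha₀, hflat⟩ := exists_nearlyFlat D h1 h2 hs M hχ
  -- The jets of `u` and `Z` are part of the index of the family, so the constants are uniform in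
  -- them as well.
  obtain ⟨hg, hπ⟩ := hflat (ι := Placement D a₀ × ((Fin n → ℕ) → E n → ℝ) ×
    ((Fin n → ℕ) → E n → E n)) fun i => i.1
  have b1 := fun i j => (hg.adjoint₁_sub (fun i => i.2.1) (fun i => i.2.2) hπ i j).bound
  have b2 := fun i j => (hg.adjoint₂_sub (fun i => i.2.1) (fun i => i.2.2) hπ i j).bound
  choose C₁ hC₁ b1 using b1
  choose C₂ hC₂ b2 using b2
  refine ⟨a₀, ∑ i, ∑ j, (C₁ i j + C₂ i j), ha₀, Finset.sum_nonneg fun i _ => Finset.sum_nonneg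
    fun j _ => add_nonneg (hC₁ i j) (hC₂ i j), fun a A ha hA J W x hx i j => ?_⟩
  have hle : C₁ i j + C₂ i j ≤ ∑ i, ∑ j, (C₁ i j + C₂ i j) :=
    (Finset.single_le_sum (f := fun j => C₁ i j + C₂ i j)
      (fun j _ => add_nonneg (hC₁ i j) (hC₂ i j)) (Finset.mem_univ j)).trans
    (Finset.single_le_sum (f := fun i => ∑ j, (C₁ i j + C₂ i j)) (fun i _ => Finset.sum_nonneg
      fun j _ => add_nonneg (hC₁ i j) (hC₂ i j)) (Finset.mem_univ i))
  have e1 := b1 i j (⟨(a, A), ha, hA⟩, J, W) x hx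
  have e2 := b2 i j (⟨(a, A), ha, hA⟩, J, W) x hx
  have hQ := jetSize_nonneg J W x
  have hj := (jb_pos x).le
  have hε : 0 ≤ ‖a‖ ^ (-s) := by positivity
  simp only [neg_zero, zpow_zero, mul_one] at e1
  rw [neg_neg, zpow_one] at e2
  exact ⟨e1.trans (mul_le_mul_of_nonneg_right (by linarith [hC₂ i j]) (by positivity)),
    e2.trans (mul_le_mul_of_nonneg_right (by linarith [hC₁ i j]) (by positivity))⟩

end PatchEstimates

/-! ### Algebra of the flat operator and the density of jets -/

section Absorption

variable {n : ℕ}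

/-- The trace of `H - (tr H) 1` is `(1 - n) tr H`. For `n ≥ 2` it determines the trace of `H`, and
hence `H`. -/
lemma sum_sq_le_sum_sq_sub_trace (hn : 2 ≤ n) (H : Matrix (Fin n) (Fin n) ℝ) :
    ∑ i, ∑ j, H i j ^ 2 ≤ (2 + 2 * n ^ 2) *
      ∑ i, ∑ j, (H i j - (∑ c, H c c) * (1 : Matrix (Fin n) (Fin n) ℝ) i j) ^ 2 := by
  obtain ⟨τ, hτ⟩ : ∃ τ, τ = ∑ c, H c c := ⟨_, rfl⟩
  rw [← hτ]
  obtain ⟨M, hM⟩ : ∃ M : Matrix (Fin n) (Fin n) ℝ,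
      ∀ i j, M i j = H i j - τ * (1 : Matrix (Fin n) (Fin n) ℝ) i j :=
    ⟨fun i j => H i j - τ * (1 : Matrix (Fin n) (Fin n) ℝ) i j, fun _ _ => rfl⟩
  simp only [← hM]
  obtain ⟨T, hT⟩ : ∃ T, T = ∑ i, ∑ j, M i j ^ 2 := ⟨_, rfl⟩
  have hn' : (2 : ℝ) ≤ n := by exact_mod_cast hn
  have htr : ∑ i, M i i = (1 - n) * τ := by
    simp only [hM, Finset.sum_sub_distrib, ← hτ, Matrix.one_apply_eq]
    simp
    ring
  have h1 : (∑ i, M i i) ^ 2 ≤ n * T := by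
    calc (∑ i, M i i) ^ 2 ≤ n * ∑ i, M i i ^ 2 := by
          simpa using sq_sum_le_card_mul_sum_sq (s := Finset.univ) (f := fun i => M i i)
      _ ≤ n * T := by
          rw [hT]
          gcongr with i
          exact Finset.single_le_sum (f := fun j => M i j ^ 2) (fun _ _ => sq_nonneg _)
            (Finset.mem_univ i)
  have h2 : τ ^ 2 ≤ n * T := by
    rw [htr] at h1
    have h3 : 1 * τ ^ 2 ≤ (n - 1 : ℝ) ^ 2 * τ ^ 2 := by
      gcongr
      nlinarith
    nlinarith
  have h4 : ∑ i, ∑ j, H i j ^ 2 ≤ ∑ i, ∑ j,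
      (2 * M i j ^ 2 + 2 * τ ^ 2 * (1 : Matrix (Fin n) (Fin n) ℝ) i j ^ 2) := by
    refine Finset.sum_le_sum fun i _ => Finset.sum_le_sum fun j _ => ?_
    have h5 : H i j = M i j + τ * (1 : Matrix (Fin n) (Fin n) ℝ) i j := by rw [hM]; ring
    rw [h5]
    nlinarith [sq_nonneg (M i j - τ * (1 : Matrix (Fin n) (Fin n) ℝ) i j)]
  have h6 : ∑ i, ∑ j, (2 * M i j ^ 2 + 2 * τ ^ 2 * (1 : Matrix (Fin n) (Fin n) ℝ) i j ^ 2) =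
      2 * T + 2 * τ ^ 2 * n := by
    simp only [Finset.sum_add_distrib, ← Finset.mul_sum, ← hT]
    simp [Matrix.one_apply]
  rw [h6] at h4
  rw [← hT]
  nlinarith [mul_le_mul_of_nonneg_left h2 (show (0 : ℝ) ≤ 2 * n by positivity)]

lemma sum_sq_le_of_abs_sub_le {A B : Matrix (Fin n) (Fin n) ℝ} {δ : ℝ}
    (h : ∀ i j, |A i j - B i j| ≤ δ) :
    ∑ i, ∑ j, B i j ^ 2 ≤ 2 * (∑ i, ∑ j, A i j ^ 2) + 2 * n ^ 2 * δ ^ 2 := by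
  have h1 : ∑ i, ∑ j, B i j ^ 2 ≤ ∑ i : Fin n, ∑ j : Fin n, (2 * A i j ^ 2 + 2 * δ ^ 2) := by
    refine Finset.sum_le_sum fun i _ => Finset.sum_le_sum fun j _ => ?_
    have h2 : (A i j - B i j) ^ 2 ≤ δ ^ 2 := by
      rw [← sq_abs]
      exact pow_le_pow_left₀ (abs_nonneg _) (h i j) 2
    nlinarith [sq_nonneg (2 * A i j - B i j)]
  refine h1.trans (le_of_eq ?_)
  simp only [Finset.sum_add_distrib, ← Finset.mul_sum, Finset.sum_const, Finset.card_univ,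
    Fintype.card_fin, nsmul_eq_mul]
  ring

lemma sq_sum_five_le (a b c d e : ℝ) :
    (a + b + c + d + e) ^ 2 ≤ 5 * (a ^ 2 + b ^ 2 + c ^ 2 + d ^ 2 + e ^ 2) := by
  nlinarith [sq_nonneg (a - b), sq_nonneg (a - c), sq_nonneg (a - d), sq_nonneg (a - e),
    sq_nonneg (b - c), sq_nonneg (b - d), sq_nonneg (b - e), sq_nonneg (c - d), sq_nonneg (c - e),
    sq_nonneg (d - e)]

variable (J : (Fin n → ℕ) → E n → ℝ) (W : (Fin n → ℕ) → E n → E n)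

/-- Passes from the sums of absolute values suited to pointwise bounds to the sums of squares in the
Sobolev norm, and from `1 + |x|²` to the weight `r`. -/
lemma jetSize_sq_le (hn : 1 ≤ n) {x : E n} {ϱ M : ℝ} (hϱ : 0 < ϱ) (hM : 1 ≤ M)
    (hj : ϱ ≤ M * jb x) : jetSize J W x ^ 2 ≤ 5 * M ^ 4 * n ^ 3 *
      ((∑ i, ∑ j, flatHessian J x i j ^ 2) + (∑ i, J (Pi.single i 1) x ^ 2) * ϱ ^ (-2 : ℤ) +
        J 0 x ^ 2 * ϱ ^ (-4 : ℤ) + (∑ i, ‖W (Pi.single i 1) x‖ ^ 2) * ϱ ^ (-2 : ℤ) +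
        ‖W 0 x‖ ^ 2 * ϱ ^ (-4 : ℤ)) := by
  have hn' : (1 : ℝ) ≤ n := by exact_mod_cast hn
  have hjp := jb_pos x
  have hM0 : 0 < M := by linarith
  have k1 : jb x ^ (-1 : ℤ) ≤ M * ϱ ^ (-1 : ℤ) := by
    rw [zpow_neg_one, zpow_neg_one, inv_le_iff_one_le_mul₀ hjp]
    field_simp
    linarith
  have hm1 : 0 < ϱ ^ (-1 : ℤ) := by positivity
  have hjm1 : 0 < jb x ^ (-1 : ℤ) := by positivity
  obtain ⟨y, hy⟩ : ∃ y, y = ϱ ^ (-1 : ℤ) := ⟨_, rfl⟩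
  obtain ⟨z, hz⟩ : ∃ z, z = jb x ^ (-1 : ℤ) := ⟨_, rfl⟩
  have y2 : ϱ ^ (-2 : ℤ) = y ^ 2 := by rw [hy, ← zpow_natCast, ← zpow_mul]; norm_num
  have y4 : ϱ ^ (-4 : ℤ) = y ^ 4 := by rw [hy, ← zpow_natCast, ← zpow_mul]; norm_num
  have z2 : jb x ^ (-2 : ℤ) = z ^ 2 := by rw [hz, ← zpow_natCast, ← zpow_mul]; norm_num
  rw [← hy] at k1 hm1
  rw [← hz] at k1 hjm1
  have s1 : (∑ i, ∑ j, |J (Pi.single i 1 + Pi.single j 1) x|) ^ 2 ≤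
      n ^ 2 * ∑ i, ∑ j, flatHessian J x i j ^ 2 := by
    have h := sq_sum_le_card_mul_sum_sq (s := (Finset.univ : Finset (Fin n × Fin n)))
      (f := fun q => |J (Pi.single q.1 1 + Pi.single q.2 1) x|)
    rw [Fintype.sum_prod_type, Fintype.sum_prod_type] at h
    simp only [sq_abs, Finset.card_univ, Fintype.card_prod, Fintype.card_fin] at h
    refine h.trans (le_of_eq ?_)
    push_cast
    simp only [flatHessian]
    ring
  have s2 : (∑ i, |J (Pi.single i 1) x|) ^ 2 ≤ n * ∑ i, J (Pi.single i 1) x ^ 2 := by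
    simpa using sq_sum_le_card_mul_sum_sq (s := (Finset.univ : Finset (Fin n)))
      (f := fun i => |J (Pi.single i 1) x|)
  have s0 : ∀ v : E n, ∑ i, |v i| ≤ n * ‖v‖ := by
    intro v
    refine (Finset.sum_le_sum (g := fun _ => ‖v‖) fun i _ => PiLp.norm_apply_le v i).trans ?_
    simp
  have s3 : (∑ l, ∑ i, |W (Pi.single l 1) x i|) ^ 2 ≤
      n ^ 3 * ∑ l, ‖W (Pi.single l 1) x‖ ^ 2 := by
    calc (∑ l, ∑ i, |W (Pi.single l 1) x i|) ^ 2 ≤ (∑ l, n * ‖W (Pi.single l 1) x‖) ^ 2 := by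
          gcongr with l
          exact s0 _
      _ ≤ n * ∑ l, (n * ‖W (Pi.single l 1) x‖) ^ 2 := by
          simpa using sq_sum_le_card_mul_sum_sq (s := (Finset.univ : Finset (Fin n)))
            (f := fun l => n * ‖W (Pi.single l 1) x‖)
      _ = _ := by
          simp only [mul_pow, ← Finset.mul_sum]
          ring
  have s4 : (∑ i, |W 0 x i|) ^ 2 ≤ n ^ 2 * ‖W 0 x‖ ^ 2 := by
    rw [← mul_pow]
    exact pow_le_pow_left₀ (Finset.sum_nonneg fun _ _ => abs_nonneg _) (s0 _) 2
  have n1 : (1 : ℝ) ≤ n ^ 3 := one_le_pow₀ hn'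
  have n2 : (n : ℝ) ≤ n ^ 3 := le_self_pow₀ hn' (by norm_num)
  have n3 : (n : ℝ) ^ 2 ≤ n ^ 3 := pow_le_pow_right₀ hn' (by norm_num)
  have m1 : 1 ≤ M ^ 4 := one_le_pow₀ hM
  have m2 : M ^ 2 ≤ M ^ 4 := pow_le_pow_right₀ hM (by norm_num)
  have zz : z ^ 2 ≤ M ^ 4 * y ^ 2 := by
    calc z ^ 2 ≤ (M * y) ^ 2 := by gcongr
      _ = M ^ 2 * y ^ 2 := by ring
      _ ≤ _ := by gcongr
  have zzz : (z ^ 2) ^ 2 ≤ M ^ 4 * y ^ 4 := by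
    calc (z ^ 2) ^ 2 ≤ ((M * y) ^ 2) ^ 2 := by gcongr
      _ = _ := by ring
  rw [jetSize, y2, y4, z2, ← hz]
  refine (sq_sum_five_le _ _ _ _ _).trans ?_
  have g1 : (∑ i, ∑ j, |J (Pi.single i 1 + Pi.single j 1) x|) ^ 2 ≤
      M ^ 4 * n ^ 3 * ∑ i, ∑ j, flatHessian J x i j ^ 2 := by
    refine s1.trans ?_
    gcongr
    calc (n : ℝ) ^ 2 ≤ 1 * n ^ 3 := by linarith
      _ ≤ _ := by gcongr
  have g2 : ((∑ i, |J (Pi.single i 1) x|) * z) ^ 2 ≤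
      M ^ 4 * n ^ 3 * ((∑ i, J (Pi.single i 1) x ^ 2) * y ^ 2) := by
    rw [mul_pow]
    calc _ ≤ (n ^ 3 * ∑ i, J (Pi.single i 1) x ^ 2) * (M ^ 4 * y ^ 2) := by
          gcongr
          exact s2.trans (by gcongr)
      _ = _ := by ring
  have g3 : (|J 0 x| * z ^ 2) ^ 2 ≤ M ^ 4 * n ^ 3 * (J 0 x ^ 2 * y ^ 4) := by
    rw [mul_pow, sq_abs]
    calc J 0 x ^ 2 * (z ^ 2) ^ 2 ≤ 1 * J 0 x ^ 2 * (M ^ 4 * y ^ 4) := by rw [one_mul]; gcongr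
      _ ≤ n ^ 3 * J 0 x ^ 2 * (M ^ 4 * y ^ 4) := by gcongr
      _ = _ := by ring
  have g4 : ((∑ l, ∑ i, |W (Pi.single l 1) x i|) * z) ^ 2 ≤
      M ^ 4 * n ^ 3 * ((∑ i, ‖W (Pi.single i 1) x‖ ^ 2) * y ^ 2) := by
    rw [mul_pow]
    calc _ ≤ (n ^ 3 * ∑ i, ‖W (Pi.single i 1) x‖ ^ 2) * (M ^ 4 * y ^ 2) := by gcongr
      _ = _ := by ring
  have g5 : ((∑ i, |W 0 x i|) * z ^ 2) ^ 2 ≤ M ^ 4 * n ^ 3 * (‖W 0 x‖ ^ 2 * y ^ 4) := by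
    rw [mul_pow]
    calc _ ≤ (n ^ 3 * ‖W 0 x‖ ^ 2) * (M ^ 4 * y ^ 4) := by
          gcongr
          exact s4.trans (by gcongr)
      _ = _ := by ring
  linarith

/-- The weighted density of the jets of a function and of a vector field. -/
def jetDensity (r ρ : E n → ℝ) (b : ℝ) (x : E n) : ℝ≥0∞ :=
  ((∑ i, ∑ j, ‖flatHessian J x i j‖ₑ ^ 2) * ENNReal.ofReal (r x ^ (b + 2) * ρ x) +
    ∑ i, ‖J (Pi.single i 1) x‖ₑ ^ 2 * ENNReal.ofReal (r x ^ b * ρ x)) +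
  ‖J 0 x‖ₑ ^ 2 * ENNReal.ofReal (r x ^ (b - 2) * ρ x) +
  (∑ i, ‖W (Pi.single i 1) x‖ₑ ^ 2 * ENNReal.ofReal (r x ^ b * ρ x)) +
  ‖W 0 x‖ₑ ^ 2 * ENNReal.ofReal (r x ^ (b - 2) * ρ x)

lemma jetDensity_eq {r ρ : E n → ℝ} {b : ℝ} {x : E n} (hr : 0 < r x) (hρ : 0 ≤ ρ x) :
    jetDensity J W r ρ b x = ENNReal.ofReal
      (((∑ i, ∑ j, flatHessian J x i j ^ 2) + (∑ i, J (Pi.single i 1) x ^ 2) * r x ^ (-2 : ℤ) +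
        J 0 x ^ 2 * r x ^ (-4 : ℤ) + (∑ i, ‖W (Pi.single i 1) x‖ ^ 2) * r x ^ (-2 : ℤ) +
        ‖W 0 x‖ ^ 2 * r x ^ (-4 : ℤ)) * (r x ^ (b + 2) * ρ x)) := by
  have e0 : r x ^ b = r x ^ (-2 : ℤ) * r x ^ (b + 2) := by
    rw [← Real.rpow_intCast, ← Real.rpow_add hr]
    congr 1; push_cast; ring
  have e2 : r x ^ (b - 2) = r x ^ (-4 : ℤ) * r x ^ (b + 2) := by
    rw [← Real.rpow_intCast, ← Real.rpow_add hr]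
    congr 1; push_cast; ring
  have hp : 0 ≤ r x ^ (b + 2) := Real.rpow_nonneg hr.le _
  unfold jetDensity
  simp only [enorm_sq_mul_ofReal]
  rw [sum_enorm_sq_mul_ofReal, e0, e2,
    ← ENNReal.ofReal_sum_of_nonneg fun i _ => by positivity,
    ← ENNReal.ofReal_sum_of_nonneg fun i _ => by positivity,
    ← ENNReal.ofReal_add (by positivity) (by positivity),
    ← ENNReal.ofReal_add (by positivity) (by positivity),
    ← ENNReal.ofReal_add (by positivity) (by positivity),
    ← ENNReal.ofReal_add (by positivity) (by positivity)]
  congr 1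
  simp only [← Finset.sum_mul, Real.norm_eq_abs, sq_abs]
  ring

variable {θ₁ θ₂ : ℝ} (D : RegularizedCone n θ₁ θ₂) {r : E n → ℝ} {A : E n ≃ₗᵢ[ℝ] E n} {N : ℕ}
  {b q : ℝ}

lemma aemeasurable_jetDensity (hr : IsRadialWeight r)
    (hJ : ∀ β : Fin n → ℕ, ∑ i, β i ≤ 2 → AEStronglyMeasurable (J β) (volume.restrict (D.region A)))
    (hW : ∀ β : Fin n → ℕ, ∑ i, β i ≤ 1 → AEStronglyMeasurable (W β) (volume.restrict (D.region A))) :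
    AEMeasurable (jetDensity J W r (D.weight A N) b) (volume.restrict (D.region A)) := by
  have hw := aemeasurable_weight D hr A N
  refine ((((?_ : AEMeasurable _ _).add ?_).add ?_).add ?_).add ?_
  · exact (Finset.aemeasurable_fun_sum _ fun i _ => Finset.aemeasurable_fun_sum _ fun j _ =>
      (hJ (Pi.single i 1 + Pi.single j 1) (by simp [Finset.sum_add_distrib])).enorm.pow_const 2).mul
        (hw _)
  · exact Finset.aemeasurable_fun_sum _ fun i _ =>
      ((hJ (Pi.single i 1) (by simp)).enorm.pow_const 2).mul (hw _)
  · exact ((hJ 0 (by simp)).enorm.pow_const 2).mul (hw _)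
  · exact Finset.aemeasurable_fun_sum _ fun i _ =>
      ((hW (Pi.single i 1) (by simp)).enorm.pow_const 2).mul (hw _)
  · exact ((hW 0 (by simp)).enorm.pow_const 2).mul (hw _)

/-- The constant counts the terms: `n²` second derivatives, `n` first derivatives and the value. -/
lemma lintegral_jetDensity_le (hr : IsRadialWeight r) (hq : -(n : ℝ) + 2 * q = b - 2)
    (hJ : ∀ β : Fin n → ℕ, ∑ i, β i ≤ 2 → AEStronglyMeasurable (J β) (volume.restrict (D.region A)))
    (hW : ∀ β : Fin n → ℕ, ∑ i, β i ≤ 1 → AEStronglyMeasurable (W β) (volume.restrict (D.region A))) :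
    ∫⁻ x in D.region A, jetDensity J W r (D.weight A N) b x ≤ (n ^ 2 + n + 1) *
      (sobolevNormSq 2 q r (D.weight A N) (D.region A) J +
        sobolevNormSq 1 q r (D.weight A N) (D.region A) W) := by
  have hw := aemeasurable_weight D hr A N
  have m1 : ∀ i : Fin n, AEMeasurable (fun x => ‖J (Pi.single i 1) x‖ₑ ^ 2 *
      ENNReal.ofReal (r x ^ b * D.weight A N x)) (volume.restrict (D.region A)) := fun i =>
    ((hJ (Pi.single i 1) (by simp)).enorm.pow_const 2).mul (hw _)
  have m2 : AEMeasurable (fun x => ‖J 0 x‖ₑ ^ 2 *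
      ENNReal.ofReal (r x ^ (b - 2) * D.weight A N x)) (volume.restrict (D.region A)) :=
    ((hJ 0 (by simp)).enorm.pow_const 2).mul (hw _)
  have m3 : ∀ i : Fin n, AEMeasurable (fun x => ‖W (Pi.single i 1) x‖ₑ ^ 2 *
      ENNReal.ofReal (r x ^ b * D.weight A N x)) (volume.restrict (D.region A)) := fun i =>
    ((hW (Pi.single i 1) (by simp)).enorm.pow_const 2).mul (hw _)
  have m4 : AEMeasurable (fun x => ‖W 0 x‖ₑ ^ 2 *
      ENNReal.ofReal (r x ^ (b - 2) * D.weight A N x)) (volume.restrict (D.region A)) :=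
    ((hW 0 (by simp)).enorm.pow_const 2).mul (hw _)
  unfold jetDensity
  rw [lintegral_add_right' _ m4, lintegral_add_right' _ (Finset.aemeasurable_fun_sum _ fun i _ => m3 i),
    lintegral_add_right' _ m2, lintegral_add_right' _ (Finset.aemeasurable_fun_sum _ fun i _ => m1 i),
    lintegral_finsetSum' _ fun i _ => m1 i, lintegral_finsetSum' _ fun i _ => m3 i]
  set X := sobolevNormSq 2 q r (D.weight A N) (D.region A) J
  set Y := sobolevNormSq 1 q r (D.weight A N) (D.region A) W
  have e1 : ∫⁻ x in D.region A, (∑ i, ∑ j, ‖flatHessian J x i j‖ₑ ^ 2) *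
      ENNReal.ofReal (r x ^ (b + 2) * D.weight A N x) ≤ ∑ i : Fin n, ∑ j : Fin n, X := by
    refine (tensorInt_eq_sum (T := flatHessian J) (hw (b + 2)) fun i j =>
      hJ (Pi.single i 1 + Pi.single j 1) (by simp [Finset.sum_add_distrib])).le.trans ?_
    exact Finset.sum_le_sum fun i _ => Finset.sum_le_sum fun j _ =>
      le_sobolevNormSq_single_add hq J i j
  have e2 : ∑ i : Fin n, ∫⁻ x in D.region A, ‖J (Pi.single i 1) x‖ₑ ^ 2 *
      ENNReal.ofReal (r x ^ b * D.weight A N x) ≤ ∑ i : Fin n, X :=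
    Finset.sum_le_sum fun i _ => le_sobolevNormSq_single hq (by norm_num) J i
  have e3 : ∫⁻ x in D.region A, ‖J 0 x‖ₑ ^ 2 *
      ENNReal.ofReal (r x ^ (b - 2) * D.weight A N x) ≤ X := le_sobolevNormSq_zero hq 2 J
  have e4 : ∑ i : Fin n, ∫⁻ x in D.region A, ‖W (Pi.single i 1) x‖ₑ ^ 2 *
      ENNReal.ofReal (r x ^ b * D.weight A N x) ≤ ∑ i : Fin n, Y :=
    Finset.sum_le_sum fun i _ => le_sobolevNormSq_single hq le_rfl W i
  have e5 : ∫⁻ x in D.region A, ‖W 0 x‖ₑ ^ 2 *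
      ENNReal.ofReal (r x ^ (b - 2) * D.weight A N x) ≤ Y := le_sobolevNormSq_zero hq 1 W
  refine (add_le_add (add_le_add (add_le_add (add_le_add e1 e2) e3) e4) e5).trans ?_
  simp only [Finset.sum_const, Finset.card_univ, Fintype.card_fin, nsmul_eq_mul]
  calc _ = (n ^ 2 + n + 1) * X + (n + 1) * Y := by ring
    _ ≤ (n ^ 2 + n + 1) * X + (n ^ 2 + n + 1) * Y := by
        gcongr
        exact le_add_of_nonneg_left zero_le
    _ = _ := by ring

/-- Absorption in extended nonnegative numbers, where finiteness of the absorbed quantity has to be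
known. -/
lemma le_two_mul_of_le_add_half {X Y : ℝ≥0∞} (hX : X ≠ ⊤) (h : X ≤ Y + X / 2) : X ≤ 2 * Y := by
  have h1 : X / 2 ≤ Y := by
    rw [← ENNReal.sub_half hX]
    exact tsub_le_iff_right.2 h
  calc X = 2 * (X / 2) := by rw [ENNReal.mul_div_cancel (by simp) (by simp)]
    _ ≤ _ := by gcongr

end Absorption

/-! ### The perturbation argument -/

section Estimate

variable {n : ℕ} {J : (Fin n → ℕ) → E n → ℝ} {W : (Fin n → ℕ) → E n → E n} {r ρ : E n → ℝ}
  {b ε C m M : ℝ} {x : E n} {T : Matrix (Fin n) (Fin n) ℝ}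

lemma ofReal_le_add_mul_ofReal {X Y Z K L w : ℝ} (hY : 0 ≤ Y) (hZ : 0 ≤ Z) (hK : 0 ≤ K)
    (hL : 0 ≤ L) (hw : 0 ≤ w) (h : X ≤ K * Y + L * Z) :
    ENNReal.ofReal (X * w) ≤ ENNReal.ofReal K * ENNReal.ofReal (Y * w) +
      ENNReal.ofReal L * ENNReal.ofReal (Z * w) := by
  rw [← ENNReal.ofReal_mul hK, ← ENNReal.ofReal_mul hL, ← ENNReal.ofReal_add (by positivity)
    (by positivity)]
  refine ENNReal.ofReal_le_ofReal ?_
  calc X * w ≤ (K * Y + L * Z) * w := by gcongr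
    _ = _ := by ring

/-- The Hessian is recovered from the trace-reversed Hessian, and the latter is the first component
of the adjoint up to an error of size `ε` times the jets, hence `ε²` after squaring. -/
lemma flatHessian_density_le (hn : 2 ≤ n) (hr : 0 < r x) (hρ : 0 ≤ ρ x) (hM : 1 ≤ M)
    (hrM : r x ≤ M * jb x)
    (h : ∀ i j, |T i j - (flatHessian J x i j - (∑ c, flatHessian J x c c) *
      (1 : Matrix (Fin n) (Fin n) ℝ) i j)| ≤ C * (ε * jetSize J W x)) :
    (∑ i, ∑ j, ‖flatHessian J x i j‖ₑ ^ 2) * ENNReal.ofReal (r x ^ (b + 2) * ρ x) ≤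
      ENNReal.ofReal ((2 + 2 * n ^ 2) * 2) *
        ((∑ i, ∑ j, ‖T i j‖ₑ ^ 2) * ENNReal.ofReal (r x ^ (b + 2) * ρ x)) +
      ENNReal.ofReal ((2 + 2 * n ^ 2) * (2 * n ^ 2 * C ^ 2 * (5 * M ^ 4 * n ^ 3)) * ε ^ 2) *
        jetDensity J W r ρ b x := by
  rw [jetDensity_eq J W hr hρ, sum_enorm_sq_mul_ofReal, sum_enorm_sq_mul_ofReal]
  have hp : 0 ≤ r x ^ (b + 2) := Real.rpow_nonneg hr.le _
  refine ofReal_le_add_mul_ofReal (by positivity) (by positivity) (by positivity) (by positivity)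
    (by positivity) ?_
  have h1 := sum_sq_le_sum_sq_sub_trace hn (flatHessian J x)
  have h2 := sum_sq_le_of_abs_sub_le (B := fun i j => flatHessian J x i j -
    (∑ c, flatHessian J x c c) * (1 : Matrix (Fin n) (Fin n) ℝ) i j) h
  have h3 := jetSize_sq_le J W (by omega) hr hM hrM
  refine h1.trans ?_
  calc _ ≤ (2 + 2 * (n : ℝ) ^ 2) * (2 * (∑ i, ∑ j, T i j ^ 2) +
        2 * n ^ 2 * (C * (ε * jetSize J W x)) ^ 2) := by gcongr
    _ = (2 + 2 * (n : ℝ) ^ 2) * 2 * (∑ i, ∑ j, T i j ^ 2) +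
        (2 + 2 * (n : ℝ) ^ 2) * (2 * n ^ 2 * C ^ 2) * ε ^ 2 * jetSize J W x ^ 2 := by ring
    _ ≤ _ := by
        rw [mul_assoc (2 + 2 * (n : ℝ) ^ 2) (2 * n ^ 2 * C ^ 2 * _), add_le_add_iff_left]
        refine (mul_le_mul_of_nonneg_left h3 (by positivity)).trans (le_of_eq ?_)
        ring

/-- The error has an additional factor `1 + |x|`. Bounding it by `r` turns the weight `r^b` of the
second component into the weight `r^(b+2)` of the jets, so both components produce the same error
density. -/
lemma symDeriv_density_le (hn : 1 ≤ n) (hr : 0 < r x) (hρ : 0 ≤ ρ x) (hM : 1 ≤ M) (hm : 0 < m)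
    (hrm : m * jb x ≤ r x) (hrM : r x ≤ M * jb x)
    (h : ∀ i j, |T i j - (-(1 / 2 : ℝ)) * symDeriv W x i j| ≤
      C * (ε * jetSize J W x * jb x)) :
    (∑ i, ∑ j, ‖symDeriv W x i j‖ₑ ^ 2) * ENNReal.ofReal (r x ^ b * ρ x) ≤
      ENNReal.ofReal 8 * ((∑ i, ∑ j, ‖T i j‖ₑ ^ 2) * ENNReal.ofReal (r x ^ b * ρ x)) +
      ENNReal.ofReal (8 * n ^ 2 * C ^ 2 * (5 * M ^ 4 * n ^ 3) * (m⁻¹) ^ 2 * ε ^ 2) *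
        jetDensity J W r ρ b x := by
  rw [jetDensity_eq J W hr hρ, sum_enorm_sq_mul_ofReal, sum_enorm_sq_mul_ofReal]
  have hp : 0 ≤ r x ^ b := Real.rpow_nonneg hr.le _
  have e0 : r x ^ (b + 2) = r x ^ 2 * r x ^ b := by
    rw [← Real.rpow_natCast (r x) 2, ← Real.rpow_add hr]
    congr 1; push_cast; ring
  rw [e0, mul_assoc (r x ^ 2), ← mul_assoc _ (r x ^ 2)]
  refine ofReal_le_add_mul_ofReal (by positivity) (by positivity) (by positivity) (by positivity)
    (by positivity) ?_
  have h2 := sum_sq_le_of_abs_sub_le (B := fun i j => (-(1 / 2 : ℝ)) * symDeriv W x i j) h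
  have h3 := jetSize_sq_le J W hn hr hM hrM
  have hj0 := jb_pos x
  have hj : jb x ≤ m⁻¹ * r x := by
    rw [inv_mul_eq_div, le_div_iff₀ hm]
    linarith
  have h4 : ∑ i, ∑ j, symDeriv W x i j ^ 2 =
      4 * ∑ i, ∑ j, ((-(1 / 2 : ℝ)) * symDeriv W x i j) ^ 2 := by
    simp only [Finset.mul_sum]
    exact Finset.sum_congr rfl fun i _ => Finset.sum_congr rfl fun j _ => by ring
  rw [h4]
  calc _ ≤ 4 * (2 * (∑ i, ∑ j, T i j ^ 2) +
        2 * n ^ 2 * (C * (ε * jetSize J W x * jb x)) ^ 2) := by gcongr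
    _ = 8 * (∑ i, ∑ j, T i j ^ 2) + 8 * n ^ 2 * C ^ 2 * ε ^ 2 * jetSize J W x ^ 2 * jb x ^ 2 := by
        ring
    _ ≤ 8 * (∑ i, ∑ j, T i j ^ 2) +
        8 * n ^ 2 * C ^ 2 * ε ^ 2 * jetSize J W x ^ 2 * (m⁻¹ * r x) ^ 2 := by gcongr
    _ ≤ _ := by
        rw [add_le_add_iff_left]
        refine (mul_le_mul_of_nonneg_right (mul_le_mul_of_nonneg_left h3
          (by positivity)) (by positivity)).trans (le_of_eq ?_)
        ring

variable {θ₁ θ₂ : ℝ} (D : RegularizedCone n θ₁ θ₂)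

/-- Coercivity of the adjoint operator of the patched data, for the squares of the norms. -/
theorem exists_adjoint_estimate (hn : 2 ≤ n) (h1 : 0 < θ₁) (h12 : θ₁ < θ₂) (h2 : θ₂ < Real.pi)
    {N : ℕ} (hN : 2 ≤ N) (hr : IsRadialWeight r) {q : ℝ} (hb : b ≤ 0) (hbn : 0 < n + b - 2)
    (hq : -(n : ℝ) + 2 * q = b - 2) {s : ℝ} (hs : 0 < s) (Mₐ : AFEnd n s) {χ : E n → ℝ}
    (hχ : IsAngularCutoff D χ) : ∃ (a₀ : ℝ) (K : ℝ≥0∞), K ≠ ⊤ ∧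
    ∀ (a : E n) (A : E n ≃ₗᵢ[ℝ] E n), a₀ < ‖a‖ → ‖a‖ • A D.axis = -a →
    ∀ (J : (Fin n → ℕ) → E n → ℝ) (W : (Fin n → ℕ) → E n → E n),
      MemSobolev 2 q r (D.weight A N) (D.region A) J →
      MemSobolev 1 q r (D.weight A N) (D.region A) W →
      sobolevNormSq 2 q r (D.weight A N) (D.region A) J +
        sobolevNormSq 1 q r (D.weight A N) (D.region A) W ≤
      K * (tensorInt r (D.weight A N) (D.region A) (b + 2)
          (adjoint₁ (Mₐ.patchMetric χ a A) (Mₐ.patchMomentum χ a A) J W) +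
        tensorInt r (D.weight A N) (D.region A) b
          (adjoint₂ (Mₐ.patchMetric χ a A) (Mₐ.patchMomentum χ a A) J W)) := by
  obtain ⟨CS, hCS, hscal⟩ := exists_scalar_estimate D hn h1 h12 h2 hN hr hb hbn hq
  obtain ⟨CV, hCV, hvec⟩ := exists_vector_estimate D hn h1 h12 h2 hN hr (by linarith) hbn hq
  obtain ⟨a₁, C, ha₁, hC, hadj⟩ := exists_adjoint_bounds D h1 (h12.trans h2) hs Mₐ hχ
  obtain ⟨m, M₀, hm, hmM⟩ := exists_radialWeight_bounds hr
  obtain ⟨M, hM⟩ : ∃ M, M = max M₀ 1 := ⟨_, rfl⟩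
  have hM1 : 1 ≤ M := by rw [hM]; exact le_max_right _ _
  have hrM : ∀ x, r x ≤ M * jb x := fun x => (hmM x).2.trans (by
    rw [hM]; exact mul_le_mul_of_nonneg_right (le_max_left _ _) (Real.sqrt_nonneg _))
  obtain ⟨L₁, hL₁⟩ : ∃ L₁ : ℝ,
    L₁ = (2 + 2 * n ^ 2) * (2 * n ^ 2 * C ^ 2 * (5 * M ^ 4 * n ^ 3)) := ⟨_, rfl⟩
  obtain ⟨L₂, hL₂⟩ : ∃ L₂ : ℝ, L₂ = 8 * n ^ 2 * C ^ 2 * (5 * M ^ 4 * n ^ 3) * (m⁻¹) ^ 2 := ⟨_, rfl⟩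
  obtain ⟨K₁, hK₁⟩ : ∃ K₁ : ℝ≥0∞, K₁ = ENNReal.ofReal ((2 + 2 * n ^ 2) * 2) := ⟨_, rfl⟩
  have hK₁' : K₁ ≠ ⊤ := by rw [hK₁]; exact ENNReal.ofReal_ne_top
  -- The total factor in front of the norm in the error, as a function of `|a|`. It tends to zero at
  -- infinity, and `a₂` is where it has dropped below one half.
  obtain ⟨P, hP⟩ : ∃ P : ℝ → ℝ≥0∞, P = fun y => (CS * ENNReal.ofReal (L₁ * (y ^ (-s)) ^ 2) +
    CV * ENNReal.ofReal (L₂ * (y ^ (-s)) ^ 2)) * (n ^ 2 + n + 1) := ⟨_, rfl⟩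
  have hlim : Tendsto P atTop (𝓝 0) := by
    have h0 : ∀ L : ℝ, Tendsto (fun y : ℝ => ENNReal.ofReal (L * (y ^ (-s)) ^ 2)) atTop (𝓝 0) := by
      intro L
      have := (((tendsto_rpow_neg_atTop hs).pow 2).const_mul L)
      rw [← ENNReal.ofReal_zero]
      refine ENNReal.tendsto_ofReal ?_
      simpa using this
    have h3 := ENNReal.Tendsto.mul_const ((ENNReal.Tendsto.const_mul (h0 L₁) (Or.inr hCS)).add
      (ENNReal.Tendsto.const_mul (h0 L₂) (Or.inr hCV))) (b := ((n : ℝ≥0∞) ^ 2 + n + 1))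
        (Or.inr (by finiteness))
    simpa [hP] using h3
  obtain ⟨a₂, ha₂⟩ := (hlim.eventually (gt_mem_nhds (show (0 : ℝ≥0∞) < 1 / 2 by simp))).exists_forall_of_atTop
  refine ⟨max a₁ a₂, 2 * (CS * K₁ + CV * ENNReal.ofReal 8), by finiteness,
    fun a A ha hA J W hJ hW => ?_⟩
  have hbd := hadj a A ((le_max_left _ _).trans_lt ha) hA J W
  have hsmall := ha₂ ‖a‖ ((le_max_right a₁ a₂).trans ha.le)
  obtain ⟨X, hX⟩ : ∃ X, X = sobolevNormSq 2 q r (D.weight A N) (D.region A) J +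
    sobolevNormSq 1 q r (D.weight A N) (D.region A) W := ⟨_, rfl⟩
  have hXtop : X ≠ ⊤ := by
    rw [hX]
    exact (ENNReal.add_lt_top.2 ⟨sobolevNormSq_lt_top D hr A hJ, sobolevNormSq_lt_top D hr A hW⟩).ne
  obtain ⟨I, hI⟩ : ∃ I, I = ∫⁻ x in D.region A, jetDensity J W r (D.weight A N) b x := ⟨_, rfl⟩
  have hIX : I ≤ (n ^ 2 + n + 1) * X := by
    rw [hI, hX]
    exact lintegral_jetDensity_le J W D hr hq hJ.1 hW.1
  have hmeas := aemeasurable_jetDensity (b := b) (N := N) J W D hr hJ.1 hW.1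
  have hΩ := (isOpen_region A D).measurableSet
  have e1 : tensorInt r (D.weight A N) (D.region A) (b + 2) (flatHessian J) ≤
      K₁ * tensorInt r (D.weight A N) (D.region A) (b + 2)
        (adjoint₁ (Mₐ.patchMetric χ a A) (Mₐ.patchMomentum χ a A) J W) +
      ENNReal.ofReal (L₁ * (‖a‖ ^ (-s)) ^ 2) * I := by
    rw [hI, hK₁, tensorInt, tensorInt, ← lintegral_const_mul' _ _ ENNReal.ofReal_ne_top,
      ← lintegral_const_mul' _ _ ENNReal.ofReal_ne_top,
      ← lintegral_add_right' _ (hmeas.const_mul _)]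
    refine setLIntegral_mono' hΩ fun x hx => ?_
    rw [hL₁]
    exact flatHessian_density_le hn (hr.2.1 x) (weight_pos D hx).le hM1 (hrM x)
      fun i j => (hbd x hx i j).1
  have e2 : tensorInt r (D.weight A N) (D.region A) b (symDeriv W) ≤
      ENNReal.ofReal 8 * tensorInt r (D.weight A N) (D.region A) b
        (adjoint₂ (Mₐ.patchMetric χ a A) (Mₐ.patchMomentum χ a A) J W) +
      ENNReal.ofReal (L₂ * (‖a‖ ^ (-s)) ^ 2) * I := by
    rw [hI, tensorInt, tensorInt, ← lintegral_const_mul' _ _ ENNReal.ofReal_ne_top,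
      ← lintegral_const_mul' _ _ ENNReal.ofReal_ne_top,
      ← lintegral_add_right' _ (hmeas.const_mul _)]
    refine setLIntegral_mono' hΩ fun x hx => ?_
    rw [hL₂]
    exact symDeriv_density_le (by omega) (hr.2.1 x) (weight_pos D hx).le hM1 hm (hmM x).1 (hrM x)
      fun i j => (hbd x hx i j).2
  obtain ⟨T₁, hT₁⟩ : ∃ T₁, T₁ = tensorInt r (D.weight A N) (D.region A) (b + 2)
    (adjoint₁ (Mₐ.patchMetric χ a A) (Mₐ.patchMomentum χ a A) J W) := ⟨_, rfl⟩
  obtain ⟨T₂, hT₂⟩ : ∃ T₂, T₂ = tensorInt r (D.weight A N) (D.region A) b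
    (adjoint₂ (Mₐ.patchMetric χ a A) (Mₐ.patchMomentum χ a A) J W) := ⟨_, rfl⟩
  rw [← hT₁] at e1
  rw [← hT₂] at e2
  rw [← hX, ← hT₁, ← hT₂, mul_assoc]
  refine le_two_mul_of_le_add_half hXtop ?_
  have hsum : X ≤ CS * (K₁ * T₁ + ENNReal.ofReal (L₁ * (‖a‖ ^ (-s)) ^ 2) * I) +
      CV * (ENNReal.ofReal 8 * T₂ + ENNReal.ofReal (L₂ * (‖a‖ ^ (-s)) ^ 2) * I) := by
    rw [hX]
    exact add_le_add ((hscal A J hJ).trans (mul_le_mul_right e1 _))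
      ((hvec A W hW).trans (mul_le_mul_right e2 _))
  calc X ≤ _ := hsum
    _ = (CS * K₁ * T₁ + CV * ENNReal.ofReal 8 * T₂) +
        (CS * ENNReal.ofReal (L₁ * (‖a‖ ^ (-s)) ^ 2) +
          CV * ENNReal.ofReal (L₂ * (‖a‖ ^ (-s)) ^ 2)) * I := by ring
    _ ≤ (CS * K₁ * T₁ + CV * ENNReal.ofReal 8 * T₂) +
        (CS * ENNReal.ofReal (L₁ * (‖a‖ ^ (-s)) ^ 2) +
          CV * ENNReal.ofReal (L₂ * (‖a‖ ^ (-s)) ^ 2)) * ((n ^ 2 + n + 1) * X) := by gcongr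
    _ = (CS * K₁ * T₁ + CV * ENNReal.ofReal 8 * T₂) + P ‖a‖ * X := by rw [hP]; ring
    _ ≤ (CS * K₁ + CV * ENNReal.ofReal 8) * (T₁ + T₂) + X / 2 := by
        refine add_le_add ?_ ?_
        · calc _ ≤ (CS * K₁ * T₁ + CV * ENNReal.ofReal 8 * T₂) +
                (CS * K₁ * T₂ + CV * ENNReal.ofReal 8 * T₁) := le_self_add
            _ = _ := by ring
        · rw [ENNReal.div_eq_inv_mul, ← one_div]
          exact mul_le_mul_left hsmall.le X

lemma sqrt_add_sqrt_le {X Y T₁ T₂ K : ℝ≥0∞} (h : X + Y ≤ K * (T₁ + T₂)) :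
    X ^ (1 / 2 : ℝ) + Y ^ (1 / 2 : ℝ) ≤
      2 * K ^ (1 / 2 : ℝ) * (T₁ ^ (1 / 2 : ℝ) + T₂ ^ (1 / 2 : ℝ)) := by
  have h0 : (0 : ℝ) ≤ 1 / 2 := by norm_num
  have h1 : (X + Y) ^ (1 / 2 : ℝ) ≤ K ^ (1 / 2 : ℝ) * (T₁ ^ (1 / 2 : ℝ) + T₂ ^ (1 / 2 : ℝ)) := by
    refine (ENNReal.rpow_le_rpow h h0).trans ?_
    rw [ENNReal.mul_rpow_of_nonneg _ _ h0]
    gcongr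
    exact ENNReal.rpow_add_le_add_rpow _ _ h0 (by norm_num)
  have hX : X ^ (1 / 2 : ℝ) ≤ (X + Y) ^ (1 / 2 : ℝ) := ENNReal.rpow_le_rpow le_self_add h0
  have hY : Y ^ (1 / 2 : ℝ) ≤ (X + Y) ^ (1 / 2 : ℝ) := ENNReal.rpow_le_rpow le_add_self h0
  calc _ ≤ 2 * (X + Y) ^ (1 / 2 : ℝ) := by rw [two_mul]; exact add_le_add hX hY
    _ ≤ 2 * (K ^ (1 / 2 : ℝ) * (T₁ ^ (1 / 2 : ℝ) + T₂ ^ (1 / 2 : ℝ))) := by gcongr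
    _ = _ := by ring

end Estimate

end ConeGluing

end

/-! ### The proposition -/

theorem proposition4 (n : ℕ) (hn : 3 ≤ n) (θ₁ θ₂ : ℝ) (hθ₁ : 0 < θ₁) (hθ : θ₁ < θ₂)
    (hθ₂ : θ₂ < Real.pi) (D : ConeGluing.RegularizedCone n θ₁ θ₂)
    (r : ConeGluing.E n → ℝ) (hr : ConeGluing.IsRadialWeight r)
    (p : ℝ) (hp : ((n : ℝ) - 2) / 2 < p) (hpn : 5 ≤ n → p ≠ (n : ℝ) / 2) :
    ∃ N₀ : ℕ, ∀ N : ℕ, N₀ ≤ N →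
      ∀ s : ℝ, p < s → s ≤ (n : ℝ) - 2 →
      ∀ (M : ConeGluing.AFEnd n s) (χ : ConeGluing.E n → ℝ), ConeGluing.IsAngularCutoff D χ →
      ∃ aInf C : ℝ, 0 < C ∧
        ∀ a : ConeGluing.E n, aInf < ‖a‖ →
        ∀ A : ConeGluing.E n ≃ₗᵢ[ℝ] ConeGluing.E n, ‖a‖ • A D.axis = -a →
        ∀ (u : (Fin n → ℕ) → ConeGluing.E n → ℝ)
          (Z : (Fin n → ℕ) → ConeGluing.E n → ConeGluing.E n),
          ConeGluing.MemSobolev 2 ((n : ℝ) - p - 2) r (D.weight A N) (D.region A) u →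
          ConeGluing.MemSobolev 1 ((n : ℝ) - p - 2) r (D.weight A N) (D.region A) Z →
          ConeGluing.sobolevNorm 2 ((n : ℝ) - p - 2) r (D.weight A N) (D.region A) u +
            ConeGluing.sobolevNorm 1 ((n : ℝ) - p - 2) r (D.weight A N) (D.region A) Z ≤
          ENNReal.ofReal C *
            (ConeGluing.tensorNorm ((n : ℝ) - p) r (D.weight A N) (D.region A)
                (ConeGluing.adjoint₁ (M.patchMetric χ a A) (M.patchMomentum χ a A) u Z) +
              ConeGluing.tensorNorm ((n : ℝ) - p - 1) r (D.weight A N) (D.region A)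
                (ConeGluing.adjoint₂ (M.patchMetric χ a A) (M.patchMomentum χ a A) u Z)) := by
  refine ⟨2, fun N hN s hps hsn M χ hχ => ?_⟩
  have hn' : (3 : ℝ) ≤ n := by exact_mod_cast hn
  -- With `b = n - 2p - 2` the norms of `(u, Z)` have the exponents `b - 2`, `b`, `b + 2`, and the
  -- two components of the adjoint have `b + 2` and `b`. The bound `p > (n - 2)/2` gives `b ≤ 0`,
  -- and `p < s ≤ n - 2` gives `n + b - 2 > 0`.
  obtain ⟨a₀, K, hK, hest⟩ := ConeGluing.exists_adjoint_estimate D (by omega) hθ₁ hθ hθ₂ hN hr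
    (b := n - 2 * p - 2) (q := n - p - 2) (by linarith) (by linarith) (by ring) (s := s)
    (by linarith) M hχ
  have hK' : 2 * K ^ (1 / 2 : ℝ) ≠ ⊤ :=
    ENNReal.mul_ne_top (by simp) (ENNReal.rpow_ne_top_of_nonneg (by norm_num) hK)
  -- The summand 1 makes the constant positive even if `K` vanishes.
  refine ⟨a₀, (2 * K ^ (1 / 2 : ℝ)).toReal + 1, by positivity, fun a ha A hA u Z hu hZ => ?_⟩
  refine (ConeGluing.sqrt_add_sqrt_le (hest a A ha hA u Z hu hZ)).trans ?_
  have h1 : -(n : ℝ) + 2 * (n - p) = n - 2 * p - 2 + 2 := by ring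
  have h2 : -(n : ℝ) + 2 * (n - p - 1) = n - 2 * p - 2 := by ring
  rw [ConeGluing.tensorNorm, ConeGluing.tensorNorm, h1, h2]
  refine mul_le_mul_left ?_ _
  rw [ENNReal.ofReal_add ENNReal.toReal_nonneg zero_le_one, ENNReal.ofReal_toReal hK']
  exact le_self_add
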